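/- Let $n\ge 1$, $\beta>0$ and $g,g_0,g_1,g_0',g_1'\ge 0$. Put $\gamma=i\beta/2$, $\mu=i\beta g$, $\mu_\delta=i\beta g_\delta$, $\mu'_\delta=i\beta g'_\delta$ ($\delta=0,1$), and $$v_a(z)=\frac{\sin\frac12(\mu+z)}{\sin\frac12 z},\qquad v_b(z)=\frac{\sin\frac12(\mu_0+z)}{\sin\frac12 z}\,\frac{\cos\frac12(\mu_1+z)}{\cos\frac12 z}\,\frac{\sin\frac12(\mu_0'+\gamma+z)}{\sin\frac12(\gamma+z)}\,\frac{\cos\frac12(\mu_1'+\gamma+z)}{\cos\frac12(\gamma+z)} .$$ For disjoint $J,K\subset\{1,\dots,n\}$ and signs $\varepsilon_j=\pm1$ ($j\in J$) let $$V_{\varepsilon J;K}=\prod_{j\in J}v_b(\varepsilon_jx_j)\prod_{j<j',\;j,j'\in J}v_a(\varepsilon_jx_j+\varepsilon_{j'}x_{j'})\,v_a(\varepsilon_jx_j+\varepsilon_{j'}x_{j'}+2\gamma)\prod_{j\in J,\,k\in K}v_a(\varepsilon_jx_j+x_k)\,v_a(\varepsilon_jx_j-x_k),$$ and for $r=1,\dots,n$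 define the difference operator $$(\hat D_rf)(x)=\sum_{\substack{|J|=r\\ \varepsilon_j=\pm1,\,j\in J}}\ \sum_{\substack{\emptyset=J_0\subsetneq J_1\subsetneq\cdots\subsetneq J_s=J\\ 1\le s\le r}}(-1)^{s-1}\prod_{s'=1}^{s}V_{\varepsilon(J_{s'}\setminus J_{s'-1});J_{s'}^c}(x)\,\Bigl(f\bigl(x+i\beta\textstyle\sum_{j\in J_1}\varepsilon_je_j\bigr)-f(x)\Bigr).$$ Let $\mathcal P^+=\{\lambda\in\mathbb Z^n:\lambda_1\ge\cdots\ge\lambda_n\ge0\}$ be the set of dominant weights, ordered by $\lambda'\le\lambda$ iff $\sum_{j\le k}\lambda'_j\le\sum_{j\le k}\lambda_j$ for $k=1,\dots,n$, and let $m_\lambda(x)=\sum_{\nu\in W\lambda}e^{i\sum_j\nu_jx_j}$, where $W$ is the group of permutations and sign flips. With $q=e^{-\beta}$, $(a;q)_\infty=\prod_{m\ge0}(1-aq^m)$ and $(a_1,\dots,a_k;q)_\infty=\prod_l(a_l;q)_\infty$, put $$d_a^+(z)=\frac{(e^{iz};q)_\infty}{(e^{-\beta g}e^{iz};q)_\infty},\qquad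 d_b^+(z)=\frac{(e^{2iz};q)_\infty}{(e^{-\beta g_0}e^{iz},-e^{-\beta g_1}e^{iz},e^{-\beta(g_0'+1/2)}e^{iz},-e^{-\beta(g_1'+1/2)}e^{iz};q)_\infty},$$ $d_c(z)=d_c^+(z)d_c^+(-z)$ for $c=a,b$, $\Delta(x)=\prod_{j<k}d_a(x_j+x_k)d_a(x_j-x_k)\prod_jd_b(x_j)$, and $\langle f,h\rangle_\Delta=\int_{[-\pi,\pi]^n}f\,\overline h\,\Delta\,dx$. The Koornwinder polynomial $p_\lambda$ ($\lambda\in\mathcal P^+$) is defined by the two conditions $p_\lambda\in m_\lambda+\operatorname{span}_{\mathbb C}\{m_{\lambda'}:\lambda'\in\mathcal P^+,\ \lambda'<\lambda\}$ and $\langle p_\lambda,m_{\lambda'}\rangle_\Delta=0$ for all $\lambda'\in\mathcal P^+$ with $\lambda'<\lambda$. Theorem. For every $\lambda\in\mathcal P^+$ these conditions determine exactly one function $p_\lambda$; it is non-zero, and for every $r=1,\dots,n$ $$\hat D_r\,p_\lambda=2^r\,E_{r,n}\bigl(\cosh\beta(\lambda_1+\rho_1),\dots,\cosh\beta(\lambda_n+\rho_n);\cosh\beta\rho_r,\dots,\cosh\beta\rho_n\bigr)\,p_\lambda$$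 at every $x\in\mathbb C^n$ at which no denominator of the coefficients of the operators $\hat D_1,\dots,\hat D_n$ vanishes, that is, at every $x$ such that, for all choices of signs, $\sin\frac{x_j}2$, $\cos\frac{x_j}2$, $\sin\frac{\gamma\pm x_j}2$, $\cos\frac{\gamma\pm x_j}2$ and, for $j\ne k$, $\sin\frac{\pm x_j\pm x_k}2$, $\sin\frac{\pm x_j\pm x_k+2\gamma}2$ are all non-zero. Here $\rho_j=(n-j)g+\frac12(g_0+g_1+g_0'+g_1')$ and $$E_{r,n}(t_1,\dots,t_n;p_r,\dots,p_n)=\sum_{s=0}^{r}(-1)^{r+s}\Bigl(\sum_{|J|=s}\prod_{j\in J}t_j\Bigr)\Bigl(\sum_{r\le i_1\le\cdots\le i_{r-s}\le n}p_{i_1}\cdots p_{i_{r-s}}\Bigr).$$ -/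

import Mathlib

open scoped BigOperators

noncomputable section

namespace Koornwinder

/-- The real parameters `β, g, g₀, g₁, g₀', g₁'`; the last two are called `gp₀`, `gp₁`. -/
structure Params where
  β : ℝ
  g : ℝ
  g₀ : ℝ
  g₁ : ℝ
  gp₀ : ℝ
  gp₁ : ℝ

/-- The admissible parameters: `β > 0` and non-negative couplings. -/
def Params.Admissible (P : Params) : Prop :=
  0 < P.β ∧ 0 ≤ P.g ∧ 0 ≤ P.g₀ ∧ 0 ≤ P.g₁ ∧ 0 ≤ P.gp₀ ∧ 0 ≤ P.gp₁

/-! ### The difference operators (with period parameter `α = 1/2`) -/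

/-- `γ = iβ/2`. -/
def Params.γ (P : Params) : ℂ := Complex.I * P.β / 2

/-- `v_a(z) = sin ½(μ+z) / sin ½z` with `μ = iβg`. -/
def va (P : Params) (z : ℂ) : ℂ :=
  Complex.sin ((Complex.I * P.β * P.g + z) / 2) / Complex.sin (z / 2)

/-- `v_b(z)`, a product of four factors, with `μ_δ = iβg_δ` and `μ_δ' = iβg_δ'`. -/
def vb (P : Params) (z : ℂ) : ℂ :=
  Complex.sin ((Complex.I * P.β * P.g₀ + z) / 2) / Complex.sin (z / 2) *
  (Complex.cos ((Complex.I * P.β * P.g₁ + z) / 2) / Complex.cos (z / 2)) *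
  (Complex.sin ((Complex.I * P.β * P.gp₀ + P.γ + z) / 2) / Complex.sin ((P.γ + z) / 2)) *
  (Complex.cos ((Complex.I * P.β * P.gp₁ + P.γ + z) / 2) / Complex.cos ((P.γ + z) / 2))

/-- The coefficient `V_{εJ;K}`. -/
def V (P : Params) {n : ℕ} (ε : Fin n → ℤ) (J K : Finset (Fin n)) (x : Fin n → ℂ) : ℂ :=
  (∏ j ∈ J, vb P (ε j * x j)) *
  (∏ q ∈ (J ×ˢ J).filter (fun q => q.1 < q.2),
    va P (ε q.1 * x q.1 + ε q.2 * x q.2) *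
    va P (ε q.1 * x q.1 + ε q.2 * x q.2 + 2 * P.γ)) *
  (∏ j ∈ J, ∏ k ∈ K, va P (ε j * x j + x k) * va P (ε j * x j - x k))

/-- The sign configurations `ε_j = ±1`, `j ∈ J`, each listed exactly once
(normalized by `ε_j = 1` for `j ∉ J`, where the value is never used). -/
def signs {n : ℕ} (J : Finset (Fin n)) : Finset (Fin n → ℤ) :=
  Fintype.piFinset fun j => if j ∈ J then {1, -1} else {1}

open Classical in
/-- The chains `∅ = J₀ ⊊ J₁ ⊊ ⋯ ⊊ J_s = J`. -/
def chains {n : ℕ} (J : Finset (Fin n)) (s : ℕ) : Finset (Fin (s + 1) → Finset (Fin n)) :=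
  Finset.univ.filter fun C => StrictMono C ∧ C 0 = ∅ ∧ C (Fin.last s) = J

/-- The action of `exp(-β θ̂_{εJ})`: the point `x` is moved to `x + iβ ∑_{j ∈ J} ε_j e_j`. -/
def shift (P : Params) {n : ℕ} (ε : Fin n → ℤ) (J : Finset (Fin n)) (x : Fin n → ℂ) :
    Fin n → ℂ :=
  fun j => if j ∈ J then x j + Complex.I * P.β * ε j else x j

/-- The analytic difference operator `D̂_r`, acting on functions on `ℂⁿ`. In a chain `C` the set
`C 1` is the nucleus `J₁` (the length `s` is at least one). -/
def D (P : Params) {n : ℕ} (r : ℕ) (f : (Fin n → ℂ) → ℂ) (x : Fin n → ℂ) : ℂ :=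
  ∑ J ∈ Finset.powersetCard r (Finset.univ : Finset (Fin n)), ∑ ε ∈ signs J,
    ∑ s ∈ Finset.Icc 1 r, ∑ C ∈ chains J s,
      (-1) ^ (s - 1) *
      (∏ t : Fin s, V P ε (C t.succ \ C t.castSucc) (C t.succ)ᶜ x) *
      (f (shift P ε (C 1) x) - f x)

/-- The points of `ℂⁿ` at which no denominator in the coefficients of the operators `D̂_r`
vanishes (the complement of a locally finite union of complex hyperplanes). -/
def IsRegular (P : Params) {n : ℕ} (x : Fin n → ℂ) : Prop :=
  (∀ j, Complex.sin (x j / 2) ≠ 0 ∧ Complex.cos (x j / 2) ≠ 0 ∧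
    ∀ s : ℤˣ, Complex.sin ((P.γ + (s : ℤ) * x j) / 2) ≠ 0 ∧
      Complex.cos ((P.γ + (s : ℤ) * x j) / 2) ≠ 0) ∧
  (∀ j k, j ≠ k → ∀ s t : ℤˣ,
    Complex.sin (((s : ℤ) * x j + (t : ℤ) * x k) / 2) ≠ 0 ∧
    Complex.sin (((s : ℤ) * x j + (t : ℤ) * x k + 2 * P.γ) / 2) ≠ 0)

/-! ### Weights and monomial symmetric functions -/

/-- The cone of dominant weights `λ₁ ≥ ⋯ ≥ λ_n ≥ 0`. -/
def IsDominant {n : ℕ} (lam : Fin n → ℤ) : Prop :=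
  Antitone lam ∧ ∀ j, 0 ≤ lam j

/-- The partial order `lam' ≤ lam` on weights: comparison of all partial sums. -/
def DomLE {n : ℕ} (lam' lam : Fin n → ℤ) : Prop :=
  ∀ k : Fin n, ∑ j ∈ Finset.Iic k, lam' j ≤ ∑ j ∈ Finset.Iic k, lam j

/-- The strict part of the partial order. -/
def DomLT {n : ℕ} (lam' lam : Fin n → ℤ) : Prop :=
  DomLE lam' lam ∧ lam' ≠ lam

/-- The exponential `e^λ(x) = exp(i ∑ λ_j x_j)`. -/
def expo {n : ℕ} (lam : Fin n → ℤ) (x : Fin n → ℂ) : ℂ :=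
  Complex.exp (Complex.I * ∑ j, (lam j : ℂ) * x j)

/-- The orbit of a weight under permutations and sign flips. -/
def weylOrbit {n : ℕ} (lam : Fin n → ℤ) : Finset (Fin n → ℤ) :=
  (Finset.univ : Finset (Equiv.Perm (Fin n) × (Fin n → ℤˣ))).image
    fun w j => (w.2 j : ℤ) * lam (w.1 j)

/-- The monomial symmetric function `m_λ`, the sum of `e^{λ'}` over the orbit of `λ`. -/
def monomial {n : ℕ} (lam : Fin n → ℤ) (x : Fin n → ℂ) : ℂ :=
  ∑ nu ∈ weylOrbit lam, expo nu x

/-! ### The weight function and the inner product -/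

/-- The infinite q-shifted factorial `(a;q)_∞ = ∏_{m ≥ 0} (1 - a q^m)`. -/
def qPoch (a q : ℂ) : ℂ := ∏' m : ℕ, (1 - a * q ^ m)

/-- `q = e^{-β}`. -/
def Params.q (P : Params) : ℂ := Complex.exp (-P.β)

/-- `d_a^+`. -/
def daPlus (P : Params) (z : ℂ) : ℂ :=
  qPoch (Complex.exp (Complex.I * z)) P.q /
  qPoch (Complex.exp (-P.β * P.g) * Complex.exp (Complex.I * z)) P.q

/-- `d_b^+`. -/
def dbPlus (P : Params) (z : ℂ) : ℂ :=
  qPoch (Complex.exp (2 * Complex.I * z)) P.q /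
  (qPoch (Complex.exp (-P.β * P.g₀) * Complex.exp (Complex.I * z)) P.q *
   qPoch (-Complex.exp (-P.β * P.g₁) * Complex.exp (Complex.I * z)) P.q *
   qPoch (Complex.exp (-P.β * (P.gp₀ + 1 / 2)) * Complex.exp (Complex.I * z)) P.q *
   qPoch (-Complex.exp (-P.β * (P.gp₁ + 1 / 2)) * Complex.exp (Complex.I * z)) P.q)

/-- `d_a(z) = d_a^+(z) d_a^+(-z)`. -/
def da (P : Params) (z : ℂ) : ℂ := daPlus P z * daPlus P (-z)

/-- `d_b(z) = d_b^+(z) d_b^+(-z)`. -/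
def db (P : Params) (z : ℂ) : ℂ := dbPlus P z * dbPlus P (-z)

/-- The weight function `Δ`. -/
def weight (P : Params) {n : ℕ} (x : Fin n → ℂ) : ℂ :=
  (∏ q ∈ (Finset.univ : Finset (Fin n × Fin n)).filter (fun q => q.1 < q.2),
    da P (x q.1 + x q.2) * da P (x q.1 - x q.2)) *
  ∏ j, db P (x j)

/-- `⟨f, h⟩_Δ = ∫_𝕋 f h̄ Δ dx`, the torus being represented by the cube `[-π, π]ⁿ`. -/
def innerProd (P : Params) {n : ℕ} (f h : (Fin n → ℂ) → ℂ) : ℂ :=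
  ∫ x in Set.Icc (fun _ : Fin n => -Real.pi) (fun _ : Fin n => Real.pi),
    f (fun j => (x j : ℂ)) * (starRingEnd ℂ) (h (fun j => (x j : ℂ))) *
      weight P (fun j => (x j : ℂ))

/-- The conditions that define the Koornwinder polynomial `p_λ`: it is `m_λ` plus a linear
combination of the `m_{λ'}` with `λ' < λ` dominant, and it is orthogonal to these `m_{λ'}`. -/
def IsKoornwinder (P : Params) {n : ℕ} (lam : Fin n → ℤ) (p : (Fin n → ℂ) → ℂ) : Prop :=
  p - monomial lam ∈
    Submodule.span ℂ {f | ∃ nu : Fin n → ℤ, IsDominant nu ∧ DomLT nu lam ∧ f = monomial nu} ∧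
  ∀ nu : Fin n → ℤ, IsDominant nu → DomLT nu lam → innerProd P p (monomial nu) = 0

/-! ### The eigenvalues -/

/-- `ρ_j = (n-j) g + (g₀+g₁+g₀'+g₁')/2` for `j = 1,…,n`; the index `j : Fin n` stands for `j+1`. -/
def rho (P : Params) {n : ℕ} (j : Fin n) : ℝ :=
  ((n : ℝ) - ((j : ℕ) + 1)) * P.g + (P.g₀ + P.g₁ + P.gp₀ + P.gp₁) / 2

open Classical in
/-- `E_{r,n}(t₁,…,t_n; p_r,…,p_n)`: the alternating sum over `s` of the elementary symmetric
function of degree `s` in the `t_j` times the sum of `p_{i₁} ⋯ p_{i_{r-s}}` over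
`r ≤ i₁ ≤ ⋯ ≤ i_{r-s} ≤ n`. Only the entries `p_r,…,p_n` of `p` are used. -/
def E {n : ℕ} (r : ℕ) (t p : Fin n → ℝ) : ℝ :=
  ∑ s ∈ Finset.range (r + 1), (-1) ^ (r + s) *
    (∑ J ∈ Finset.powersetCard s (Finset.univ : Finset (Fin n)), ∏ j ∈ J, t j) *
    (∑ i ∈ (Finset.univ : Finset (Fin (r - s) → Fin n)).filter
        (fun i : Fin (r - s) → Fin n => Monotone i ∧ ∀ a, r ≤ (i a : ℕ) + 1), ∏ a, p (i a))

end Koornwinder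

end

/-! The operators act triangularly on the monomials `m_λ` and are symmetric for the weight `Δ`.
Hence the orthogonalised monomials are eigenfunctions, and the eigenvalue is the diagonal
coefficient, which is visible at infinity.

Signs and chains. The coefficient with signs `ε` is the positive-sign coefficient evaluated at `εx`.
For `f` invariant under sign flips, `two_pow_mul_D` therefore expresses `D` through the sum `Dsum`
of `Dpos` over all sign flips of the point. The alternating sum over chains becomes the recursion
`recSum`, which splits off one block at a time.

Polynomiality. For invariant `f` all poles of `Dsum f` cancel. Across a hyperplane fixed by a Weyl
reflection, up to periods, `Dsum f` is even, and a simple pole of an even function has residue zero.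
On a shifted hyperplane the pole is created only by blocks containing a set `S` of one or two
indices. There the residue attached to the block `A ∪ S` is opposite to the one attached to `A`,
whose pole comes from the rest of the recursion, and `f` takes equal values at the two shifted
points because they are related by a reflection (`BlockPole.tendsto_sum`). A factor theorem then
divides out the denominators (`exists_trig_of_residues`, `exists_trig_Dsum`).

Triangularity. Along `x₀ - iRv` with `v` strictly dominant all coefficients converge as `R → ∞`, and
`m_λ` grows like `e^λ`. A bound by `e^λ` in all these directions leaves only dominant weights `≤ λ`
(`domLE_of_dot_le`), and the limit is the diagonal coefficient. Its average over the signs is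
`E_{r,n}`, by a relation between elementary and complete symmetric functions in different numbers of
variables (`sum_recSum_Vlim`, `sum_signs_leading`).

Symmetry. The product of the weight with a coefficient loses its poles on the torus. It extends
holomorphically to a strip of width `β` and is invariant under `x_j ↦ -x_j - iβ` for the shifted
variables. Moving their contours by `-iβ` and reflecting exchanges the two functions in the form
(`integral_formTerm_symm`, `bform_Dsum_symm`).

Conclusion. The weight is positive almost everywhere, so orthogonal projection onto the lower
monomials exists; this gives existence and uniqueness of `p_λ`. By triangularity `Dsum p_λ = c p_λ +
L` with `L` in the span of the lower monomials. For `u` in that span symmetry gives `⟨L, u⟩ = ⟨p_λ,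
Dsum u⟩ = 0`, so `L = 0`. -/

open scoped BigOperators

noncomputable section

namespace Koornwinder

/-! ### Chains of finite sets and the associated recursive sums -/

section Chains

variable {ι : Type*}

/-- The non-empty subsets of `K` with at most `m` elements. -/
def smallSubsets (K : Finset ι) (m : ℕ) : Finset (Finset ι) :=
  K.powerset.filter fun A => A.Nonempty ∧ A.card ≤ m

lemma mem_smallSubsets {K A : Finset ι} {m : ℕ} :
    A ∈ smallSubsets K m ↔ A ⊆ K ∧ A.Nonempty ∧ A.card ≤ m := by
  simp [smallSubsets]

variable [DecidableEq ι]

/-- The alternating sum over chains that is built up by splitting off a non-empty block. -/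
def recSum (v : Finset ι → Finset ι → ℂ) (w : Finset ι → ℂ) (m : ℕ) (K : Finset ι) : ℂ :=
  if m = 0 then w K else
    -∑ A : smallSubsets K m, v A (K \ A) * recSum v w (m - (A : Finset ι).card) (K \ A)
termination_by m
decreasing_by
  have h := (mem_smallSubsets.1 A.2).2.1.card_pos
  omega

lemma recSum_zero (v : Finset ι → Finset ι → ℂ) (w : Finset ι → ℂ) (K : Finset ι) :
    recSum v w 0 K = w K := by
  rw [recSum]; simp

lemma recSum_of_ne_zero (v : Finset ι → Finset ι → ℂ) (w : Finset ι → ℂ) {m : ℕ} (hm : m ≠ 0)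
    (K : Finset ι) :
    recSum v w m K =
      -∑ A ∈ smallSubsets K m, v A (K \ A) * recSum v w (m - A.card) (K \ A) := by
  rw [recSum, if_neg hm, ← Finset.sum_coe_sort (smallSubsets K m)]

open Classical in
/-- The strictly increasing chains of length `s` from `B` to `J`. -/
def chainsFrom [Fintype ι] (B J : Finset ι) (s : ℕ) : Finset (Fin (s + 1) → Finset ι) :=
  Finset.univ.filter fun C => StrictMono C ∧ C 0 = B ∧ C (Fin.last s) = J

lemma mem_chainsFrom [Fintype ι] {B J : Finset ι} {s : ℕ} {C : Fin (s + 1) → Finset ι} :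
    C ∈ chainsFrom B J s ↔ StrictMono C ∧ C 0 = B ∧ C (Fin.last s) = J := by
  simp [chainsFrom]

/-- A chain is peeled from the bottom: its second member is the start of the remaining chain. -/
lemma sum_chainsFrom_succ [Fintype ι] (B J : Finset ι) (s : ℕ)
    (F : (Fin (s + 2) → Finset ι) → ℂ) :
    ∑ C ∈ chainsFrom B J (s + 1), F C =
      ∑ B' ∈ Finset.univ.filter (B ⊂ ·), ∑ C ∈ chainsFrom B' J s, F (Matrix.vecCons B C) := by
  rw [Finset.sum_sigma']
  symm
  refine Finset.sum_bij (fun a _ => Matrix.vecCons B a.2) ?_ ?_ ?_ ?_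
  · rintro ⟨B', C⟩ h
    simp only [Finset.mem_sigma, Finset.mem_filter, Finset.mem_univ, true_and,
      mem_chainsFrom] at h ⊢
    obtain ⟨h1, h2, h3, h4⟩ := h
    refine ⟨strictMono_vecCons.2 ⟨by rw [h3]; exact h1, h2⟩, rfl, ?_⟩
    rw [← h4, ← Fin.succ_last, Matrix.cons_val_succ]
  · rintro ⟨B', C⟩ h ⟨B'', C'⟩ h' e
    simp only [Finset.mem_sigma, Finset.mem_filter, Finset.mem_univ, true_and,
      mem_chainsFrom] at h h'
    have hC : C = C' := by
      funext i
      have := congrFun e i.succ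
      simpa using this
    subst hC
    obtain rfl : B' = B'' := by rw [← h.2.2.1, ← h'.2.2.1]
    rfl
  · intro C h
    rw [mem_chainsFrom] at h
    obtain ⟨h2, h3, h4⟩ := h
    refine ⟨⟨C 1, fun i => C i.succ⟩, ?_, ?_⟩
    · simp only [Finset.mem_sigma, Finset.mem_filter, Finset.mem_univ, true_and, mem_chainsFrom]
      refine ⟨?_, fun i j hij => h2 (Fin.succ_lt_succ_iff.2 hij), rfl, ?_⟩
      · rw [← h3]; exact h2 (by simp)
      · rw [← h4, ← Fin.succ_last]
    · funext i
      refine Fin.cases ?_ (fun i => ?_) i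
      · simp [h3]
      · simp
  · intros; rfl

/-- The alternating sum over chains from `B` to `J` of length at most `N`. -/
def chainSum [Fintype ι] (v : Finset ι → Finset ι → ℂ) (N : ℕ) (B J : Finset ι) : ℂ :=
  ∑ s ∈ Finset.range (N + 1), ∑ C ∈ chainsFrom B J s,
    (-1) ^ s * ∏ t : Fin s, v (C t.succ \ C t.castSucc) (C t.succ)ᶜ

lemma sum_chainsFrom_zero [Fintype ι] (B J : Finset ι) (F : (Fin 1 → Finset ι) → ℂ) :
    ∑ C ∈ chainsFrom B J 0, F C = if B = J then F (fun _ => B) else 0 := by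
  split_ifs with h
  · subst h
    have : chainsFrom B B 0 = {fun _ => B} := by
      ext C
      rw [mem_chainsFrom, Finset.mem_singleton]
      constructor
      · rintro ⟨-, h, -⟩
        funext i
        rw [Fin.eq_zero i, ← h]
      · rintro rfl
        exact ⟨fun i j hij => absurd hij (by simp [Fin.eq_zero i, Fin.eq_zero j]), rfl, rfl⟩
    rw [this, Finset.sum_singleton]
  · refine Finset.sum_eq_zero fun C hC => ?_
    rw [mem_chainsFrom] at hC
    exact absurd (hC.2.1.symm.trans hC.2.2) h

lemma chainSum_zero [Fintype ι] (v : Finset ι → Finset ι → ℂ) (B J : Finset ι) :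
    chainSum v 0 B J = if B = J then 1 else 0 := by
  simp only [chainSum, zero_add, Finset.range_one, Finset.sum_singleton, sum_chainsFrom_zero]
  simp

/-- Only `B = J` admits a chain of length zero. Splitting a longer chain at its second member costs
one sign and one factor; the other factors are untouched because each of them sees only two
consecutive members. -/
lemma chainSum_succ [Fintype ι] (v : Finset ι → Finset ι → ℂ) (N : ℕ) (B J : Finset ι) :
    chainSum v (N + 1) B J = (if B = J then 1 else 0) -
      ∑ B' ∈ Finset.univ.filter (B ⊂ ·), v (B' \ B) B'ᶜ * chainSum v N B' J := by
  rw [chainSum, Finset.sum_range_succ', sum_chainsFrom_zero, add_comm, sub_eq_add_neg]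
  congr 1
  · simp
  · simp only [sum_chainsFrom_succ, chainSum]
    rw [Finset.sum_comm, ← Finset.sum_neg_distrib]
    refine Finset.sum_congr rfl fun B' _ => ?_
    rw [Finset.mul_sum, ← Finset.sum_neg_distrib]
    refine Finset.sum_congr rfl fun s _ => ?_
    rw [Finset.mul_sum, ← Finset.sum_neg_distrib]
    refine Finset.sum_congr rfl fun C hC => ?_
    rw [Fin.prod_univ_succ]
    rw [mem_chainsFrom] at hC
    simp only [Matrix.cons_val_succ, Fin.castSucc_zero, Matrix.cons_val_zero, Fin.castSucc_succ]
    rw [hC.2.1]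
    ring

lemma chainSum_eq_zero [Fintype ι] (v : Finset ι → Finset ι → ℂ) (N : ℕ) {B J : Finset ι}
    (h : ¬ B ⊆ J) : chainSum v N B J = 0 := by
  refine Finset.sum_eq_zero fun s _ => Finset.sum_eq_zero fun C hC => ?_
  rw [mem_chainsFrom] at hC
  refine absurd ?_ h
  rw [← hC.2.1, ← hC.2.2]
  exact hC.1.monotone (Fin.zero_le _)

lemma sum_smallSubsets_compl [Fintype ι] (B : Finset ι) (m : ℕ) (F : Finset ι → ℂ) :
    ∑ A ∈ smallSubsets Bᶜ m, F A =
      ∑ B' ∈ Finset.univ.filter (fun B' => B ⊂ B' ∧ B'.card ≤ B.card + m), F (B' \ B) := by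
  refine Finset.sum_bij' (fun A _ => B ∪ A) (fun B' _ => B' \ B) ?_ ?_ ?_ ?_ ?_
  · intro A hA
    rw [mem_smallSubsets] at hA
    obtain ⟨h1, h2, h3⟩ := hA
    have hd : Disjoint B A := Finset.disjoint_left.2 fun x hx hx' =>
      (Finset.mem_compl.1 (h1 hx')) hx
    simp only [Finset.mem_filter, Finset.mem_univ, true_and]
    refine ⟨Finset.ssubset_iff_subset_ne.2 ⟨Finset.subset_union_left, fun h => ?_⟩, ?_⟩
    · obtain ⟨x, hx⟩ := h2
      exact Finset.disjoint_left.1 hd (h ▸ Finset.mem_union_right _ hx) hx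
    · rw [Finset.card_union_of_disjoint hd]; omega
  · intro B' hB'
    simp only [Finset.mem_filter, Finset.mem_univ, true_and] at hB'
    rw [mem_smallSubsets]
    refine ⟨fun x hx => Finset.mem_compl.2 (Finset.mem_sdiff.1 hx).2,
      Finset.sdiff_nonempty.2 hB'.1.2, ?_⟩
    rw [Finset.card_sdiff_of_subset hB'.1.1]; omega
  · intro A hA
    rw [mem_smallSubsets] at hA
    ext x
    have := @hA.1 x
    simp only [Finset.mem_compl] at this
    simp only [Finset.mem_sdiff, Finset.mem_union]
    tauto
  · intro B' hB'
    simp only [Finset.mem_filter, Finset.mem_univ, true_and] at hB'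
    exact Finset.union_sdiff_of_subset hB'.1.1
  · intro A hA
    rw [mem_smallSubsets] at hA
    congr 1
    ext x
    have := @hA.1 x
    simp only [Finset.mem_compl] at this
    simp only [Finset.mem_sdiff, Finset.mem_union]
    tauto

/-- A factor depends only on its block and on what remains afterwards, so after summing over all
ends `J` of size `r` only the free set `Bᶜ` and the number of indices still to be chosen matter. The
length bound `r - B.card ≤ N` suffices because every step enlarges the set. -/
lemma sum_chainSum [Fintype ι] (v : Finset ι → Finset ι → ℂ) (r : ℕ) :
    ∀ (N : ℕ) (B : Finset ι), B.card ≤ r → r - B.card ≤ N →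
      ∑ J ∈ Finset.powersetCard r Finset.univ, chainSum v N B J =
        recSum v (fun _ => 1) (r - B.card) Bᶜ := by
  intro N
  induction N with
  | zero =>
    intro B h1 h2
    have h3 : B.card = r := by omega
    simp only [chainSum_zero]
    rw [h3, Nat.sub_self, recSum_zero, Finset.sum_ite_eq, if_pos]
    simp [h3]
  | succ N ih =>
    intro B h1 h2
    simp only [chainSum_succ, Finset.sum_sub_distrib, Finset.sum_ite_eq,
      Finset.mem_powersetCard_univ]
    rw [Finset.sum_comm]
    simp only [← Finset.mul_sum]
    -- A set with more than `r` elements lies below no `J` of size `r`; this produces the size bound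
    -- built into `smallSubsets`.
    have key : ∀ B' : Finset ι, B ⊂ B' → ¬ B'.card ≤ r →
        ∑ J ∈ Finset.powersetCard r Finset.univ, chainSum v N B' J = 0 := by
      intro B' _ h
      refine Finset.sum_eq_zero fun J hJ => chainSum_eq_zero v N fun hBJ => h ?_
      rw [Finset.mem_powersetCard_univ] at hJ
      exact hJ ▸ Finset.card_le_card hBJ
    by_cases h3 : B.card = r
    · rw [if_pos h3, h3, Nat.sub_self, recSum_zero, Finset.sum_eq_zero, sub_zero]
      intro B' hB'
      rw [Finset.mem_filter] at hB'
      rw [key B' hB'.2, mul_zero]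
      have := Finset.card_lt_card hB'.2
      omega
    · have h4 : r - B.card ≠ 0 := by omega
      rw [if_neg h3, zero_sub, recSum_of_ne_zero _ _ h4, sum_smallSubsets_compl, neg_inj]
      rw [← Finset.sum_filter_add_sum_filter_not _ (fun B' => B'.card ≤ r),
        Finset.filter_filter, Finset.filter_filter, add_eq_left.2]
      · have e : B.card + (r - B.card) = r := by omega
        rw [e]
        refine Finset.sum_congr rfl fun B' hB' => ?_
        simp only [Finset.mem_filter, Finset.mem_univ, true_and] at hB'
        obtain ⟨h5, h6⟩ := hB'
        have h7 := Finset.card_lt_card h5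
        rw [ih B' h6 (by omega)]
        have e1 : Bᶜ \ (B' \ B) = B'ᶜ := by
          ext x
          have := @h5.1 x
          simp only [Finset.mem_sdiff, Finset.mem_compl]
          tauto
        rw [e1, Finset.card_sdiff_of_subset h5.1]
        congr 2
        omega
      · refine Finset.sum_eq_zero fun B' hB' => ?_
        simp only [Finset.mem_filter, Finset.mem_univ, true_and] at hB'
        rw [key B' hB'.1 hB'.2, mul_zero]

end Chains

/-! ### Sums over sign configurations -/

section Signs

variable {n : ℕ}

/-- The function `b` of the signs does not depend on the signs outside `A`. -/
def DependsOnlyOn (b : (Fin n → ℤˣ) → ℂ) (A : Finset (Fin n)) : Prop :=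
  ∀ ε η : Fin n → ℤˣ, (∀ j ∈ A, ε j = η j) → b ε = b η

/-- Independence of the signs on `A` and off `A`; the factor `2 ^ n` replaces the normalisation of
the averages. -/
lemma sum_mul_of_dependsOnlyOn {a b : (Fin n → ℤˣ) → ℂ} {A : Finset (Fin n)}
    (ha : DependsOnlyOn a A) (hb : DependsOnlyOn b Aᶜ) :
    2 ^ n * ∑ ε, a ε * b ε = (∑ ε, a ε) * ∑ ε, b ε := by
  classical
  -- Two sign vectors exchange their coordinates outside `A`. This turns `a ε * b η` into `a` and
  -- `b` at one and the same vector.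
  let σ : (Fin n → ℤˣ) × (Fin n → ℤˣ) → (Fin n → ℤˣ) × (Fin n → ℤˣ) := fun p =>
    (fun j => if j ∈ A then p.1 j else p.2 j, fun j => if j ∈ A then p.2 j else p.1 j)
  have hσ : Function.Involutive σ := by
    rintro ⟨ε, η⟩
    ext j <;> simp only [σ] <;> split_ifs <;> rfl
  have h1 : (∑ ε, a ε) * ∑ ε, b ε = ∑ p : (Fin n → ℤˣ) × (Fin n → ℤˣ), a p.1 * b p.2 := by
    rw [Finset.sum_mul_sum, Fintype.sum_prod_type]
  have h2 : ∑ p : (Fin n → ℤˣ) × (Fin n → ℤˣ), a p.1 * b p.2 =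
      ∑ p : (Fin n → ℤˣ) × (Fin n → ℤˣ), a p.1 * b p.1 := by
    refine Fintype.sum_equiv hσ.toPerm _ _ fun p => ?_
    congr 1
    · exact ha _ _ fun j hj => by simp [σ, hj]
    · exact hb _ _ fun j hj => by simp [σ, Finset.mem_compl.1 hj]
  rw [h1, h2, Fintype.sum_prod_type]
  simp [Finset.mul_sum]

/-- Each choice of signs on `J` extends to `2 ^ (n - J.card)` full sign vectors. -/
lemma sum_signs (J : Finset (Fin n)) (X : (Fin n → ℤ) → ℂ)
    (hX : ∀ ε η : Fin n → ℤ, (∀ j ∈ J, ε j = η j) → X ε = X η) :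
    2 ^ n * ∑ ε ∈ signs J, X ε = 2 ^ J.card * ∑ ε : Fin n → ℤˣ, X fun j => (ε j : ℤ) := by
  classical
  have e1 : ∑ ε ∈ signs J, X ε = ∑ ε : Fin n → ℤˣ, X (fun j => (ε j : ℤ)) *
      (if ∀ j ∈ Jᶜ, ε j = 1 then 1 else 0) := by
    simp only [mul_ite, mul_one, mul_zero]
    rw [← Finset.sum_filter]
    symm
    refine Finset.sum_bij (fun ε _ j => (ε j : ℤ)) ?_ ?_ ?_ ?_
    · intro ε hε
      rw [Finset.mem_filter] at hε
      simp only [signs, Fintype.mem_piFinset]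
      intro j
      split_ifs with hj
      · rcases Int.units_eq_one_or (ε j) with h | h <;> simp [h]
      · simp [hε.2 j (Finset.mem_compl.2 hj)]
    · intro ε _ η _ h
      funext j
      exact Units.ext (congrFun h j)
    · intro ε hε
      simp only [signs, Fintype.mem_piFinset] at hε
      have hu : ∀ j, IsUnit (ε j) := by
        intro j
        have := hε j
        split_ifs at this with hj
        · simp only [Finset.mem_insert, Finset.mem_singleton] at this
          exact Int.isUnit_iff.2 this
        · simp only [Finset.mem_singleton] at this
          exact this ▸ isUnit_one
      refine ⟨fun j => (hu j).unit, ?_, by simp⟩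
      simp only [Finset.mem_filter, Finset.mem_univ, true_and]
      intro j hj
      have := hε j
      rw [if_neg (Finset.mem_compl.1 hj), Finset.mem_singleton] at this
      exact Units.ext (by simp [this])
    · intros; rfl
  have e2 : ∑ ε : Fin n → ℤˣ, (if ∀ j ∈ Jᶜ, ε j = 1 then (1 : ℂ) else 0) = 2 ^ J.card := by
    rw [← Finset.sum_filter, Finset.sum_const, nsmul_eq_mul, mul_one]
    have : (Finset.univ.filter fun ε : Fin n → ℤˣ => ∀ j ∈ Jᶜ, ε j = 1) =
        Fintype.piFinset fun j => if j ∈ J then Finset.univ else {1} := by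
      ext ε
      simp only [Finset.mem_filter, Finset.mem_univ, true_and, Finset.mem_compl,
        Fintype.mem_piFinset]
      refine forall_congr' fun j => ?_
      split_ifs with h
      · simp only [h, not_true_eq_false, false_imp_iff, true_iff]
        exact Finset.mem_univ _
      · simp [h]
    rw [this, Fintype.card_piFinset]
    have : ∀ j, (if j ∈ J then (Finset.univ : Finset ℤˣ) else {1}).card =
        if j ∈ J then 2 else 1 := by
      intro j; split_ifs <;> rfl
    simp only [this, Finset.prod_ite, Finset.prod_const, one_pow, mul_one]
    simp
  rw [e1, sum_mul_of_dependsOnlyOn (A := J), e2, mul_comm]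
  · intro ε η h
    exact hX _ _ fun j hj => by rw [h j hj]
  · intro ε η h
    have : (∀ j ∈ Jᶜ, ε j = 1) ↔ ∀ j ∈ Jᶜ, η j = 1 :=
      forall₂_congr fun j hj => by rw [h j hj]
    simp only [this]

end Signs

/-! ### Reduction of the difference operators to positive signs -/

section Reduction

variable {n : ℕ}

/-- The action of a sign configuration on `ℂⁿ`. -/
def flipSigns (ε : Fin n → ℤˣ) (x : Fin n → ℂ) : Fin n → ℂ := fun j => ((ε j : ℤ) : ℂ) * x j

/-- The coefficient `V_{εJ;K}` with all signs positive. -/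
def Vpos (P : Params) (A B : Finset (Fin n)) (x : Fin n → ℂ) : ℂ :=
  (∏ j ∈ A, vb P (x j)) *
  (∏ q ∈ (A ×ˢ A).filter (fun q => q.1 < q.2),
    va P (x q.1 + x q.2) * va P (x q.1 + x q.2 + 2 * P.γ)) *
  (∏ j ∈ A, ∏ k ∈ B, va P (x j + x k) * va P (x j - x k))

/-- The point `x + iβ ∑_{j ∈ A} e_j`. -/
def up (P : Params) (A : Finset (Fin n)) (x : Fin n → ℂ) : Fin n → ℂ :=
  fun j => if j ∈ A then x j + 2 * P.γ else x j

/-- The part of the difference operator that belongs to positive signs. -/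
def Dpos (P : Params) (r : ℕ) (f : (Fin n → ℂ) → ℂ) (x : Fin n → ℂ) : ℂ :=
  ∑ A ∈ Finset.univ.filter (fun A : Finset (Fin n) => A.card ≤ r),
    Vpos P A Aᶜ x * recSum (fun A B => Vpos P A B x) (fun _ => 1) (r - A.card) Aᶜ * f (up P A x)

/-- The whole point may be flipped, not only its coordinates in `J`: a sign at `k ∈ K` merely
exchanges the two factors `va (x_j ± x_k)`. -/
lemma V_eq_Vpos (P : Params) (ε : Fin n → ℤˣ) (J K : Finset (Fin n)) (x : Fin n → ℂ) :
    V P (fun j => (ε j : ℤ)) J K x = Vpos P J K (flipSigns ε x) := by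
  unfold V Vpos flipSigns
  congr 1
  refine Finset.prod_congr rfl fun j _ => Finset.prod_congr rfl fun k _ => ?_
  rcases Int.units_eq_one_or (ε k) with h | h
  · simp [h]
  · simp only [h, Units.val_neg, Units.val_one, Int.cast_neg, Int.cast_one, neg_mul, one_mul,
      sub_neg_eq_add]
    rw [mul_comm, ← sub_eq_add_neg]

lemma V_congr (P : Params) {ε η : Fin n → ℤ} {J : Finset (Fin n)} (h : ∀ j ∈ J, ε j = η j)
    (K : Finset (Fin n)) (x : Fin n → ℂ) : V P ε J K x = V P η J K x := by
  unfold V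
  congr 1
  · congr 1
    · exact Finset.prod_congr rfl fun j hj => by rw [h j hj]
    · refine Finset.prod_congr rfl fun q hq => ?_
      simp only [Finset.mem_filter, Finset.mem_product] at hq
      rw [h _ hq.1.1, h _ hq.1.2]
  · exact Finset.prod_congr rfl fun j hj => by rw [h j hj]

lemma shift_congr (P : Params) {ε η : Fin n → ℤ} {J : Finset (Fin n)} (h : ∀ j ∈ J, ε j = η j)
    (x : Fin n → ℂ) : shift P ε J x = shift P η J x := by
  funext j
  unfold shift
  split_ifs with hj
  · rw [h j hj]
  · rfl

lemma shift_flipSigns (P : Params) (ε : Fin n → ℤˣ) (J : Finset (Fin n)) (x : Fin n → ℂ) :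
    shift P (fun j => (ε j : ℤ)) J x = flipSigns ε (up P J (flipSigns ε x)) := by
  funext j
  unfold shift flipSigns up Params.γ
  split_ifs with hj <;> rcases Int.units_eq_one_or (ε j) with h | h <;> simp [h] <;> ring

/-- Only the nucleus `B = J₁` enters `f`, so it is split off. What is left of a chain of length `s`
is a chain of length `s - 1` from `B`, whose sign is exactly `(-1) ^ (s - 1)`. -/
lemma sum_chains (P : Params) {r : ℕ} (hr : 1 ≤ r) (J : Finset (Fin n))
    (f : (Fin n → ℂ) → ℂ) (ε : Fin n → ℤˣ) (hf : ∀ x, f (flipSigns ε x) = f x) (x : Fin n → ℂ) :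
    ∑ s ∈ Finset.Icc 1 r, ∑ C ∈ chains J s,
      (-1) ^ (s - 1) *
      (∏ t : Fin s, V P (fun j => (ε j : ℤ)) (C t.succ \ C t.castSucc) (C t.succ)ᶜ x) *
      (f (shift P (fun j => (ε j : ℤ)) (C 1) x) - f x) =
    ∑ B ∈ Finset.univ.filter (∅ ⊂ ·), Vpos P B Bᶜ (flipSigns ε x) *
      (f (up P B (flipSigns ε x)) - f (flipSigns ε x)) *
      chainSum (fun A B => Vpos P A B (flipSigns ε x)) (r - 1) B J := by
  obtain ⟨r, rfl⟩ : ∃ k, r = k + 1 := ⟨r - 1, by omega⟩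
  have e : ∀ F : ℕ → ℂ, ∑ s ∈ Finset.Icc 1 (r + 1), F s = ∑ s ∈ Finset.range (r + 1), F (s + 1) := by
    intro F
    rw [Finset.range_eq_Ico, Finset.sum_Ico_add' F 0 (r + 1) 1]
    rfl
  rw [e]
  have hch : ∀ s, chains J s = chainsFrom ∅ J s := by
    intro s
    ext C
    simp [chains, chainsFrom]
  simp only [hch, V_eq_Vpos, shift_flipSigns, hf, Nat.add_sub_cancel,
    sum_chainsFrom_succ]
  rw [Finset.sum_comm]
  refine Finset.sum_congr rfl fun B _ => ?_
  rw [chainSum, Finset.mul_sum]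
  refine Finset.sum_congr rfl fun s _ => ?_
  rw [Finset.mul_sum]
  refine Finset.sum_congr rfl fun C hC => ?_
  rw [mem_chainsFrom] at hC
  rw [Fin.prod_univ_succ]
  simp only [Matrix.cons_val_succ, Fin.castSucc_zero, Matrix.cons_val_zero, Fin.castSucc_succ]
  have : (Matrix.vecCons ∅ C : Fin (s + 2) → Finset (Fin n)) 1 = C 0 := rfl
  rw [this, hC.2.1, Finset.sdiff_empty]
  ring

/-- The recursion itself collects the terms `-f y`: their total coefficient is `recSum` for all of
`univ`, which is the `A = ∅` term of `Dpos`. Differences of values thus become values. -/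
lemma sum_Vpos_mul_chainSum (P : Params) {r : ℕ} (hr : 1 ≤ r) (f : (Fin n → ℂ) → ℂ)
    (y : Fin n → ℂ) :
    ∑ J ∈ Finset.powersetCard r (Finset.univ : Finset (Fin n)),
      ∑ B ∈ Finset.univ.filter (∅ ⊂ ·), Vpos P B Bᶜ y * (f (up P B y) - f y) *
        chainSum (fun A B => Vpos P A B y) (r - 1) B J = Dpos P r f y := by
  rw [Finset.sum_comm]
  simp only [← Finset.mul_sum]
  set v : Finset (Fin n) → Finset (Fin n) → ℂ := fun A B => Vpos P A B y
  have h1 : ∑ B ∈ Finset.univ.filter (∅ ⊂ ·), Vpos P B Bᶜ y * (f (up P B y) - f y) *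
        ∑ J ∈ Finset.powersetCard r Finset.univ, chainSum v (r - 1) B J =
      ∑ B ∈ smallSubsets Finset.univ r, Vpos P B Bᶜ y * (f (up P B y) - f y) *
        recSum v (fun _ => 1) (r - B.card) Bᶜ := by
    have e : smallSubsets (Finset.univ : Finset (Fin n)) r =
        (Finset.univ.filter (∅ ⊂ ·)).filter fun B => B.card ≤ r := by
      ext B
      simp [mem_smallSubsets, Finset.empty_ssubset]
    rw [e, ← Finset.sum_filter_add_sum_filter_not (Finset.univ.filter (∅ ⊂ ·))
      (fun B : Finset (Fin n) => B.card ≤ r), add_eq_left.2]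
    · refine Finset.sum_congr rfl fun B hB => ?_
      simp only [Finset.mem_filter, Finset.mem_univ, true_and] at hB
      have := Finset.card_pos.2 (Finset.empty_ssubset.1 hB.1)
      rw [sum_chainSum v r (r - 1) B hB.2 (by omega)]
    · refine Finset.sum_eq_zero fun B hB => ?_
      simp only [Finset.mem_filter, Finset.mem_univ, true_and] at hB
      rw [Finset.sum_eq_zero, mul_zero]
      intro J hJ
      refine chainSum_eq_zero _ _ fun h => hB.2 ?_
      rw [Finset.mem_powersetCard_univ] at hJ
      exact hJ ▸ Finset.card_le_card h
  rw [h1, Dpos]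
  have e2 : Finset.univ.filter (fun A : Finset (Fin n) => A.card ≤ r) =
      insert ∅ (smallSubsets Finset.univ r) := by
    ext A
    rcases A.eq_empty_or_nonempty with h | h
    · simp [h]
    · simp [mem_smallSubsets, h, h.ne_empty]
  have e3 : (∅ : Finset (Fin n)) ∉ smallSubsets Finset.univ r := by simp [mem_smallSubsets]
  have e4 : recSum v (fun _ => 1) r (Finset.univ : Finset (Fin n)) =
      -∑ B ∈ smallSubsets Finset.univ r, Vpos P B Bᶜ y * recSum v (fun _ => 1) (r - B.card) Bᶜ := by
    rw [recSum_of_ne_zero _ _ (by omega)]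
    simp only [← Finset.compl_eq_univ_sdiff, v]
  have e5 : Vpos P ∅ ∅ᶜ y = 1 := by simp [Vpos]
  have e6 : up P ∅ y = y := by funext j; simp [up]
  rw [e2, Finset.sum_insert e3, e5, e6, Finset.card_empty, Nat.sub_zero, Finset.compl_empty, e4,
    ← Finset.sum_neg_distrib, one_mul, Finset.sum_mul, ← Finset.sum_add_distrib]
  refine Finset.sum_congr rfl fun B _ => ?_
  ring

/-- A shift with signs `ε` is a positive shift conjugated by the flip `ε`, which `f` does not
notice. The powers of two compare signs on the `r` elements of `J` with signs on all coordinates. -/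
theorem two_pow_mul_D (P : Params) {r : ℕ} (hr : 1 ≤ r) (f : (Fin n → ℂ) → ℂ)
    (hf : ∀ (ε : Fin n → ℤˣ) x, f (flipSigns ε x) = f x) (x : Fin n → ℂ) :
    2 ^ n * D P r f x = 2 ^ r * ∑ ε : Fin n → ℤˣ, Dpos P r f (flipSigns ε x) := by
  unfold D
  rw [Finset.mul_sum]
  simp only [← sum_Vpos_mul_chainSum P hr]
  rw [Finset.sum_comm, Finset.mul_sum]
  refine Finset.sum_congr rfl fun J hJ => ?_
  rw [Finset.mem_powersetCard_univ] at hJ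
  rw [sum_signs, hJ]
  · congr 1
    refine Finset.sum_congr rfl fun ε _ => ?_
    exact sum_chains P hr J f ε (hf ε) x
  · intro ε η h
    refine Finset.sum_congr rfl fun s hs => Finset.sum_congr rfl fun C hC => ?_
    have hC' : ∀ t, C t ⊆ J := by
      simp only [chains, Finset.mem_filter] at hC
      intro t
      rw [← hC.2.2.2]
      exact hC.2.1.monotone (Fin.le_last t)
    have h1 : ∏ t : Fin s, V P ε (C t.succ \ C t.castSucc) (C t.succ)ᶜ x =
        ∏ t : Fin s, V P η (C t.succ \ C t.castSucc) (C t.succ)ᶜ x :=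
      Finset.prod_congr rfl fun t _ =>
        V_congr P (fun j hj => h j (hC' _ (Finset.mem_sdiff.1 hj).1)) _ _
    rw [shift_congr P (fun j hj => h j (hC' _ hj)), h1]

end Reduction

end Koornwinder
end

open scoped BigOperators

noncomputable section

namespace Koornwinder

open Filter Topology

/-! ### Trigonometric polynomials -/

section Trig

variable {n : ℕ}

lemma expo_zero : expo (0 : Fin n → ℤ) = 1 := by
  funext x; simp [expo]

lemma expo_add (μ ν : Fin n → ℤ) : expo (μ + ν) = expo μ * expo ν := by
  funext x
  simp only [expo, Pi.mul_apply, ← Complex.exp_add, ← mul_add, ← Finset.sum_add_distrib,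
    Pi.add_apply, Int.cast_add, add_mul]

lemma expo_neg (μ : Fin n → ℤ) (x : Fin n → ℂ) : expo (-μ) x = (expo μ x)⁻¹ := by
  simp only [expo, ← Complex.exp_neg, Pi.neg_apply, Int.cast_neg, neg_mul,
    Finset.sum_neg_distrib, mul_neg]

lemma expo_ne_zero (μ : Fin n → ℤ) (x : Fin n → ℂ) : expo μ x ≠ 0 := Complex.exp_ne_zero _

lemma expo_add_smul (μ : Fin n → ℤ) (p v : Fin n → ℂ) (s : ℂ) :
    expo μ (p + s • v) = expo μ p * Complex.exp (s * (Complex.I * ∑ j, (μ j : ℂ) * v j)) := by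
  simp only [expo, ← Complex.exp_add]
  congr 1
  simp only [Pi.add_apply, Pi.smul_apply, smul_eq_mul, mul_add, Finset.sum_add_distrib,
    Finset.mul_sum]
  congr 1
  exact Finset.sum_congr rfl fun j _ => by ring

/-- The algebra of trigonometric polynomials. -/
def trig (n : ℕ) : Subalgebra ℂ ((Fin n → ℂ) → ℂ) := Algebra.adjoin ℂ (Set.range expo)

lemma expo_mem_trig (μ : Fin n → ℤ) : expo μ ∈ trig n := Algebra.subset_adjoin ⟨μ, rfl⟩

lemma const_mem_trig (c : ℂ) : (fun _ : Fin n → ℂ => c) ∈ trig n := (trig n).algebraMap_mem c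

lemma trig_eq_span : Subalgebra.toSubmodule (trig n) = Submodule.span ℂ (Set.range expo) := by
  rw [trig, Algebra.adjoin_eq_span]
  congr 1
  refine Set.Subset.antisymm (fun F hF => ?_) Submonoid.subset_closure
  induction hF using Submonoid.closure_induction with
  | mem F h => exact h
  | one => exact ⟨0, expo_zero⟩
  | mul F G _ _ h1 h2 =>
    obtain ⟨μ, rfl⟩ := h1
    obtain ⟨ν, rfl⟩ := h2
    exact ⟨μ + ν, expo_add μ ν⟩

lemma mem_trig_iff {F : (Fin n → ℂ) → ℂ} :
    F ∈ trig n ↔ ∃ a : (Fin n → ℤ) →₀ ℂ, Finsupp.linearCombination ℂ expo a = F := by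
  rw [← LinearMap.mem_range, Finsupp.range_linearCombination, ← trig_eq_span,
    Subalgebra.mem_toSubmodule]

lemma linearCombination_expo_apply (a : (Fin n → ℤ) →₀ ℂ) (x : Fin n → ℂ) :
    Finsupp.linearCombination ℂ expo a x = ∑ ν ∈ a.support, a ν * expo ν x := by
  rw [Finsupp.linearCombination_apply, Finsupp.sum, Finset.sum_apply]
  rfl

lemma trig_induction {p : ((Fin n → ℂ) → ℂ) → Prop} (he : ∀ μ, p (expo μ)) (h0 : p 0)
    (hadd : ∀ F G, p F → p G → p (F + G)) (hsmul : ∀ (c : ℂ) F, p F → p (c • F))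
    {F : (Fin n → ℂ) → ℂ} (hF : F ∈ trig n) : p F := by
  rw [← Subalgebra.mem_toSubmodule, trig_eq_span] at hF
  induction hF using Submodule.span_induction with
  | mem F h => obtain ⟨μ, rfl⟩ := h; exact he μ
  | zero => exact h0
  | add F G _ _ h1 h2 => exact hadd F G h1 h2
  | smul c F _ h => exact hsmul c F h

lemma continuous_expo (μ : Fin n → ℤ) : Continuous (expo μ) := by
  unfold expo; fun_prop

lemma continuous_of_mem_trig {F : (Fin n → ℂ) → ℂ} (hF : F ∈ trig n) : Continuous F := by
  refine trig_induction continuous_expo continuous_zero (fun F G h1 h2 => h1.add h2)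
    (fun c F h => h.const_smul c) hF

/-- The character of `ℝⁿ` that belongs to an integral weight. -/
def realChar (μ : Fin n → ℤ) : Multiplicative (Fin n → ℝ) →* ℂ where
  toFun x := expo μ fun j => ((Multiplicative.toAdd x j : ℝ) : ℂ)
  map_one' := by simp [expo]
  map_mul' x y := by
    simp only [expo, toAdd_mul, Pi.add_apply, Complex.ofReal_add, mul_add,
      Finset.sum_add_distrib, Complex.exp_add]

lemma realChar_injective : Function.Injective (realChar (n := n)) := by
  intro μ ν h
  funext j
  by_contra hne
  have hne' : ((μ j : ℂ) - ν j) ≠ 0 := by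
    rw [sub_ne_zero]; exact_mod_cast hne
  -- At this point of the `j`-th axis the quotient of the two characters is `exp (π i) = -1`.
  have h1 := DFunLike.congr_fun h
    (Multiplicative.ofAdd (Pi.single j (Real.pi / ((μ j : ℝ) - ν j))))
  simp only [realChar, MonoidHom.coe_mk, OneHom.coe_mk, expo, toAdd_ofAdd] at h1
  have h2 : ∀ κ : Fin n → ℤ, ∑ i, (κ i : ℂ) *
      (((Pi.single j (Real.pi / ((μ j : ℝ) - ν j)) : Fin n → ℝ) i : ℝ) : ℂ) =
      κ j * (Real.pi / ((μ j : ℂ) - ν j)) := by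
    intro κ
    rw [Finset.sum_eq_single j]
    · simp
    · intro i _ hi
      simp [hi]
    · simp
  rw [h2, h2] at h1
  have h3 : Complex.exp (Complex.I * (μ j * (Real.pi / ((μ j : ℂ) - ν j)))) /
      Complex.exp (Complex.I * (ν j * (Real.pi / ((μ j : ℂ) - ν j)))) = 1 := by
    rw [h1, div_self (Complex.exp_ne_zero _)]
  rw [← Complex.exp_sub] at h3
  have h4 : Complex.I * (μ j * (Real.pi / ((μ j : ℂ) - ν j))) -
      Complex.I * (ν j * (Real.pi / ((μ j : ℂ) - ν j))) = Real.pi * Complex.I := by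
    field_simp
  rw [h4, Complex.exp_pi_mul_I] at h3
  norm_num at h3

/-- A trigonometric polynomial that vanishes on `ℝⁿ` has zero coefficients. -/
lemma coeff_eq_zero_of_real (a : (Fin n → ℤ) →₀ ℂ)
    (h : ∀ x : Fin n → ℝ, Finsupp.linearCombination ℂ expo a (fun j => (x j : ℂ)) = 0) :
    a = 0 := by
  have hli := (linearIndependent_monoidHom (Multiplicative (Fin n → ℝ)) ℂ).comp _
    (realChar_injective (n := n))
  rw [linearIndependent_iff] at hli
  refine hli a ?_
  funext x
  have := h (Multiplicative.toAdd x)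
  rw [linearCombination_expo_apply] at this
  rw [Finsupp.linearCombination_apply, Finsupp.sum, Finset.sum_apply]
  exact this

/-! ### Division by `expo ν - c` -/

lemma exists_zpow_sub_one (ν : Fin n → ℤ) {c : ℂ} (hc : c ≠ 0) (m : ℤ) :
    ∃ M ∈ trig n, ∀ x, (expo ν x / c) ^ m - 1 = (expo ν x - c) * M x := by
  have hE : (fun x => expo ν x / c) ∈ trig n := by
    have : (fun x => expo ν x / c) = c⁻¹ • expo ν := by
      funext x; simp [div_eq_inv_mul]
    rw [this]; exact (trig n).smul_mem (expo_mem_trig ν) _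
  have hEi : (fun x => (expo ν x / c)⁻¹) ∈ trig n := by
    have : (fun x => (expo ν x / c)⁻¹) = c • expo (-ν) := by
      funext x; simp [expo_neg, div_eq_mul_inv]
    rw [this]; exact (trig n).smul_mem (expo_mem_trig _) _
  have hnat : ∀ k : ℕ, ∃ M ∈ trig n, ∀ x, (expo ν x / c) ^ k - 1 = (expo ν x - c) * M x := by
    intro k
    refine ⟨c⁻¹ • ∑ i ∈ Finset.range k, (fun x => expo ν x / c) ^ i,
      (trig n).smul_mem (sum_mem fun i _ => pow_mem hE i) _, fun x => ?_⟩
    rw [← mul_geom_sum]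
    simp only [Pi.smul_apply, Finset.sum_apply, Pi.pow_apply, smul_eq_mul]
    field_simp
  obtain ⟨k, rfl | rfl⟩ := m.eq_nat_or_neg
  · simpa using hnat k
  · obtain ⟨M, hM, h⟩ := hnat k
    refine ⟨-((fun x => (expo ν x / c)⁻¹) ^ k * M), neg_mem (mul_mem (pow_mem hEi k) hM),
      fun x => ?_⟩
    have h1 := h x
    have h2 : expo ν x / c ≠ 0 := div_ne_zero (expo_ne_zero _ _) hc
    simp only [zpow_neg, zpow_natCast, Pi.neg_apply, Pi.mul_apply, Pi.pow_apply, inv_pow]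
    have h3 : (expo ν x / c) ^ k ≠ 0 := pow_ne_zero _ h2
    calc ((expo ν x / c) ^ k)⁻¹ - 1 = -((expo ν x / c) ^ k)⁻¹ * ((expo ν x / c) ^ k - 1) := by
          rw [mul_sub, neg_mul, inv_mul_cancel₀ h3]; ring
      _ = _ := by rw [h1]; ring

/-- The factor theorem for trigonometric polynomials. -/
lemma exists_eq_mul_of_vanish {N : (Fin n → ℂ) → ℂ} (hN : N ∈ trig n) {ν : Fin n → ℤ}
    {j : Fin n} (hj : ν j = 1) {c : ℂ} (hc : c ≠ 0) (h0 : ∀ x, expo ν x = c → N x = 0) :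
    ∃ M ∈ trig n, ∀ x, N x = (expo ν x - c) * M x := by
  set κ : ℂ := -Complex.I * Complex.log c
  have hκ : Complex.exp (Complex.I * κ) = c := by
    have : Complex.I * κ = Complex.log c := by
      simp only [κ]; rw [← mul_assoc]; simp
    rw [this, Complex.exp_log hc]
  -- Projection along `e_j` onto the hyperplane `ν·x = κ`, on which `N` vanishes. Since `ν j = 1`,
  -- composing `expo μ` with it produces an integral power of `expo ν / c`, so `N - N ∘ σ` is
  -- divisible by `expo ν - c`.
  let σ : (Fin n → ℂ) → Fin n → ℂ := fun x =>
    x + (-(∑ i, (ν i : ℂ) * x i - κ)) • (Pi.single j 1 : Fin n → ℂ)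
  have hsum : ∀ μ : Fin n → ℤ, ∑ i, (μ i : ℂ) * (Pi.single j 1 : Fin n → ℂ) i = μ j := by
    intro μ
    rw [Finset.sum_eq_single j]
    · simp
    · intro i _ hi; simp [hi]
    · simp
  have hσ : ∀ μ x, expo μ (σ x) = expo μ x * (expo ν x / c) ^ (-(μ j)) := by
    intro μ x
    simp only [σ]
    rw [expo_add_smul, hsum]
    congr 1
    have : expo ν x / c = Complex.exp (Complex.I * (∑ i, (ν i : ℂ) * x i - κ)) := by
      rw [mul_sub, Complex.exp_sub, hκ]; rfl
    rw [this, ← Complex.exp_int_mul]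
    congr 1
    push_cast
    ring
  have key : ∃ M ∈ trig n, ∀ x, N x - N (σ x) = (expo ν x - c) * M x := by
    refine trig_induction (p := fun N => ∃ M ∈ trig n, ∀ x, N x - N (σ x) = (expo ν x - c) * M x)
      ?_ ?_ ?_ ?_ hN
    · intro μ
      obtain ⟨M, hM, h⟩ := exists_zpow_sub_one ν hc (-(μ j))
      refine ⟨-(expo μ * M), neg_mem (mul_mem (expo_mem_trig μ) hM), fun x => ?_⟩
      rw [hσ]
      simp only [Pi.neg_apply, Pi.mul_apply]
      linear_combination (-expo μ x) * h x
    · exact ⟨0, zero_mem _, by simp⟩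
    · rintro F G ⟨M1, h1, h1'⟩ ⟨M2, h2, h2'⟩
      refine ⟨M1 + M2, add_mem h1 h2, fun x => ?_⟩
      simp only [Pi.add_apply]
      linear_combination h1' x + h2' x
    · rintro a F ⟨M1, h1, h1'⟩
      refine ⟨a • M1, (trig n).smul_mem h1 a, fun x => ?_⟩
      simp only [Pi.smul_apply, smul_eq_mul]
      linear_combination a * h1' x
  obtain ⟨M, hM, h⟩ := key
  refine ⟨M, hM, fun x => ?_⟩
  rw [← h x, h0 (σ x), sub_zero]
  rw [hσ, hj, zpow_neg, zpow_one]
  field_simp [expo_ne_zero ν x]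

/-! ### Removal of poles -/

/-- The function whose zero set is the union of hyperplanes `e^{iν·x} = c`. -/
def hypFun (h : (Fin n → ℤ) × ℂ) (x : Fin n → ℂ) : ℂ := expo h.1 x - h.2

lemma hypFun_mem_trig (h : (Fin n → ℤ) × ℂ) : hypFun h ∈ trig n :=
  sub_mem (expo_mem_trig h.1) (const_mem_trig h.2)

lemma continuous_line (p v : Fin n → ℂ) : Continuous fun s : ℂ => p + s • v := by
  fun_prop

lemma tendsto_line {F : (Fin n → ℂ) → ℂ} (hF : Continuous F) (p v : Fin n → ℂ) :
    Tendsto (fun s : ℂ => F (p + s • v)) (𝓝[≠] 0) (𝓝 (F p)) := by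
  have h : Continuous fun s : ℂ => F (p + s • v) := hF.comp (continuous_line p v)
  have := (h.tendsto 0).mono_left (nhdsWithin_le_nhds (s := {0}ᶜ))
  simpa using this

lemma hasDerivAt_hypFun_line (h : (Fin n → ℤ) × ℂ) (p v : Fin n → ℂ) :
    HasDerivAt (fun s : ℂ => hypFun h (p + s • v))
      (expo h.1 p * (Complex.I * ∑ j, (h.1 j : ℂ) * v j)) 0 := by
  have e : (fun s : ℂ => hypFun h (p + s • v)) = fun s =>
      expo h.1 p * Complex.exp (s * (Complex.I * ∑ j, (h.1 j : ℂ) * v j)) - h.2 := by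
    funext s; rw [hypFun, expo_add_smul]
  rw [e]
  have h1 : HasDerivAt (fun s : ℂ => s * (Complex.I * ∑ j, (h.1 j : ℂ) * v j))
      (Complex.I * ∑ j, (h.1 j : ℂ) * v j) 0 := by
    simpa using (hasDerivAt_id (0 : ℂ)).mul_const (Complex.I * ∑ j, (h.1 j : ℂ) * v j)
  have h2 := (h1.cexp.const_mul (expo h.1 p)).sub_const h.2
  simpa using h2

lemma eventually_hypFun_ne_zero (h : (Fin n → ℤ) × ℂ) (p v : Fin n → ℂ)
    (hv : hypFun h p ≠ 0 ∨ ∑ j, (h.1 j : ℂ) * v j ≠ 0) :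
    ∀ᶠ s in 𝓝[≠] (0 : ℂ), hypFun h (p + s • v) ≠ 0 := by
  rcases hv with hv | hv
  · exact (tendsto_line (continuous_of_mem_trig (hypFun_mem_trig h)) p v).eventually_ne hv
  · exact (hasDerivAt_hypFun_line h p v).eventually_ne
      (mul_ne_zero (expo_ne_zero _ _) (mul_ne_zero Complex.I_ne_zero hv))

/-- A family of hyperplanes in general position: each is primitive, and each contains a direction
that is transversal to all non-parallel ones. -/
structure GeneralPosition (H : Finset ((Fin n → ℤ) × ℂ)) : Prop where
  ne_zero : ∀ h ∈ H, h.2 ≠ 0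
  primitive : ∀ h ∈ H, ∃ j, h.1 j = 1
  direction : ∀ h ∈ H, ∃ u : Fin n → ℂ, ∑ j, (h.1 j : ℂ) * u j = 0 ∧
    ∀ h' ∈ H, h'.1 = h.1 ∨ ∑ j, (h'.1 j : ℂ) * u j ≠ 0

/-- `p` lies on the hyperplane `h` and on no other one. -/
def GenericOn (H : Finset ((Fin n → ℤ) × ℂ)) (h : (Fin n → ℤ) × ℂ) (p : Fin n → ℂ) : Prop :=
  hypFun h p = 0 ∧ ∀ h' ∈ H, h' ≠ h → hypFun h' p ≠ 0

/-- Moving along the direction `u` stays on `h` and immediately leaves the other hyperplanes: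
non-parallel ones are crossed transversally, parallel ones with another constant do not meet `h`.
Continuity does the rest. -/
lemma vanish_of_vanish_generic {H : Finset ((Fin n → ℤ) × ℂ)} (hH : GeneralPosition H)
    {h : (Fin n → ℤ) × ℂ} (hh : h ∈ H) {N : (Fin n → ℂ) → ℂ} (hN : N ∈ trig n)
    (h0 : ∀ p, GenericOn H h p → N p = 0) (p : Fin n → ℂ) (hp : hypFun h p = 0) : N p = 0 := by
  obtain ⟨u, hu, hu'⟩ := hH.direction h hh
  have h1 : ∀ᶠ s in 𝓝[≠] (0 : ℂ), N (p + s • u) = 0 := by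
    have h2 : ∀ᶠ s in 𝓝[≠] (0 : ℂ), ∀ h' ∈ H, h' ≠ h → hypFun h' (p + s • u) ≠ 0 := by
      rw [Filter.eventually_all_finset]
      intro h' hh'
      by_cases hne : h' = h
      · simp [hne]
      · refine (eventually_hypFun_ne_zero h' p u ?_).mono fun s hs _ => hs
        refine (hu' h' hh').imp_left fun e => ?_
        intro h0'
        refine hne (Prod.ext e ?_)
        rw [hypFun, sub_eq_zero] at hp h0'
        rw [← hp, ← h0', e]
    refine h2.mono fun s hs => h0 _ ⟨?_, hs⟩
    rw [hypFun, expo_add_smul, hu]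
    simpa [hypFun] using hp
  exact tendsto_nhds_unique_of_eventuallyEq
    (tendsto_line (continuous_of_mem_trig hN) p u) tendsto_const_nhds h1

/-- A function with denominators from a family of hyperplanes in general position is a
trigonometric polynomial if its residues along generic points of the hyperplanes vanish. -/
lemma exists_trig_of_residues {H : Finset ((Fin n → ℤ) × ℂ)} (hH : GeneralPosition H)
    {F : (Fin n → ℂ) → ℂ}
    (hres : ∀ h ∈ H, ∀ p, GenericOn H h p → ∃ v : Fin n → ℂ, ∑ j, (h.1 j : ℂ) * v j ≠ 0 ∧
      Tendsto (fun s : ℂ => s * F (p + s • v)) (𝓝[≠] 0) (𝓝 0))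
    (S : Multiset ((Fin n → ℤ) × ℂ)) (hS : ∀ h ∈ S, h ∈ H) :
    ∀ N ∈ trig n, (∀ x, (∀ h ∈ H, hypFun h x ≠ 0) →
      (S.map fun h => hypFun h x).prod * F x = N x) →
    ∃ M ∈ trig n, ∀ x, (∀ h ∈ H, hypFun h x ≠ 0) → F x = M x := by
  induction S using Multiset.induction with
  | empty =>
    intro N hN h
    exact ⟨N, hN, fun x hx => by simpa using h x hx⟩
  | cons h S ih =>
    intro N hN hF
    have hh : h ∈ H := hS h (Multiset.mem_cons_self h S)
    have hvan : ∀ p, GenericOn H h p → N p = 0 := by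
      intro p hp
      obtain ⟨v, hv, hlim⟩ := hres h hh p hp
      have hprod : Continuous fun x => (S.map fun h => hypFun h x).prod :=
        continuous_multiset_prod _ fun h' _ => continuous_of_mem_trig (hypFun_mem_trig h')
      -- Near `p` this product equals `N`. The first factor tends to a derivative, the second stays
      -- bounded, and the last tends to zero by the residue hypothesis.
      have h1 : Tendsto (fun s : ℂ => (s⁻¹ * hypFun h (p + s • v)) *
          (S.map fun h => hypFun h (p + s • v)).prod * (s * F (p + s • v))) (𝓝[≠] 0)
          (𝓝 ((expo h.1 p * (Complex.I * ∑ j, (h.1 j : ℂ) * v j)) * (S.map fun h => hypFun h p).prod * 0)) := by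
        refine (Tendsto.mul ?_ (tendsto_line hprod p v)).mul hlim
        have := (hasDerivAt_hypFun_line h p v).tendsto_slope_zero
        simpa [hp.1] using this
      rw [mul_zero] at h1
      refine tendsto_nhds_unique_of_eventuallyEq
        (tendsto_line (continuous_of_mem_trig hN) p v) h1 ?_
      have h2 : ∀ᶠ s in 𝓝[≠] (0 : ℂ), ∀ h' ∈ H, hypFun h' (p + s • v) ≠ 0 := by
        rw [Filter.eventually_all_finset]
        intro h' hh'
        by_cases hne : h' = h
        · subst hne; exact eventually_hypFun_ne_zero h' p v (Or.inr hv)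
        · exact eventually_hypFun_ne_zero h' p v (Or.inl (hp.2 h' hh' hne))
      filter_upwards [h2, self_mem_nhdsWithin] with s hs hs0
      rw [← hF _ hs, Multiset.map_cons, Multiset.prod_cons]
      have hs0' : s ≠ 0 := hs0
      field_simp
    obtain ⟨j, hj⟩ := hH.primitive h hh
    obtain ⟨M, hM, hNM⟩ := exists_eq_mul_of_vanish hN hj (hH.ne_zero h hh) fun x hx =>
      vanish_of_vanish_generic hH hh hN hvan x (by rw [hypFun, hx, sub_self])
    refine ih (fun h' hh' => hS h' (Multiset.mem_cons_of_mem hh')) M hM fun x hx => ?_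
    have := hF x hx
    rw [Multiset.map_cons, Multiset.prod_cons, hNM, mul_assoc] at this
    exact mul_left_cancel₀ (hx h hh) this

end Trig

end Koornwinder
end

open scoped BigOperators

noncomputable section

namespace Koornwinder

open Filter Topology

/-! ### Simple poles in one complex variable -/

section Poles

/-- `g` has at most a simple pole at `0`. -/
def SimplePole (g : ℂ → ℂ) : Prop :=
  ∃ L : ℂ, Tendsto (fun s => s * g s) (𝓝[≠] 0) (𝓝 L)

lemma tendsto_mul_of_continuousAt {g : ℂ → ℂ} (hg : ContinuousAt g 0) :
    Tendsto (fun s => s * g s) (𝓝[≠] 0) (𝓝 0) := by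
  have h : ContinuousAt (fun s => s * g s) 0 := continuousAt_id.mul hg
  have := h.tendsto.mono_left (nhdsWithin_le_nhds (s := {0}ᶜ))
  simpa using this

lemma SimplePole.of_continuousAt {g : ℂ → ℂ} (hg : ContinuousAt g 0) : SimplePole g :=
  ⟨0, tendsto_mul_of_continuousAt hg⟩

lemma ContinuousAt.tendsto_punctured {g : ℂ → ℂ} (hg : ContinuousAt g 0) :
    Tendsto g (𝓝[≠] 0) (𝓝 (g 0)) :=
  hg.tendsto.mono_left nhdsWithin_le_nhds

lemma SimplePole.mul_continuousAt {f g : ℂ → ℂ} (hf : SimplePole f) (hg : ContinuousAt g 0) :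
    SimplePole fun s => f s * g s := by
  obtain ⟨L, hL⟩ := hf
  refine ⟨L * g 0, ?_⟩
  simpa only [mul_assoc] using hL.mul (ContinuousAt.tendsto_punctured hg)

lemma SimplePole.continuousAt_mul {f g : ℂ → ℂ} (hf : ContinuousAt f 0) (hg : SimplePole g) :
    SimplePole fun s => f s * g s := by
  simpa only [mul_comm] using hg.mul_continuousAt hf

lemma SimplePole.sum {ι : Type*} {t : Finset ι} {f : ι → ℂ → ℂ}
    (h : ∀ i ∈ t, SimplePole (f i)) : SimplePole fun s => ∑ i ∈ t, f i s := by
  choose! L hL using h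
  refine ⟨∑ i ∈ t, L i, ?_⟩
  simpa only [Finset.mul_sum] using tendsto_finsetSum t hL

lemma SimplePole.neg {f : ℂ → ℂ} (h : SimplePole f) : SimplePole fun s => -f s := by
  obtain ⟨L, hL⟩ := h
  exact ⟨-L, by simpa only [mul_neg] using hL.neg⟩

lemma continuousAt_prod {ι : Type*} {t : Finset ι} {f : ι → ℂ → ℂ}
    (h : ∀ i ∈ t, ContinuousAt (f i) 0) : ContinuousAt (fun s => ∏ i ∈ t, f i s) 0 :=
  tendsto_finsetProd t h

lemma SimplePole.prod {ι : Type*} {t : Finset ι} {f : ι → ℂ → ℂ}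
    (h : ∀ i ∈ t, SimplePole (f i))
    (h' : ∀ i ∈ t, ∀ j ∈ t, i ≠ j → ContinuousAt (f i) 0 ∨ ContinuousAt (f j) 0) :
    SimplePole fun s => ∏ i ∈ t, f i s := by
  classical
  by_cases hc : ∀ i ∈ t, ContinuousAt (f i) 0
  · exact .of_continuousAt (continuousAt_prod hc)
  · push Not at hc
    obtain ⟨i, hi, hci⟩ := hc
    have e : (fun s => ∏ i ∈ t, f i s) = fun s => f i s * ∏ j ∈ t.erase i, f j s := by
      funext s; rw [Finset.mul_prod_erase t (fun j => f j s) hi]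
    rw [e]
    refine (h i hi).mul_continuousAt (continuousAt_prod fun j hj => ?_)
    rw [Finset.mem_erase] at hj
    exact (h' i hi j hj.2 hj.1.symm).resolve_left hci

end Poles

/-! ### Poles of the recursive sums -/

section RecSumPoles

variable {ι : Type*} [DecidableEq ι] {v : ℂ → Finset ι → Finset ι → ℂ}

lemma continuousAt_recSum (K : Finset ι)
    (hv : ∀ A B, Disjoint A B → A ∪ B ⊆ K → ContinuousAt (fun s => v s A B) 0) (m : ℕ) :
    ContinuousAt (fun s => recSum (v s) (fun _ => 1) m K) 0 := by
  induction m using Nat.strong_induction_on generalizing K with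
  | _ m ih =>
    by_cases hm : m = 0
    · subst hm; simpa only [recSum_zero] using continuousAt_const
    · simp only [recSum_of_ne_zero _ _ hm]
      refine ContinuousAt.neg (tendsto_finsetSum _ fun A hA => ?_)
      rw [mem_smallSubsets] at hA
      have h1 := hA.2.1.card_pos
      refine ContinuousAt.mul (hv _ _ Finset.disjoint_sdiff ?_) (ih _ (by omega) _ ?_)
      · rw [Finset.union_sdiff_of_subset hA.1]
      · exact fun A' B' h h' => hv A' B' h (h'.trans Finset.sdiff_subset)

/-- At most one factor in a product of coefficients is singular. While `S` lies in the remaining set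
the coefficient is regular, and once a block has touched `S` everything after it is regular. -/
lemma simplePole_recSum (S : Finset ι)
    (hreg : ∀ A B, Disjoint A B → (¬ S ⊆ A ∪ B ∨ S ⊆ B) → ContinuousAt (fun s => v s A B) 0)
    (hpol : ∀ A B, Disjoint A B → SimplePole (fun s => v s A B)) (m : ℕ) (K : Finset ι) :
    SimplePole (fun s => recSum (v s) (fun _ => 1) m K) := by
  induction m using Nat.strong_induction_on generalizing K with
  | _ m ih =>
    by_cases hm : m = 0
    · subst hm; simpa only [recSum_zero] using .of_continuousAt continuousAt_const
    · simp only [recSum_of_ne_zero _ _ hm]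
      refine SimplePole.neg (SimplePole.sum fun A hA => ?_)
      rw [mem_smallSubsets] at hA
      have h1 := hA.2.1.card_pos
      by_cases hS : S ⊆ K \ A
      · exact .continuousAt_mul (hreg _ _ Finset.disjoint_sdiff (Or.inr hS)) (ih _ (by omega) _)
      · refine (hpol _ _ Finset.disjoint_sdiff).mul_continuousAt (continuousAt_recSum _ ?_ _)
        exact fun A' B' hd hB => hreg A' B' hd (Or.inl fun hSA => hS (hSA.trans hB))

/-- The residue data of a coefficient system along a line through a pole that is caused by the
block `S`. -/
structure BlockPole (v : ℂ → Finset ι → Finset ι → ℂ) (S : Finset ι) (ρ : Finset ι → ℂ) :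
    Prop where
  reg : ∀ A B, Disjoint A B → ¬ S ⊆ A → ContinuousAt (fun s => v s A B) 0
  empty : ∀ B, v 0 ∅ B = 1
  res : ∀ A B, Disjoint A S → Disjoint A B → Disjoint S B →
    Tendsto (fun s => s * v s (A ∪ S) B) (𝓝[≠] 0) (𝓝 (ρ B * v 0 A (B ∪ S)))

/-- The residue of the summand that belongs to the block `A ∪ S`. -/
def blockResidue (v : ℂ → Finset ι → Finset ι → ℂ) (S : Finset ι) (ρ : Finset ι → ℂ) (m : ℕ)
    (K A : Finset ι) : ℂ :=
  if A.card + S.card ≤ m then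
    ρ ((K \ S) \ A) * v 0 A (K \ A) *
      recSum (v 0) (fun _ => 1) (m - A.card - S.card) ((K \ S) \ A) else 0

/-- The sets containing `S` and those disjoint from `S` correspond by `A ↦ A \ S`, and partners
carry opposite residues and equal weights. -/
lemma sum_blockResidue (S : Finset ι) (ρ : Finset ι → ℂ) (m : ℕ) {K : Finset ι} (hSK : S ⊆ K)
    (hS : S.Nonempty) (ψ : Finset ι → ℂ) (hψ : ∀ A, Disjoint A S → ψ (A ∪ S) = ψ A) :
    ∑ A ∈ K.powerset.filter (fun A => A.card ≤ m),
      (if S ⊆ A then blockResidue v S ρ m K (A \ S) else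
        if Disjoint A S then -blockResidue v S ρ m K A else 0) * ψ A = 0 := by
  -- The bound on the cardinality breaks the pairing, but it can be dropped: `blockResidue` is zero
  -- beyond it.
  rw [Finset.sum_filter_of_ne]
  · have h1 : ∀ A, (if S ⊆ A then blockResidue v S ρ m K (A \ S) else
        if Disjoint A S then -blockResidue v S ρ m K A else 0) * ψ A =
        (if S ⊆ A then blockResidue v S ρ m K (A \ S) * ψ A else 0) -
        (if Disjoint A S then blockResidue v S ρ m K A * ψ A else 0) := by
      intro A
      by_cases hA : S ⊆ A
      · have : ¬ Disjoint A S := fun h => by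
          obtain ⟨x, hx⟩ := hS
          exact Finset.disjoint_left.1 h (hA hx) hx
        simp [hA, this]
      · by_cases hd : Disjoint A S <;> simp [hA, hd]
    simp only [h1, Finset.sum_sub_distrib]
    rw [← Finset.sum_filter, ← Finset.sum_filter, sub_eq_zero]
    refine Finset.sum_bij' (fun A _ => A \ S) (fun A _ => A ∪ S) ?_ ?_ ?_ ?_ ?_
    · intro A hA
      simp only [Finset.mem_filter, Finset.mem_powerset] at hA ⊢
      exact ⟨Finset.sdiff_subset.trans hA.1, Finset.sdiff_disjoint⟩
    · intro A hA
      simp only [Finset.mem_filter, Finset.mem_powerset] at hA ⊢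
      exact ⟨Finset.union_subset hA.1 hSK, Finset.subset_union_right⟩
    · intro A hA
      simp only [Finset.mem_filter, Finset.mem_powerset] at hA
      exact Finset.sdiff_union_of_subset hA.2
    · intro A hA
      simp only [Finset.mem_filter, Finset.mem_powerset] at hA
      exact Finset.union_sdiff_cancel_right hA.2
    · intro A hA
      simp only [Finset.mem_filter, Finset.mem_powerset] at hA
      rw [← hψ (A \ S) Finset.sdiff_disjoint, Finset.sdiff_union_of_subset hA.2]
  · intro A _ hne
    by_contra hcard
    apply hne
    split_ifs with h1 h2
    · have : (A \ S).card + S.card = A.card := by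
        rw [Finset.card_sdiff_of_subset h1]
        have := Finset.card_le_card h1
        omega
      rw [blockResidue, if_neg (by omega), zero_mul]
    · rw [blockResidue, if_neg (by omega), neg_zero, zero_mul]
    · rw [zero_mul]

variable {S : Finset ι} {ρ : Finset ι → ℂ}

lemma BlockPole.continuousAt_recSum (h : BlockPole v S ρ) {K : Finset ι} (hK : ¬ S ⊆ K) (m : ℕ) :
    ContinuousAt (fun s => recSum (v s) (fun _ => 1) m K) 0 :=
  Koornwinder.continuousAt_recSum K (fun A B hd hAB => h.reg A B hd fun hA =>
    hK ((hA.trans Finset.subset_union_left).trans hAB)) m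

/-- If the block contains `S`, the pole sits in its coefficient and the rest is regular. If it
avoids `S`, the coefficient is regular and the pole comes from the rest, whose residue is supplied
by `ih`. If it cuts `S`, there is no pole at all. -/
lemma BlockPole.tendsto_term (h : BlockPole v S ρ) (hS : S.Nonempty) {m : ℕ} {K A : Finset ι}
    (hSK : S ⊆ K) (hA : A.card ≤ m)
    (ih : Disjoint A S →
      Tendsto (fun s => s * recSum (v s) (fun _ => 1) (m - A.card) (K \ A)) (𝓝[≠] 0)
        (𝓝 (-blockResidue v S ρ (m - A.card) (K \ A) ∅))) :
    Tendsto (fun s => s * (v s A (K \ A) * recSum (v s) (fun _ => 1) (m - A.card) (K \ A)))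
      (𝓝[≠] 0) (𝓝 (if S ⊆ A then blockResidue v S ρ m K (A \ S) else
        if Disjoint A S then -blockResidue v S ρ m K A else 0)) := by
  split_ifs with h1 h2
  · have e1 : A \ S ∪ S = A := Finset.sdiff_union_of_subset h1
    have e2 : (K \ S) \ (A \ S) = K \ A := by
      ext x; have := @h1 x; simp only [Finset.mem_sdiff]; tauto
    have e3 : K \ A ∪ S = K \ (A \ S) := by
      ext x
      have := @h1 x
      have := @hSK x
      simp only [Finset.mem_sdiff, Finset.mem_union]; tauto
    have e4 : (A \ S).card + S.card = A.card := by
      rw [Finset.card_sdiff_of_subset h1]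
      have := Finset.card_le_card h1
      omega
    have hres := h.res (A \ S) (K \ A) Finset.sdiff_disjoint
      (Finset.disjoint_sdiff.mono_left Finset.sdiff_subset) (Finset.disjoint_sdiff.mono_left h1)
    rw [e1, e3] at hres
    have hreg := h.continuousAt_recSum (K := K \ A) (fun hK => by
      obtain ⟨x, hx⟩ := hS
      exact (Finset.mem_sdiff.1 (hK hx)).2 (h1 hx)) (m - A.card)
    have := hres.mul (ContinuousAt.tendsto_punctured hreg)
    rw [blockResidue, if_pos (by omega), e2]
    have e5 : m - (A \ S).card - S.card = m - A.card := by omega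
    rw [e5]
    simpa only [mul_assoc] using this
  · have hreg := h.reg A (K \ A) Finset.disjoint_sdiff h1
    have := (ContinuousAt.tendsto_punctured hreg).mul (ih h2)
    have e : v 0 A (K \ A) * -blockResidue v S ρ (m - A.card) (K \ A) ∅ =
        -blockResidue v S ρ m K A := by
      unfold blockResidue
      have e1 : (K \ A) \ S = (K \ S) \ A := sdiff_right_comm _ _ _
      simp only [Finset.card_empty, zero_add, Finset.sdiff_empty, Nat.sub_zero, h.empty, e1,
        mul_one]
      by_cases hc : A.card + S.card ≤ m
      · rw [if_pos hc, if_pos (by omega)]; ring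
      · rw [if_neg hc, if_neg (by omega)]; ring
    rw [e] at this
    refine this.congr fun s => ?_
    ring
  · refine tendsto_mul_of_continuousAt
      (ContinuousAt.mul (h.reg A (K \ A) Finset.disjoint_sdiff h1) (h.continuousAt_recSum ?_ _))
    intro hK
    exact h2 (Finset.disjoint_left.2 fun x hx hx' => (Finset.mem_sdiff.1 (hK hx')).2 hx)

lemma empty_notMem_smallSubsets {ι : Type*} (K : Finset ι) (m : ℕ) : ∅ ∉ smallSubsets K m := by
  simp [mem_smallSubsets]

lemma filter_card_eq_insert (K : Finset ι) (m : ℕ) :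
    K.powerset.filter (fun A => A.card ≤ m) = insert ∅ (smallSubsets K m) := by
  ext A
  rcases A.eq_empty_or_nonempty with h | h
  · simp [h]
  · simp [mem_smallSubsets, h, h.ne_empty]

/-- The residues cancel in pairs, but `A = ∅` does not occur in the recursion, so its partner, the
block `S` itself, survives. -/
lemma BlockPole.tendsto_recSum (h : BlockPole v S ρ) (hS : S.Nonempty) (m : ℕ) {K : Finset ι}
    (hSK : S ⊆ K) :
    Tendsto (fun s => s * recSum (v s) (fun _ => 1) m K) (𝓝[≠] 0)
      (𝓝 (-blockResidue v S ρ m K ∅)) := by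
  induction m using Nat.strong_induction_on generalizing K with
  | _ m ih =>
    have hSc := hS.card_pos
    by_cases hm : m = 0
    · subst hm
      simp only [recSum_zero]
      rw [blockResidue, if_neg (by simpa using hS.ne_empty), neg_zero]
      exact tendsto_mul_of_continuousAt continuousAt_const
    · have h1 := sum_blockResidue (v := v) S ρ m hSK hS (fun _ => 1) (fun _ _ => rfl)
      rw [filter_card_eq_insert, Finset.sum_insert (empty_notMem_smallSubsets K m)] at h1
      have h2 : ¬ S ⊆ ∅ := fun h => hS.ne_empty (Finset.subset_empty.1 h)
      simp only [mul_one, h2, if_false, Finset.disjoint_empty_left, if_true] at h1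
      have h3 : -blockResidue v S ρ m K ∅ = -∑ A ∈ smallSubsets K m,
          (if S ⊆ A then blockResidue v S ρ m K (A \ S) else
            if Disjoint A S then -blockResidue v S ρ m K A else 0) := by
        linear_combination h1
      rw [h3]
      simp only [recSum_of_ne_zero _ _ hm, mul_neg, Finset.mul_sum]
      refine Tendsto.neg (tendsto_finsetSum _ fun A hA => ?_)
      rw [mem_smallSubsets] at hA
      have := hA.2.1.card_pos
      refine h.tendsto_term hS hSK hA.2.2 fun hd => ih _ (by omega) ?_
      exact fun x hx => Finset.mem_sdiff.2 ⟨hSK hx, fun hxA => Finset.disjoint_left.1 hd hxA hx⟩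

/-- The poles caused by the block `S` cancel in sums with `S`-invariant weights. -/
lemma BlockPole.tendsto_sum (h : BlockPole v S ρ) (hS : S.Nonempty) (m : ℕ) {K : Finset ι}
    (hSK : S ⊆ K) (ψ : ℂ → Finset ι → ℂ) (hψ : ∀ A, ContinuousAt (fun s => ψ s A) 0)
    (hψS : ∀ A, Disjoint A S → ψ 0 (A ∪ S) = ψ 0 A) :
    Tendsto (fun s => s * ∑ A ∈ K.powerset.filter (fun A => A.card ≤ m),
      v s A (K \ A) * recSum (v s) (fun _ => 1) (m - A.card) (K \ A) * ψ s A) (𝓝[≠] 0) (𝓝 0) := by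
  refine Eq.subst (motive := fun c => Tendsto _ (𝓝[≠] 0) (𝓝 c))
    (sum_blockResidue (v := v) S ρ m hSK hS (ψ 0) hψS) ?_
  simp only [Finset.mul_sum]
  refine tendsto_finsetSum _ fun A hA => ?_
  rw [Finset.mem_filter, Finset.mem_powerset] at hA
  have := (h.tendsto_term hS hSK hA.2 (fun hd => h.tendsto_recSum hS _ ?_)).mul
    (ContinuousAt.tendsto_punctured (hψ A))
  · simpa only [mul_assoc] using this
  · exact fun x hx => Finset.mem_sdiff.2 ⟨hSK hx, fun hx' => Finset.disjoint_left.1 hd hx' hx⟩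

end RecSumPoles

end Koornwinder
end

open scoped BigOperators

noncomputable section

namespace Koornwinder

open Filter Topology

/-! ### The coefficients as rational functions of exponentials -/

section Coefficients

/-- `q^{1/2} = e^{-β/2}`. -/
def Params.sq (P : Params) : ℂ := Complex.exp (-P.β / 2)

lemma Params.sq_ne_zero (P : Params) : P.sq ≠ 0 := Complex.exp_ne_zero _

lemma Params.exp_γ (P : Params) : Complex.exp (Complex.I * P.γ) = P.sq := by
  rw [Params.γ, Params.sq]
  congr 1
  linear_combination (P.β / 2 : ℂ) * Complex.I_sq

lemma Params.exp_two_γ (P : Params) : Complex.exp (Complex.I * (2 * P.γ)) = P.sq * P.sq := by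
  rw [← P.exp_γ, ← Complex.exp_add]; congr 1; ring

lemma Params.sq_eq_ofReal (P : Params) : P.sq = ((Real.exp (-P.β / 2) : ℝ) : ℂ) := by
  rw [Params.sq]; push_cast; rfl

/-- `(1 - t w) / (1 - w)`. -/
def ratio (t w : ℂ) : ℂ := (1 - t * w) / (1 - w)

lemma sin_half (a : ℂ) : Complex.sin (a / 2) =
    Complex.I / 2 * Complex.exp (-(Complex.I * a / 2)) * (1 - Complex.exp (Complex.I * a)) := by
  have : Complex.exp (Complex.I * a) =
      Complex.exp (Complex.I * a / 2) * Complex.exp (Complex.I * a / 2) := by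
    rw [← Complex.exp_add]; congr 1; ring
  rw [Complex.sin, this]
  have h2 : Complex.exp (-(Complex.I * a / 2)) * Complex.exp (Complex.I * a / 2) = 1 := by
    rw [← Complex.exp_add]; simp
  have e1 : -(a / 2) * Complex.I = -(Complex.I * a / 2) := by ring
  have e2 : a / 2 * Complex.I = Complex.I * a / 2 := by ring
  rw [e1, e2]
  linear_combination (-Complex.I / 2 * Complex.exp (Complex.I * a / 2)) * (-h2)

lemma cos_half (a : ℂ) : Complex.cos (a / 2) =
    1 / 2 * Complex.exp (-(Complex.I * a / 2)) * (1 + Complex.exp (Complex.I * a)) := by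
  have : Complex.exp (Complex.I * a) =
      Complex.exp (Complex.I * a / 2) * Complex.exp (Complex.I * a / 2) := by
    rw [← Complex.exp_add]; congr 1; ring
  rw [Complex.cos, this]
  have h2 : Complex.exp (-(Complex.I * a / 2)) * Complex.exp (Complex.I * a / 2) = 1 := by
    rw [← Complex.exp_add]; simp
  have e1 : -(a / 2) * Complex.I = -(Complex.I * a / 2) := by ring
  have e2 : a / 2 * Complex.I = Complex.I * a / 2 := by ring
  rw [e1, e2]
  linear_combination (1 / 2 * Complex.exp (Complex.I * a / 2)) * (-h2)

lemma sin_half_eq_zero (a : ℂ) : Complex.sin (a / 2) = 0 ↔ Complex.exp (Complex.I * a) = 1 := by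
  rw [sin_half, eq_comm (b := (1 : ℂ))]
  simp [Complex.exp_ne_zero, sub_eq_zero]

lemma cos_half_eq_zero (a : ℂ) : Complex.cos (a / 2) = 0 ↔ Complex.exp (Complex.I * a) = -1 := by
  rw [cos_half]
  simp [Complex.exp_ne_zero, add_eq_zero_iff_eq_neg']

lemma sin_half_div (β g : ℝ) (z : ℂ) :
    Complex.sin ((Complex.I * β * g + z) / 2) / Complex.sin (z / 2) =
      Complex.exp (β * g / 2) * ratio (Complex.exp (-β * g)) (Complex.exp (Complex.I * z)) := by
  have e1 : Complex.exp (-(Complex.I * (Complex.I * β * g + z) / 2)) =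
      Complex.exp (β * g / 2) * Complex.exp (-(Complex.I * z / 2)) := by
    rw [← Complex.exp_add]; congr 1
    linear_combination (-(β * g : ℂ) / 2) * Complex.I_sq
  have e2 : Complex.exp (Complex.I * (Complex.I * β * g + z)) =
      Complex.exp (-β * g) * Complex.exp (Complex.I * z) := by
    rw [← Complex.exp_add]; congr 1
    linear_combination ((β * g : ℂ)) * Complex.I_sq
  rw [sin_half, sin_half z, e1, e2, ratio]
  have h1 := Complex.exp_ne_zero (-(Complex.I * z / 2))
  have h2 : Complex.I / 2 * Complex.exp (-(Complex.I * z / 2)) ≠ 0 :=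
    mul_ne_zero (by simp) h1
  rw [← mul_div_assoc, ← mul_div_mul_left _ (1 - _) h2]
  congr 1
  ring

lemma cos_half_div (β g : ℝ) (z : ℂ) :
    Complex.cos ((Complex.I * β * g + z) / 2) / Complex.cos (z / 2) =
      Complex.exp (β * g / 2) * ratio (Complex.exp (-β * g)) (-Complex.exp (Complex.I * z)) := by
  have e1 : Complex.exp (-(Complex.I * (Complex.I * β * g + z) / 2)) =
      Complex.exp (β * g / 2) * Complex.exp (-(Complex.I * z / 2)) := by
    rw [← Complex.exp_add]; congr 1
    linear_combination (-(β * g : ℂ) / 2) * Complex.I_sq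
  have e2 : Complex.exp (Complex.I * (Complex.I * β * g + z)) =
      Complex.exp (-β * g) * Complex.exp (Complex.I * z) := by
    rw [← Complex.exp_add]; congr 1
    linear_combination ((β * g : ℂ)) * Complex.I_sq
  rw [cos_half, cos_half z, e1, e2, ratio]
  have h1 := Complex.exp_ne_zero (-(Complex.I * z / 2))
  have h2 : 1 / 2 * Complex.exp (-(Complex.I * z / 2)) ≠ 0 :=
    mul_ne_zero (by simp) h1
  rw [← mul_div_assoc, ← mul_div_mul_left _ (1 - _) h2]
  congr 1 <;> ring

lemma va_eq (P : Params) (z : ℂ) : va P z =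
    Complex.exp (P.β * P.g / 2) * ratio (Complex.exp (-P.β * P.g)) (Complex.exp (Complex.I * z)) :=
  sin_half_div _ _ _

lemma vb_eq (P : Params) (z : ℂ) : vb P z =
    (Complex.exp (P.β * P.g₀ / 2) *
      ratio (Complex.exp (-P.β * P.g₀)) (Complex.exp (Complex.I * z))) *
    (Complex.exp (P.β * P.g₁ / 2) *
      ratio (Complex.exp (-P.β * P.g₁)) (-Complex.exp (Complex.I * z))) *
    (Complex.exp (P.β * P.gp₀ / 2) *
      ratio (Complex.exp (-P.β * P.gp₀)) (P.sq * Complex.exp (Complex.I * z))) *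
    (Complex.exp (P.β * P.gp₁ / 2) *
      ratio (Complex.exp (-P.β * P.gp₁)) (-(P.sq * Complex.exp (Complex.I * z)))) := by
  unfold vb
  rw [sin_half_div, cos_half_div, add_assoc, sin_half_div, add_assoc, cos_half_div, mul_add,
    Complex.exp_add, P.exp_γ]

lemma va_congr (P : Params) {z z' : ℂ}
    (h : Complex.exp (Complex.I * z) = Complex.exp (Complex.I * z')) : va P z = va P z' := by
  rw [va_eq, va_eq, h]

lemma vb_congr (P : Params) {z z' : ℂ}
    (h : Complex.exp (Complex.I * z) = Complex.exp (Complex.I * z')) : vb P z = vb P z' := by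
  rw [vb_eq, vb_eq, h]

end Coefficients

/-! ### Behaviour along complex lines -/

section Lines

lemma exp_line (k a b s : ℂ) : k * Complex.exp (Complex.I * (a + s * b)) =
    (k * Complex.exp (Complex.I * a)) * Complex.exp (s * (Complex.I * b)) := by
  rw [mul_assoc, ← Complex.exp_add]; congr 2; ring

lemma continuousAt_ratio_line (t k a b : ℂ) (h : k * Complex.exp (Complex.I * a) ≠ 1) :
    ContinuousAt (fun s => ratio t (k * Complex.exp (Complex.I * (a + s * b)))) 0 := by
  unfold ratio
  refine ContinuousAt.div (by fun_prop) (by fun_prop) ?_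
  simpa [sub_eq_zero] using Ne.symm h

lemma simplePole_ratio_line (t k a b : ℂ) :
    SimplePole (fun s => ratio t (k * Complex.exp (Complex.I * (a + s * b)))) := by
  by_cases h : k * Complex.exp (Complex.I * a) = 1
  -- A direction inside the polar hyperplane gives a constant function, with value zero by the
  -- convention for division.
  · by_cases hb : b = 0
    · subst hb
      simp only [mul_zero]
      exact .of_continuousAt continuousAt_const
    · have hd : HasDerivAt (fun s : ℂ => 1 - Complex.exp (s * (Complex.I * b)))
          (-(Complex.I * b)) 0 := by
        have h1 : HasDerivAt (fun s : ℂ => s * (Complex.I * b)) (Complex.I * b) 0 := by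
          simpa using (hasDerivAt_id (0 : ℂ)).mul_const (Complex.I * b)
        simpa using h1.cexp.const_sub 1
      have hne : -(Complex.I * b) ≠ 0 := neg_ne_zero.2 (mul_ne_zero Complex.I_ne_zero hb)
      have h2 := hd.tendsto_slope_zero
      simp only [zero_add, zero_mul, Complex.exp_zero, sub_self, sub_zero, smul_eq_mul] at h2
      have h3 := h2.inv₀ hne
      have h4 : ContinuousAt (fun s => 1 - t * Complex.exp (s * (Complex.I * b))) 0 := by fun_prop
      refine ⟨_, (h3.mul (ContinuousAt.tendsto_punctured h4)).congr fun s => ?_⟩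
      dsimp only
      rw [exp_line, h, one_mul, ratio, mul_inv, inv_inv]
      ring
  · exact .of_continuousAt (continuousAt_ratio_line t k a b h)

variable (P : Params)

lemma continuousAt_va_line {a : ℂ} (h : Complex.exp (Complex.I * a) ≠ 1) (b : ℂ) :
    ContinuousAt (fun s => va P (a + s * b)) 0 := by
  simp only [va_eq]
  refine ContinuousAt.mul continuousAt_const ?_
  simpa only [one_mul] using continuousAt_ratio_line _ 1 a b (by simpa using h)

lemma simplePole_va_line (a b : ℂ) : SimplePole (fun s => va P (a + s * b)) := by
  simp only [va_eq]
  refine .continuousAt_mul continuousAt_const ?_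
  simpa only [one_mul] using simplePole_ratio_line _ 1 a b

lemma continuousAt_va_line_shift {a : ℂ}
    (h : P.sq * P.sq * Complex.exp (Complex.I * a) ≠ 1) (b : ℂ) :
    ContinuousAt (fun s => va P (a + s * b + 2 * P.γ)) 0 := by
  have e : (fun s : ℂ => va P (a + s * b + 2 * P.γ)) =
      fun s => va P ((a + 2 * P.γ) + s * b) := by
    funext s; congr 1; ring
  rw [e]
  refine continuousAt_va_line P ?_ b
  rwa [mul_add, Complex.exp_add, P.exp_two_γ, mul_comm]

lemma simplePole_va_line_shift (a b : ℂ) : SimplePole (fun s => va P (a + s * b + 2 * P.γ)) := by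
  have e : (fun s : ℂ => va P (a + s * b + 2 * P.γ)) =
      fun s => va P ((a + 2 * P.γ) + s * b) := by
    funext s; congr 1; ring
  rw [e]
  exact simplePole_va_line P _ b

lemma continuousAt_vb_line {a : ℂ} (h1 : Complex.exp (Complex.I * a) ≠ 1)
    (h2 : Complex.exp (Complex.I * a) ≠ -1) (h3 : P.sq * Complex.exp (Complex.I * a) ≠ 1)
    (h4 : P.sq * Complex.exp (Complex.I * a) ≠ -1) (b : ℂ) :
    ContinuousAt (fun s => vb P (a + s * b)) 0 := by
  simp only [vb_eq]
  refine ContinuousAt.mul (ContinuousAt.mul (ContinuousAt.mul ?_ ?_) ?_) ?_ <;>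
    refine ContinuousAt.mul continuousAt_const ?_
  · simpa only [one_mul] using continuousAt_ratio_line _ 1 a b (by simpa using h1)
  · simpa only [neg_mul, one_mul] using continuousAt_ratio_line _ (-1) a b
      (by rwa [neg_mul, one_mul, Ne, neg_eq_iff_eq_neg])
  · exact continuousAt_ratio_line _ _ a b h3
  · simpa only [neg_mul] using continuousAt_ratio_line _ (-P.sq) a b
      (by rwa [neg_mul, Ne, neg_eq_iff_eq_neg])

lemma SimplePole.mul_four {f₁ f₂ f₃ f₄ : ℂ → ℂ} (p₁ : SimplePole f₁) (p₂ : SimplePole f₂)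
    (p₃ : SimplePole f₃) (p₄ : SimplePole f₄)
    (h : (ContinuousAt f₂ 0 ∧ ContinuousAt f₃ 0 ∧ ContinuousAt f₄ 0) ∨
      (ContinuousAt f₁ 0 ∧ ContinuousAt f₃ 0 ∧ ContinuousAt f₄ 0) ∨
      (ContinuousAt f₁ 0 ∧ ContinuousAt f₂ 0 ∧ ContinuousAt f₄ 0) ∨
      (ContinuousAt f₁ 0 ∧ ContinuousAt f₂ 0 ∧ ContinuousAt f₃ 0)) :
    SimplePole fun s => f₁ s * f₂ s * f₃ s * f₄ s := by
  rcases h with ⟨a, b, c⟩ | ⟨a, b, c⟩ | ⟨a, b, c⟩ | ⟨a, b, c⟩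
  · exact ((p₁.mul_continuousAt a).mul_continuousAt b).mul_continuousAt c
  · exact ((SimplePole.continuousAt_mul a p₂).mul_continuousAt b).mul_continuousAt c
  · exact (SimplePole.continuousAt_mul (a.mul b) p₃).mul_continuousAt c
  · exact SimplePole.continuousAt_mul ((a.mul b).mul c) p₄

/-- The four denominators vanish at `e^{ia} = ±1` and `e^{ia} = ±q^{-1/2}`. These values are
distinct because `q^{1/2} ≠ ±1`, so at most one factor is singular. -/
lemma simplePole_vb_line (hq : P.sq ≠ 1) (hq' : P.sq ≠ -1) (a b : ℂ) :
    SimplePole (fun s => vb P (a + s * b)) := by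
  have pole : ∀ c t k : ℂ,
      SimplePole (fun s => c * ratio t (k * Complex.exp (Complex.I * (a + s * b)))) :=
    fun c t k => .continuousAt_mul continuousAt_const (simplePole_ratio_line t k a b)
  have cont : ∀ c t k : ℂ, k * Complex.exp (Complex.I * a) ≠ 1 →
      ContinuousAt (fun s => c * ratio t (k * Complex.exp (Complex.I * (a + s * b)))) 0 :=
    fun c t k h => continuousAt_const.mul (continuousAt_ratio_line t k a b h)
  have e : (fun s => vb P (a + s * b)) = fun s =>
      (Complex.exp (P.β * P.g₀ / 2) * ratio (Complex.exp (-P.β * P.g₀))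
        (1 * Complex.exp (Complex.I * (a + s * b)))) *
      (Complex.exp (P.β * P.g₁ / 2) * ratio (Complex.exp (-P.β * P.g₁))
        (-1 * Complex.exp (Complex.I * (a + s * b)))) *
      (Complex.exp (P.β * P.gp₀ / 2) * ratio (Complex.exp (-P.β * P.gp₀))
        (P.sq * Complex.exp (Complex.I * (a + s * b)))) *
      (Complex.exp (P.β * P.gp₁ / 2) * ratio (Complex.exp (-P.β * P.gp₁))
        (-P.sq * Complex.exp (Complex.I * (a + s * b)))) := by
    funext s; rw [vb_eq, one_mul, neg_one_mul, neg_mul P.sq]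
  rw [e]
  refine SimplePole.mul_four (pole _ _ _) (pole _ _ _) (pole _ _ _) (pole _ _ _) ?_
  have h11 : (-1 : ℂ) ≠ 1 := by norm_num
  have hn : -P.sq ≠ 1 := by rwa [Ne, neg_eq_iff_eq_neg]
  by_cases h1 : Complex.exp (Complex.I * a) = 1
  · left
    refine ⟨cont _ _ _ ?_, cont _ _ _ ?_, cont _ _ _ ?_⟩ <;> rw [h1, mul_one]
    · exact h11
    · exact hq
    · exact hn
  have h1' : 1 * Complex.exp (Complex.I * a) ≠ 1 := by rwa [one_mul]
  by_cases h2 : Complex.exp (Complex.I * a) = -1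
  · right; left
    refine ⟨cont _ _ _ h1', cont _ _ _ ?_, cont _ _ _ ?_⟩ <;> rw [h2, mul_neg_one]
    · exact hn
    · rwa [neg_neg]
  have h2' : -1 * Complex.exp (Complex.I * a) ≠ 1 := by rwa [neg_one_mul, Ne, neg_eq_iff_eq_neg]
  by_cases h3 : P.sq * Complex.exp (Complex.I * a) = 1
  · right; right; left
    refine ⟨cont _ _ _ h1', cont _ _ _ h2', cont _ _ _ ?_⟩
    rw [neg_mul, h3]; exact h11
  · right; right; right
    exact ⟨cont _ _ _ h1', cont _ _ _ h2', cont _ _ _ h3⟩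

end Lines

/-! ### Products over pairs -/

section PairProducts

variable {ι : Type*} [LinearOrder ι]

/-- The product of `f i j` over the pairs `i < j` in `A`. -/
def pairProd (f : ι → ι → ℂ) (A : Finset ι) : ℂ :=
  ∏ q ∈ (A ×ˢ A).filter (fun q => q.1 < q.2), f q.1 q.2

lemma pairProd_empty (f : ι → ι → ℂ) : pairProd f ∅ = 1 := by simp [pairProd]

/-- Symmetry of `f` makes the position of `b` in the order irrelevant; from here on pair products no
longer depend on how index sets interlace. -/
lemma pairProd_insert (f : ι → ι → ℂ) (hf : ∀ i j, f i j = f j i) {A : Finset ι} {b : ι}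
    (hb : b ∉ A) : pairProd f (insert b A) = pairProd f A * ∏ a ∈ A, f a b := by
  classical
  have h1 : ((insert b A) ×ˢ (insert b A)).filter (fun q => q.1 < q.2) =
      (A ×ˢ A).filter (fun q => q.1 < q.2) ∪
        A.image (fun a => if a < b then (a, b) else (b, a)) := by
    ext ⟨i, j⟩
    simp only [Finset.mem_filter, Finset.mem_product, Finset.mem_insert, Finset.mem_union,
      Finset.mem_image]
    constructor
    · rintro ⟨⟨rfl | hi, rfl | hj⟩, h⟩
      · exact absurd h (lt_irrefl _)
      · right; exact ⟨j, hj, by rw [if_neg (not_lt.2 h.le)]⟩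
      · right; exact ⟨i, hi, by rw [if_pos h]⟩
      · left; exact ⟨⟨hi, hj⟩, h⟩
    · rintro (⟨⟨hi, hj⟩, h⟩ | ⟨a, ha, h⟩)
      · exact ⟨⟨Or.inr hi, Or.inr hj⟩, h⟩
      · split_ifs at h with hab <;> (rw [Prod.mk.injEq] at h; obtain ⟨rfl, rfl⟩ := h)
        · exact ⟨⟨Or.inr ha, Or.inl rfl⟩, hab⟩
        · refine ⟨⟨Or.inl rfl, Or.inr ha⟩, lt_of_le_of_ne (not_lt.1 hab) ?_⟩
          rintro rfl; exact hb ha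
  rw [pairProd, h1, Finset.prod_union, Finset.prod_image]
  · rw [pairProd]
    congr 1
    refine Finset.prod_congr rfl fun a _ => ?_
    split_ifs
    · rfl
    · exact hf _ _
  · intro a ha a' ha' h
    have ha1 : a ≠ b := fun h => hb (h ▸ ha)
    have ha2 : a' ≠ b := fun h => hb (h ▸ ha')
    dsimp only at h
    split_ifs at h <;> simp_all
  · rw [Finset.disjoint_left]
    rintro ⟨i, j⟩ h h'
    simp only [Finset.mem_filter, Finset.mem_product, Finset.mem_image] at h h'
    obtain ⟨a, ha, e⟩ := h'
    split_ifs at e <;> (rw [Prod.mk.injEq] at e; obtain ⟨rfl, rfl⟩ := e)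
    · exact hb h.1.2
    · exact hb h.1.1

lemma pairProd_union (f : ι → ι → ℂ) (hf : ∀ i j, f i j = f j i) {A B : Finset ι}
    (hAB : Disjoint A B) :
    pairProd f (A ∪ B) = pairProd f A * pairProd f B * ∏ a ∈ A, ∏ b ∈ B, f a b := by
  induction B using Finset.induction_on with
  | empty => simp [pairProd_empty]
  | insert b B hb ih =>
    rw [Finset.disjoint_insert_right] at hAB
    have h1 : b ∉ A ∪ B := by simp [hAB.1, hb]
    rw [Finset.union_insert, pairProd_insert f hf h1, ih hAB.2, pairProd_insert f hf hb,
      Finset.prod_union hAB.2]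
    have : ∏ a ∈ A, ∏ b' ∈ insert b B, f a b' = (∏ a ∈ A, f a b) * ∏ a ∈ A, ∏ b' ∈ B, f a b' := by
      rw [← Finset.prod_mul_distrib]
      exact Finset.prod_congr rfl fun a _ => Finset.prod_insert hb
    rw [this]
    ring

lemma pairProd_map (f : ι → ι → ℂ) (hf : ∀ i j, f i j = f j i) (σ : Equiv.Perm ι)
    (A : Finset ι) : pairProd (fun i j => f (σ i) (σ j)) A = pairProd f (A.map σ.toEmbedding) := by
  induction A using Finset.induction_on with
  | empty => simp [pairProd_empty]
  | insert b A hb ih =>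
    rw [pairProd_insert _ (fun i j => hf _ _) hb, Finset.map_insert,
      pairProd_insert f hf (by simpa using hb), ih, Finset.prod_map]
    rfl

lemma pairProd_congr {f f' : ι → ι → ℂ} {A : Finset ι}
    (h : ∀ i ∈ A, ∀ j ∈ A, i < j → f i j = f' i j) : pairProd f A = pairProd f' A := by
  refine Finset.prod_congr rfl fun q hq => ?_
  simp only [Finset.mem_filter, Finset.mem_product] at hq
  exact h _ hq.1.1 _ hq.1.2 hq.2

lemma pairProd_mul (f g : ι → ι → ℂ) (A : Finset ι) :
    pairProd (fun i j => f i j * g i j) A = pairProd f A * pairProd g A :=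
  Finset.prod_mul_distrib

end PairProducts

/-! ### Poles of the coefficients along lines -/

section CoefficientPoles

variable {n : ℕ} (P : Params)

/-- The factor of `V` for a pair inside a block. -/
def vaa (x : Fin n → ℂ) (i l : Fin n) : ℂ :=
  va P (x i + x l) * va P (x i + x l + 2 * P.γ)

/-- The factor of `V` for a pair consisting of an index in the block and one outside. -/
def vac (x : Fin n → ℂ) (i l : Fin n) : ℂ := va P (x i + x l) * va P (x i - x l)

lemma vaa_symm (x : Fin n → ℂ) (i l : Fin n) : vaa P x i l = vaa P x l i := by
  simp only [vaa, add_comm (x i)]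

lemma Vpos_eq (A B : Finset (Fin n)) (x : Fin n → ℂ) : Vpos P A B x =
    (∏ j ∈ A, vb P (x j)) * pairProd (vaa P x) A * ∏ j ∈ A, ∏ k ∈ B, vac P x j k := rfl

lemma Vpos_empty (B : Finset (Fin n)) (x : Fin n → ℂ) : Vpos P ∅ B x = 1 := by
  simp [Vpos]

/-- Putting `S` into the block multiplies by factors `vaa`, putting it into the complement
(`Vpos_union_right`) by factors `vac`. The cancellation of residues rests on comparing the two
products. -/
lemma Vpos_union_left {A S : Finset (Fin n)} (h : Disjoint A S) (B : Finset (Fin n))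
    (x : Fin n → ℂ) : Vpos P (A ∪ S) B x =
      Vpos P S B x * (Vpos P A B x * ∏ a ∈ A, ∏ j ∈ S, vaa P x a j) := by
  rw [Vpos_eq, Vpos_eq, Vpos_eq, Finset.prod_union h, Finset.prod_union h,
    pairProd_union _ (vaa_symm P x) h]
  ring

lemma Vpos_union_right (A : Finset (Fin n)) {B S : Finset (Fin n)} (h : Disjoint B S)
    (x : Fin n → ℂ) : Vpos P A (B ∪ S) x = Vpos P A B x * ∏ a ∈ A, ∏ j ∈ S, vac P x a j := by
  rw [Vpos_eq, Vpos_eq, mul_assoc _ _ (∏ a ∈ A, ∏ j ∈ S, _), ← Finset.prod_mul_distrib]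
  congr 1
  exact Finset.prod_congr rfl fun a _ => Finset.prod_union h

/-- The point `y` lies on polar hyperplanes of the coefficients that involve exactly the
coordinates in `S`, and only on one of them. -/
structure PolesIn (S : Finset (Fin n)) (y : Fin n → ℂ) : Prop where
  single : ∀ i, {i} ≠ S → Complex.exp (Complex.I * y i) ≠ 1 ∧
    Complex.exp (Complex.I * y i) ≠ -1 ∧ P.sq * Complex.exp (Complex.I * y i) ≠ 1 ∧
    P.sq * Complex.exp (Complex.I * y i) ≠ -1
  add : ∀ i l, i ≠ l → {i, l} ≠ S → Complex.exp (Complex.I * (y i + y l)) ≠ 1 ∧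
    P.sq * P.sq * Complex.exp (Complex.I * (y i + y l)) ≠ 1
  sub : ∀ i l, i ≠ l → {i, l} ≠ S → Complex.exp (Complex.I * (y i - y l)) ≠ 1
  not_both : ∀ i l, i ≠ l → Complex.exp (Complex.I * (y i + y l)) ≠ 1 ∨
    Complex.exp (Complex.I * (y i - y l)) ≠ 1

variable {P} {S : Finset (Fin n)} {y : Fin n → ℂ}

lemma line_add (y u : Fin n → ℂ) (s : ℂ) (i l : Fin n) :
    (y + s • u) i + (y + s • u) l = (y i + y l) + s * (u i + u l) := by
  simp only [Pi.add_apply, Pi.smul_apply, smul_eq_mul]; ring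

lemma line_sub (y u : Fin n → ℂ) (s : ℂ) (i l : Fin n) :
    (y + s • u) i - (y + s • u) l = (y i - y l) + s * (u i - u l) := by
  simp only [Pi.add_apply, Pi.smul_apply, smul_eq_mul]; ring

lemma PolesIn.continuousAt_vb (h : PolesIn P S y) (u : Fin n → ℂ) {i : Fin n} (hi : {i} ≠ S) :
    ContinuousAt (fun s : ℂ => vb P ((y + s • u) i)) 0 := by
  obtain ⟨h1, h2, h3, h4⟩ := h.single i hi
  exact continuousAt_vb_line P h1 h2 h3 h4 (u i)

lemma PolesIn.continuousAt_vaa (h : PolesIn P S y) (u : Fin n → ℂ) {i l : Fin n} (hil : i ≠ l)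
    (hi : {i, l} ≠ S) : ContinuousAt (fun s : ℂ => vaa P (y + s • u) i l) 0 := by
  obtain ⟨h1, h2⟩ := h.add i l hil hi
  simp only [vaa, line_add]
  exact (continuousAt_va_line P h1 _).mul (continuousAt_va_line_shift P h2 _)

lemma PolesIn.continuousAt_vac (h : PolesIn P S y) (u : Fin n → ℂ) {i l : Fin n} (hil : i ≠ l)
    (hi : {i, l} ≠ S) : ContinuousAt (fun s : ℂ => vac P (y + s • u) i l) 0 := by
  simp only [vac, line_add, line_sub]
  exact (continuousAt_va_line P (h.add i l hil hi).1 _).mul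
    (continuousAt_va_line P (h.sub i l hil hi) _)

lemma simplePole_vaa (hq : P.sq * P.sq ≠ 1) (y u : Fin n → ℂ) (i l : Fin n) :
    SimplePole (fun s : ℂ => vaa P (y + s • u) i l) := by
  simp only [vaa, line_add]
  by_cases h : Complex.exp (Complex.I * (y i + y l)) = 1
  · exact (simplePole_va_line P _ _).mul_continuousAt
      (continuousAt_va_line_shift P (by rwa [h, mul_one]) _)
  · exact .continuousAt_mul (continuousAt_va_line P h _) (simplePole_va_line_shift P _ _)

lemma PolesIn.simplePole_vac (h : PolesIn P S y) (u : Fin n → ℂ) {i l : Fin n} (hil : i ≠ l) :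
    SimplePole (fun s : ℂ => vac P (y + s • u) i l) := by
  simp only [vac, line_add, line_sub]
  rcases h.not_both i l hil with h1 | h1
  · exact .continuousAt_mul (continuousAt_va_line P h1 _) (simplePole_va_line P _ _)
  · exact (simplePole_va_line P _ _).mul_continuousAt (continuousAt_va_line P h1 _)

lemma continuousAt_Vpos (h : PolesIn P S y) (u : Fin n → ℂ) {A B : Finset (Fin n)} (h1 : ∀ i ∈ A, {i} ≠ S) (h2 : ∀ i ∈ A, ∀ l ∈ A, {i, l} ≠ S)
    (h3 : ∀ i ∈ A, ∀ l ∈ B, ContinuousAt (fun s : ℂ => vac P (y + s • u) i l) 0) :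
    ContinuousAt (fun s : ℂ => Vpos P A B (y + s • u)) 0 := by
  simp only [Vpos_eq]
  refine ContinuousAt.mul (ContinuousAt.mul ?_ ?_) ?_
  · exact continuousAt_prod fun i hi => h.continuousAt_vb u (h1 i hi)
  · refine continuousAt_prod fun q hq => ?_
    simp only [Finset.mem_filter, Finset.mem_product] at hq
    exact h.continuousAt_vaa u hq.2.ne (h2 _ hq.1.1 _ hq.1.2)
  · exact continuousAt_prod fun i hi => continuousAt_prod fun l hl => h3 i hi l hl

/-- Every factor of `Vpos` involves an index of `A`, and otherwise only indices of `A ∪ B`. Under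
either alternative its index set cannot be `S`. -/
lemma PolesIn.continuousAt_Vpos (h : PolesIn P S y) (u : Fin n → ℂ) {A B : Finset (Fin n)}
    (hAB : Disjoint A B) (hS : ¬ S ⊆ A ∪ B ∨ S ⊆ B) :
    ContinuousAt (fun s : ℂ => Vpos P A B (y + s • u)) 0 := by
  have key : ∀ i ∈ A, ∀ l ∈ A ∪ B, {i, l} ≠ S := by
    rintro i hi l hl rfl
    rcases hS with hS | hS
    · refine hS fun x hx => ?_
      simp only [Finset.mem_insert, Finset.mem_singleton] at hx
      rcases hx with rfl | rfl
      · exact Finset.mem_union_left _ hi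
      · exact hl
    · exact Finset.disjoint_left.1 hAB hi (hS (by simp))
  refine Koornwinder.continuousAt_Vpos h u ?_ ?_ ?_
  · intro i hi
    have := key i hi i (Finset.mem_union_left _ hi)
    simpa using this
  · exact fun i hi l hl => key i hi l (Finset.mem_union_left _ hl)
  · exact fun i hi l hl => h.continuousAt_vac u
      (fun e => Finset.disjoint_left.1 hAB hi (e ▸ hl)) (key i hi l (Finset.mem_union_right _ hl))

/-- A singular factor must have index set exactly `S`. At most one factor does: a single index of
`A`, a pair inside `A`, or a pair across `A` and `B`. -/
lemma PolesIn.simplePole_Vpos (h : PolesIn P S y) (hq1 : P.sq ≠ 1) (hq2 : P.sq ≠ -1)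
    (u : Fin n → ℂ) {A B : Finset (Fin n)} (hAB : Disjoint A B) :
    SimplePole (fun s : ℂ => Vpos P A B (y + s • u)) := by
  have hq : P.sq * P.sq ≠ 1 := fun e => by
    rcases mul_self_eq_one_iff.1 e with h | h
    · exact hq1 h
    · exact hq2 h
  have hne : ∀ i ∈ A, ∀ l ∈ B, i ≠ l := fun i hi l hl e =>
    Finset.disjoint_left.1 hAB hi (e ▸ hl)
  have e : (fun s : ℂ => Vpos P A B (y + s • u)) = fun s =>
      (∏ j ∈ A, vb P ((y + s • u) j)) * (pairProd (vaa P (y + s • u)) A *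
        ∏ q ∈ A ×ˢ B, vac P (y + s • u) q.1 q.2) := by
    funext s; rw [Vpos_eq, Finset.prod_product, mul_assoc]
  have c1 : (∀ i ∈ A, {i} ≠ S) → ContinuousAt (fun s : ℂ => ∏ j ∈ A, vb P ((y + s • u) j)) 0 :=
    fun h1 => continuousAt_prod fun i hi => h.continuousAt_vb u (h1 i hi)
  have c2 : (∀ i ∈ A, ∀ l ∈ A, i < l → {i, l} ≠ S) →
      ContinuousAt (fun s : ℂ => pairProd (vaa P (y + s • u)) A) 0 := by
    refine fun h2 => continuousAt_prod fun q hq => ?_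
    simp only [Finset.mem_filter, Finset.mem_product] at hq
    exact h.continuousAt_vaa u hq.2.ne (h2 _ hq.1.1 _ hq.1.2 hq.2)
  have c3 : (∀ i ∈ A, ∀ l ∈ B, {i, l} ≠ S) →
      ContinuousAt (fun s : ℂ => ∏ q ∈ A ×ˢ B, vac P (y + s • u) q.1 q.2) 0 := by
    refine fun h3 => continuousAt_prod fun q hq => ?_
    rw [Finset.mem_product] at hq
    exact h.continuousAt_vac u (hne _ hq.1 _ hq.2) (h3 _ hq.1 _ hq.2)
  rw [e]
  by_cases h1 : ∀ i ∈ A, {i} ≠ S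
  · refine .continuousAt_mul (c1 h1) ?_
    by_cases h2 : ∀ i ∈ A, ∀ l ∈ A, i < l → {i, l} ≠ S
    · refine .continuousAt_mul (c2 h2) (SimplePole.prod ?_ ?_)
      · intro q hq
        rw [Finset.mem_product] at hq
        exact h.simplePole_vac u (hne _ hq.1 _ hq.2)
      · intro q hq q' hq' hqq
        rw [Finset.mem_product] at hq hq'
        by_contra hcon
        rw [not_or] at hcon
        have a1 : {q.1, q.2} = S := by
          by_contra hc; exact hcon.1 (h.continuousAt_vac u (hne _ hq.1 _ hq.2) hc)
        have a2 : {q'.1, q'.2} = S := by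
          by_contra hc; exact hcon.2 (h.continuousAt_vac u (hne _ hq'.1 _ hq'.2) hc)
        have m1 : q'.1 ∈ ({q.1, q.2} : Finset (Fin n)) := by rw [a1, ← a2]; simp
        have m2 : q'.2 ∈ ({q.1, q.2} : Finset (Fin n)) := by rw [a1, ← a2]; simp
        simp only [Finset.mem_insert, Finset.mem_singleton] at m1 m2
        have n1 := hne _ hq'.1 _ hq.2
        have n2 := hne _ hq.1 _ hq'.2
        exact hqq (Prod.ext (m1.resolve_right n1).symm (m2.resolve_left n2.symm).symm)
    · push Not at h2
      obtain ⟨i, hi, l, hl, hil, rfl⟩ := h2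
      refine SimplePole.mul_continuousAt (SimplePole.prod ?_ ?_) (c3 ?_)
      · intro q _
        exact simplePole_vaa hq y u _ _
      · intro q hq q' hq' hqq
        simp only [Finset.mem_filter, Finset.mem_product] at hq hq'
        by_contra hcon
        rw [not_or] at hcon
        have a1 : {q.1, q.2} = ({i, l} : Finset (Fin n)) := by
          by_contra hc; exact hcon.1 (h.continuousAt_vaa u hq.2.ne hc)
        have a2 : {q'.1, q'.2} = ({i, l} : Finset (Fin n)) := by
          by_contra hc; exact hcon.2 (h.continuousAt_vaa u hq'.2.ne hc)
        have m1 : q'.1 ∈ ({q.1, q.2} : Finset (Fin n)) := by rw [a1, ← a2]; simp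
        have m2 : q'.2 ∈ ({q.1, q.2} : Finset (Fin n)) := by rw [a1, ← a2]; simp
        simp only [Finset.mem_insert, Finset.mem_singleton] at m1 m2
        have o1 := hq.2
        have o2 := hq'.2
        apply hqq
        rcases m1 with m1 | m1 <;> rcases m2 with m2 | m2 <;> rw [m1, m2] at o2
        · exact absurd o2 (lt_irrefl _)
        · exact Prod.ext m1.symm m2.symm
        · exact absurd o2 (lt_asymm o1)
        · exact absurd o2 (lt_irrefl _)
      · intro a _ b hb hab
        have : b ∈ ({i, l} : Finset (Fin n)) := by rw [← hab]; simp
        simp only [Finset.mem_insert, Finset.mem_singleton] at this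
        rcases this with rfl | rfl
        · exact Finset.disjoint_left.1 hAB hi hb
        · exact Finset.disjoint_left.1 hAB hl hb
  · push Not at h1
    obtain ⟨j, hj, rfl⟩ := h1
    have hpair : ∀ i l : Fin n, i ≠ l → {i, l} ≠ ({j} : Finset (Fin n)) := by
      intro i l hil e
      have := congrArg Finset.card e
      rw [Finset.card_pair hil, Finset.card_singleton] at this
      omega
    refine SimplePole.mul_continuousAt (SimplePole.prod ?_ ?_)
      ((c2 fun i _ l _ hil => hpair i l hil.ne).mul (c3 fun i hi l hl => hpair i l (hne i hi l hl)))
    · exact fun i _ => simplePole_vb_line P hq1 hq2 _ _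
    · intro i hi i' hi' hii
      by_cases hij : i = j
      · right
        exact h.continuousAt_vb u fun e => hii (hij.trans (Finset.singleton_inj.1 e).symm)
      · left
        exact h.continuousAt_vb u fun e => hij (Finset.singleton_inj.1 e)

/-- `hsing` keeps all factors `vac` regular, so a pole needs a `vb` or `vaa` factor and hence a
block containing `S`. By `heq`, joining `S` to the block and joining it to the complement have the
same effect at the polar point. -/
lemma exists_blockPole (h : PolesIn P S y) (hq1 : P.sq ≠ 1) (hq2 : P.sq ≠ -1) (u : Fin n → ℂ)
    (hsing : ∀ i l, i ≠ l → Complex.exp (Complex.I * (y i + y l)) ≠ 1 ∧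
      Complex.exp (Complex.I * (y i - y l)) ≠ 1)
    (heq : ∀ a, ∏ j ∈ S, vaa P y a j = ∏ j ∈ S, vac P y a j) :
    ∃ ρ, BlockPole (fun s A B => Vpos P A B (y + s • u)) S ρ := by
  -- The residue of the block `S` alone, as a function of the complement; for `B` meeting `S` the
  -- value is arbitrary.
  have hpol : ∀ B : Finset (Fin n), ∃ L, Disjoint S B →
      Tendsto (fun s : ℂ => s * Vpos P S B (y + s • u)) (𝓝[≠] 0) (𝓝 L) := by
    intro B
    by_cases hd : Disjoint S B
    · obtain ⟨L, hL⟩ := h.simplePole_Vpos hq1 hq2 u hd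
      exact ⟨L, fun _ => hL⟩
    · exact ⟨0, fun h => absurd h hd⟩
  choose ρ hρ using hpol
  have hvac : ∀ i l, i ≠ l → ContinuousAt (fun s : ℂ => vac P (y + s • u) i l) 0 := by
    intro i l hil
    simp only [vac, line_add, line_sub]
    exact (continuousAt_va_line P (hsing i l hil).1 _).mul
      (continuousAt_va_line P (hsing i l hil).2 _)
  have hreg : ∀ A B, Disjoint A B → ¬ S ⊆ A →
      ContinuousAt (fun s : ℂ => Vpos P A B (y + s • u)) 0 := by
    intro A B hAB hSA
    refine continuousAt_Vpos h u ?_ ?_ ?_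
    · rintro i hi rfl
      exact hSA (Finset.singleton_subset_iff.2 hi)
    · rintro i hi l hl rfl
      exact hSA (Finset.insert_subset hi (Finset.singleton_subset_iff.2 hl))
    · exact fun i hi l hl => hvac i l fun e => Finset.disjoint_left.1 hAB hi (e ▸ hl)
  refine ⟨ρ, hreg, fun B => Vpos_empty P B _, ?_⟩
  intro A B hAS hAB hSB
  have hmem : ∀ a ∈ A, ∀ j ∈ S, a ≠ j ∧ {a, j} ≠ S := by
    intro a ha j hj
    refine ⟨fun e => Finset.disjoint_left.1 hAS ha (e ▸ hj), ?_⟩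
    rintro rfl
    exact Finset.disjoint_left.1 hAS ha (by simp)
  have hc : ContinuousAt (fun s : ℂ => Vpos P A B (y + s • u) *
      ∏ a ∈ A, ∏ j ∈ S, vaa P (y + s • u) a j) 0 := by
    refine ContinuousAt.mul ?_ (continuousAt_prod fun a ha => continuousAt_prod fun j hj =>
      h.continuousAt_vaa u (hmem a ha j hj).1 (hmem a ha j hj).2)
    refine continuousAt_Vpos h u ?_ ?_ ?_
    · rintro i hi rfl
      exact Finset.disjoint_left.1 hAS hi (by simp)
    · rintro i hi l hl rfl
      exact Finset.disjoint_left.1 hAS hi (by simp)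
    · exact fun i hi l hl => hvac i l fun e => Finset.disjoint_left.1 hAB hi (e ▸ hl)
  have := (hρ B hSB).mul (ContinuousAt.tendsto_punctured hc)
  simp only [zero_smul, add_zero] at this ⊢
  have e : Vpos P A (B ∪ S) y = Vpos P A B y * ∏ a ∈ A, ∏ j ∈ S, vaa P y a j := by
    rw [Vpos_union_right P A hSB.symm]
    congr 1
    exact Finset.prod_congr rfl fun a _ => (heq a).symm
  rw [e]
  refine this.congr fun s => ?_
  rw [Vpos_union_left P hAS]
  ring

end CoefficientPoles

end Koornwinder
end

open scoped BigOperators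

noncomputable section

namespace Koornwinder

open Filter Topology

/-! ### Functions invariant under the Weyl group and under `2π`-translations -/

section Invariance

variable {n : ℕ}

/-- Functions of `e^{ix_1}, …, e^{ix_n}` that are invariant under permutations and sign flips. -/
structure IsWeylInvariant (f : (Fin n → ℂ) → ℂ) : Prop where
  congr : ∀ x x' : Fin n → ℂ,
    (∀ j, Complex.exp (Complex.I * x j) = Complex.exp (Complex.I * x' j)) → f x = f x'
  perm : ∀ (σ : Equiv.Perm (Fin n)) x, f (fun j => x (σ j)) = f x
  flip : ∀ (ε : Fin n → ℤˣ) x, f (flipSigns ε x) = f x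

lemma flipSigns_mul (ε η : Fin n → ℤˣ) (x : Fin n → ℂ) :
    flipSigns ε (flipSigns η x) = flipSigns (ε * η) x := by
  funext j; simp [flipSigns, mul_assoc]

lemma flipSigns_line (ε : Fin n → ℤˣ) (p v : Fin n → ℂ) (s : ℂ) :
    flipSigns ε (p + s • v) = flipSigns ε p + s • flipSigns ε v := by
  funext j; simp only [flipSigns, Pi.add_apply, Pi.smul_apply, smul_eq_mul]; ring

lemma IsWeylInvariant.reflect_single {f : (Fin n → ℂ) → ℂ} (hf : IsWeylInvariant f) {j : Fin n}
    {x x' : Fin n → ℂ} (h : ∀ i, i ≠ j → x' i = x i)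
    (hj : Complex.exp (Complex.I * x' j) = Complex.exp (-(Complex.I * x j))) : f x' = f x := by
  classical
  rw [← hf.flip (fun i => if i = j then -1 else 1) x]
  refine hf.congr _ _ fun i => ?_
  by_cases hi : i = j
  · subst hi; simp [flipSigns, hj]
  · simp [flipSigns, hi, h]

/-- The reflection in the root `e_j + τ e_k`, up to `2π`-periods. -/
lemma IsWeylInvariant.reflect_pair {f : (Fin n → ℂ) → ℂ} (hf : IsWeylInvariant f) {j k : Fin n}
    (hjk : j ≠ k) (τ : ℤˣ) {x x' : Fin n → ℂ} (h : ∀ i, i ≠ j → i ≠ k → x' i = x i)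
    (hj : Complex.exp (Complex.I * x' j) = Complex.exp (-(Complex.I * ((τ : ℤ) * x k))))
    (hk : Complex.exp (Complex.I * x' k) = Complex.exp (-(Complex.I * ((τ : ℤ) * x j)))) :
    f x' = f x := by
  classical
  rw [← hf.perm (Equiv.swap j k) x,
    ← hf.flip (fun i => if i = j ∨ i = k then -τ else 1) (fun i => x (Equiv.swap j k i))]
  refine hf.congr _ _ fun i => ?_
  by_cases hi : i = j
  · subst hi; simp [flipSigns, hj]
  · by_cases hi' : i = k
    · subst hi'; simp [flipSigns, hk]
    · simp [flipSigns, hi, hi', h, Equiv.swap_apply_of_ne_of_ne hi hi']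

variable (P : Params)

lemma recSum_map {ι : Type*} [DecidableEq ι] (σ : Equiv.Perm ι)
    (v w : Finset ι → Finset ι → ℂ)
    (h : ∀ A B, v A B = w (A.map σ.toEmbedding) (B.map σ.toEmbedding)) (m : ℕ) (K : Finset ι) :
    recSum v (fun _ => 1) m K = recSum w (fun _ => 1) m (K.map σ.toEmbedding) := by
  induction m using Nat.strong_induction_on generalizing K with
  | _ m ih =>
    by_cases hm : m = 0
    · subst hm; rw [recSum_zero, recSum_zero]
    · rw [recSum_of_ne_zero _ _ hm, recSum_of_ne_zero _ _ hm, neg_inj]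
      refine Finset.sum_bij' (fun A _ => A.map σ.toEmbedding)
        (fun A _ => A.map σ.symm.toEmbedding) ?_ ?_ ?_ ?_ ?_
      · intro A hA
        rw [mem_smallSubsets] at hA ⊢
        exact ⟨Finset.map_subset_map.2 hA.1, by simpa using hA.2.1, by simpa using hA.2.2⟩
      · intro A hA
        rw [mem_smallSubsets] at hA ⊢
        refine ⟨?_, by simpa using hA.2.1, by simpa using hA.2.2⟩
        have := Finset.map_subset_map (f := σ.symm.toEmbedding).2 hA.1
        rwa [Finset.map_map, ← Equiv.trans_toEmbedding, Equiv.self_trans_symm,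
          Equiv.refl_toEmbedding, Finset.map_refl] at this
      · intro A _
        rw [Finset.map_map, ← Equiv.trans_toEmbedding, Equiv.self_trans_symm,
          Equiv.refl_toEmbedding, Finset.map_refl]
      · intro A _
        rw [Finset.map_map, ← Equiv.trans_toEmbedding, Equiv.symm_trans_self,
          Equiv.refl_toEmbedding, Finset.map_refl]
      · intro A hA
        rw [mem_smallSubsets] at hA
        have := hA.2.1.card_pos
        rw [h, ih _ (by omega), Finset.map_sdiff, Finset.card_map]

lemma recSum_congr {ι : Type*} [DecidableEq ι] {v w : Finset ι → Finset ι → ℂ}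
    (h : ∀ A B, v A B = w A B) (m : ℕ) (K : Finset ι) :
    recSum v (fun _ => 1) m K = recSum w (fun _ => 1) m K := by
  have : v = w := by funext A B; exact h A B
  rw [this]

lemma Vpos_congr {x x' : Fin n → ℂ}
    (h : ∀ j, Complex.exp (Complex.I * x j) = Complex.exp (Complex.I * x' j))
    (A B : Finset (Fin n)) : Vpos P A B x = Vpos P A B x' := by
  have h1 : ∀ i l, Complex.exp (Complex.I * (x i + x l)) =
      Complex.exp (Complex.I * (x' i + x' l)) := fun i l => by
    rw [mul_add, mul_add, Complex.exp_add, Complex.exp_add, h, h]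
  have h2 : ∀ i l, va P (x i - x l) = va P (x' i - x' l) := fun i l => va_congr P (by
    rw [mul_sub, mul_sub, Complex.exp_sub, Complex.exp_sub, h, h])
  have h3 : ∀ i l, va P (x i + x l + 2 * P.γ) = va P (x' i + x' l + 2 * P.γ) :=
    fun i l => va_congr P (by rw [mul_add, mul_add _ (x' i + x' l), Complex.exp_add, h1,
      ← Complex.exp_add])
  unfold Vpos
  simp only [fun j => vb_congr P (h j), fun i l => va_congr P (h1 i l), h2, h3]

lemma Vpos_perm (σ : Equiv.Perm (Fin n)) (A B : Finset (Fin n)) (x : Fin n → ℂ) :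
    Vpos P A B (fun j => x (σ j)) =
      Vpos P (A.map σ.toEmbedding) (B.map σ.toEmbedding) x := by
  rw [Vpos_eq, Vpos_eq, Finset.prod_map, Finset.prod_map,
    ← pairProd_map _ (vaa_symm P x)]
  simp only [Finset.prod_map]
  rfl

lemma Dpos_congr {r : ℕ} {f : (Fin n → ℂ) → ℂ} (hf : IsWeylInvariant f) {x x' : Fin n → ℂ}
    (h : ∀ j, Complex.exp (Complex.I * x j) = Complex.exp (Complex.I * x' j)) :
    Dpos P r f x = Dpos P r f x' := by
  unfold Dpos
  refine Finset.sum_congr rfl fun A _ => ?_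
  rw [Vpos_congr P h, recSum_congr (Vpos_congr P h)]
  congr 1
  refine hf.congr _ _ fun j => ?_
  unfold up
  split_ifs
  · rw [mul_add, mul_add, Complex.exp_add, Complex.exp_add, h]
  · exact h j

lemma Dpos_perm {r : ℕ} {f : (Fin n → ℂ) → ℂ} (hf : IsWeylInvariant f)
    (σ : Equiv.Perm (Fin n)) (x : Fin n → ℂ) :
    Dpos P r f (fun j => x (σ j)) = Dpos P r f x := by
  unfold Dpos
  have hcompl : ∀ A : Finset (Fin n), Aᶜ.map σ.toEmbedding = (A.map σ.toEmbedding)ᶜ := by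
    intro A
    ext i
    simp only [Finset.mem_map_equiv, Finset.mem_compl]
  refine Finset.sum_bij' (fun A _ => A.map σ.toEmbedding)
    (fun A _ => A.map σ.symm.toEmbedding) ?_ ?_ ?_ ?_ ?_
  · intro A hA; simpa using hA
  · intro A hA; simpa using hA
  · intro A _
    rw [Finset.map_map, ← Equiv.trans_toEmbedding, Equiv.self_trans_symm,
      Equiv.refl_toEmbedding, Finset.map_refl]
  · intro A _
    rw [Finset.map_map, ← Equiv.trans_toEmbedding, Equiv.symm_trans_self,
      Equiv.refl_toEmbedding, Finset.map_refl]
  · intro A _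
    rw [Vpos_perm, recSum_map σ _ (fun A B => Vpos P A B x) (fun A B => Vpos_perm P σ A B x), hcompl, Finset.card_map,
      ← hf.perm σ (up P (A.map σ.toEmbedding) x)]
    congr 2
    funext j
    simp [up]

/-- The sum over all sign configurations of the positive part of the difference operator. -/
def Dsum (r : ℕ) (f : (Fin n → ℂ) → ℂ) (x : Fin n → ℂ) : ℂ :=
  ∑ ε : Fin n → ℤˣ, Dpos P r f (flipSigns ε x)

/-- `Dpos` already respects periods and permutations; the sum over the sign vectors adds the flips.
-/
lemma IsWeylInvariant.Dsum {r : ℕ} {f : (Fin n → ℂ) → ℂ} (hf : IsWeylInvariant f) :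
    IsWeylInvariant (Dsum P r f) where
  congr x x' h := by
    refine Finset.sum_congr rfl fun ε _ => Dpos_congr P hf fun j => ?_
    rcases Int.units_eq_one_or (ε j) with e | e
    · simpa [flipSigns, e] using h j
    · simp only [flipSigns, e, Units.val_neg, Units.val_one, Int.cast_neg, Int.cast_one, neg_mul,
        one_mul, mul_neg, Complex.exp_neg, h j]
  perm σ x := by
    refine Fintype.sum_equiv (Equiv.arrowCongr σ (Equiv.refl ℤˣ)) _ _ fun ε => ?_
    rw [← Dpos_perm P hf σ (flipSigns (Equiv.arrowCongr σ (Equiv.refl ℤˣ) ε) x)]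
    congr 1
    funext j
    simp [flipSigns, Equiv.arrowCongr]
  flip η x := by
    refine Fintype.sum_equiv (Equiv.mulRight η) _ _ fun ε => ?_
    rw [flipSigns_mul]
    rfl

end Invariance

/-! ### The polar hyperplanes -/

section Hyperplanes

variable {n : ℕ} (P : Params)

/-- The values of `e^{ix_j}` at which the coefficients may have poles. -/
def singleRoots : Finset ℂ := {1, -1, P.sq, -P.sq, P.sq⁻¹, -P.sq⁻¹}

/-- The values of `e^{i(x_j ± x_k)}` at which the coefficients may have poles. -/
def pairRoots : Finset ℂ := {1, P.sq * P.sq, (P.sq * P.sq)⁻¹}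

variable {P}

lemma mem_singleRoots {c : ℂ} : c ∈ singleRoots P ↔
    c = 1 ∨ c = -1 ∨ c = P.sq ∨ c = -P.sq ∨ c = P.sq⁻¹ ∨ c = -P.sq⁻¹ := by
  simp [singleRoots]

lemma mem_pairRoots {c : ℂ} : c ∈ pairRoots P ↔
    c = 1 ∨ c = P.sq * P.sq ∨ c = (P.sq * P.sq)⁻¹ := by
  simp [pairRoots]

lemma inv_mem_singleRoots {c : ℂ} (h : c ∈ singleRoots P) : c⁻¹ ∈ singleRoots P := by
  rw [mem_singleRoots] at h ⊢
  rcases h with rfl | rfl | rfl | rfl | rfl | rfl <;> simp [inv_neg]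

lemma inv_mem_pairRoots {c : ℂ} (h : c ∈ pairRoots P) : c⁻¹ ∈ pairRoots P := by
  rw [mem_pairRoots] at h ⊢
  rcases h with rfl | rfl | rfl <;> simp

lemma ne_zero_of_mem_singleRoots {c : ℂ} (h : c ∈ singleRoots P) : c ≠ 0 := by
  rw [mem_singleRoots] at h
  have := P.sq_ne_zero
  rcases h with rfl | rfl | rfl | rfl | rfl | rfl <;> simp [this]

lemma ne_zero_of_mem_pairRoots {c : ℂ} (h : c ∈ pairRoots P) : c ≠ 0 := by
  rw [mem_pairRoots] at h
  have := P.sq_ne_zero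
  rcases h with rfl | rfl | rfl <;> simp [this]

/-- The weight `e_j + τ e_k`. -/
def pairWeight (j k : Fin n) (τ : ℤˣ) : Fin n → ℤ := Pi.single j 1 + (τ : ℤ) • Pi.single k 1

lemma sum_single_mul (j : Fin n) (u : Fin n → ℂ) :
    ∑ i, (((Pi.single j 1 : Fin n → ℤ) i : ℤ) : ℂ) * u i = u j := by
  rw [Finset.sum_eq_single j]
  · simp
  · intro i _ hi; simp [hi]
  · simp

lemma sum_pairWeight_mul (j k : Fin n) (τ : ℤˣ) (u : Fin n → ℂ) :
    ∑ i, ((pairWeight j k τ i : ℤ) : ℂ) * u i = u j + ((τ : ℤ) : ℂ) * u k := by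
  have : ∀ i, ((pairWeight j k τ i : ℤ) : ℂ) * u i =
      (((Pi.single j 1 : Fin n → ℤ) i : ℤ) : ℂ) * u i +
      ((τ : ℤ) : ℂ) * ((((Pi.single k 1 : Fin n → ℤ) i : ℤ) : ℂ) * u i) := by
    intro i
    simp only [pairWeight, Pi.add_apply, Pi.smul_apply, smul_eq_mul]
    push_cast
    ring
  simp only [this, Finset.sum_add_distrib, ← Finset.mul_sum, sum_single_mul]

lemma expo_single (j : Fin n) (x : Fin n → ℂ) :
    expo (Pi.single j 1) x = Complex.exp (Complex.I * x j) := by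
  rw [expo, sum_single_mul]

lemma expo_pairWeight (j k : Fin n) (τ : ℤˣ) (x : Fin n → ℂ) :
    expo (pairWeight j k τ) x = Complex.exp (Complex.I * (x j + ((τ : ℤ) : ℂ) * x k)) := by
  rw [expo, sum_pairWeight_mul]

/-- All the hyperplanes on which the coefficients of the difference operators may have poles. -/
def polarHyps (P : Params) (n : ℕ) : Finset ((Fin n → ℤ) × ℂ) :=
  ((Finset.univ ×ˢ singleRoots P).image fun a : Fin n × ℂ => (Pi.single a.1 1, a.2)) ∪
  (((Finset.univ.filter fun a : Fin n × Fin n => a.1 < a.2) ×ˢ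
    (Finset.univ : Finset ℤˣ) ×ˢ pairRoots P).image
      fun a => (pairWeight a.1.1 a.1.2 a.2.1, a.2.2))

lemma mem_polarHyps {h : (Fin n → ℤ) × ℂ} : h ∈ polarHyps P n ↔
    (∃ j, ∃ c ∈ singleRoots P, h = (Pi.single j 1, c)) ∨
    (∃ j k, j < k ∧ ∃ τ : ℤˣ, ∃ c ∈ pairRoots P, h = (pairWeight j k τ, c)) := by
  simp only [polarHyps, Finset.mem_union, Finset.mem_image, Finset.mem_product, Finset.mem_univ,
    true_and, Finset.mem_filter, Prod.exists]
  constructor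
  · rintro (⟨j, c, hc, rfl⟩ | ⟨j, k, τ, c, ⟨hjk, hc⟩, rfl⟩)
    · exact Or.inl ⟨j, c, hc, rfl⟩
    · exact Or.inr ⟨j, k, hjk, τ, c, hc, rfl⟩
  · rintro (⟨j, c, hc, rfl⟩ | ⟨j, k, hjk, τ, c, hc, rfl⟩)
    · exact Or.inl ⟨j, c, hc, rfl⟩
    · exact Or.inr ⟨j, k, τ, c, ⟨hjk, hc⟩, rfl⟩

lemma generalPosition_polarHyps : GeneralPosition (polarHyps P n) where
  ne_zero h hh := by
    rcases mem_polarHyps.1 hh with ⟨j, c, hc, rfl⟩ | ⟨j, k, hjk, τ, c, hc, rfl⟩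
    · exact ne_zero_of_mem_singleRoots hc
    · exact ne_zero_of_mem_pairRoots hc
  primitive h hh := by
    rcases mem_polarHyps.1 hh with ⟨j, c, hc, rfl⟩ | ⟨j, k, hjk, τ, c, hc, rfl⟩
    · exact ⟨j, by simp⟩
    · exact ⟨j, by simp [pairWeight, hjk.ne]⟩
  direction h hh := by
    have sgn : ∀ (σ : ℤˣ) (a b : ℤ), a + σ * b = 0 → a = b ∨ a = -b := by
      intro σ a b h
      rcases Int.units_eq_one_or σ with rfl | rfl
      · right; simp at h; omega
      · left; simp at h; omega
    rcases mem_polarHyps.1 hh with ⟨j, c, hc, rfl⟩ | ⟨j, k, hjk, τ, c, hc, rfl⟩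
    -- The coordinates other than the `j`-th are distinct and positive, so no other weight of the
    -- family annihilates this direction.
    · refine ⟨fun i => ((if i = j then 0 else (i : ℕ) + 1 : ℤ) : ℂ), ?_, ?_⟩
      · rw [sum_single_mul]; simp
      · intro h' hh'
        rcases mem_polarHyps.1 hh' with ⟨i, c', hc', rfl⟩ | ⟨a, b, hab, σ, c', hc', rfl⟩
        · rw [sum_single_mul]
          by_cases hi : i = j
          · left; rw [hi]
          · right; rw [if_neg hi]; exact_mod_cast Nat.succ_ne_zero (i : ℕ)
        · right
          rw [sum_pairWeight_mul]
          intro h0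
          have h1 : ((if a = j then 0 else (a : ℕ) + 1 : ℤ)) +
              σ * (if b = j then 0 else (b : ℕ) + 1 : ℤ) = 0 := by exact_mod_cast h0
          have hab' : (a : ℕ) < b := hab
          have := sgn _ _ _ h1
          by_cases ha : a = j <;> by_cases hb : b = j
          · exact hab.ne (ha.trans hb.symm)
          · rw [if_pos ha, if_neg hb] at this; omega
          · rw [if_neg ha, if_pos hb] at this; omega
          · rw [if_neg ha, if_neg hb] at this; omega
    -- The `k`-th coordinate is chosen so that `e_j + τ e_k` annihilates the direction. All
    -- coordinates are non-zero and only the `j`-th and `k`-th agree in absolute value, so no other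
    -- weight does.
    · refine ⟨fun i => ((if i = k then -(τ : ℤ) * ((j : ℕ) + 1) else (i : ℕ) + 1 : ℤ) : ℂ), ?_, ?_⟩
      · rw [sum_pairWeight_mul, if_neg hjk.ne, if_pos rfl]
        rcases Int.units_eq_one_or τ with rfl | rfl <;> simp
      · have hτ : (τ : ℤ) = 1 ∨ (τ : ℤ) = -1 := by
          rcases Int.units_eq_one_or τ with rfl | rfl <;> simp
        have hjk' : (j : ℕ) < k := hjk
        intro h' hh'
        rcases mem_polarHyps.1 hh' with ⟨i, c', hc', rfl⟩ | ⟨a, b, hab, σ, c', hc', rfl⟩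
        · right
          rw [sum_single_mul]
          intro h0
          have h1 : (if i = k then -(τ : ℤ) * ((j : ℕ) + 1) else (i : ℕ) + 1 : ℤ) = 0 := by
            exact_mod_cast h0
          split_ifs at h1
          · rcases hτ with e | e <;> rw [e] at h1 <;> omega
          · omega
        · by_cases hcase : a = j ∧ b = k ∧ σ = τ
          · obtain ⟨rfl, rfl, rfl⟩ := hcase
            left; rfl
          right
          rw [sum_pairWeight_mul]
          intro h0
          have h1 : ((if a = k then -(τ : ℤ) * ((j : ℕ) + 1) else (a : ℕ) + 1 : ℤ)) +
              σ * (if b = k then -(τ : ℤ) * ((j : ℕ) + 1) else (b : ℕ) + 1 : ℤ) = 0 := by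
            exact_mod_cast h0
          have hab' : (a : ℕ) < b := hab
          have h2 := sgn _ _ _ h1
          have hinj : ∀ i l : Fin n, (i : ℕ) = l → i = l := fun i l h => Fin.ext h
          by_cases ha : a = k
          · have hb : b ≠ k := fun hb => hab.ne (ha.trans hb.symm)
            rw [if_pos ha, if_neg hb] at h2
            have hak : (a : ℕ) = k := by rw [ha]
            rcases hτ with e | e <;> rw [e] at h2 <;> omega
          · by_cases hb : b = k
            · rw [if_neg ha, if_pos hb] at h1 h2
              have haj : a = j := by
                apply hinj
                rcases hτ with e | e <;> rw [e] at h2 <;> omega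
              apply hcase
              refine ⟨haj, hb, ?_⟩
              rw [haj] at h1
              rcases Int.units_eq_one_or τ with rfl | rfl <;>
                rcases Int.units_eq_one_or σ with rfl | rfl <;> simp at h1 ⊢ <;> omega
            · rw [if_neg ha, if_neg hb] at h2
              omega

lemma pairWeight_left {j k : Fin n} (hjk : j ≠ k) (τ : ℤˣ) : pairWeight j k τ j = 1 := by
  simp [pairWeight, hjk]

lemma pairWeight_right {j k : Fin n} (hjk : j ≠ k) (τ : ℤˣ) : pairWeight j k τ k = τ := by
  simp [pairWeight, hjk.symm]

lemma pairWeight_of_ne {i j k : Fin n} (hj : i ≠ j) (hk : i ≠ k) (τ : ℤˣ) :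
    pairWeight j k τ i = 0 := by
  simp [pairWeight, hj, hk]

lemma pairWeight_ne_single {j k i : Fin n} (hjk : j ≠ k) (τ : ℤˣ) :
    pairWeight j k τ ≠ Pi.single i 1 := by
  intro h
  have h1 := congrFun h j
  have h2 := congrFun h k
  rw [pairWeight_left hjk] at h1
  rw [pairWeight_right hjk] at h2
  have e1 : j = i := by by_contra hne; simp [hne] at h1
  have e2 : k = i := by
    by_contra hne
    rcases Int.units_eq_one_or τ with rfl | rfl <;> simp [hne] at h2
  exact hjk (e1.trans e2.symm)

lemma pairWeight_inj {i l j k : Fin n} (hil : i < l) (hjk : j < k) {σ τ : ℤˣ}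
    (h : pairWeight i l σ = pairWeight j k τ) : i = j ∧ l = k ∧ σ = τ := by
  have h1 := congrFun h i
  have h2 := congrFun h l
  rw [pairWeight_left hil.ne] at h1
  rw [pairWeight_right hil.ne] at h2
  have e1 : i = j ∨ i = k := by
    by_contra hne
    rw [not_or] at hne
    rw [pairWeight_of_ne hne.1 hne.2] at h1
    omega
  have e2 : l = j ∨ l = k := by
    by_contra hne
    rw [not_or] at hne
    rw [pairWeight_of_ne hne.1 hne.2] at h2
    exact σ.ne_zero h2
  rcases e1 with rfl | rfl <;> rcases e2 with rfl | rfl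
  · exact absurd hil (lt_irrefl _)
  · refine ⟨rfl, rfl, ?_⟩
    rw [pairWeight_right hil.ne] at h2
    exact Units.ext h2
  · exact absurd hil (lt_asymm hjk)
  · exact absurd hil (lt_irrefl _)

lemma exp_pair_mem_swap {a b : ℂ} {τ : ℤˣ}
    (h : Complex.exp (Complex.I * (a + ((τ : ℤ) : ℂ) * b)) ∈ pairRoots P) :
    Complex.exp (Complex.I * (b + ((τ : ℤ) : ℂ) * a)) ∈ pairRoots P := by
  rcases Int.units_eq_one_or τ with rfl | rfl
  · simpa [add_comm] using h
  · have := inv_mem_pairRoots h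
    rw [← Complex.exp_neg] at this
    convert this using 2
    simp
    ring

lemma genericOn_single {j : Fin n} {c : ℂ} {p : Fin n → ℂ}
    (hp : GenericOn (polarHyps P n) (Pi.single j 1, c) p) :
    Complex.exp (Complex.I * p j) = c ∧
    (∀ i, i ≠ j → Complex.exp (Complex.I * p i) ∉ singleRoots P) ∧
    (∀ i l, i ≠ l → ∀ τ : ℤˣ,
      Complex.exp (Complex.I * (p i + ((τ : ℤ) : ℂ) * p l)) ∉ pairRoots P) := by
  obtain ⟨h1, h2⟩ := hp
  refine ⟨?_, ?_, ?_⟩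
  · rw [hypFun, expo_single, sub_eq_zero] at h1
    exact h1
  · intro i hi hmem
    refine h2 (Pi.single i 1, _) (mem_polarHyps.2 (Or.inl ⟨i, _, hmem, rfl⟩)) ?_ ?_
    · intro e
      have := congrFun (congrArg Prod.fst e) i
      simp [hi] at this
    · rw [hypFun, expo_single, sub_self]
  · have key : ∀ i l, i < l → ∀ τ : ℤˣ,
        Complex.exp (Complex.I * (p i + ((τ : ℤ) : ℂ) * p l)) ∉ pairRoots P := by
      intro i l hil τ hmem
      refine h2 (pairWeight i l τ, _) (mem_polarHyps.2 (Or.inr ⟨i, l, hil, τ, _, hmem, rfl⟩)) ?_ ?_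
      · exact fun e => pairWeight_ne_single hil.ne τ (congrArg Prod.fst e)
      · rw [hypFun, expo_pairWeight, sub_self]
    intro i l hil τ hmem
    rcases lt_or_gt_of_ne hil with h | h
    · exact key i l h τ hmem
    · exact key l i h τ (exp_pair_mem_swap hmem)

lemma genericOn_pair {j k : Fin n} (hjk : j < k) {τ : ℤˣ} {c : ℂ} {p : Fin n → ℂ}
    (hp : GenericOn (polarHyps P n) (pairWeight j k τ, c) p) :
    Complex.exp (Complex.I * (p j + ((τ : ℤ) : ℂ) * p k)) = c ∧
    (∀ i, Complex.exp (Complex.I * p i) ∉ singleRoots P) ∧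
    (∀ i l, i ≠ l → ∀ σ : ℤˣ,
      Complex.exp (Complex.I * (p i + ((σ : ℤ) : ℂ) * p l)) ∈ pairRoots P →
        ({i, l} : Finset (Fin n)) = {j, k} ∧ σ = τ) := by
  obtain ⟨h1, h2⟩ := hp
  refine ⟨?_, ?_, ?_⟩
  · rw [hypFun, expo_pairWeight, sub_eq_zero] at h1
    exact h1
  · intro i hmem
    refine h2 (Pi.single i 1, _) (mem_polarHyps.2 (Or.inl ⟨i, _, hmem, rfl⟩)) ?_ ?_
    · exact fun e => pairWeight_ne_single hjk.ne τ (congrArg Prod.fst e).symm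
    · rw [hypFun, expo_single, sub_self]
  · have key : ∀ i l, i < l → ∀ σ : ℤˣ,
        Complex.exp (Complex.I * (p i + ((σ : ℤ) : ℂ) * p l)) ∈ pairRoots P →
        i = j ∧ l = k ∧ σ = τ := by
      intro i l hil σ hmem
      by_contra hne
      refine h2 (pairWeight i l σ, _) (mem_polarHyps.2 (Or.inr ⟨i, l, hil, σ, _, hmem, rfl⟩)) ?_ ?_
      · exact fun e => hne (pairWeight_inj hil hjk (congrArg Prod.fst e))
      · rw [hypFun, expo_pairWeight, sub_self]
    intro i l hil σ hmem
    rcases lt_or_gt_of_ne hil with h | h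
    · obtain ⟨rfl, rfl, rfl⟩ := key i l h σ hmem
      exact ⟨rfl, rfl⟩
    · obtain ⟨rfl, rfl, rfl⟩ := key l i h σ (exp_pair_mem_swap hmem)
      exact ⟨Finset.pair_comm _ _, rfl⟩

end Hyperplanes

end Koornwinder
end

open scoped BigOperators

noncomputable section

namespace Koornwinder

open Filter Topology

/-! ### Vanishing of residues off the reflection hyperplanes -/

section Residues

variable {n : ℕ} {P : Params}

lemma Params.sq_ne_one (hβ : 0 < P.β) : P.sq ≠ 1 := by
  rw [P.sq_eq_ofReal]
  have : Real.exp (-P.β / 2) ≠ 1 := by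
    rw [Ne, Real.exp_eq_one_iff]; linarith
  exact_mod_cast this

lemma Params.sq_ne_neg_one : P.sq ≠ -1 := by
  rw [P.sq_eq_ofReal]
  have : Real.exp (-P.β / 2) ≠ -1 := by
    have := Real.exp_pos (-P.β / 2); linarith
  exact_mod_cast this

lemma exp_sign_mul (τ : ℤˣ) (z : ℂ) : Complex.exp (Complex.I * (((τ : ℤ) : ℂ) * z)) =
    if τ = 1 then Complex.exp (Complex.I * z) else (Complex.exp (Complex.I * z))⁻¹ := by
  rcases Int.units_eq_one_or τ with rfl | rfl
  · simp
  · rw [if_neg (by decide), ← Complex.exp_neg]; simp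

lemma exp_sign_mul_notMem_singleRoots {z : ℂ}
    (h : Complex.exp (Complex.I * z) ∉ singleRoots P) (τ : ℤˣ) :
    Complex.exp (Complex.I * (((τ : ℤ) : ℂ) * z)) ∉ singleRoots P := by
  rw [exp_sign_mul]
  split_ifs
  · exact h
  · intro h'; exact h (by simpa using inv_mem_singleRoots h')

lemma exp_sign_mul_mem_pairRoots {z : ℂ} {τ : ℤˣ}
    (h : Complex.exp (Complex.I * (((τ : ℤ) : ℂ) * z)) ∈ pairRoots P) :
    Complex.exp (Complex.I * z) ∈ pairRoots P := by
  rw [exp_sign_mul] at h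
  split_ifs at h
  · exact h
  · simpa using inv_mem_pairRoots h

lemma flipSigns_add (ε : Fin n → ℤˣ) (p : Fin n → ℂ) (i l : Fin n) :
    flipSigns ε p i + flipSigns ε p l =
      ((ε i : ℤ) : ℂ) * (p i + (((ε i * ε l : ℤˣ) : ℤ) : ℂ) * p l) := by
  simp only [flipSigns]
  rcases Int.units_eq_one_or (ε i) with e | e <;> simp [e, add_comm]

lemma flipSigns_sub (ε : Fin n → ℤˣ) (p : Fin n → ℂ) (i l : Fin n) :
    flipSigns ε p i - flipSigns ε p l =
      ((ε i : ℤ) : ℂ) * (p i + (((-(ε i * ε l) : ℤˣ) : ℤ) : ℂ) * p l) := by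
  simp only [flipSigns]
  rcases Int.units_eq_one_or (ε i) with e | e <;> simp [e, sub_eq_add_neg, add_comm]

lemma single_conditions {E : ℂ} (h : E ∉ singleRoots P) :
    E ≠ 1 ∧ E ≠ -1 ∧ P.sq * E ≠ 1 ∧ P.sq * E ≠ -1 := by
  rw [mem_singleRoots] at h
  push Not at h
  have h0 := P.sq_ne_zero
  refine ⟨h.1, h.2.1, fun e => h.2.2.2.2.1 (eq_inv_of_mul_eq_one_right e), fun e => ?_⟩
  apply h.2.2.2.2.2
  rw [eq_neg_iff_add_eq_zero] at e ⊢
  field_simp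
  linear_combination e

lemma pair_conditions {E : ℂ} (h : E ∉ pairRoots P) : E ≠ 1 ∧ P.sq * P.sq * E ≠ 1 := by
  rw [mem_pairRoots] at h
  push Not at h
  exact ⟨h.1, fun e => h.2.2 (eq_inv_of_mul_eq_one_right e)⟩

/-- Both root sets are closed under inversion, so the polar hyperplanes are stable under sign flips
and the conditions may be checked at `p`. -/
lemma polesIn_flip {S : Finset (Fin n)} {p : Fin n → ℂ}
    (h1 : ∀ i, {i} ≠ S → Complex.exp (Complex.I * p i) ∉ singleRoots P)
    (h2 : ∀ i l, i ≠ l → {i, l} ≠ S → ∀ σ : ℤˣ,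
      Complex.exp (Complex.I * (p i + ((σ : ℤ) : ℂ) * p l)) ∉ pairRoots P)
    (h3 : ∀ i l, i ≠ l → ∀ σ σ' : ℤˣ,
      Complex.exp (Complex.I * (p i + ((σ : ℤ) : ℂ) * p l)) ∈ pairRoots P →
      Complex.exp (Complex.I * (p i + ((σ' : ℤ) : ℂ) * p l)) ∈ pairRoots P → σ = σ')
    (ε : Fin n → ℤˣ) : PolesIn P S (flipSigns ε p) where
  single i hi := single_conditions (exp_sign_mul_notMem_singleRoots (h1 i hi) (ε i))
  add i l hil hS := by
    refine pair_conditions fun hmem => ?_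
    rw [flipSigns_add] at hmem
    exact h2 i l hil hS _ (exp_sign_mul_mem_pairRoots hmem)
  sub i l hil hS h := by
    rw [flipSigns_sub] at h
    refine h2 i l hil hS (-(ε i * ε l)) (exp_sign_mul_mem_pairRoots (τ := ε i) ?_)
    rw [h, mem_pairRoots]
    exact Or.inl rfl
  not_both i l hil := by
    by_contra hcon
    push Not at hcon
    rw [flipSigns_add, flipSigns_sub] at hcon
    have := h3 i l hil (ε i * ε l) (-(ε i * ε l))
      (exp_sign_mul_mem_pairRoots (τ := ε i) (by rw [hcon.1, mem_pairRoots]; exact Or.inl rfl))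
      (exp_sign_mul_mem_pairRoots (τ := ε i) (by rw [hcon.2, mem_pairRoots]; exact Or.inl rfl))
    rcases Int.units_eq_one_or (ε i * ε l) with e | e <;> rw [e] at this <;>
      exact absurd this (by decide)

lemma Dpos_eq (r : ℕ) (f : (Fin n → ℂ) → ℂ) (x : Fin n → ℂ) : Dpos P r f x =
    ∑ A ∈ (Finset.univ : Finset (Fin n)).powerset.filter (fun A => A.card ≤ r),
      Vpos P A (Finset.univ \ A) x *
        recSum (fun A B => Vpos P A B x) (fun _ => 1) (r - A.card) (Finset.univ \ A) *
        f (up P A x) := by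
  simp only [Dpos, Finset.powerset_univ, Finset.compl_eq_univ_sdiff]

lemma continuousAt_up {f : (Fin n → ℂ) → ℂ} (hf : Continuous f) (y u : Fin n → ℂ)
    (A : Finset (Fin n)) : ContinuousAt (fun s : ℂ => f (up P A (y + s • u))) 0 := by
  refine (hf.comp ?_).continuousAt
  refine continuous_pi fun j => ?_
  unfold up
  split_ifs <;> fun_prop

lemma simplePole_Dpos (hβ : 0 < P.β) {S : Finset (Fin n)} {y : Fin n → ℂ} (h : PolesIn P S y)
    (u : Fin n → ℂ) (r : ℕ) {f : (Fin n → ℂ) → ℂ} (hf : Continuous f) :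
    SimplePole (fun s => Dpos P r f (y + s • u)) := by
  simp only [Dpos_eq]
  refine SimplePole.sum fun A _ => SimplePole.mul_continuousAt ?_ (continuousAt_up hf y u A)
  by_cases hS : S ⊆ Finset.univ \ A
  · refine .continuousAt_mul (h.continuousAt_Vpos u Finset.disjoint_sdiff (Or.inr hS)) ?_
    exact simplePole_recSum (v := fun s A B => Vpos P A B (y + s • u)) S
      (fun A B hAB hS => h.continuousAt_Vpos u hAB hS)
      (fun A B hAB => h.simplePole_Vpos (Params.sq_ne_one hβ) Params.sq_ne_neg_one u hAB) _ _
  · refine (h.simplePole_Vpos (Params.sq_ne_one hβ) Params.sq_ne_neg_one u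
      Finset.disjoint_sdiff).mul_continuousAt ?_
    exact continuousAt_recSum (v := fun s A B => Vpos P A B (y + s • u)) _
      (fun A' B' hAB hS' => h.continuousAt_Vpos u hAB (Or.inl fun h'' => hS (h''.trans hS'))) _

lemma tendsto_Dpos_of_regular {y : Fin n → ℂ} (h : PolesIn P ∅ y) (u : Fin n → ℂ) (r : ℕ)
    {f : (Fin n → ℂ) → ℂ} (hf : Continuous f) :
    Tendsto (fun s => s * Dpos P r f (y + s • u)) (𝓝[≠] 0) (𝓝 0) := by
  refine tendsto_mul_of_continuousAt ?_
  simp only [Dpos_eq]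
  refine tendsto_finsetSum _ fun A _ => ContinuousAt.mul (ContinuousAt.mul ?_ ?_)
    (continuousAt_up hf y u A)
  · exact h.continuousAt_Vpos u Finset.disjoint_sdiff (Or.inr (Finset.empty_subset _))
  · exact continuousAt_recSum (v := fun s A B => Vpos P A B (y + s • u)) _
      (fun A' B' hAB _ => h.continuousAt_Vpos u hAB (Or.inr (Finset.empty_subset _))) _

lemma tendsto_Dpos_of_block (hβ : 0 < P.β) {S : Finset (Fin n)} (hS : S.Nonempty) {y : Fin n → ℂ}
    (h : PolesIn P S y)
    (u : Fin n → ℂ) (r : ℕ) {f : (Fin n → ℂ) → ℂ} (hf : Continuous f)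
    (hsing : ∀ i l, i ≠ l → Complex.exp (Complex.I * (y i + y l)) ≠ 1 ∧
      Complex.exp (Complex.I * (y i - y l)) ≠ 1)
    (heq : ∀ a, ∏ j ∈ S, vaa P y a j = ∏ j ∈ S, vac P y a j)
    (hfS : ∀ A, Disjoint A S → f (up P (A ∪ S) y) = f (up P A y)) :
    Tendsto (fun s => s * Dpos P r f (y + s • u)) (𝓝[≠] 0) (𝓝 0) := by
  obtain ⟨ρ, hρ⟩ := exists_blockPole h (Params.sq_ne_one hβ) Params.sq_ne_neg_one u hsing heq
  have := hρ.tendsto_sum hS r (Finset.subset_univ S) (fun s A => f (up P A (y + s • u)))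
    (fun A => continuousAt_up hf y u A) (by simpa using hfS)
  simpa only [Dpos_eq] using this

/-- A block consisting of one coordinate. -/
lemma tendsto_Dpos_single (hβ : 0 < P.β) {j : Fin n} {y : Fin n → ℂ}
    (h1 : ∀ i, i ≠ j → Complex.exp (Complex.I * y i) ∉ singleRoots P)
    (h2 : ∀ i l, i ≠ l → ∀ τ : ℤˣ,
      Complex.exp (Complex.I * (y i + ((τ : ℤ) : ℂ) * y l)) ∉ pairRoots P)
    (hj : Complex.exp (Complex.I * y j) ∈ singleRoots P)
    (hj1 : Complex.exp (Complex.I * y j) ≠ 1) (hj2 : Complex.exp (Complex.I * y j) ≠ -1)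
    (u : Fin n → ℂ) (r : ℕ) {f : (Fin n → ℂ) → ℂ} (hf : Continuous f) (hfW : IsWeylInvariant f) :
    Tendsto (fun s => s * Dpos P r f (y + s • u)) (𝓝[≠] 0) (𝓝 0) := by
  have h0 := P.sq_ne_zero
  have hadd : ∀ i l, i ≠ l → Complex.exp (Complex.I * (y i + y l)) ∉ pairRoots P :=
    fun i l hil => by simpa using h2 i l hil 1
  have hsub : ∀ i l, i ≠ l → Complex.exp (Complex.I * (y i - y l)) ≠ 1 := fun i l hil => by
    have := (pair_conditions (h2 i l hil (-1))).1
    simpa [sub_eq_add_neg] using this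
  -- The roots `±q^{1/2}` and `±q^{-1/2}` are exchanged by a flip. Only the latter are poles of `vb`
  -- itself; for the former the coefficients are regular.
  by_cases hreg : P.sq * Complex.exp (Complex.I * y j) ≠ 1 ∧
      P.sq * Complex.exp (Complex.I * y j) ≠ -1
  · refine tendsto_Dpos_of_regular ⟨?_, ?_, ?_, ?_⟩ u r hf
    · intro i _
      by_cases hi : i = j
      · subst hi; exact ⟨hj1, hj2, hreg⟩
      · exact single_conditions (h1 i hi)
    · exact fun i l hil _ => pair_conditions (hadd i l hil)
    · exact fun i l hil _ => hsub i l hil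
    · exact fun i l hil => Or.inr (hsub i l hil)
  -- Here `q e^{2iy_j} = 1`, so the shift of the `j`-th coordinate is a reflection modulo periods.
  -- This yields both the equality of the `vaa` and `vac` products and the equality of the two
  -- values of `f`.
  · have hinv : Complex.exp (Complex.I * (y j + 2 * P.γ)) = Complex.exp (-(Complex.I * y j)) := by
      rw [Complex.exp_neg, mul_add, Complex.exp_add, P.exp_two_γ]
      apply eq_inv_of_mul_eq_one_left
      have hE2 : (P.sq * Complex.exp (Complex.I * y j)) * (P.sq * Complex.exp (Complex.I * y j))
          = 1 := by
        rw [not_and_or, not_not, not_not] at hreg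
        exact mul_self_eq_one_iff.2 hreg
      linear_combination hE2
    refine tendsto_Dpos_of_block hβ (Finset.singleton_nonempty j) ⟨?_, ?_, ?_, ?_⟩ u r hf ?_ ?_ ?_
    · exact fun i hi => single_conditions (h1 i fun e => hi (by rw [e]))
    · exact fun i l hil _ => pair_conditions (hadd i l hil)
    · exact fun i l hil _ => hsub i l hil
    · exact fun i l hil => Or.inr (hsub i l hil)
    · exact fun i l hil => ⟨(pair_conditions (hadd i l hil)).1, hsub i l hil⟩
    · intro a
      simp only [Finset.prod_singleton, vaa, vac]
      congr 1
      refine va_congr P ?_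
      rw [add_assoc, mul_add, Complex.exp_add, hinv, ← Complex.exp_add]
      congr 1; ring
    · intro A hA
      rw [Finset.disjoint_singleton_right] at hA
      refine hfW.reflect_single (j := j) ?_ ?_
      · intro i hi; simp [up, hi]
      · simp only [up, Finset.mem_union, Finset.mem_singleton, or_true, if_true, hA, if_false, hinv]

/-- A block consisting of two coordinates. -/
lemma tendsto_Dpos_pair (hβ : 0 < P.β) {j k : Fin n} (hjk : j ≠ k) {y : Fin n → ℂ}
    (h1 : ∀ i, Complex.exp (Complex.I * y i) ∉ singleRoots P)
    (h2 : ∀ i l, i ≠ l → ({i, l} : Finset (Fin n)) ≠ {j, k} → ∀ τ : ℤˣ,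
      Complex.exp (Complex.I * (y i + ((τ : ℤ) : ℂ) * y l)) ∉ pairRoots P)
    (hadd : Complex.exp (Complex.I * (y j + y k)) ≠ 1)
    (hsub : Complex.exp (Complex.I * (y j - y k)) ≠ 1)
    (u : Fin n → ℂ) (r : ℕ) {f : (Fin n → ℂ) → ℂ} (hf : Continuous f) (hfW : IsWeylInvariant f) :
    Tendsto (fun s => s * Dpos P r f (y + s • u)) (𝓝[≠] 0) (𝓝 0) := by
  have h0 := P.sq_ne_zero
  have hsub' : Complex.exp (Complex.I * (y k - y j)) ≠ 1 := by
    rw [← neg_sub, mul_neg, Complex.exp_neg]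
    simpa using hsub
  have hcases : ∀ i l : Fin n, i ≠ l → ({i, l} : Finset (Fin n)) = {j, k} →
      (i = j ∧ l = k) ∨ (i = k ∧ l = j) := by
    intro i l hil e
    have m1 : i ∈ ({j, k} : Finset (Fin n)) := by rw [← e]; simp
    have m2 : l ∈ ({j, k} : Finset (Fin n)) := by rw [← e]; simp
    simp only [Finset.mem_insert, Finset.mem_singleton] at m1 m2
    rcases m1 with rfl | rfl <;> rcases m2 with rfl | rfl <;> simp_all
  have hadd_all : ∀ i l, i ≠ l → Complex.exp (Complex.I * (y i + y l)) ≠ 1 := by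
    intro i l hil
    by_cases e : ({i, l} : Finset (Fin n)) = {j, k}
    · rcases hcases i l hil e with ⟨rfl, rfl⟩ | ⟨rfl, rfl⟩
      · exact hadd
      · rwa [add_comm]
    · have := (pair_conditions (h2 i l hil e 1)).1
      simpa using this
  have hsub_all : ∀ i l, i ≠ l → Complex.exp (Complex.I * (y i - y l)) ≠ 1 := by
    intro i l hil
    by_cases e : ({i, l} : Finset (Fin n)) = {j, k}
    · rcases hcases i l hil e with ⟨rfl, rfl⟩ | ⟨rfl, rfl⟩
      · exact hsub
      · exact hsub'
    · have := (pair_conditions (h2 i l hil e (-1))).1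
      simpa [sub_eq_add_neg] using this
  have hshift : ∀ i l, i ≠ l → ({i, l} : Finset (Fin n)) ≠ {j, k} →
      P.sq * P.sq * Complex.exp (Complex.I * (y i + y l)) ≠ 1 := fun i l hil e => by
    have := (pair_conditions (h2 i l hil e 1)).2
    simpa using this
  by_cases hreg : P.sq * P.sq * Complex.exp (Complex.I * (y j + y k)) ≠ 1
  · refine tendsto_Dpos_of_regular ⟨?_, ?_, ?_, ?_⟩ u r hf
    · exact fun i _ => single_conditions (h1 i)
    · intro i l hil _
      refine ⟨hadd_all i l hil, ?_⟩
      by_cases e : ({i, l} : Finset (Fin n)) = {j, k}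
      · rcases hcases i l hil e with ⟨rfl, rfl⟩ | ⟨rfl, rfl⟩
        · exact hreg
        · rwa [add_comm]
      · exact hshift i l hil e
    · exact fun i l hil _ => hsub_all i l hil
    · exact fun i l hil => Or.inr (hsub_all i l hil)
  · rw [not_not] at hreg
    -- Here `q e^{i(y_j + y_k)} = 1`: the joint shift sends the two coordinates to `-y k` and `-y
    -- j`, again a Weyl reflection modulo periods.
    have hinv : Complex.exp (Complex.I * (y j + 2 * P.γ)) = Complex.exp (-(Complex.I * y k)) := by
      rw [Complex.exp_neg, mul_add, Complex.exp_add, P.exp_two_γ]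
      apply eq_inv_of_mul_eq_one_left
      rw [← hreg, mul_add, Complex.exp_add]
      ring
    have hinv' : Complex.exp (Complex.I * (y k + 2 * P.γ)) = Complex.exp (-(Complex.I * y j)) := by
      rw [Complex.exp_neg, mul_add, Complex.exp_add, P.exp_two_γ]
      apply eq_inv_of_mul_eq_one_left
      rw [← hreg, mul_add, Complex.exp_add]
      ring
    refine tendsto_Dpos_of_block hβ (S := {j, k}) (by simp) ⟨?_, ?_, ?_, ?_⟩ u r hf ?_ ?_ ?_
    · exact fun i _ => single_conditions (h1 i)
    · exact fun i l hil e => ⟨hadd_all i l hil, hshift i l hil e⟩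
    · exact fun i l hil _ => hsub_all i l hil
    · exact fun i l hil => Or.inr (hsub_all i l hil)
    · exact fun i l hil => ⟨hadd_all i l hil, hsub_all i l hil⟩
    · intro a
      rw [Finset.prod_pair hjk, Finset.prod_pair hjk]
      simp only [vaa, vac]
      have e1 : va P (y a + y j + 2 * P.γ) = va P (y a - y k) := by
        refine va_congr P ?_
        rw [add_assoc, mul_add, Complex.exp_add, hinv, ← Complex.exp_add]
        congr 1; ring
      have e2 : va P (y a + y k + 2 * P.γ) = va P (y a - y j) := by
        refine va_congr P ?_
        rw [add_assoc, mul_add, Complex.exp_add, hinv', ← Complex.exp_add]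
        congr 1; ring
      rw [e1, e2]
      ring
    · intro A hA
      rw [Finset.disjoint_right] at hA
      have hjA : j ∉ A := hA (by simp)
      have hkA : k ∉ A := hA (by simp)
      refine hfW.reflect_pair hjk 1 ?_ ?_ ?_
      · intro i hi hi'; simp [up, hi, hi']
      · simp [up, hjA, hkA, hinv]
      · simp [up, hjA, hkA, hinv']

end Residues

end Koornwinder
end

open scoped BigOperators

noncomputable section

namespace Koornwinder

open Filter Topology

/-! ### Polynomiality of the images of invariant trigonometric polynomials -/

section Polynomiality

variable {n : ℕ} {P : Params}

/-- Replacing `s` by `-s` shows that the residue equals its own negative. -/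
lemma tendsto_zero_of_even {g : ℂ → ℂ} (hg : SimplePole g) (he : ∀ s, g (-s) = g s) :
    Tendsto (fun s => s * g s) (𝓝[≠] 0) (𝓝 0) := by
  obtain ⟨L, hL⟩ := hg
  have hneg : Tendsto (fun s : ℂ => -s) (𝓝[≠] 0) (𝓝[≠] 0) := by
    refine tendsto_nhdsWithin_of_tendsto_nhds_of_eventually_within _ ?_ ?_
    · have : Tendsto (fun s : ℂ => -s) (𝓝 0) (𝓝 (-0)) := continuous_neg.tendsto 0
      rw [neg_zero] at this
      exact this.mono_left nhdsWithin_le_nhds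
    · filter_upwards [self_mem_nhdsWithin] with s hs
      simpa using hs
  have h1 := hL.comp hneg
  have h2 : Tendsto (fun s => s * g s) (𝓝[≠] 0) (𝓝 (-L)) := by
    refine h1.neg.congr fun s => ?_
    simp only [Function.comp_apply, he]
    ring
  have h3 : L = -L := tendsto_nhds_unique hL h2
  have h4 : L = 0 := by
    have : (2 : ℂ) * L = 0 := by linear_combination h3
    simpa using this
  rwa [h4] at hL

lemma flipSigns_add_sign (ε : Fin n → ℤˣ) (p : Fin n → ℂ) (i l : Fin n) (τ : ℤˣ) :
    flipSigns ε p i + ((τ : ℤ) : ℂ) * flipSigns ε p l =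
      ((ε i : ℤ) : ℂ) * (p i + (((ε i * τ * ε l : ℤˣ) : ℤ) : ℂ) * p l) := by
  simp only [flipSigns]
  rcases Int.units_eq_one_or (ε i) with e | e <;> simp [e, add_comm] <;> ring

lemma tendsto_Dsum_single (hβ : 0 < P.β) {j : Fin n} {c : ℂ} (hc : c ∈ singleRoots P)
    {p : Fin n → ℂ} (hp : GenericOn (polarHyps P n) (Pi.single j 1, c) p) (r : ℕ)
    {f : (Fin n → ℂ) → ℂ} (hf : Continuous f) (hfW : IsWeylInvariant f) :
    Tendsto (fun s : ℂ => s * Dsum P r f (p + s • (Pi.single j 1 : Fin n → ℂ))) (𝓝[≠] 0)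
      (𝓝 0) := by
  obtain ⟨h1, h2, h3⟩ := genericOn_single hp
  by_cases hc1 : c = 1 ∨ c = -1
  -- On a hyperplane of reflection the individual `Dpos` terms may keep their poles; evenness
  -- belongs to the sum over the signs.
  · refine tendsto_zero_of_even ?_ ?_
    · refine SimplePole.sum fun ε _ => ?_
      simp only [flipSigns_line]
      refine simplePole_Dpos hβ (S := {j}) (polesIn_flip ?_ ?_ ?_ ε) _ r hf
      · exact fun i hi => h2 i fun e => hi (by rw [e])
      · exact fun i l hil _ σ => h3 i l hil σ
      · exact fun i l hil σ _ h => absurd h (h3 i l hil σ)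
    · intro s
      refine (hfW.Dsum P).reflect_single (j := j) ?_ ?_
      · intro i hi; simp [hi]
      · have : Complex.exp (Complex.I * p j) * Complex.exp (Complex.I * p j) = 1 := by
          rw [h1]; exact mul_self_eq_one_iff.2 hc1
        have h4 : Complex.exp (Complex.I * p j) = Complex.exp (-(Complex.I * p j)) := by
          rw [Complex.exp_neg]; exact eq_inv_of_mul_eq_one_left this
        simp only [Pi.add_apply, Pi.smul_apply, Pi.single_eq_same, smul_eq_mul, mul_one]
        rw [mul_add, Complex.exp_add, h4, ← Complex.exp_add]
        congr 1; ring
  -- Off the reflection hyperplanes each sign configuration has zero residue by itself.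
  · rw [not_or] at hc1
    simp only [Dsum, Finset.mul_sum]
    refine Eq.subst (motive := fun c => Tendsto _ (𝓝[≠] 0) (𝓝 c))
      (Finset.sum_const_zero (s := (Finset.univ : Finset (Fin n → ℤˣ)))) ?_
    refine tendsto_finsetSum _ fun ε _ => ?_
    simp only [flipSigns_line]
    refine tendsto_Dpos_single hβ (j := j) ?_ ?_ ?_ ?_ ?_ _ r hf hfW
    · exact fun i hi => exp_sign_mul_notMem_singleRoots (h2 i hi) (ε i)
    · intro i l hil τ hmem
      rw [flipSigns_add_sign] at hmem
      exact h3 i l hil _ (exp_sign_mul_mem_pairRoots hmem)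
    all_goals rw [flipSigns, exp_sign_mul, h1]
    · split_ifs
      · exact hc
      · exact inv_mem_singleRoots hc
    · split_ifs
      · exact hc1.1
      · simpa using hc1.1
    · split_ifs
      · exact hc1.2
      · rw [Ne, inv_eq_iff_eq_inv, inv_neg, inv_one]; exact hc1.2

lemma exp_sign_mul_eq_one {z : ℂ} {τ : ℤˣ}
    (h : Complex.exp (Complex.I * (((τ : ℤ) : ℂ) * z)) = 1) : Complex.exp (Complex.I * z) = 1 := by
  rw [exp_sign_mul] at h
  split_ifs at h
  · exact h
  · simpa using h

lemma one_mem_pairRoots : (1 : ℂ) ∈ pairRoots P := mem_pairRoots.2 (Or.inl rfl)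

lemma tendsto_Dsum_pair (hβ : 0 < P.β) {j k : Fin n} (hjk : j < k) {τ : ℤˣ} {c : ℂ}
    {p : Fin n → ℂ} (hp : GenericOn (polarHyps P n) (pairWeight j k τ, c) p) (r : ℕ)
    {f : (Fin n → ℂ) → ℂ} (hf : Continuous f) (hfW : IsWeylInvariant f) :
    ∃ v : Fin n → ℂ, v j + ((τ : ℤ) : ℂ) * v k ≠ 0 ∧
      Tendsto (fun s : ℂ => s * Dsum P r f (p + s • v)) (𝓝[≠] 0) (𝓝 0) := by
  obtain ⟨h1, h2, h3⟩ := genericOn_pair hjk hp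
  by_cases hc1 : c = 1
  · have hτ : ((τ : ℤ) : ℂ) * ((τ : ℤ) : ℂ) = 1 := by
      rcases Int.units_eq_one_or τ with rfl | rfl <;> simp
    -- The normal direction `e_j + τ e_k`: the reflection sends `p + s • v` to `p - s • v` modulo
    -- periods.
    refine ⟨fun i => if i = j then 1 else if i = k then ((τ : ℤ) : ℂ) else 0, ?_,
      tendsto_zero_of_even ?_ ?_⟩
    · simp only [if_true, hjk.ne', if_false, hτ]; norm_num
    · refine SimplePole.sum fun ε _ => ?_
      simp only [flipSigns_line]
      refine simplePole_Dpos hβ (S := {j, k}) (polesIn_flip ?_ ?_ ?_ ε) _ r hf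
      · exact fun i _ => h2 i
      · exact fun i l hil e σ h => e (h3 i l hil σ h).1
      · exact fun i l hil σ σ' h h' => (h3 i l hil σ h).2.trans (h3 i l hil σ' h').2.symm
    · intro s
      rw [hc1] at h1
      refine (hfW.Dsum P).reflect_pair hjk.ne τ ?_ ?_ ?_
      · intro i hi hi'; simp [hi, hi']
      · simp only [Pi.add_apply, Pi.smul_apply, smul_eq_mul, if_true, hjk.ne', if_false, mul_one]
        have e1 : Complex.exp (Complex.I * p j) = Complex.exp (-(Complex.I * ((τ : ℤ) * p k))) := by
          rw [Complex.exp_neg]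
          apply eq_inv_of_mul_eq_one_left
          rw [← Complex.exp_add, ← mul_add, h1]
        rw [mul_add, Complex.exp_add, e1, ← Complex.exp_add]
        congr 1
        linear_combination Complex.I * s * hτ
      · simp only [Pi.add_apply, Pi.smul_apply, smul_eq_mul, if_true, hjk.ne', if_false, mul_one]
        have e1 : Complex.exp (Complex.I * p k) = Complex.exp (-(Complex.I * ((τ : ℤ) * p j))) := by
          rw [Complex.exp_neg]
          apply eq_inv_of_mul_eq_one_left
          rw [← Complex.exp_add, ← mul_add]
          refine exp_sign_mul_eq_one (τ := τ) ?_
          rw [← h1]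
          congr 2
          linear_combination p j * hτ
        rw [mul_add, Complex.exp_add, e1, ← Complex.exp_add]
        congr 1
        ring
  · refine ⟨Pi.single j 1, by simp [hjk.ne'], ?_⟩
    simp only [Dsum, Finset.mul_sum]
    refine Eq.subst (motive := fun c => Tendsto _ (𝓝[≠] 0) (𝓝 c))
      (Finset.sum_const_zero (s := (Finset.univ : Finset (Fin n → ℤˣ)))) ?_
    refine tendsto_finsetSum _ fun ε _ => ?_
    simp only [flipSigns_line]
    refine tendsto_Dpos_pair hβ hjk.ne ?_ ?_ ?_ ?_ _ r hf hfW
    · exact fun i => exp_sign_mul_notMem_singleRoots (h2 i) (ε i)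
    · intro i l hil e τ hmem
      rw [flipSigns_add_sign] at hmem
      exact e (h3 i l hil _ (exp_sign_mul_mem_pairRoots hmem)).1
    · intro e
      rw [flipSigns_add] at e
      have e1 := exp_sign_mul_eq_one e
      have e2 := (h3 j k hjk.ne _ (by rw [e1]; exact one_mem_pairRoots)).2
      rw [e2, h1] at e1
      exact hc1 e1
    · intro e
      rw [flipSigns_sub] at e
      have e1 := exp_sign_mul_eq_one e
      have e2 := (h3 j k hjk.ne _ (by rw [e1]; exact one_mem_pairRoots)).2
      rw [e2, h1] at e1
      exact hc1 e1

/-! ### Functions with denominators from the polar hyperplanes -/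

/-- A function that becomes a trigonometric polynomial after multiplication with denominators. -/
def HasPolarDenominators (P : Params) (F : (Fin n → ℂ) → ℂ) : Prop :=
  ∃ S : Multiset ((Fin n → ℤ) × ℂ), (∀ h ∈ S, h ∈ polarHyps P n) ∧ ∃ N ∈ trig n,
    ∀ x, (∀ h ∈ polarHyps P n, hypFun h x ≠ 0) → (S.map fun h => hypFun h x).prod * F x = N x

lemma hypProd_mem_trig (S : Multiset ((Fin n → ℤ) × ℂ)) :
    (fun x => (S.map fun h => hypFun h x).prod) ∈ trig n := by
  induction S using Multiset.induction with
  | empty => simpa using const_mem_trig (n := n) 1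
  | cons h S ih =>
    simp only [Multiset.map_cons, Multiset.prod_cons]
    exact mul_mem (hypFun_mem_trig h) ih

namespace HasPolarDenominators

lemma of_mem_trig {F : (Fin n → ℂ) → ℂ} (hF : F ∈ trig n) : HasPolarDenominators P F :=
  ⟨0, by simp, F, hF, by simp⟩

lemma mul {F G : (Fin n → ℂ) → ℂ} (hF : HasPolarDenominators P F)
    (hG : HasPolarDenominators P G) : HasPolarDenominators P (fun x => F x * G x) := by
  obtain ⟨S, hS, N, hN, h⟩ := hF
  obtain ⟨S', hS', N', hN', h'⟩ := hG
  refine ⟨S + S', fun a ha => (Multiset.mem_add.1 ha).elim (hS a) (hS' a), N * N',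
    mul_mem hN hN', fun x hx => ?_⟩
  rw [Multiset.map_add, Multiset.prod_add, Pi.mul_apply, ← h x hx, ← h' x hx]
  ring

lemma add {F G : (Fin n → ℂ) → ℂ} (hF : HasPolarDenominators P F)
    (hG : HasPolarDenominators P G) : HasPolarDenominators P (fun x => F x + G x) := by
  obtain ⟨S, hS, N, hN, h⟩ := hF
  obtain ⟨S', hS', N', hN', h'⟩ := hG
  refine ⟨S + S', fun a ha => (Multiset.mem_add.1 ha).elim (hS a) (hS' a),
    (fun x => (S'.map fun h => hypFun h x).prod) * N +
      (fun x => (S.map fun h => hypFun h x).prod) * N',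
    add_mem (mul_mem (hypProd_mem_trig S') hN) (mul_mem (hypProd_mem_trig S) hN'), fun x hx => ?_⟩
  rw [Multiset.map_add, Multiset.prod_add, Pi.add_apply, Pi.mul_apply, Pi.mul_apply, ← h x hx,
    ← h' x hx]
  ring

lemma const (c : ℂ) : HasPolarDenominators P (fun _ : Fin n → ℂ => c) :=
  of_mem_trig (const_mem_trig c)

lemma neg {F : (Fin n → ℂ) → ℂ} (hF : HasPolarDenominators P F) :
    HasPolarDenominators P (fun x => -F x) := by
  simpa only [neg_one_mul] using (const (-1)).mul hF

lemma sum {ι : Type*} {t : Finset ι} {F : ι → (Fin n → ℂ) → ℂ}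
    (h : ∀ i ∈ t, HasPolarDenominators P (F i)) :
    HasPolarDenominators P (fun x => ∑ i ∈ t, F i x) := by
  classical
  induction t using Finset.induction_on with
  | empty => simpa using const 0
  | insert a t ha ih =>
    simp only [Finset.sum_insert ha]
    exact (h a (by simp)).add (ih fun i hi => h i (by simp [hi]))

lemma prod {ι : Type*} {t : Finset ι} {F : ι → (Fin n → ℂ) → ℂ}
    (h : ∀ i ∈ t, HasPolarDenominators P (F i)) :
    HasPolarDenominators P (fun x => ∏ i ∈ t, F i x) := by
  classical
  induction t using Finset.induction_on with
  | empty => simpa using const 1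
  | insert a t ha ih =>
    simp only [Finset.prod_insert ha]
    exact (h a (by simp)).mul (ih fun i hi => h i (by simp [hi]))

lemma inv {h : (Fin n → ℤ) × ℂ} (hh : h ∈ polarHyps P n) :
    HasPolarDenominators P (fun x => (hypFun h x)⁻¹) :=
  ⟨{h}, by simpa using hh, 1, one_mem _, fun x hx => by simp [mul_inv_cancel₀ (hx h hh)]⟩

/-- Only one of two opposite weights is listed in `polarHyps`; the other is reached by `e^μ - c = -c
e^μ (e^{-μ} - c⁻¹)`. -/
lemma inv_expo_sub {μ : Fin n → ℤ} {c : ℂ} (hc : c ≠ 0)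
    (h : (μ, c) ∈ polarHyps P n ∨ (-μ, c⁻¹) ∈ polarHyps P n) :
    HasPolarDenominators P (fun x => (expo μ x - c)⁻¹) := by
  rcases h with h | h
  · have h1 := HasPolarDenominators.inv h
    simp only [hypFun] at h1
    exact h1
  · have e : (fun x => (expo μ x - c)⁻¹) =
        fun x => -c⁻¹ * expo (-μ) x * (hypFun (-μ, c⁻¹) x)⁻¹ := by
      funext x
      have hE := expo_ne_zero μ x
      have h3 : expo μ x - c = -(c * expo μ x) * ((expo μ x)⁻¹ - c⁻¹) := by
        field_simp; ring
      simp only [hypFun]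
      rw [expo_neg, h3, mul_inv, ← neg_inv, mul_inv]
      ring
    rw [e]
    exact mul (mul (const _) (of_mem_trig (expo_mem_trig (-μ)))) (HasPolarDenominators.inv h)

lemma ratio_expo (t : ℂ) {k : ℂ} (hk : k ≠ 0) {μ : Fin n → ℤ}
    (h : (μ, k⁻¹) ∈ polarHyps P n ∨ (-μ, k) ∈ polarHyps P n) :
    HasPolarDenominators P (fun x => ratio t (k * expo μ x)) := by
  have h1 := inv_expo_sub (P := P) (μ := μ) (inv_ne_zero hk) (by rwa [inv_inv])
  have h2 : HasPolarDenominators P (fun x => 1 + (-t * k) * expo μ x) :=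
    add (const 1) (mul (const (-t * k)) (of_mem_trig (expo_mem_trig μ)))
  have e : (fun x => ratio t (k * expo μ x)) =
      fun x => -k⁻¹ * (1 + (-t * k) * expo μ x) * (expo μ x - k⁻¹)⁻¹ := by
    funext x
    have h3 : 1 - k * expo μ x = -k * (expo μ x - k⁻¹) := by field_simp; ring
    rw [ratio, h3, div_eq_mul_inv, mul_inv, ← neg_inv]
    ring
  rw [e]
  exact mul (mul (const _) h2) h1

end HasPolarDenominators

lemma single_mem_polarHyps (i : Fin n) (ε : ℤˣ) {c : ℂ} (hc : c ∈ singleRoots P) :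
    ((ε : ℤ) • (Pi.single i 1 : Fin n → ℤ), c) ∈ polarHyps P n ∨
    (-((ε : ℤ) • (Pi.single i 1 : Fin n → ℤ)), c⁻¹) ∈ polarHyps P n := by
  rcases Int.units_eq_one_or ε with rfl | rfl
  · left; exact mem_polarHyps.2 (Or.inl ⟨i, c, hc, by simp⟩)
  · right; exact mem_polarHyps.2 (Or.inl ⟨i, c⁻¹, inv_mem_singleRoots hc, by simp⟩)

lemma pair_mem_polarHyps {i l : Fin n} (hil : i ≠ l) (ε η : ℤˣ) {c : ℂ} (hc : c ∈ pairRoots P) :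
    ((ε : ℤ) • (Pi.single i 1 : Fin n → ℤ) + (η : ℤ) • Pi.single l 1, c) ∈ polarHyps P n ∨
    (-((ε : ℤ) • (Pi.single i 1 : Fin n → ℤ) + (η : ℤ) • Pi.single l 1), c⁻¹) ∈
      polarHyps P n := by
  have hc' := inv_mem_pairRoots hc
  have key : ∀ {i l : Fin n}, i < l → ∀ ε η : ℤˣ,
      ((ε : ℤ) • (Pi.single i 1 : Fin n → ℤ) + (η : ℤ) • Pi.single l 1, c) ∈ polarHyps P n ∨
      (-((ε : ℤ) • (Pi.single i 1 : Fin n → ℤ) + (η : ℤ) • Pi.single l 1), c⁻¹) ∈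
        polarHyps P n := by
    intro i l h ε η
    rcases Int.units_eq_one_or ε with rfl | rfl
    · left
      exact mem_polarHyps.2 (Or.inr ⟨i, l, h, η, c, hc, by simp [pairWeight]⟩)
    · right
      refine mem_polarHyps.2 (Or.inr ⟨i, l, h, -η, c⁻¹, hc', ?_⟩)
      simp [pairWeight, add_comm]
  rcases lt_or_gt_of_ne hil with h | h
  · exact key h ε η
  · rw [add_comm]; exact key h η ε

lemma expo_smul_single (i : Fin n) (ε : ℤ) (x : Fin n → ℂ) :
    expo (ε • (Pi.single i 1 : Fin n → ℤ)) x = Complex.exp (Complex.I * ((ε : ℂ) * x i)) := by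
  rw [expo, Finset.sum_eq_single i]
  · simp
  · intro l _ hl; simp [hl]
  · simp

variable (P) in
lemma hasPolarDenominators_vb (i : Fin n) (ε : Fin n → ℤˣ) :
    HasPolarDenominators P (fun x => vb P (flipSigns ε x i)) := by
  have key : ∀ c t k : ℂ, k ≠ 0 → k⁻¹ ∈ singleRoots P → HasPolarDenominators P (fun x =>
      c * ratio t (k * Complex.exp (Complex.I * flipSigns ε x i))) := by
    intro c t k hk hmem
    have := single_mem_polarHyps i (ε i) hmem
    rw [inv_inv] at this
    have h1 := HasPolarDenominators.ratio_expo t hk this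
    simp only [expo_smul_single] at h1
    exact (HasPolarDenominators.const c).mul h1
  have h0 := P.sq_ne_zero
  have e : (fun x => vb P (flipSigns ε x i)) = fun x =>
      (Complex.exp (P.β * P.g₀ / 2) * ratio (Complex.exp (-P.β * P.g₀))
        (1 * Complex.exp (Complex.I * flipSigns ε x i))) *
      (Complex.exp (P.β * P.g₁ / 2) * ratio (Complex.exp (-P.β * P.g₁))
        (-1 * Complex.exp (Complex.I * flipSigns ε x i))) *
      (Complex.exp (P.β * P.gp₀ / 2) * ratio (Complex.exp (-P.β * P.gp₀))
        (P.sq * Complex.exp (Complex.I * flipSigns ε x i))) *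
      (Complex.exp (P.β * P.gp₁ / 2) * ratio (Complex.exp (-P.β * P.gp₁))
        (-P.sq * Complex.exp (Complex.I * flipSigns ε x i))) := by
    funext s; rw [vb_eq, one_mul, neg_one_mul, neg_mul P.sq]
  rw [e]
  refine (((key _ _ _ ?_ ?_).mul (key _ _ _ ?_ ?_)).mul (key _ _ _ ?_ ?_)).mul (key _ _ _ ?_ ?_)
  · simp
  · simp [mem_singleRoots]
  · simp
  · simp [mem_singleRoots, inv_neg]
  · exact h0
  · simp [mem_singleRoots]
  · simpa using h0
  · simp [mem_singleRoots, inv_neg]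

variable (P) in
lemma hasPolarDenominators_va {i l : Fin n} (hil : i ≠ l) (ε η : ℤˣ) :
    HasPolarDenominators P (fun x => va P (((ε : ℤ) : ℂ) * x i + ((η : ℤ) : ℂ) * x l)) ∧
    HasPolarDenominators P
      (fun x => va P (((ε : ℤ) : ℂ) * x i + ((η : ℤ) : ℂ) * x l + 2 * P.γ)) := by
  have hexp : ∀ x : Fin n → ℂ, expo ((ε : ℤ) • (Pi.single i 1 : Fin n → ℤ) +
      (η : ℤ) • Pi.single l 1) x =
      Complex.exp (Complex.I * (((ε : ℤ) : ℂ) * x i + ((η : ℤ) : ℂ) * x l)) := by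
    intro x
    rw [expo_add, Pi.mul_apply, expo_smul_single, expo_smul_single, ← Complex.exp_add, mul_add]
  have key : ∀ c t k : ℂ, k ≠ 0 → k⁻¹ ∈ pairRoots P → HasPolarDenominators P (fun x : Fin n → ℂ =>
      c * ratio t (k * Complex.exp
        (Complex.I * (((ε : ℤ) : ℂ) * x i + ((η : ℤ) : ℂ) * x l)))) := by
    intro c t k hk hmem
    have := pair_mem_polarHyps hil ε η hmem
    rw [inv_inv] at this
    have h1 := HasPolarDenominators.ratio_expo t hk this
    simp only [hexp] at h1
    exact (HasPolarDenominators.const c).mul h1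
  have h0 := P.sq_ne_zero
  constructor
  · have := key (Complex.exp (P.β * P.g / 2)) (Complex.exp (-P.β * P.g)) 1 one_ne_zero
      (by simp [mem_pairRoots])
    simpa only [va_eq, one_mul] using this
  · have := key (Complex.exp (P.β * P.g / 2)) (Complex.exp (-P.β * P.g)) (P.sq * P.sq)
      (mul_ne_zero h0 h0) (by simp [mem_pairRoots])
    convert this using 2 with x
    rw [va_eq, mul_add Complex.I _ (2 * P.γ), Complex.exp_add, P.exp_two_γ, mul_comm (P.sq * P.sq)]

variable (P) in
lemma hasPolarDenominators_Vpos (ε : Fin n → ℤˣ) {A B : Finset (Fin n)} (hAB : Disjoint A B) :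
    HasPolarDenominators P (fun x => Vpos P A B (flipSigns ε x)) := by
  unfold Vpos
  refine HasPolarDenominators.mul (HasPolarDenominators.mul ?_ ?_) ?_
  · exact .prod fun i _ => hasPolarDenominators_vb P i ε
  · refine .prod fun q hq => ?_
    simp only [Finset.mem_filter, Finset.mem_product] at hq
    exact (hasPolarDenominators_va P hq.2.ne _ _).1.mul (hasPolarDenominators_va P hq.2.ne _ _).2
  · refine .prod fun i hi => .prod fun l hl => ?_
    have hil : i ≠ l := fun e => Finset.disjoint_left.1 hAB hi (e ▸ hl)
    refine (hasPolarDenominators_va P hil _ _).1.mul ?_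
    have := (hasPolarDenominators_va P hil (ε i) (-(ε l))).1
    simpa [sub_eq_add_neg, flipSigns] using this

variable (P) in
lemma hasPolarDenominators_recSum (ε : Fin n → ℤˣ) (m : ℕ) (K : Finset (Fin n)) :
    HasPolarDenominators P
      (fun x => recSum (fun A B => Vpos P A B (flipSigns ε x)) (fun _ => 1) m K) := by
  induction m using Nat.strong_induction_on generalizing K with
  | _ m ih =>
    by_cases hm : m = 0
    · subst hm; simpa only [recSum_zero] using .const 1
    · simp only [recSum_of_ne_zero _ _ hm]
      refine HasPolarDenominators.neg (.sum fun A hA => ?_)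
      rw [mem_smallSubsets] at hA
      have := hA.2.1.card_pos
      exact (hasPolarDenominators_Vpos P ε Finset.disjoint_sdiff).mul (ih _ (by omega) _)

lemma comp_up_mem_trig {f : (Fin n → ℂ) → ℂ} (hf : f ∈ trig n) (A : Finset (Fin n))
    (ε : Fin n → ℤˣ) : (fun x => f (up P A (flipSigns ε x))) ∈ trig n := by
  refine trig_induction (p := fun f => (fun x => f (up P A (flipSigns ε x))) ∈ trig n)
    ?_ ?_ ?_ ?_ hf
  · intro μ
    have : (fun x => expo μ (up P A (flipSigns ε x))) =
        (Complex.exp (Complex.I * ∑ j, (μ j : ℂ) * (if j ∈ A then 2 * P.γ else 0))) •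
          expo (fun j => μ j * ε j) := by
      funext x
      simp only [expo, Pi.smul_apply, smul_eq_mul, ← Complex.exp_add, ← mul_add,
        ← Finset.sum_add_distrib]
      congr 2
      refine Finset.sum_congr rfl fun j _ => ?_
      simp only [up, flipSigns]
      push_cast
      split_ifs <;> ring
    rw [this]
    exact (trig n).smul_mem (expo_mem_trig _) _
  · exact zero_mem _
  · intro F G h1 h2; exact add_mem h1 h2
  · intro c F h; exact (trig n).smul_mem h c

lemma hasPolarDenominators_Dsum (r : ℕ) {f : (Fin n → ℂ) → ℂ} (hf : f ∈ trig n) :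
    HasPolarDenominators P (Dsum P r f) := by
  unfold Dsum Dpos
  refine .sum fun ε _ => .sum fun A _ => HasPolarDenominators.mul (HasPolarDenominators.mul ?_ ?_) ?_
  · exact hasPolarDenominators_Vpos P ε disjoint_compl_right
  · exact hasPolarDenominators_recSum P ε _ _
  · exact .of_mem_trig (comp_up_mem_trig hf A ε)

/-- The roots `q^{-1/2}` and `q⁻¹` come from the denominators with positive signs, the roots
`q^{1/2}` and `q` from those with reversed signs. -/
lemma IsRegular.hypFun_ne_zero {x : Fin n → ℂ} (hx : IsRegular P x) :
    ∀ h ∈ polarHyps P n, hypFun h x ≠ 0 := by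
  have h0 := P.sq_ne_zero
  intro h hh
  rcases mem_polarHyps.1 hh with ⟨j, c, hc, rfl⟩ | ⟨j, k, hjk, τ, c, hc, rfl⟩
  · obtain ⟨h1, h2, h3⟩ := hx.1 j
    rw [Ne, sin_half_eq_zero] at h1
    rw [Ne, cos_half_eq_zero] at h2
    have h4 := h3 1
    have h5 := h3 (-1)
    simp only [Ne, sin_half_eq_zero, cos_half_eq_zero, mul_add, Complex.exp_add, P.exp_γ,
      Units.val_one, Int.cast_one, one_mul, Units.val_neg, Int.cast_neg, neg_mul, mul_neg,
      Complex.exp_neg] at h4 h5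
    rw [hypFun, expo_single, sub_ne_zero]
    dsimp only
    rintro rfl
    rw [mem_singleRoots] at hc
    rcases hc with e | e | e | e | e | e
    · exact h1 e
    · exact h2 e
    · rw [e] at h5; exact h5.1 (mul_inv_cancel₀ h0)
    · rw [e] at h5; exact h5.2 (by rw [inv_neg, mul_neg, mul_inv_cancel₀ h0])
    · rw [e] at h4; exact h4.1 (mul_inv_cancel₀ h0)
    · rw [e] at h4; exact h4.2 (by rw [mul_neg, mul_inv_cancel₀ h0])
  · have h1 := hx.2 j k hjk.ne 1 τ
    have h2 := hx.2 j k hjk.ne (-1) (-τ)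
    have e2 : (((-1 : ℤˣ) : ℤ) : ℂ) * x j + (((-τ : ℤˣ) : ℤ) : ℂ) * x k =
        -(x j + ((τ : ℤ) : ℂ) * x k) := by push_cast; ring
    rw [e2] at h2
    simp only [Ne, sin_half_eq_zero, Units.val_one, Int.cast_one, one_mul] at h1 h2
    rw [mul_add _ _ (2 * P.γ), Complex.exp_add, P.exp_two_γ] at h1 h2
    rw [mul_neg, Complex.exp_neg] at h2
    rw [hypFun, expo_pairWeight, sub_ne_zero]
    dsimp only
    rintro rfl
    rw [mem_pairRoots] at hc
    have h00 : P.sq * P.sq ≠ 0 := mul_ne_zero h0 h0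
    rcases hc with e | e | e
    · exact h1.1 e
    · rw [e] at h2; exact h2.2 (inv_mul_cancel₀ h00)
    · rw [e] at h1; exact h1.2 (inv_mul_cancel₀ h00)

/-- The difference operators map invariant trigonometric polynomials to trigonometric
polynomials. -/
theorem exists_trig_Dsum (hβ : 0 < P.β) (r : ℕ) {f : (Fin n → ℂ) → ℂ} (hf : f ∈ trig n)
    (hfW : IsWeylInvariant f) :
    ∃ N ∈ trig n, ∀ x, (∀ h ∈ polarHyps P n, hypFun h x ≠ 0) → Dsum P r f x = N x := by
  obtain ⟨S, hS, N, hN, h⟩ := hasPolarDenominators_Dsum (P := P) r hf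
  refine exists_trig_of_residues generalPosition_polarHyps ?_ S hS N hN h
  intro a ha p hp
  have hfc := continuous_of_mem_trig hf
  rcases mem_polarHyps.1 ha with ⟨j, c, hc, rfl⟩ | ⟨j, k, hjk, τ, c, hc, rfl⟩
  · refine ⟨Pi.single j 1, ?_, tendsto_Dsum_single hβ hc hp r hfc hfW⟩
    rw [sum_single_mul]; simp
  · obtain ⟨v, hv, hlim⟩ := tendsto_Dsum_pair hβ hjk hp r hfc hfW
    refine ⟨v, ?_, hlim⟩
    rwa [sum_pairWeight_mul]

end Polynomiality

end Koornwinder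
end

open scoped BigOperators

noncomputable section

namespace Koornwinder

open Filter Topology

/-! ### Elementary and complete symmetric functions in different numbers of variables -/

section SymmetricFunctions

variable {R : Type*} [CommRing R] (c : ℕ → R)

/-- The complete homogeneous symmetric function of degree `m` in `c 0, …, c (N - 1)`. -/
def homSum : ℕ → ℕ → R
  | 0, _ => 1
  | _ + 1, 0 => 0
  | m + 1, N + 1 => homSum (m + 1) N + c N * homSum m (N + 1)

lemma homSum_zero (N : ℕ) : homSum c 0 N = 1 := by
  cases N <;> rw [homSum]

lemma homSeries_succ (N : ℕ) :
    PowerSeries.mk (fun m => homSum c m (N + 1)) *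
      (1 - PowerSeries.C (c N) * PowerSeries.X) = PowerSeries.mk fun m => homSum c m N := by
  rw [mul_sub, mul_one, mul_comm (PowerSeries.C (c N)), ← mul_assoc]
  ext m
  cases m with
  | zero => simp [homSum_zero]
  | succ m =>
    rw [map_sub, PowerSeries.coeff_mul_C, PowerSeries.coeff_succ_mul_X]
    simp only [PowerSeries.coeff_mk, homSum]
    ring

lemma homSeries_mul_prod (N : ℕ) :
    PowerSeries.mk (fun m => homSum c m N) *
      ∏ i ∈ Finset.range N, (1 - PowerSeries.C (c i) * PowerSeries.X) = 1 := by
  induction N with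
  | zero =>
    ext m
    cases m with
    | zero => simp [homSum_zero]
    | succ m => simp [homSum, PowerSeries.coeff_one]
  | succ N ih =>
    rw [Finset.prod_range_succ, mul_comm (∏ i ∈ _, _), ← mul_assoc, homSeries_succ, ih]

lemma coeff_prod_one_sub (I : Finset ℕ) (s : ℕ) :
    PowerSeries.coeff s (∏ i ∈ I, (1 - PowerSeries.C (c i) * PowerSeries.X)) =
      (-1) ^ s * ∑ A ∈ Finset.powersetCard s I, ∏ i ∈ A, c i := by
  have h1 : ∀ A : Finset ℕ, ∏ i ∈ A, (-(PowerSeries.C (c i) * PowerSeries.X)) =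
      PowerSeries.C ((-1) ^ A.card * ∏ i ∈ A, c i) * PowerSeries.X ^ A.card := by
    intro A
    rw [Finset.prod_neg, Finset.prod_mul_distrib, Finset.prod_const, map_mul, map_prod, map_pow,
      map_neg, map_one, mul_assoc]
  simp only [sub_eq_add_neg, Finset.prod_one_add, h1, map_sum, PowerSeries.coeff_C_mul,
    PowerSeries.coeff_X_pow, mul_ite, mul_one, mul_zero]
  rw [← Finset.sum_filter, Finset.mul_sum]
  have h2 : I.powerset.filter (fun A => s = A.card) = Finset.powersetCard s I := by
    ext A; simp [Finset.mem_powersetCard, eq_comm]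
  rw [h2]
  refine Finset.sum_congr rfl fun A hA => ?_
  rw [(Finset.mem_powersetCard.1 hA).2]

/-- The relation between elementary and complete symmetric functions, in different numbers of
variables. -/
lemma sum_elementary_mul_homSum {m M : ℕ} (hm : m ≠ 0) (hM : m ≤ M) :
    ∑ s ∈ Finset.range (m + 1), (-1) ^ s *
      (∑ A ∈ Finset.powersetCard s (Finset.range M), ∏ i ∈ A, c i) *
        homSum c (m - s) (M + 1 - m) = 0 := by
  set N := M + 1 - m
  have hN : N ≤ M := by omega
  -- Of the `M` linear factors, `N = M + 1 - m` are cancelled by the series of complete functions.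
  -- The remaining `m - 1` factors have a product without a term of degree `m`.
  have h1 := congrArg (PowerSeries.coeff m)
    (show (∏ i ∈ Finset.range M, (1 - PowerSeries.C (c i) * PowerSeries.X)) *
      PowerSeries.mk (fun m => homSum c m N) =
        ∏ i ∈ Finset.Ico N M, (1 - PowerSeries.C (c i) * PowerSeries.X) by
      rw [← Finset.prod_range_mul_prod_Ico _ hN, mul_comm, ← mul_assoc, homSeries_mul_prod,
        one_mul])
  rw [PowerSeries.coeff_mul, coeff_prod_one_sub,
    Finset.Nat.sum_antidiagonal_eq_sum_range_succ (fun i j =>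
      PowerSeries.coeff i (∏ i ∈ Finset.range M, (1 - PowerSeries.C (c i) * PowerSeries.X)) *
      PowerSeries.coeff j (PowerSeries.mk fun m => homSum c m N)),
    Finset.powersetCard_eq_empty.2 (by rw [Nat.card_Ico]; omega), Finset.sum_empty,
    mul_zero] at h1
  simpa only [coeff_prod_one_sub, PowerSeries.coeff_mk] using h1

/-- The number of elements of `K` that are larger than `j`. -/
def rankIn {n : ℕ} (K : Finset (Fin n)) (j : Fin n) : ℕ := (K.filter (j < ·)).card

/-- The rank is a bijection from `K` onto `{0, …, K.card - 1}`, and elementary symmetric functions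
see only the multiset of values. -/
lemma sum_powersetCard_rankIn {n : ℕ} (K : Finset (Fin n)) (s : ℕ) :
    ∑ A ∈ Finset.powersetCard s K, ∏ j ∈ A, c (rankIn K j) =
      ∑ A ∈ Finset.powersetCard s (Finset.range K.card), ∏ i ∈ A, c i := by
  have hlt : ∀ i ∈ K, ∀ j ∈ K, i < j → rankIn K j < rankIn K i := by
    intro i _ j hj hij
    refine Finset.card_lt_card ⟨fun k hk => ?_, fun h => ?_⟩
    · rw [Finset.mem_filter] at hk ⊢
      exact ⟨hk.1, hij.trans hk.2⟩
    · have := h (Finset.mem_filter.2 ⟨hj, hij⟩)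
      simp at this
  have hinj : Set.InjOn (rankIn K) K := by
    intro i hi j hj e
    rcases lt_trichotomy i j with h | h | h
    · exact absurd e (hlt i hi j hj h).ne'
    · exact h
    · exact absurd e (hlt j hj i hi h).ne
  have himg : K.image (rankIn K) = Finset.range K.card := by
    refine Finset.eq_of_subset_of_card_le ?_ ?_
    · intro a ha
      obtain ⟨j, hj, rfl⟩ := Finset.mem_image.1 ha
      refine Finset.mem_range.2 (Finset.card_lt_card ⟨Finset.filter_subset _ _, fun h => ?_⟩)
      have := h hj
      simp at this
    · rw [Finset.card_range, Finset.card_image_of_injOn hinj]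
  have hval : K.val.map (rankIn K) = (Finset.range K.card).val := by
    rw [← himg, Finset.image_val_of_injOn hinj]
  have h1 := Finset.esymm_map_val (fun j => c (rankIn K j)) K s
  have h2 := Finset.esymm_map_val c (Finset.range K.card) s
  rw [← h1, ← h2, ← hval, Multiset.map_map]
  rfl

open Classical in
/-- The weakly increasing `m`-tuples of indices that are at least `k`. -/
def monotoneTuples (n m k : ℕ) : Finset (Fin m → Fin n) :=
  Finset.univ.filter fun i : Fin m → Fin n => Monotone i ∧ ∀ a, k ≤ (i a : ℕ)

lemma mem_monotoneTuples {n m k : ℕ} {i : Fin m → Fin n} :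
    i ∈ monotoneTuples n m k ↔ Monotone i ∧ ∀ a, k ≤ (i a : ℕ) := by
  simp [monotoneTuples]

lemma monotoneTuples_zero (n k : ℕ) : monotoneTuples n 0 k = Finset.univ := by
  ext i
  simp only [mem_monotoneTuples, Finset.mem_univ, iff_true]
  exact ⟨fun a => a.elim0, fun a => a.elim0⟩

/-- The first entry is the smallest one: either it equals `k` and is split off, or all entries
exceed `k`. This is the recursion of `homSum`. -/
lemma sum_monotone_succ {n : ℕ} (p : Fin n → R) (m : ℕ) (k : Fin n) :
    ∑ i ∈ monotoneTuples n (m + 1) k, ∏ a, p (i a) =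
      (∑ i ∈ monotoneTuples n (m + 1) (k + 1), ∏ a, p (i a)) +
      p k * ∑ i ∈ monotoneTuples n m k, ∏ a, p (i a) := by
  classical
  rw [add_comm (∑ i ∈ _, _) (p k * _),
    ← Finset.sum_filter_add_sum_filter_not _ (fun i => i 0 = k)]
  congr 1
  · rw [Finset.mul_sum]
    refine Finset.sum_bij' (fun i _ => Fin.tail i) (fun i _ => Fin.cons k i) ?_ ?_ ?_ ?_ ?_
    · intro i hi
      simp only [Finset.mem_filter, mem_monotoneTuples] at hi ⊢
      exact ⟨fun a b hab => hi.1.1 (Fin.succ_le_succ_iff.2 hab), fun a => hi.1.2 _⟩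
    · intro i hi
      simp only [Finset.mem_filter, mem_monotoneTuples, Fin.cons_zero, and_true] at hi ⊢
      refine ⟨fun a b hab => ?_, fun a => ?_⟩
      · induction a using Fin.cases with
        | zero =>
          induction b using Fin.cases with
          | zero => exact le_rfl
          | succ b => simpa using hi.2 b
        | succ a =>
          induction b using Fin.cases with
          | zero => exact absurd hab (by simp)
          | succ b => simpa using hi.1 (Fin.succ_le_succ_iff.1 hab)
      · induction a using Fin.cases with
        | zero => simp
        | succ a => simpa using hi.2 a
    · intro i hi
      simp only [Finset.mem_filter, mem_monotoneTuples] at hi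
      rw [← hi.2]
      exact Fin.cons_self_tail i
    · intro i _
      exact Fin.tail_cons _ _
    · intro i hi
      simp only [Finset.mem_filter, mem_monotoneTuples] at hi
      rw [Fin.prod_univ_succ, hi.2]
      rfl
  · refine Finset.sum_congr ?_ fun _ _ => rfl
    ext i
    simp only [Finset.mem_filter, mem_monotoneTuples]
    constructor
    · rintro ⟨⟨h1, h2⟩, h3⟩
      refine ⟨h1, fun a => ?_⟩
      have h4 : (k : ℕ) < i 0 := lt_of_le_of_ne (h2 0) fun e => h3 (Fin.ext e.symm)
      have h5 : (i 0 : ℕ) ≤ i a := h1 (Fin.zero_le a)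
      omega
    · rintro ⟨h1, h2⟩
      refine ⟨⟨h1, fun a => (Nat.le_succ _).trans (h2 a)⟩, fun e => ?_⟩
      have := h2 0
      rw [e] at this
      omega

/-- The `N` indices from `k` on carry the values `c (N - 1), …, c 0`, in reversed order. -/
lemma sum_monotone_eq_homSum {n : ℕ} (p : Fin n → R) (hp : ∀ j : Fin n, p j = c (n - 1 - j)) :
    ∀ (N m k : ℕ), k + N = n →
    ∑ i ∈ monotoneTuples n m k, ∏ a, p (i a) = homSum c m N := by
  intro N
  induction N with
  | zero =>
    intro m k hk
    cases m with
    | zero =>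
      rw [homSum_zero, monotoneTuples_zero]
      simp
    | succ m =>
      rw [homSum, Finset.sum_eq_zero]
      intro i hi
      have := (mem_monotoneTuples.1 hi).2 0
      have := (i 0).isLt
      omega
  | succ N ihN =>
    intro m
    induction m with
    | zero =>
      intro k hk
      rw [homSum_zero, monotoneTuples_zero]
      simp
    | succ m ihm =>
      intro k hk
      have hkn : k < n := by omega
      rw [homSum, sum_monotone_succ p m ⟨k, hkn⟩, ihN (m + 1) (k + 1) (by omega),
        ihm k hk, hp]
      congr 3
      simp only []
      omega

end SymmetricFunctions

/-! ### Averages of the limiting coefficients over the signs -/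

section SignAverages

variable {n : ℕ} (P : Params)

/-- The sum of the couplings `(g₀ + g₁ + g₀' + g₁') / 2`. -/
def Params.gbar : ℝ := (P.g₀ + P.g₁ + P.gp₀ + P.gp₁) / 2

/-- The limit of the coefficient `V` at infinity in the dominant chamber. -/
def Vlim (ε : Fin n → ℤˣ) (A B : Finset (Fin n)) : ℂ :=
  ∏ j ∈ A, Complex.exp (-(((ε j : ℤ) : ℂ) * (P.β * (P.gbar + rankIn (A ∪ B) j * P.g) : ℝ)))

/-- `cosh β(ḡ + i g)`. -/
def coshSeq (i : ℕ) : ℂ := Complex.cosh ((P.β * (P.gbar + i * P.g) : ℝ) : ℂ)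

lemma sum_signs_prod_exp (A : Finset (Fin n)) (y : Fin n → ℂ) :
    ∑ ε : Fin n → ℤˣ, ∏ j ∈ A, Complex.exp (-(((ε j : ℤ) : ℂ) * y j)) =
      2 ^ n * ∏ j ∈ A, Complex.cosh (y j) := by
  have h1 := Finset.prod_univ_sum (fun _ : Fin n => (Finset.univ : Finset ℤˣ))
    (fun j s => if j ∈ A then Complex.exp (-(((s : ℤ) : ℂ) * y j)) else 1)
  rw [Fintype.piFinset_univ] at h1
  have h2 : ∀ j : Fin n, ∑ s : ℤˣ, (if j ∈ A then Complex.exp (-(((s : ℤ) : ℂ) * y j)) else 1) =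
      2 * if j ∈ A then Complex.cosh (y j) else 1 := by
    intro j
    rw [show (Finset.univ : Finset ℤˣ) = {1, -1} from rfl, Finset.sum_pair (by decide)]
    split_ifs
    · simp [Complex.cosh]; ring
    · norm_num
  simp only [h2, Finset.prod_mul_distrib, Finset.prod_ite_mem, Finset.univ_inter,
    Finset.prod_const, Finset.card_univ, Fintype.card_fin] at h1
  exact h1.symm

lemma dependsOnlyOn_Vlim (A B : Finset (Fin n)) : DependsOnlyOn (fun ε => Vlim P ε A B) A :=
  fun ε η h => Finset.prod_congr rfl fun j hj => by rw [h j hj]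

lemma dependsOnlyOn_recSum_Vlim (m : ℕ) (K : Finset (Fin n)) :
    DependsOnlyOn (fun ε => recSum (Vlim P ε) (fun _ => 1) m K) K := by
  intro ε η h
  induction m using Nat.strong_induction_on generalizing K with
  | _ m ih =>
    by_cases hm : m = 0
    · subst hm; simp only [recSum_zero]
    · simp only [recSum_of_ne_zero _ _ hm]
      congr 1
      refine Finset.sum_congr rfl fun A hA => ?_
      rw [mem_smallSubsets] at hA
      have := hA.2.1.card_pos
      have e1 := dependsOnlyOn_Vlim P A (K \ A) ε η fun j hj => h j (hA.1 hj)
      have e2 := ih (m - A.card) (by omega) (K \ A) fun j hj => h j (Finset.sdiff_subset hj)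
      dsimp only at e1 e2
      rw [e1, e2]

lemma sum_filter_card_le {ι : Type*} (K : Finset ι) (m : ℕ) (F : Finset ι → ℂ) :
    ∑ A ∈ K.powerset.filter (fun A => A.card ≤ m), F A =
      ∑ s ∈ Finset.range (m + 1), ∑ A ∈ Finset.powersetCard s K, F A := by
  classical
  rw [← Finset.sum_fiberwise_of_maps_to (g := Finset.card) (t := Finset.range (m + 1))]
  · refine Finset.sum_congr rfl fun s hs => Finset.sum_congr ?_ fun _ _ => rfl
    ext A
    simp only [Finset.mem_filter, Finset.mem_powerset, Finset.mem_powersetCard, Finset.mem_range]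
      at hs ⊢
    constructor
    · rintro ⟨⟨h1, _⟩, h2⟩; exact ⟨h1, h2⟩
    · rintro ⟨h1, h2⟩; exact ⟨⟨h1, by omega⟩, h2⟩
  · intro A hA
    have := (Finset.mem_filter.1 hA).2
    exact Finset.mem_range.2 (by omega)

lemma sum_Vlim {A K : Finset (Fin n)} (h : A ⊆ K) :
    ∑ ε : Fin n → ℤˣ, Vlim P ε A (K \ A) = 2 ^ n * ∏ j ∈ A, coshSeq P (rankIn K j) := by
  simp only [Vlim, Finset.union_sdiff_of_subset h]
  rw [sum_signs_prod_exp A fun j => ((P.β * (P.gbar + rankIn K j * P.g) : ℝ) : ℂ)]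
  rfl

lemma DependsOnlyOn.mono {b : (Fin n → ℤˣ) → ℂ} {A B : Finset (Fin n)} (hb : DependsOnlyOn b A)
    (h : A ⊆ B) : DependsOnlyOn b B :=
  fun ε η e => hb ε η fun j hj => e j (h hj)

/-- The average over the signs of the limit of the coefficient sums. -/
lemma sum_recSum_Vlim (m : ℕ) (K : Finset (Fin n)) (hm : m ≤ K.card) :
    ∑ ε : Fin n → ℤˣ, recSum (Vlim P ε) (fun _ => 1) m K =
      2 ^ n * ((-1) ^ m * homSum (coshSeq P) m (K.card + 1 - m)) := by
  induction m using Nat.strong_induction_on generalizing K with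
  | _ m ih =>
    by_cases hm0 : m = 0
    · subst hm0
      simp [recSum_zero, homSum_zero]
    · have h2n : (2 : ℂ) ^ n ≠ 0 := pow_ne_zero _ two_ne_zero
      apply mul_left_cancel₀ h2n
      set X : Finset (Fin n) → ℂ := fun A =>
        2 ^ n * ((∏ j ∈ A, coshSeq P (rankIn K j)) *
          (2 ^ n * ((-1) ^ (m - A.card) * homSum (coshSeq P) (m - A.card) (K.card + 1 - m))))
        with hX
      have hterm : ∀ A ∈ smallSubsets K m, 2 ^ n * ∑ ε : Fin n → ℤˣ, Vlim P ε A (K \ A) *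
          recSum (Vlim P ε) (fun _ => 1) (m - A.card) (K \ A) = X A := by
        intro A hA
        rw [mem_smallSubsets] at hA
        have hpos := hA.2.1.card_pos
        have hcard := Finset.card_sdiff_of_subset hA.1
        have hle := Finset.card_le_card hA.1
        rw [sum_mul_of_dependsOnlyOn (dependsOnlyOn_Vlim P A (K \ A))
          ((dependsOnlyOn_recSum_Vlim P (m - A.card) (K \ A)).mono
            (fun j hj => Finset.mem_compl.2 (Finset.mem_sdiff.1 hj).2)), sum_Vlim P hA.1,
          ih _ (by omega) _ (by omega), hX, hcard]
        -- Removing `A` lowers the size of the set and the degree by the same amount, so all terms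
        -- involve complete functions in the same number of variables.
        have : K.card - A.card + 1 - (m - A.card) = K.card + 1 - m := by omega
        rw [this]; ring
      -- The recursion contains every `A` except `∅`, and the missing term is the asserted value.
      -- Thus it suffices that the sum over all `A` vanishes.
      have hsum : ∑ A ∈ K.powerset.filter (fun A => A.card ≤ m), X A = 0 := by
        rw [sum_filter_card_le]
        have h1 := sum_elementary_mul_homSum (coshSeq P) hm0 hm
        have h2 : ∀ s ∈ Finset.range (m + 1), ∑ A ∈ Finset.powersetCard s K, X A =
            2 ^ n * 2 ^ n * (-1) ^ m * ((-1) ^ s *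
              (∑ A ∈ Finset.powersetCard s (Finset.range K.card), ∏ i ∈ A, coshSeq P i) *
                homSum (coshSeq P) (m - s) (K.card + 1 - m)) := by
          intro s hs
          have hs' : s ≤ m := by have := Finset.mem_range.1 hs; omega
          rw [← sum_powersetCard_rankIn, Finset.mul_sum, Finset.sum_mul, Finset.mul_sum]
          refine Finset.sum_congr rfl fun A hA => ?_
          have hsgn : ((-1 : ℂ)) ^ (m - s) = (-1) ^ m * (-1) ^ s := by
            obtain ⟨d, rfl⟩ := Nat.exists_eq_add_of_le hs'
            rw [Nat.add_sub_cancel_left, pow_add, mul_assoc, mul_comm ((-1 : ℂ) ^ d), ← mul_assoc,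
              ← mul_pow]
            norm_num
          simp only [hX, (Finset.mem_powersetCard.1 hA).2, hsgn]
          ring
        rw [Finset.sum_congr rfl h2, ← Finset.mul_sum, h1, mul_zero]
      rw [filter_card_eq_insert, Finset.sum_insert (empty_notMem_smallSubsets K m)] at hsum
      simp only [recSum_of_ne_zero _ _ hm0, Finset.sum_neg_distrib, mul_neg]
      rw [Finset.sum_comm, Finset.mul_sum, Finset.sum_congr rfl hterm, neg_eq_of_add_eq_zero_left
        hsum]
      simp [hX]

lemma rankIn_univ (j : Fin n) : rankIn Finset.univ j = n - 1 - j := by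
  rw [rankIn, show (Finset.univ.filter (j < ·)) = Finset.Ioi j by ext; simp, Fin.card_Ioi]

lemma beta_mul_rho (j : Fin n) :
    P.β * (P.gbar + rankIn Finset.univ j * P.g) = P.β * rho P j := by
  rw [rankIn_univ, rho, Params.gbar, Nat.sub_sub, Nat.cast_sub (by omega)]
  push_cast
  ring

lemma ofReal_E (r : ℕ) (hr : 1 ≤ r) (hrn : r ≤ n) (t : Fin n → ℝ) :
    ((E r t (fun j => Real.cosh (P.β * rho P j)) : ℝ) : ℂ) =
      ∑ s ∈ Finset.range (r + 1), (-1) ^ (r + s) *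
        (∑ J ∈ Finset.powersetCard s (Finset.univ : Finset (Fin n)), ∏ j ∈ J, (t j : ℂ)) *
        homSum (coshSeq P) (r - s) (n + 1 - r) := by
  classical
  rw [E]
  push_cast
  refine Finset.sum_congr rfl fun s hs => ?_
  congr 1
  -- In zero-based indexing the range `r ≤ i ≤ n` starts at `r - 1` and has `n + 1 - r` elements.
  rw [← sum_monotone_eq_homSum (n := n) (coshSeq P)
    (fun j => Complex.cosh (((P.β * rho P j : ℝ) : ℂ))) (fun j => ?_) (n + 1 - r) (r - s) (r - 1)
    (by omega)]
  · push_cast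
    refine Finset.sum_congr ?_ fun _ _ => rfl
    ext i
    simp only [Finset.mem_filter, Finset.mem_univ, true_and, mem_monotoneTuples,
      and_congr_right_iff]
    intro _
    exact forall_congr' fun a => by omega
  · rw [coshSeq, ← beta_mul_rho, rankIn_univ]

/-- The average over the signs of the leading coefficients is the eigenvalue. -/
lemma sum_signs_leading {r : ℕ} (hr : 1 ≤ r) (hrn : r ≤ n) (lam : Fin n → ℤ) :
    ∑ ε : Fin n → ℤˣ, ∑ A ∈ Finset.univ.filter (fun A : Finset (Fin n) => A.card ≤ r),
      Vlim P ε A Aᶜ * recSum (Vlim P ε) (fun _ => 1) (r - A.card) Aᶜ *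
        ∏ j ∈ A, Complex.exp (-(((ε j : ℤ) : ℂ) * (P.β * lam j : ℝ))) =
      2 ^ n * ((E r (fun j => Real.cosh (P.β * ((lam j : ℝ) + rho P j)))
        (fun j => Real.cosh (P.β * rho P j)) : ℝ) : ℂ) := by
  have h2n : (2 : ℂ) ^ n ≠ 0 := pow_ne_zero _ two_ne_zero
  apply mul_left_cancel₀ h2n
  rw [Finset.sum_comm, Finset.mul_sum, ofReal_E P r hr hrn]
  have hfil : (Finset.univ.filter fun A : Finset (Fin n) => A.card ≤ r) =
      (Finset.univ : Finset (Fin n)).powerset.filter (fun A => A.card ≤ r) := by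
    rw [Finset.powerset_univ]
  rw [hfil, sum_filter_card_le, Finset.mul_sum, Finset.mul_sum]
  refine Finset.sum_congr rfl fun s hs => ?_
  have hs' : s ≤ r := by have := Finset.mem_range.1 hs; omega
  rw [Finset.mul_sum, Finset.sum_mul, Finset.mul_sum, Finset.mul_sum]
  refine Finset.sum_congr rfl fun A hA => ?_
  have hcard := (Finset.mem_powersetCard.1 hA).2
  have e1 : ∀ ε : Fin n → ℤˣ, Vlim P ε A Aᶜ * recSum (Vlim P ε) (fun _ => 1) (r - A.card) Aᶜ *
        ∏ j ∈ A, Complex.exp (-(((ε j : ℤ) : ℂ) * (P.β * lam j : ℝ))) =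
      (∏ j ∈ A, Complex.exp (-(((ε j : ℤ) : ℂ) * ((P.β * (lam j + rho P j) : ℝ) : ℂ)))) *
        recSum (Vlim P ε) (fun _ => 1) (r - A.card) Aᶜ := by
    intro ε
    -- With complement `Aᶜ` the exponents in `Vlim` are `βρ_j`; together with `βλ_j` from the
    -- monomial they give `β(λ_j + ρ_j)`.
    rw [mul_right_comm, Vlim, Finset.union_compl, ← Finset.prod_mul_distrib]
    congr 1
    refine Finset.prod_congr rfl fun j _ => ?_
    rw [beta_mul_rho, ← Complex.exp_add]
    congr 1
    push_cast
    ring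
  simp only [e1]
  rw [sum_mul_of_dependsOnlyOn (A := A)
    (a := fun ε => ∏ j ∈ A, Complex.exp (-(((ε j : ℤ) : ℂ) * ((P.β * (lam j + rho P j) : ℝ) : ℂ))))
    (fun ε η h => Finset.prod_congr rfl fun j hj => by rw [h j hj])
    (dependsOnlyOn_recSum_Vlim P (r - A.card) Aᶜ), sum_signs_prod_exp A
      (fun j => ((P.β * (lam j + rho P j) : ℝ) : ℂ)), sum_recSum_Vlim P _ _ (by
        rw [Finset.card_compl, Fintype.card_fin]; omega), Finset.card_compl, Fintype.card_fin,
      hcard]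
  have e2 : n - s + 1 - (r - s) = n + 1 - r := by omega
  have hsgn : ((-1 : ℂ)) ^ (r - s) = (-1) ^ (r + s) := by
    obtain ⟨d, rfl⟩ := Nat.exists_eq_add_of_le hs'
    rw [Nat.add_sub_cancel_left, show s + d + s = d + 2 * s by ring, pow_add, pow_mul]
    norm_num
  rw [e2, hsgn]
  push_cast
  ring

end SignAverages

end Koornwinder
end

open scoped BigOperators

noncomputable section

namespace Koornwinder

open Filter Topology

/-! ### Weyl orbits and the dominance order -/

section Orbits

variable {n : ℕ}

lemma mem_weylOrbit {lam nu : Fin n → ℤ} : nu ∈ weylOrbit lam ↔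
    ∃ (σ : Equiv.Perm (Fin n)) (s : Fin n → ℤˣ), nu = fun j => (s j : ℤ) * lam (σ j) := by
  simp [weylOrbit, eq_comm]

lemma self_mem_weylOrbit (lam : Fin n → ℤ) : lam ∈ weylOrbit lam :=
  mem_weylOrbit.2 ⟨1, 1, by simp⟩

lemma mem_weylOrbit_trans {lam mu nu : Fin n → ℤ} (h : nu ∈ weylOrbit mu)
    (h' : mu ∈ weylOrbit lam) : nu ∈ weylOrbit lam := by
  obtain ⟨σ, s, rfl⟩ := mem_weylOrbit.1 h
  obtain ⟨τ, t, rfl⟩ := mem_weylOrbit.1 h'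
  exact mem_weylOrbit.2 ⟨σ.trans τ, fun j => s j * t (σ j), by
    funext j; simp [mul_assoc]⟩

lemma mem_weylOrbit_symm {lam nu : Fin n → ℤ} (h : nu ∈ weylOrbit lam) : lam ∈ weylOrbit nu := by
  obtain ⟨σ, s, rfl⟩ := mem_weylOrbit.1 h
  refine mem_weylOrbit.2 ⟨σ.symm, fun j => s (σ.symm j), ?_⟩
  funext j
  rcases Int.units_eq_one_or (s (σ.symm j)) with e | e <;> simp [e]

lemma flip_mem_weylOrbit {lam nu : Fin n → ℤ} (h : nu ∈ weylOrbit lam) (ε : Fin n → ℤˣ) :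
    (fun j => (ε j : ℤ) * nu j) ∈ weylOrbit lam :=
  mem_weylOrbit_trans (mem_weylOrbit.2 ⟨1, ε, rfl⟩) h

lemma perm_mem_weylOrbit {lam nu : Fin n → ℤ} (h : nu ∈ weylOrbit lam)
    (σ : Equiv.Perm (Fin n)) : (fun j => nu (σ j)) ∈ weylOrbit lam :=
  mem_weylOrbit_trans (mem_weylOrbit.2 ⟨σ, 1, by simp⟩) h

lemma flip_flip (ε : Fin n → ℤˣ) (nu : Fin n → ℤ) :
    (fun j => (ε j : ℤ) * ((ε j : ℤ) * nu j)) = nu := by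
  funext j
  rcases Int.units_eq_one_or (ε j) with e | e <;> simp [e]

lemma exists_isDominant_mem_weylOrbit (nu : Fin n → ℤ) :
    ∃ kap ∈ weylOrbit nu, IsDominant kap := by
  set f : Fin n → ℤ := fun j => -|nu j| with hf
  set σ := Tuple.sort f
  have hσ : Monotone (f ∘ σ) := Tuple.monotone_sort f
  refine ⟨fun j => |nu (σ j)|, mem_weylOrbit.2
    ⟨σ, fun j => if 0 ≤ nu (σ j) then 1 else -1, ?_⟩, ?_, fun j => abs_nonneg _⟩
  · funext j
    dsimp only
    split_ifs with h
    · simp [abs_of_nonneg h]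
    · simp [abs_of_neg (not_le.1 h)]
  · intro i j hij
    have := hσ hij
    simp only [hf, Function.comp_apply] at this
    exact neg_le_neg_iff.1 this

/-- The pairing of two integral weights. -/
def dot (v nu : Fin n → ℤ) : ℤ := ∑ j, v j * nu j

/-- Strictly dominant weights: `v₁ > ⋯ > v_n > 0`. -/
def IsStrictlyDominant (v : Fin n → ℤ) : Prop := StrictAnti v ∧ ∀ j, 0 < v j

/-- Rearrangement inequality: making the signs positive and sorting decreasingly can only raise the
pairing with `v`. Equality forces the signs to be trivial and `lam ∘ σ` to be antitone, hence equal
to `lam`. -/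
lemma eq_or_dot_lt_of_mem_weylOrbit {lam nu v : Fin n → ℤ} (hlam : IsDominant lam)
    (hv : IsStrictlyDominant v) (h : nu ∈ weylOrbit lam) : nu = lam ∨ dot v nu < dot v lam := by
  obtain ⟨σ, s, rfl⟩ := mem_weylOrbit.1 h
  have hmono : Monovary v lam := fun i j hij => (hv.1 (hlam.1.reflect_lt hij)).le
  have h1 : ∀ j, v j * ((s j : ℤ) * lam (σ j)) ≤ v j * lam (σ j) := by
    intro j
    have := hlam.2 (σ j)
    have := hv.2 j
    rcases Int.units_eq_one_or (s j) with e | e <;> (simp [e]; try positivity)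
  have h2 : dot v (fun j => (s j : ℤ) * lam (σ j)) ≤ ∑ j, v j * lam (σ j) :=
    Finset.sum_le_sum fun j _ => h1 j
  have h3 : ∑ j, v j * lam (σ j) ≤ dot v lam := hmono.sum_mul_comp_perm_le_sum_mul
  rcases lt_or_eq_of_le (h2.trans h3) with h4 | h4
  · exact Or.inr h4
  left
  have h5 : ∑ j, v j * lam (σ j) = dot v lam := le_antisymm h3 (h4 ▸ h2)
  have h6 : dot v (fun j => (s j : ℤ) * lam (σ j)) = ∑ j, v j * lam (σ j) := h4.trans h5.symm
  have h7 : ∀ j, (s j : ℤ) * lam (σ j) = lam (σ j) := by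
    intro j
    have := (Finset.sum_eq_sum_iff_of_le fun j _ => h1 j).1 h6 j (Finset.mem_univ j)
    exact mul_left_cancel₀ (hv.2 j).ne' this
  have h8 : Monovary v (lam ∘ σ) := hmono.sum_mul_comp_perm_eq_sum_mul_iff.1 h5
  have h9 : Antitone (lam ∘ σ) := by
    intro i j hij
    by_contra hlt
    have h10 := h8 (not_le.1 hlt)
    rcases hij.lt_or_eq with h11 | h11
    · exact absurd (hv.1 h11) (not_lt.2 h10)
    · exact hlt (h11 ▸ le_rfl)
  have h10 : (fun j => -lam j) ∘ σ = (fun j => -lam j) ∘ (1 : Equiv.Perm (Fin n)) :=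
    Tuple.unique_monotone (fun i j hij => neg_le_neg (h9 hij))
      (fun i j hij => neg_le_neg (hlam.1 hij))
  funext j
  rw [h7]
  exact neg_injective (congrFun h10 j)

/-- The `k`-th partial sum is the dominating part of the pairing with `M · 1_{≤ k} + δ`, where `δ`
is the staircase making this strictly dominant. `M` exceeds the discrepancy of the `δ`-pairings, so
a failure by at least one unit would show up. -/
lemma domLE_of_dot_le {nu lam : Fin n → ℤ}
    (h : ∀ v, IsStrictlyDominant v → dot v nu ≤ dot v lam) : DomLE nu lam := by
  intro k
  by_contra hlt
  rw [not_le] at hlt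
  set δ : Fin n → ℤ := fun j => n - (j : ℕ) with hδ
  set M : ℤ := |dot δ nu - dot δ lam| + 1 with hM
  have hMpos : 0 < M := by positivity
  have hdom : IsStrictlyDominant fun j => M * (if j ≤ k then 1 else 0) + δ j := by
    refine ⟨fun i j hij => ?_, fun j => ?_⟩
    · have : (i : ℕ) < j := hij
      simp only [hδ]
      have h1 : M * (if j ≤ k then 1 else 0) ≤ M * (if i ≤ k then 1 else 0) := by
        by_cases hj : j ≤ k
        · simp [hj, hij.le.trans hj]
        · simp only [hj, if_false, mul_zero]
          split_ifs <;> positivity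
      omega
    · have := j.isLt
      simp only [hδ]
      have h1 : 0 ≤ M * (if j ≤ k then 1 else 0) := by split_ifs <;> positivity
      omega
  have h1 := h _ hdom
  have h2 : ∀ μ : Fin n → ℤ, dot (fun j => M * (if j ≤ k then 1 else 0) + δ j) μ =
      M * ∑ j ∈ Finset.Iic k, μ j + dot δ μ := by
    intro μ
    have e : Finset.Iic k = Finset.univ.filter (· ≤ k) := by ext; simp
    simp only [dot, add_mul, Finset.sum_add_distrib, mul_assoc, ← Finset.mul_sum, ite_mul, one_mul,
      zero_mul]
    rw [e, Finset.sum_filter]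
  rw [h2, h2] at h1
  have h3 : M * 1 ≤ M * (∑ j ∈ Finset.Iic k, nu j - ∑ j ∈ Finset.Iic k, lam j) :=
    mul_le_mul_of_nonneg_left (by omega) hMpos.le
  have h4 := neg_abs_le (dot δ nu - dot δ lam)
  rw [mul_sub] at h3
  omega

end Orbits

/-! ### Monomial symmetric functions and invariant expansions -/

section Monomials

variable {n : ℕ}

lemma expo_congr (mu : Fin n → ℤ) {x x' : Fin n → ℂ}
    (h : ∀ j, Complex.exp (Complex.I * x j) = Complex.exp (Complex.I * x' j)) :
    expo mu x = expo mu x' := by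
  have key : ∀ y : Fin n → ℂ, expo mu y = ∏ j, Complex.exp (Complex.I * y j) ^ mu j := by
    intro y
    rw [expo, Finset.mul_sum, Complex.exp_sum]
    refine Finset.prod_congr rfl fun j _ => ?_
    rw [← Complex.exp_int_mul]
    congr 1; ring
  rw [key, key]
  exact Finset.prod_congr rfl fun j _ => by rw [h]

lemma expo_flipSigns (mu : Fin n → ℤ) (ε : Fin n → ℤˣ) (x : Fin n → ℂ) :
    expo mu (flipSigns ε x) = expo (fun j => (ε j : ℤ) * mu j) x := by
  simp only [expo, flipSigns]
  congr 2
  refine Finset.sum_congr rfl fun j _ => ?_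
  push_cast; ring

lemma expo_perm (mu : Fin n → ℤ) (σ : Equiv.Perm (Fin n)) (x : Fin n → ℂ) :
    expo mu (fun j => x (σ j)) = expo (fun j => mu (σ.symm j)) x := by
  simp only [expo]
  congr 2
  exact Fintype.sum_equiv σ _ _ fun j => by simp

lemma sum_weylOrbit_flip (lam : Fin n → ℤ) (ε : Fin n → ℤˣ) (F : (Fin n → ℤ) → ℂ) :
    ∑ nu ∈ weylOrbit lam, F (fun j => (ε j : ℤ) * nu j) = ∑ nu ∈ weylOrbit lam, F nu := by
  refine Finset.sum_bij' (fun nu _ j => (ε j : ℤ) * nu j) (fun nu _ j => (ε j : ℤ) * nu j)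
    (fun nu h => flip_mem_weylOrbit h ε) (fun nu h => flip_mem_weylOrbit h ε)
    (fun nu _ => flip_flip ε nu) (fun nu _ => flip_flip ε nu) (fun _ _ => rfl)

lemma sum_weylOrbit_perm (lam : Fin n → ℤ) (σ : Equiv.Perm (Fin n)) (F : (Fin n → ℤ) → ℂ) :
    ∑ nu ∈ weylOrbit lam, F (fun j => nu (σ j)) = ∑ nu ∈ weylOrbit lam, F nu := by
  refine Finset.sum_bij' (fun nu _ j => nu (σ j)) (fun nu _ j => nu (σ.symm j))
    (fun nu h => perm_mem_weylOrbit h σ) (fun nu h => perm_mem_weylOrbit h σ.symm)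
    (fun nu _ => by simp) (fun nu _ => by simp) (fun _ _ => rfl)

lemma monomial_mem_trig (lam : Fin n → ℤ) : monomial lam ∈ trig n := by
  have : monomial lam = ∑ nu ∈ weylOrbit lam, expo nu := by
    funext x; simp [monomial]
  rw [this]
  exact sum_mem fun nu _ => expo_mem_trig nu

lemma isWeylInvariant_monomial (lam : Fin n → ℤ) : IsWeylInvariant (monomial lam) where
  congr x x' h := Finset.sum_congr rfl fun nu _ => expo_congr nu h
  perm σ x := by
    simp only [monomial, expo_perm]
    exact sum_weylOrbit_perm lam σ.symm fun nu => expo nu x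
  flip ε x := by
    simp only [monomial, expo_flipSigns]
    exact sum_weylOrbit_flip lam ε fun nu => expo nu x

/-- The indicator function of an orbit. -/
def orbitSum (lam : Fin n → ℤ) : (Fin n → ℤ) →₀ ℂ :=
  ∑ nu ∈ weylOrbit lam, Finsupp.single nu 1

lemma orbitSum_apply (lam nu : Fin n → ℤ) :
    orbitSum lam nu = if nu ∈ weylOrbit lam then 1 else 0 := by
  simp [orbitSum, Finsupp.finsetSum_apply, Finsupp.single_apply]

lemma linearCombination_orbitSum (lam : Fin n → ℤ) :
    Finsupp.linearCombination ℂ expo (orbitSum lam) = monomial lam := by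
  funext x
  simp [orbitSum, monomial, Finsupp.linearCombination_single]

lemma finsupp_eq_of_linearCombination_eq {a b : (Fin n → ℤ) →₀ ℂ}
    (h : Finsupp.linearCombination ℂ expo a = Finsupp.linearCombination ℂ expo b) : a = b := by
  rw [← sub_eq_zero]
  apply coeff_eq_zero_of_real
  intro x
  rw [map_sub, h, sub_self]
  rfl

/-- A Weyl element permutes the exponentials; uniqueness of the coefficients is applied to `N` and
its transform. -/
lemma coeff_flip {a : (Fin n → ℤ) →₀ ℂ} {N : (Fin n → ℂ) → ℂ} (hN : IsWeylInvariant N)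
    (ha : Finsupp.linearCombination ℂ expo a = N) {nu mu : Fin n → ℤ} (h : mu ∈ weylOrbit nu) :
    a mu = a nu := by
  obtain ⟨σ, s, rfl⟩ := mem_weylOrbit.1 h
  have hinj : Function.Injective fun (nu : Fin n → ℤ) j => (s j : ℤ) * nu (σ j) := by
    intro α β e
    funext j
    have := congrFun e (σ.symm j)
    simpa using this
  have h1 : Finsupp.mapDomain (fun (nu : Fin n → ℤ) j => (s j : ℤ) * nu (σ j)) a = a := by
    apply finsupp_eq_of_linearCombination_eq
    rw [Finsupp.linearCombination_mapDomain]
    funext x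
    have h2 : N (fun j => flipSigns s x (σ.symm j)) = N x := by
      rw [hN.perm σ.symm, hN.flip]
    rw [ha, ← h2, ← ha, Finsupp.linearCombination_apply, Finsupp.linearCombination_apply,
      Finsupp.sum, Finsupp.sum, Finset.sum_apply, Finset.sum_apply]
    refine Finset.sum_congr rfl fun ν _ => ?_
    simp only [Function.comp_apply, Pi.smul_apply]
    rw [expo_perm ν σ.symm, expo_flipSigns]
    rfl
  conv_lhs => rw [← h1]
  exact Finsupp.mapDomain_apply hinj a nu

/-- An invariant linear combination of exponentials is a linear combination of monomials. -/
lemma linearCombination_mem_span (a : (Fin n → ℤ) →₀ ℂ)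
    (ha : ∀ nu, ∀ mu ∈ weylOrbit nu, a mu = a nu) :
    Finsupp.linearCombination ℂ expo a ∈
      Submodule.span ℂ {f | ∃ nu : Fin n → ℤ, IsDominant nu ∧ a nu ≠ 0 ∧ f = monomial nu} := by
  induction hk : a.support.card using Nat.strong_induction_on generalizing a with
  | _ k ih =>
    by_cases h0 : a = 0
    · simp [h0]
    obtain ⟨nu, hnu⟩ := Finsupp.ne_iff.1 h0
    obtain ⟨kap, hkap, hdom⟩ := exists_isDominant_mem_weylOrbit nu
    have hak : a kap ≠ 0 := by rw [ha nu kap hkap]; exact hnu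
    -- This removes the entire orbit of `kap` from the support, so induction on the size of the
    -- support applies.
    set b := a - a kap • orbitSum kap with hb
    have hbapp : ∀ mu, b mu = if mu ∈ weylOrbit kap then 0 else a mu := by
      intro mu
      rw [hb, Finsupp.sub_apply, Finsupp.smul_apply, orbitSum_apply, smul_eq_mul]
      split_ifs with h
      · rw [ha kap mu h]; ring
      · ring
    have hbinv : ∀ nu, ∀ mu ∈ weylOrbit nu, b mu = b nu := by
      intro nu mu h
      have h1 : mu ∈ weylOrbit kap ↔ nu ∈ weylOrbit kap :=
        ⟨fun h' => mem_weylOrbit_trans (mem_weylOrbit_symm h) h', fun h' => mem_weylOrbit_trans h h'⟩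
      rw [hbapp, hbapp, ha nu mu h]
      simp only [h1]
    have hsub : b.support ⊂ a.support := by
      refine ⟨fun mu hmu => ?_, fun h => ?_⟩
      · rw [Finsupp.mem_support_iff, hbapp] at hmu
        rw [Finsupp.mem_support_iff]
        exact fun e => hmu (by rw [e]; simp)
      · have := h (Finsupp.mem_support_iff.2 hak)
        rw [Finsupp.mem_support_iff, hbapp, if_pos (self_mem_weylOrbit kap)] at this
        exact this rfl
    have h1 := ih _ (hk ▸ Finset.card_lt_card hsub) b hbinv rfl
    have h2 : Finsupp.linearCombination ℂ expo a =
        Finsupp.linearCombination ℂ expo b + a kap • monomial kap := by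
      rw [hb, map_sub, map_smul, linearCombination_orbitSum, sub_add_cancel]
    rw [h2]
    refine add_mem (Submodule.span_mono ?_ h1) (Submodule.smul_mem _ _ (Submodule.subset_span
      ⟨kap, hdom, hak, rfl⟩))
    rintro f ⟨mu, h3, h4, h5⟩
    refine ⟨mu, h3, fun e => h4 ?_, h5⟩
    rw [hbapp, e]; simp

end Monomials

end Koornwinder
end

open scoped BigOperators

noncomputable section

namespace Koornwinder

open Filter Topology

/-! ### Limits along rays in the dominant chamber -/

section Asymptotics

variable {n : ℕ} (P : Params)

lemma tendsto_ratio_of_cobounded (t : ℂ) {w : ℝ → ℂ} (hw : Tendsto w atTop (Bornology.cobounded ℂ)) :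
    Tendsto (fun R => ratio t (w R)) atTop (𝓝 t) := by
  have h1 : Tendsto (fun R => (w R)⁻¹) atTop (𝓝 0) := tendsto_inv₀_cobounded.comp hw
  have h2 : Tendsto (fun R => ((w R)⁻¹ - t) / ((w R)⁻¹ - 1)) atTop (𝓝 ((0 - t) / (0 - 1))) :=
    (h1.sub_const t).div (h1.sub_const 1) (by norm_num)
  rw [show (0 - t) / (0 - 1) = t by ring] at h2
  refine h2.congr' ?_
  filter_upwards [hw.eventually (Bornology.eventually_ne_cobounded 0)] with R hR
  rw [ratio]
  have e1 : (w R)⁻¹ - t = (w R)⁻¹ * (1 - t * w R) := by field_simp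
  have e2 : (w R)⁻¹ - 1 = (w R)⁻¹ * (1 - w R) := by field_simp
  rw [e1, e2, mul_div_mul_left _ _ (inv_ne_zero hR)]

lemma tendsto_ratio_of_zero (t : ℂ) {w : ℝ → ℂ} (hw : Tendsto w atTop (𝓝 0)) :
    Tendsto (fun R => ratio t (w R)) atTop (𝓝 1) := by
  have h2 : Tendsto (fun R => ratio t (w R)) atTop (𝓝 ((1 - t * 0) / (1 - 0))) :=
    ((hw.const_mul t).const_sub 1).div (hw.const_sub 1) (by norm_num)
  simpa using h2

lemma tendsto_exp_mul_cobounded {k : ℂ} (hk : k ≠ 0) {κ : ℝ} (hκ : 0 < κ) :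
    Tendsto (fun R : ℝ => k * Complex.exp ((R * κ : ℝ) : ℂ)) atTop (Bornology.cobounded ℂ) := by
  rw [← tendsto_norm_atTop_iff_cobounded]
  simp only [norm_mul, Complex.norm_exp, Complex.ofReal_re]
  exact (Real.tendsto_exp_atTop.comp (tendsto_id.atTop_mul_const hκ)).const_mul_atTop
    (norm_pos_iff.2 hk)

lemma tendsto_exp_mul_zero (k : ℂ) {κ : ℝ} (hκ : κ < 0) :
    Tendsto (fun R : ℝ => k * Complex.exp ((R * κ : ℝ) : ℂ)) atTop (𝓝 0) := by
  rw [tendsto_zero_iff_norm_tendsto_zero]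
  simp only [norm_mul, Complex.norm_exp, Complex.ofReal_re]
  have h1 : Tendsto (fun R : ℝ => Real.exp (R * κ)) atTop (𝓝 0) :=
    Real.tendsto_exp_atBot.comp (tendsto_id.atTop_mul_const_of_neg hκ)
  simpa using h1.const_mul ‖k‖

lemma exp_ray (k z₀ : ℂ) (κ : ℤ) (R : ℝ) :
    k * Complex.exp (Complex.I * (z₀ - Complex.I * R * κ)) =
      (k * Complex.exp (Complex.I * z₀)) * Complex.exp ((R * κ : ℝ) : ℂ) := by
  rw [mul_assoc k, ← Complex.exp_add]
  congr 2
  push_cast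
  linear_combination (-(R : ℂ) * κ) * Complex.I_mul_I

/-- `s` is the sign of `κ`. For `κ > 0` the exponential blows up and the ratio tends to `e^{-b}`;
for `κ < 0` it decays and the ratio tends to `1`. The prefactor `e^{b/2}` makes the two limits
reciprocal. -/
lemma tendsto_exp_mul_ratio_ray (b : ℝ) {k : ℂ} (hk : k ≠ 0) (z₀ : ℂ) {κ : ℤ} {s : ℤˣ}
    (h : 0 < (s : ℤ) * κ) :
    Tendsto (fun R : ℝ => Complex.exp (b / 2) * ratio (Complex.exp (-b))
      (k * Complex.exp (Complex.I * (z₀ - Complex.I * R * κ)))) atTop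
      (𝓝 (Complex.exp (-(((s : ℤ) : ℂ) * (b / 2))))) := by
  simp only [exp_ray]
  have hk' : k * Complex.exp (Complex.I * z₀) ≠ 0 := mul_ne_zero hk (Complex.exp_ne_zero _)
  rcases Int.units_eq_one_or s with rfl | rfl
  · have hκ : (0 : ℝ) < κ := by exact_mod_cast (by simpa using h : 0 < κ)
    have h1 := (tendsto_ratio_of_cobounded (Complex.exp (-b))
      (tendsto_exp_mul_cobounded hk' hκ)).const_mul (Complex.exp (b / 2))
    rw [← Complex.exp_add] at h1
    convert h1 using 3
    push_cast; ring
  · have hκ : (κ : ℝ) < 0 := by exact_mod_cast (by simpa using h : κ < 0)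
    have h1 := (tendsto_ratio_of_zero (Complex.exp (-b))
      (tendsto_exp_mul_zero (k * Complex.exp (Complex.I * z₀)) hκ)).const_mul (Complex.exp (b / 2))
    convert h1 using 2
    simp

lemma tendsto_va_ray (z₀ : ℂ) {κ : ℤ} {s : ℤˣ} (h : 0 < (s : ℤ) * κ) :
    Tendsto (fun R : ℝ => va P (z₀ - Complex.I * R * κ)) atTop
      (𝓝 (Complex.exp (-(((s : ℤ) : ℂ) * ((P.β * P.g : ℝ) / 2))))) := by
  have h1 := tendsto_exp_mul_ratio_ray (P.β * P.g) one_ne_zero z₀ h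
  refine h1.congr fun R => ?_
  rw [va_eq, one_mul]
  push_cast
  rw [neg_mul]

lemma tendsto_vb_ray (z₀ : ℂ) {κ : ℤ} {s : ℤˣ} (h : 0 < (s : ℤ) * κ) :
    Tendsto (fun R : ℝ => vb P (z₀ - Complex.I * R * κ)) atTop
      (𝓝 (Complex.exp (-(((s : ℤ) : ℂ) * (P.β * P.gbar : ℝ))))) := by
  have h0 := P.sq_ne_zero
  have h1 := tendsto_exp_mul_ratio_ray (P.β * P.g₀) one_ne_zero z₀ h
  have h2 := tendsto_exp_mul_ratio_ray (P.β * P.g₁) (neg_ne_zero.2 one_ne_zero) z₀ h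
  have h3 := tendsto_exp_mul_ratio_ray (P.β * P.gp₀) h0 z₀ h
  have h4 := tendsto_exp_mul_ratio_ray (P.β * P.gp₁) (neg_ne_zero.2 h0) z₀ h
  have h5 := ((h1.mul h2).mul h3).mul h4
  simp only [← Complex.exp_add] at h5
  refine (h5.congr fun R => ?_).trans (le_of_eq ?_)
  · rw [vb_eq, one_mul, neg_one_mul, neg_mul P.sq]
    push_cast
    simp only [neg_mul]
  · congr 2
    rw [Params.gbar]
    push_cast
    ring

/-- The point `x₀ - i R v`. -/
def ray (x₀ : Fin n → ℂ) (v : Fin n → ℤ) (R : ℝ) : Fin n → ℂ :=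
  fun j => x₀ j - Complex.I * R * v j

lemma flipSigns_ray (ε : Fin n → ℤˣ) (x₀ : Fin n → ℂ) (v : Fin n → ℤ) (R : ℝ) (j : Fin n) :
    flipSigns ε (ray x₀ v R) j =
      flipSigns ε x₀ j - Complex.I * R * (((ε j : ℤ) * v j : ℤ) : ℂ) := by
  simp only [flipSigns, ray]
  push_cast
  ring

lemma expo_ray (mu : Fin n → ℤ) (x₀ : Fin n → ℂ) (v : Fin n → ℤ) (R : ℝ) :
    expo mu (ray x₀ v R) = expo mu x₀ * Complex.exp ((R * dot v mu : ℝ) : ℂ) := by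
  rw [expo, expo, ← Complex.exp_add]
  congr 1
  simp only [ray, dot]
  push_cast
  simp only [Finset.mul_sum, ← Finset.sum_add_distrib]
  refine Finset.sum_congr rfl fun j _ => ?_
  linear_combination (-(R : ℂ) * v j * mu j) * Complex.I_mul_I

variable {v : Fin n → ℤ} (x₀ : Fin n → ℂ) (ε : Fin n → ℤˣ)

lemma tendsto_vaa_ray (hv : IsStrictlyDominant v) {i l : Fin n} (hil : i < l) :
    Tendsto (fun R : ℝ => vaa P (flipSigns ε (ray x₀ v R)) i l) atTop
      (𝓝 (Complex.exp (-(((ε i : ℤ) : ℂ) * (P.β * P.g : ℝ))))) := by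
  have h1 := hv.1 hil
  have h2 := hv.2 i
  have h3 := hv.2 l
  have hs : 0 < (ε i : ℤ) * ((ε i : ℤ) * v i + (ε l : ℤ) * v l) := by
    rcases Int.units_eq_one_or (ε i) with e | e <;> rcases Int.units_eq_one_or (ε l) with e' | e' <;>
      simp only [e, e', Units.val_one, Units.val_neg] <;> omega
  have h4 := (tendsto_va_ray P (flipSigns ε x₀ i + flipSigns ε x₀ l) hs).mul
    (tendsto_va_ray P (flipSigns ε x₀ i + flipSigns ε x₀ l + 2 * P.γ) hs)
  rw [← Complex.exp_add] at h4
  refine (h4.congr fun R => ?_).trans (le_of_eq ?_)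
  · rw [vaa, flipSigns_ray, flipSigns_ray]
    congr 2 <;> (push_cast; ring)
  · congr 2; ring

/-- If `i < l` then `v i > v l`, and both arguments `ε_i v_i ± ε_l v_l` have the sign `ε i`. If `i >
l` they have opposite signs and the limits of the two factors cancel. -/
lemma tendsto_vac_ray (hv : IsStrictlyDominant v) {i l : Fin n} (hil : i ≠ l) :
    Tendsto (fun R : ℝ => vac P (flipSigns ε (ray x₀ v R)) i l) atTop
      (𝓝 (if i < l then Complex.exp (-(((ε i : ℤ) : ℂ) * (P.β * P.g : ℝ))) else 1)) := by
  have h2 := hv.2 i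
  have h3 := hv.2 l
  have key : ∀ s t : ℤˣ, 0 < (s : ℤ) * ((ε i : ℤ) * v i + (ε l : ℤ) * v l) →
      0 < (t : ℤ) * ((ε i : ℤ) * v i - (ε l : ℤ) * v l) →
      Tendsto (fun R : ℝ => vac P (flipSigns ε (ray x₀ v R)) i l) atTop
      (𝓝 (Complex.exp (-(((s : ℤ) : ℂ) * ((P.β * P.g : ℝ) / 2))) *
        Complex.exp (-(((t : ℤ) : ℂ) * ((P.β * P.g : ℝ) / 2))))) := by
    intro s t hs ht
    refine ((tendsto_va_ray P (flipSigns ε x₀ i + flipSigns ε x₀ l) hs).mul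
      (tendsto_va_ray P (flipSigns ε x₀ i - flipSigns ε x₀ l) ht)).congr fun R => ?_
    rw [vac, flipSigns_ray, flipSigns_ray]
    congr 2 <;> (push_cast; ring)
  split_ifs with h
  · have h1 := hv.1 h
    have h4 := key (ε i) (ε i)
      (by rcases Int.units_eq_one_or (ε i) with e | e <;>
            rcases Int.units_eq_one_or (ε l) with e' | e' <;>
            simp only [e, e', Units.val_one, Units.val_neg] <;> omega)
      (by rcases Int.units_eq_one_or (ε i) with e | e <;>
            rcases Int.units_eq_one_or (ε l) with e' | e' <;>
            simp only [e, e', Units.val_one, Units.val_neg] <;> omega)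
    rw [← Complex.exp_add] at h4
    convert h4 using 3
    ring
  · have h1 := hv.1 (lt_of_le_of_ne (not_lt.1 h) hil.symm)
    have h4 := key (ε l) (-ε l)
      (by rcases Int.units_eq_one_or (ε i) with e | e <;>
            rcases Int.units_eq_one_or (ε l) with e' | e' <;>
            simp only [e, e', Units.val_one, Units.val_neg] <;> omega)
      (by rcases Int.units_eq_one_or (ε i) with e | e <;>
            rcases Int.units_eq_one_or (ε l) with e' | e' <;>
            simp only [e, e', Units.val_one, Units.val_neg] <;> omega)
    rw [← Complex.exp_add] at h4
    convert h4 using 2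
    rw [← Complex.exp_zero]
    congr 1
    push_cast
    ring

lemma tendsto_Vpos_ray (hv : IsStrictlyDominant v) {A B : Finset (Fin n)} (hAB : Disjoint A B) :
    Tendsto (fun R : ℝ => Vpos P A B (flipSigns ε (ray x₀ v R))) atTop (𝓝 (Vlim P ε A B)) := by
  set F : Fin n → ℂ := fun j => Complex.exp (-(((ε j : ℤ) : ℂ) * (P.β * P.g : ℝ))) with hF
  have h1 : Tendsto (fun R : ℝ => ∏ j ∈ A, vb P (flipSigns ε (ray x₀ v R) j)) atTop
      (𝓝 (∏ j ∈ A, Complex.exp (-(((ε j : ℤ) : ℂ) * (P.β * P.gbar : ℝ))))) := by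
    refine tendsto_finsetProd _ fun j _ => ?_
    have hs : 0 < (ε j : ℤ) * ((ε j : ℤ) * v j) := by
      have := hv.2 j
      rcases Int.units_eq_one_or (ε j) with e | e <;> simpa [e] using this
    refine (tendsto_vb_ray P (flipSigns ε x₀ j) hs).congr fun R => ?_
    rw [flipSigns_ray]
  have h2 : Tendsto (fun R : ℝ => pairProd (vaa P (flipSigns ε (ray x₀ v R))) A) atTop
      (𝓝 (pairProd (fun i _ => F i) A)) := by
    refine tendsto_finsetProd _ fun q hq => ?_
    exact tendsto_vaa_ray P x₀ ε hv (Finset.mem_filter.1 hq).2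
  have h3 : Tendsto (fun R : ℝ => ∏ j ∈ A, ∏ k ∈ B, vac P (flipSigns ε (ray x₀ v R)) j k) atTop
      (𝓝 (∏ j ∈ A, ∏ k ∈ B, if j < k then F j else 1)) := by
    refine tendsto_finsetProd _ fun j hj => tendsto_finsetProd _ fun k hk => ?_
    exact tendsto_vac_ray P x₀ ε hv fun e => Finset.disjoint_left.1 hAB hj (e ▸ hk)
  have h4 := (h1.mul h2).mul h3
  simp only [Vpos_eq]
  convert h4 using 2
  -- An index `j ∈ A` receives one factor `F j` for each larger index of `A` and one for each larger
  -- index of `B`, together `rankIn (A ∪ B) j`.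
  have e1 : pairProd (fun i _ => F i) A = ∏ j ∈ A, F j ^ (A.filter (j < ·)).card := by
    rw [pairProd, Finset.prod_filter, Finset.prod_product]
    refine Finset.prod_congr rfl fun j _ => ?_
    dsimp only
    rw [← Finset.prod_filter, Finset.prod_const]
  have e2 : ∀ j, ∏ k ∈ B, (if j < k then F j else 1) = F j ^ (B.filter (j < ·)).card := by
    intro j
    rw [← Finset.prod_filter, Finset.prod_const]
  simp only [e1, e2]
  rw [← Finset.prod_mul_distrib, ← Finset.prod_mul_distrib, Vlim]
  refine Finset.prod_congr rfl fun j _ => ?_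
  rw [mul_assoc, ← pow_add, ← Finset.card_union_of_disjoint
    (Finset.disjoint_filter_filter hAB), ← Finset.filter_union, hF, ← Complex.exp_nat_mul,
    ← Complex.exp_add, rankIn]
  congr 1
  push_cast
  ring

lemma tendsto_recSum_ray (hv : IsStrictlyDominant v) (m : ℕ) (K : Finset (Fin n)) :
    Tendsto (fun R : ℝ => recSum (fun A B => Vpos P A B (flipSigns ε (ray x₀ v R))) (fun _ => 1) m K)
      atTop (𝓝 (recSum (Vlim P ε) (fun _ => 1) m K)) := by
  induction m using Nat.strong_induction_on generalizing K with
  | _ m ih =>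
    by_cases hm : m = 0
    · subst hm; simp only [recSum_zero]; exact tendsto_const_nhds
    · simp only [recSum_of_ne_zero _ _ hm]
      refine (tendsto_finsetSum _ fun A hA => ?_).neg
      rw [mem_smallSubsets] at hA
      have := hA.2.1.card_pos
      exact (tendsto_Vpos_ray P x₀ ε hv Finset.disjoint_sdiff).mul (ih _ (by omega) _)

/-- The orbit is re-indexed by `ε`, so that the exponentials are taken at the unflipped point and
the shift contributes only constants. -/
lemma monomial_up_flipSigns (lam : Fin n → ℤ) (A : Finset (Fin n)) (x : Fin n → ℂ) :
    monomial lam (up P A (flipSigns ε x)) = ∑ nu ∈ weylOrbit lam,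
      (∏ j ∈ A, Complex.exp (-(((ε j : ℤ) : ℂ) * (P.β * nu j : ℝ)))) * expo nu x := by
  rw [monomial, ← sum_weylOrbit_flip lam ε fun nu => (∏ j ∈ A, Complex.exp
    (-(((ε j : ℤ) : ℂ) * (P.β * nu j : ℝ)))) * expo nu x]
  refine Finset.sum_congr rfl fun nu _ => ?_
  rw [← expo_flipSigns, expo, expo, ← Complex.exp_sum, ← Complex.exp_add]
  congr 1
  have e1 : ∀ j, (nu j : ℂ) * up P A (flipSigns ε x) j =
      (if j ∈ A then (nu j : ℂ) * (Complex.I * P.β) else 0) + nu j * flipSigns ε x j := by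
    intro j
    simp only [up, Params.γ]
    split_ifs <;> ring
  simp only [e1, Finset.sum_add_distrib, mul_add, Finset.sum_ite_mem, Finset.univ_inter]
  congr 1
  rw [Finset.mul_sum]
  refine Finset.sum_congr rfl fun j _ => ?_
  have e2 : (((ε j : ℤ) : ℂ)) * ((ε j : ℤ) : ℂ) = 1 := by
    rcases Int.units_eq_one_or (ε j) with e | e <;> simp [e]
  push_cast
  linear_combination (nu j * P.β : ℂ) * Complex.I_mul_I + (P.β * nu j : ℂ) * e2

/-- Every other weight of the orbit pairs strictly less with `v` than `lam` does, so its exponential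
is negligible. -/
lemma tendsto_monomial_ray (hv : IsStrictlyDominant v) {lam : Fin n → ℤ} (hlam : IsDominant lam)
    (A : Finset (Fin n)) :
    Tendsto (fun R : ℝ => monomial lam (up P A (flipSigns ε (ray x₀ v R))) / expo lam (ray x₀ v R))
      atTop (𝓝 (∏ j ∈ A, Complex.exp (-(((ε j : ℤ) : ℂ) * (P.β * lam j : ℝ))))) := by
  simp only [monomial_up_flipSigns, Finset.sum_div]
  refine Eq.subst (motive := fun c => Tendsto _ atTop (𝓝 c))
    (Finset.sum_eq_single_of_mem (s := weylOrbit lam) (f := fun nu => if nu = lam then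
      ∏ j ∈ A, Complex.exp (-(((ε j : ℤ) : ℂ) * (P.β * lam j : ℝ))) else 0) lam
      (self_mem_weylOrbit lam) (fun nu _ h => if_neg h) |>.trans (if_pos rfl)) ?_
  refine tendsto_finsetSum _ fun nu hnu => ?_
  split_ifs with h
  · subst h
    refine tendsto_const_nhds.congr fun R => ?_
    rw [mul_div_assoc, div_self (expo_ne_zero _ _), mul_one]
  · have h1 := (eq_or_dot_lt_of_mem_weylOrbit hlam hv hnu).resolve_left h
    have h2 : ((dot v nu - dot v lam : ℤ) : ℝ) < 0 := by exact_mod_cast sub_neg.2 h1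
    refine (tendsto_exp_mul_zero ((∏ j ∈ A, Complex.exp (-(((ε j : ℤ) : ℂ) * (P.β * nu j : ℝ)))) *
      (expo nu x₀ / expo lam x₀)) h2).congr fun R => ?_
    rw [expo_ray, expo_ray, show ((R * ((dot v nu - dot v lam : ℤ) : ℝ) : ℝ) : ℂ) =
      (R * dot v nu : ℝ) - (R * dot v lam : ℝ) by push_cast; ring, Complex.exp_sub]
    have := expo_ne_zero lam x₀
    have := Complex.exp_ne_zero ((R * dot v lam : ℝ) : ℂ)
    field_simp

/-- The leading asymptotics of the difference operators on monomials. -/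
lemma tendsto_Dsum_ray (hv : IsStrictlyDominant v) {lam : Fin n → ℤ} (hlam : IsDominant lam)
    {r : ℕ} (hr : 1 ≤ r) (hrn : r ≤ n) :
    Tendsto (fun R : ℝ => Dsum P r (monomial lam) (ray x₀ v R) / expo lam (ray x₀ v R)) atTop
      (𝓝 (2 ^ n * ((E r (fun j => Real.cosh (P.β * ((lam j : ℝ) + rho P j)))
        (fun j => Real.cosh (P.β * rho P j)) : ℝ) : ℂ))) := by
  rw [← sum_signs_leading P hr hrn lam]
  simp only [Dsum, Dpos, Finset.sum_div, mul_div_assoc]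
  refine tendsto_finsetSum _ fun ε _ => tendsto_finsetSum _ fun A _ => ?_
  exact ((tendsto_Vpos_ray P x₀ ε hv disjoint_compl_right).mul
    (tendsto_recSum_ray P x₀ ε hv _ _)).mul (tendsto_monomial_ray P x₀ ε hv hlam A)

end Asymptotics

end Koornwinder
end

open scoped BigOperators

noncomputable section

namespace Koornwinder

open Filter Topology

/-! ### Triangular action on the monomials and the diagonal coefficients -/

section Triangularity

variable {n : ℕ} {P : Params}

/-- Division by the fastest possible growth `e^{Rm}` keeps precisely the terms with `v·ν = m`, as a
function of the base point. -/
lemma tendsto_linearCombination_ray (a : (Fin n → ℤ) →₀ ℂ) (v : Fin n → ℤ) {m : ℤ}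
    (hm : ∀ nu ∈ a.support, dot v nu ≤ m) (x₀ : Fin n → ℂ) :
    Tendsto (fun R : ℝ => Finsupp.linearCombination ℂ expo a (ray x₀ v R) *
      Complex.exp (-(R * m : ℝ))) atTop
      (𝓝 (Finsupp.linearCombination ℂ expo (a.filter fun nu => dot v nu = m) x₀)) := by
  simp only [linearCombination_expo_apply, Finsupp.support_filter]
  rw [Finset.sum_filter]
  simp only [Finset.sum_mul]
  refine tendsto_finsetSum _ fun nu hnu => ?_
  have h1 : ∀ R : ℝ, a nu * expo nu (ray x₀ v R) * Complex.exp (-(R * m : ℝ)) =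
      a nu * expo nu x₀ * Complex.exp ((R * ((dot v nu - m : ℤ) : ℝ) : ℝ) : ℂ) := by
    intro R
    rw [expo_ray, ← mul_assoc, mul_assoc _ (Complex.exp _), ← Complex.exp_add]
    congr 2
    push_cast
    ring
  simp only [h1]
  split_ifs with h
  · rw [Finsupp.filter_apply_pos (fun nu => dot v nu = m) _ h, h]
    simp
  · have h2 : dot v nu < m := lt_of_le_of_ne (hm nu hnu) h
    exact tendsto_exp_mul_zero _ (by exact_mod_cast sub_neg.2 h2)

lemma tendsto_linearCombination_ray_of_div {a : (Fin n → ℤ) →₀ ℂ} {v lam : Fin n → ℤ} {c : ℂ}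
    {x₀ : Fin n → ℂ} (h : Tendsto (fun R : ℝ => Finsupp.linearCombination ℂ expo a (ray x₀ v R) /
      expo lam (ray x₀ v R)) atTop (𝓝 c)) {m : ℤ} {d : ℂ}
    (hd : Tendsto (fun R : ℝ => Complex.exp ((R * ((dot v lam - m : ℤ) : ℝ) : ℝ) : ℂ)) atTop
      (𝓝 d)) :
    Tendsto (fun R : ℝ => Finsupp.linearCombination ℂ expo a (ray x₀ v R) *
      Complex.exp (-(R * m : ℝ))) atTop (𝓝 (c * (expo lam x₀ * d))) := by
  refine (h.mul (hd.const_mul (expo lam x₀))).congr fun R => ?_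
  have e : expo lam x₀ * Complex.exp ((R * ((dot v lam - m : ℤ) : ℝ) : ℝ) : ℂ) =
      expo lam (ray x₀ v R) * Complex.exp (-(R * m : ℝ)) := by
    rw [expo_ray, mul_assoc, ← Complex.exp_add]
    congr 2
    push_cast
    ring
  rw [e, ← mul_assoc, div_mul_cancel₀ _ (expo_ne_zero _ _)]

/-- The part of highest `v`-degree is a trigonometric polynomial in the base point. If its degree
exceeded `v·lam`, convergence of the quotient would make it vanish at all real base points. -/
lemma coeff_eq_zero_of_tendsto_ray {a : (Fin n → ℤ) →₀ ℂ} {v lam : Fin n → ℤ} {c : ℂ}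
    (h : ∀ x₀ : Fin n → ℂ, Tendsto (fun R : ℝ => Finsupp.linearCombination ℂ expo a (ray x₀ v R) /
      expo lam (ray x₀ v R)) atTop (𝓝 c)) {nu : Fin n → ℤ} (hnu : dot v lam < dot v nu) :
    a nu = 0 := by
  by_contra hne
  have hne' : a.support.Nonempty := ⟨nu, Finsupp.mem_support_iff.2 hne⟩
  obtain ⟨mu, hmu, hmax⟩ := a.support.exists_max_image (dot v) hne'
  have hlt : dot v lam < dot v mu := hnu.trans_le (hmax nu (Finsupp.mem_support_iff.2 hne))
  have h0 : a.filter (fun nu => dot v nu = dot v mu) = 0 := by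
    refine coeff_eq_zero_of_real _ fun x => ?_
    have h1 := tendsto_linearCombination_ray a v hmax fun j => (x j : ℂ)
    have h2 := tendsto_linearCombination_ray_of_div (h fun j => (x j : ℂ)) (m := dot v mu)
      (d := 0) (by
        have := tendsto_exp_mul_zero 1 (κ := ((dot v lam - dot v mu : ℤ) : ℝ))
          (by exact_mod_cast sub_neg.2 hlt)
        simpa only [one_mul] using this)
    have h3 := tendsto_nhds_unique h1 h2
    rw [h3, mul_zero, mul_zero]
  have h4 := DFunLike.congr_fun h0 mu
  rw [Finsupp.filter_apply_pos (fun nu => dot v nu = dot v mu) _ rfl] at h4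
  exact Finsupp.mem_support_iff.1 hmu h4

/-- Other weights may have the same `v`-degree as `lam`. They are excluded because the whole part of
this degree equals `c e^lam` as a function of the base point. -/
lemma coeff_eq_of_tendsto_ray {a : (Fin n → ℤ) →₀ ℂ} {v lam : Fin n → ℤ} {c : ℂ}
    (h : ∀ x₀ : Fin n → ℂ, Tendsto (fun R : ℝ => Finsupp.linearCombination ℂ expo a (ray x₀ v R) /
      expo lam (ray x₀ v R)) atTop (𝓝 c)) : a lam = c := by
  have hle : ∀ nu ∈ a.support, dot v nu ≤ dot v lam := by
    intro nu hnu
    by_contra hlt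
    exact Finsupp.mem_support_iff.1 hnu (coeff_eq_zero_of_tendsto_ray h (not_le.1 hlt))
  have h0 : a.filter (fun nu => dot v nu = dot v lam) = Finsupp.single lam c := by
    apply finsupp_eq_of_linearCombination_eq
    funext x
    have h1 := tendsto_linearCombination_ray a v hle x
    have h2 := tendsto_linearCombination_ray_of_div (h x) (m := dot v lam) (d := 1) (by simp)
    rw [tendsto_nhds_unique h1 h2, Finsupp.linearCombination_single]
    simp
  have h4 := DFunLike.congr_fun h0 lam
  rwa [Finsupp.filter_apply_pos (fun nu => dot v nu = dot v lam) _ rfl, Finsupp.single_eq_same] at h4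

lemma eventually_ray_hypFun_ne_zero {v : Fin n → ℤ} (hv : IsStrictlyDominant v)
    (x₀ : Fin n → ℂ) :
    ∀ᶠ R : ℝ in atTop, ∀ h ∈ polarHyps P n, hypFun h (ray x₀ v R) ≠ 0 := by
  rw [Filter.eventually_all_finset]
  intro h hh
  have hpos : 0 < dot v h.1 := by
    rcases mem_polarHyps.1 hh with ⟨j, c, hc, rfl⟩ | ⟨j, k, hjk, τ, c, hc, rfl⟩
    · simpa [dot, Pi.single_apply] using hv.2 j
    · have h1 := hv.1 hjk
      have h2 := hv.2 k
      have h3 : dot v (pairWeight j k τ) = v j + τ * v k := by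
        simp only [dot, pairWeight, Pi.add_apply, Pi.smul_apply, mul_add, Finset.sum_add_distrib]
        simp [Pi.single_apply, mul_comm]
      dsimp only
      rw [h3]
      rcases Int.units_eq_one_or τ with e | e <;> simp only [e, Units.val_one, Units.val_neg] <;>
        omega
  have h1 := tendsto_exp_mul_cobounded (expo_ne_zero h.1 x₀) (κ := (dot v h.1 : ℝ))
    (by exact_mod_cast hpos)
  filter_upwards [h1.eventually (Bornology.eventually_ne_cobounded h.2)] with R hR
  rw [hypFun, expo_ray, sub_ne_zero]
  exact hR

/-- The smallest strictly dominant weight `(n, n - 1, …, 1)`. -/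
def staircase (n : ℕ) : Fin n → ℤ := fun j => n - (j : ℕ)

lemma isStrictlyDominant_staircase : IsStrictlyDominant (staircase n) := by
  refine ⟨fun i j hij => ?_, fun j => ?_⟩
  · have : (i : ℕ) < j := hij
    simp only [staircase]; omega
  · have := j.isLt
    simp only [staircase]; omega

/-- Every Weyl image of the staircase has coordinates with distinct non-zero absolute values, so no
polar weight annihilates it and the line is transversal to all polar hyperplanes. -/
lemma eventually_line_hypFun_ne_zero (p : Fin n → ℂ) (σ : Equiv.Perm (Fin n)) (s : Fin n → ℤˣ) :
    ∀ᶠ z in 𝓝[≠] (0 : ℂ), ∀ h ∈ polarHyps P n,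
      hypFun h (p + z • fun j => (((s j : ℤ) * staircase n (σ j) : ℤ) : ℂ)) ≠ 0 := by
  rw [Filter.eventually_all_finset]
  intro h hh
  refine eventually_hypFun_ne_zero h p _ (Or.inr ?_)
  have hpos := (isStrictlyDominant_staircase (n := n)).2
  rcases mem_polarHyps.1 hh with ⟨j, c, hc, rfl⟩ | ⟨j, k, hjk, τ, c, hc, rfl⟩
  · rw [sum_single_mul]
    have h1 := hpos (σ j)
    exact_mod_cast mul_ne_zero (s j).ne_zero h1.ne'
  · rw [sum_pairWeight_mul]
    have h1 := hpos (σ j)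
    have h2 := hpos (σ k)
    have h3 : staircase n (σ j) ≠ staircase n (σ k) := fun e =>
      hjk.ne (σ.injective (isStrictlyDominant_staircase.1.injective e))
    norm_cast
    rcases Int.units_eq_one_or τ with e | e <;> rcases Int.units_eq_one_or (s j) with e' | e' <;>
      rcases Int.units_eq_one_or (s k) with e'' | e'' <;>
      simp only [e, e', e'', Units.val_one, Units.val_neg] <;> omega

/-- `N` agrees with the invariant function `Dsum` only off the polar hyperplanes. The two points are
approached along lines that correspond under the Weyl element, and continuity of `N` transfers the
invariance. -/
lemma eq_of_eq_Dsum {r : ℕ} {f N : (Fin n → ℂ) → ℂ} (hN : N ∈ trig n)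
    (h : ∀ x, (∀ h ∈ polarHyps P n, hypFun h x ≠ 0) → Dsum P r f x = N x)
    (hf : IsWeylInvariant f) (p : Fin n → ℂ) (σ : Equiv.Perm (Fin n)) (s : Fin n → ℤˣ) :
    N (fun j => ((s j : ℤ) : ℂ) * p (σ j)) = N p := by
  have hc := continuous_of_mem_trig hN
  set u : Fin n → ℂ := fun j => (((s j : ℤ) * staircase n (σ j) : ℤ) : ℂ) with hu
  set u' : Fin n → ℂ := fun j => ((((1 : Fin n → ℤˣ) j : ℤ) *
    staircase n ((1 : Equiv.Perm (Fin n)) j) : ℤ) : ℂ) with hu'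
  refine tendsto_nhds_unique_of_eventuallyEq (tendsto_line hc _ u) (tendsto_line hc p u') ?_
  filter_upwards [eventually_line_hypFun_ne_zero (P := P) (fun j => ((s j : ℤ) : ℂ) * p (σ j)) σ s,
    eventually_line_hypFun_ne_zero (P := P) p 1 1] with z h1 h2
  rw [← h _ h1, ← h _ h2]
  have e : (fun j => ((s j : ℤ) : ℂ) * p (σ j)) + z • u =
      flipSigns s (fun j => (p + z • u') (σ j)) := by
    funext j
    simp [flipSigns, hu, hu']
    ring
  rw [e, (hf.Dsum P).flip, (hf.Dsum P).perm]

lemma isWeylInvariant_of_eq_Dsum {r : ℕ} {f N : (Fin n → ℂ) → ℂ} (hN : N ∈ trig n)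
    (h : ∀ x, (∀ h ∈ polarHyps P n, hypFun h x ≠ 0) → Dsum P r f x = N x)
    (hf : IsWeylInvariant f) : IsWeylInvariant N where
  congr x x' hx := by
    refine trig_induction (p := fun F => F x = F x') (fun μ => expo_congr μ hx) rfl ?_ ?_ hN
    · intro F G h1 h2; simp [h1, h2]
    · intro c F h1; simp [h1]
  perm σ x := by simpa using eq_of_eq_Dsum hN h hf x σ 1
  flip ε x := eq_of_eq_Dsum hN h hf x 1 ε

/-- The span of the monomials below `λ`. -/
def lowerSpan (lam : Fin n → ℤ) : Submodule ℂ ((Fin n → ℂ) → ℂ) :=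
  Submodule.span ℂ {f | ∃ nu : Fin n → ℤ, IsDominant nu ∧ DomLT nu lam ∧ f = monomial nu}

/-- The difference operators act triangularly on the monomials. -/
theorem exists_Dsum_monomial_eq (hβ : 0 < P.β) {lam : Fin n → ℤ} (hlam : IsDominant lam) {r : ℕ}
    (hr : 1 ≤ r) (hrn : r ≤ n) :
    ∃ L ∈ lowerSpan lam, ∀ x, (∀ h ∈ polarHyps P n, hypFun h x ≠ 0) →
      Dsum P r (monomial lam) x =
        2 ^ n * ((E r (fun j => Real.cosh (P.β * ((lam j : ℝ) + rho P j)))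
          (fun j => Real.cosh (P.β * rho P j)) : ℝ) : ℂ) * monomial lam x + L x := by
  set c : ℂ := 2 ^ n * ((E r (fun j => Real.cosh (P.β * ((lam j : ℝ) + rho P j)))
          (fun j => Real.cosh (P.β * rho P j)) : ℝ) : ℂ) with hc
  have hW := isWeylInvariant_monomial lam
  obtain ⟨N, hN, hDN⟩ := exists_trig_Dsum hβ r (monomial_mem_trig lam) hW
  have hNW := isWeylInvariant_of_eq_Dsum hN hDN hW
  obtain ⟨a, ha⟩ := mem_trig_iff.1 hN
  have hlim : ∀ v, IsStrictlyDominant v → ∀ x₀ : Fin n → ℂ, Tendsto (fun R : ℝ =>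
      Finsupp.linearCombination ℂ expo a (ray x₀ v R) / expo lam (ray x₀ v R)) atTop (𝓝 c) := by
    intro v hv x₀
    refine (tendsto_Dsum_ray P x₀ hv hlam hr hrn).congr' ?_
    filter_upwards [eventually_ray_hypFun_ne_zero (P := P) hv x₀] with R hR
    rw [ha, hDN _ hR]
  have halam : a lam = c := coeff_eq_of_tendsto_ray (hlim _ isStrictlyDominant_staircase)
  have hinv : ∀ nu, ∀ mu ∈ weylOrbit nu, a mu = a nu := fun nu mu h => coeff_flip hNW ha h
  set b := a - c • orbitSum lam with hb
  have hbapp : ∀ mu, b mu = if mu ∈ weylOrbit lam then 0 else a mu := by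
    intro mu
    rw [hb, Finsupp.sub_apply, Finsupp.smul_apply, orbitSum_apply, smul_eq_mul]
    split_ifs with h
    · rw [hinv lam mu h, halam]; ring
    · ring
  have hbinv : ∀ nu, ∀ mu ∈ weylOrbit nu, b mu = b nu := by
    intro nu mu h
    have h1 : mu ∈ weylOrbit lam ↔ nu ∈ weylOrbit lam :=
      ⟨fun h' => mem_weylOrbit_trans (mem_weylOrbit_symm h) h', fun h' => mem_weylOrbit_trans h h'⟩
    rw [hbapp, hbapp, hinv nu mu h]
    simp only [h1]
  refine ⟨Finsupp.linearCombination ℂ expo b,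
    Submodule.span_mono ?_ (linearCombination_mem_span b hbinv), fun x hx => ?_⟩
  · rintro f ⟨nu, hdom, hne, rfl⟩
    rw [hbapp] at hne
    -- The growth bound holds in every strictly dominant direction, which is exactly what the
    -- dominance order needs.
    refine ⟨nu, hdom, ⟨domLE_of_dot_le fun v hv => ?_, fun e => ?_⟩, rfl⟩
    · by_contra hlt
      rw [coeff_eq_zero_of_tendsto_ray (hlim v hv) (not_le.1 hlt)] at hne
      simp at hne
    · rw [e, if_pos (self_mem_weylOrbit lam)] at hne
      exact hne rfl
  · rw [hDN x hx, ← ha, hb, map_sub, map_smul, linearCombination_orbitSum]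
    simp

end Triangularity

end Koornwinder
end

open scoped BigOperators

noncomputable section

namespace Koornwinder

open Filter Topology

/-! ### The infinite q-shifted factorial -/

section QPochhammer

variable {q : ℂ}

lemma summable_qPoch (hq : ‖q‖ < 1) (a : ℂ) : Summable fun m : ℕ => ‖-(a * q ^ m)‖ := by
  simp only [norm_neg, norm_mul, norm_pow]
  exact (summable_geometric_of_lt_one (norm_nonneg _) hq).mul_left _

lemma multipliable_qPoch (hq : ‖q‖ < 1) (a : ℂ) : Multipliable fun m : ℕ => 1 - a * q ^ m := by
  simp only [sub_eq_add_neg]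
  exact multipliable_one_add_of_summable (summable_qPoch hq a)

lemma qPoch_eq_mul (hq : ‖q‖ < 1) (a : ℂ) : qPoch a q = (1 - a) * qPoch (q * a) q := by
  have h : ∀ m : ℕ, 1 - q * a * q ^ m = 1 - a * q ^ (m + 1) := by
    intro m; ring
  have h1 : Multipliable fun m : ℕ => 1 - a * q ^ (m + 1) :=
    (multipliable_qPoch hq (q * a)).congr h
  have h2 := tprod_eq_zero_mul' (f := fun m : ℕ => 1 - a * q ^ m) h1
  rw [pow_zero, mul_one] at h2
  rw [qPoch, h2, qPoch]
  congr 1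
  exact tprod_congr fun m => (h m).symm

lemma qPoch_ne_zero (hq : ‖q‖ < 1) {a : ℂ} (ha : ∀ m : ℕ, a * q ^ m ≠ 1) : qPoch a q ≠ 0 := by
  rw [qPoch]
  simp only [sub_eq_add_neg]
  refine tprod_one_add_ne_zero_of_summable (fun m => ?_) (summable_qPoch hq a)
  rw [← sub_eq_add_neg, sub_ne_zero]
  exact (ha m).symm

lemma differentiable_qPoch (hq : ‖q‖ < 1) : Differentiable ℂ fun a => qPoch a q := by
  intro a
  have hu : Summable fun m : ℕ => (‖a‖ + 1) * ‖q‖ ^ m :=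
    (summable_geometric_of_lt_one (norm_nonneg _) hq).mul_left _
  have h1 := hu.hasProdLocallyUniformlyOn_nat_one_add (f := fun m b => -(b * q ^ m))
    (Metric.isOpen_ball (x := a) (ε := 1)) (.of_forall fun m b hb => by
      rw [norm_neg, norm_mul, norm_pow]
      gcongr
      have h2 : ‖b - a‖ < 1 := by rwa [← dist_eq_norm]
      calc ‖b‖ = ‖a + (b - a)‖ := by congr 1; ring
        _ ≤ ‖a‖ + ‖b - a‖ := norm_add_le _ _
        _ ≤ ‖a‖ + 1 := by linarith) (fun m => by fun_prop)
  have h2 : DifferentiableOn ℂ (fun b => ∏' m : ℕ, (1 + -(b * q ^ m))) (Metric.ball a 1) :=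
    h1.differentiableOn (.of_forall fun s => by
      simpa [Finset.prod_fn] using DifferentiableOn.finsetProd (fun _ _ ↦ by fun_prop))
      Metric.isOpen_ball
  have h3 := h2.differentiableAt (Metric.isOpen_ball.mem_nhds (Metric.mem_ball_self one_pos))
  simp only [← sub_eq_add_neg] at h3
  exact h3

lemma qPoch_conj (hq : ‖q‖ < 1) (hq' : (starRingEnd ℂ) q = q) (a : ℂ) :
    qPoch ((starRingEnd ℂ) a) q = (starRingEnd ℂ) (qPoch a q) := by
  rw [qPoch, qPoch, (multipliable_qPoch hq a).map_tprod (starRingEnd ℂ) Complex.continuous_conj]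
  simp [hq']

/-- First `(w²; t²) = (w; t)(-w; t)`; then each product is split into even and odd powers of `t`.
With `t = q^{1/2}` this distributes the numerator of `d_b^+` over its four denominators. -/
lemma qPoch_sq_mul_sq {t : ℂ} (ht : ‖t‖ < 1) (w : ℂ) :
    qPoch (w * w) (t * t) =
      qPoch w (t * t) * qPoch (-w) (t * t) * qPoch (t * w) (t * t) * qPoch (-(t * w)) (t * t) := by
  have htt : ‖t * t‖ < 1 := by
    rw [norm_mul]; exact mul_lt_one_of_nonneg_of_lt_one_left (norm_nonneg _) ht ht.le
  have key : ∀ a : ℂ, qPoch a (t * t) * qPoch (t * a) (t * t) = qPoch a t := by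
    intro a
    have he : (fun k : ℕ => 1 - a * (t * t) ^ k) = fun k : ℕ => 1 - a * t ^ (2 * k) := by
      funext k; rw [pow_mul, pow_two]
    have ho : (fun k : ℕ => 1 - t * a * (t * t) ^ k) = fun k : ℕ => 1 - a * t ^ (2 * k + 1) := by
      funext k; rw [pow_succ, pow_mul, pow_two]; ring
    have h1 := multipliable_qPoch htt a
    have h2 := multipliable_qPoch htt (t * a)
    rw [he] at h1
    rw [ho] at h2
    rw [qPoch, qPoch, he, ho, qPoch]
    exact tprod_even_mul_odd (f := fun k => 1 - a * t ^ k) h1 h2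
  have h3 : qPoch (w * w) (t * t) = qPoch w t * qPoch (-w) t := by
    rw [qPoch, qPoch, qPoch, ← (multipliable_qPoch ht w).tprod_mul (multipliable_qPoch ht (-w))]
    congr 1
    funext m
    rw [mul_pow]; ring
  rw [h3, ← key w, ← key (-w), mul_neg]
  ring

end QPochhammer

/-! ### The elementary factors of the weight function and their q-difference equation -/

section Phi

variable (P : Params)

/-- The elementary factor `(w;q)_∞ / (e^{-βg} w;q)_∞` of the weight function, with the removable
singularities removed for `g = 0`. -/
def phi (g : ℝ) (w : ℂ) : ℂ :=
  if g = 0 then 1 else qPoch w P.q / qPoch (Complex.exp (-P.β * g) * w) P.q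

variable {P}

lemma Params.q_eq : P.q = P.sq * P.sq := by
  rw [Params.q, Params.sq, ← Complex.exp_add]
  congr 1; ring

lemma norm_exp_neg_beta (g : ℝ) : ‖Complex.exp (-P.β * g)‖ = Real.exp (-P.β * g) := by
  rw [Complex.norm_exp]
  congr 1
  norm_cast

lemma Params.norm_q_lt_one (hβ : 0 < P.β) : ‖P.q‖ < 1 := by
  rw [Params.q, Complex.norm_exp, Real.exp_lt_one_iff]
  simpa using hβ

lemma Params.norm_sq_lt_one (hβ : 0 < P.β) : ‖P.sq‖ < 1 := by
  rw [P.sq_eq_ofReal, Complex.norm_real, Real.norm_of_nonneg (Real.exp_pos _).le,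
    Real.exp_lt_one_iff]
  linarith

lemma norm_exp_lt_one (hβ : 0 < P.β) {g : ℝ} (hg : 0 ≤ g) (hg0 : g ≠ 0) :
    ‖Complex.exp (-P.β * g)‖ < 1 := by
  rw [norm_exp_neg_beta, Real.exp_lt_one_iff]
  have := mul_pos hβ (lt_of_le_of_ne hg hg0.symm)
  linarith

lemma mul_q_pow_ne_one (hβ : 0 < P.β) {a : ℂ} (ha : ‖a‖ < 1) (m : ℕ) : a * P.q ^ m ≠ 1 := by
  intro e
  have h1 : ‖a * P.q ^ m‖ = 1 := by rw [e, norm_one]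
  rw [norm_mul, norm_pow] at h1
  have h2 : ‖P.q‖ ^ m ≤ 1 := pow_le_one₀ (norm_nonneg _) (P.norm_q_lt_one hβ).le
  have h3 : ‖a‖ * ‖P.q‖ ^ m ≤ ‖a‖ := mul_le_of_le_one_right (norm_nonneg _) h2
  linarith

lemma qPoch_ne_zero_of_norm_lt (hβ : 0 < P.β) {a : ℂ} (ha : ‖a‖ < 1) : qPoch a P.q ≠ 0 :=
  qPoch_ne_zero (P.norm_q_lt_one hβ) (mul_q_pow_ne_one hβ ha)

lemma qPoch_ne_zero_of_norm_le (hβ : 0 < P.β) {a : ℂ} (ha : ‖a‖ ≤ 1) (h1 : a ≠ 1) :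
    qPoch a P.q ≠ 0 := by
  rw [qPoch_eq_mul (P.norm_q_lt_one hβ)]
  refine mul_ne_zero (sub_ne_zero.2 h1.symm) (qPoch_ne_zero_of_norm_lt hβ ?_)
  rw [norm_mul]
  exact mul_lt_one_of_nonneg_of_lt_one_left (norm_nonneg _) (P.norm_q_lt_one hβ) ha

lemma norm_exp_mul_lt_one (hβ : 0 < P.β) {g : ℝ} (hg : 0 ≤ g) (hg0 : g ≠ 0) {w : ℂ}
    (hw : ‖w‖ ≤ 1) : ‖Complex.exp (-P.β * g) * w‖ < 1 := by
  rw [norm_mul]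
  exact mul_lt_one_of_nonneg_of_lt_one_left (norm_nonneg _) (norm_exp_lt_one hβ hg hg0) hw

/-- For `g > 0` the zeros of the denominator have absolute value at least `e^{βg} > 1`. For `g = 0`
they move onto the unit circle but cancel identically, whence the separate case in `phi`. -/
lemma differentiableAt_phi (hβ : 0 < P.β) {g : ℝ} (hg : 0 ≤ g) {w : ℂ} (hw : ‖w‖ ≤ 1) :
    DifferentiableAt ℂ (phi P g) w := by
  unfold phi
  by_cases hg0 : g = 0
  · simp [hg0]
  · simp only [hg0, if_false]
    have h1 := differentiable_qPoch (P.norm_q_lt_one hβ)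
    refine (h1 w).div ((h1 _).comp w (by fun_prop)) ?_
    exact qPoch_ne_zero_of_norm_lt hβ (norm_exp_mul_lt_one hβ hg hg0 hw)

/-- Passing from `w` to `q w` drops the first factor of both infinite products, and the quotient of
these two factors is `ratio`. This is the link between the weight and the coefficients of the
operators. -/
lemma phi_q_mul (hβ : 0 < P.β) {g : ℝ} (hg : 0 ≤ g) {w : ℂ} (hw : ‖w‖ ≤ 1) (hw1 : w ≠ 1) :
    phi P g (P.q * w) = ratio (Complex.exp (-P.β * g)) w * phi P g w := by
  unfold phi
  by_cases hg0 : g = 0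
  · simp [hg0, ratio, div_self (sub_ne_zero.2 hw1.symm)]
  · simp only [hg0, if_false]
    have hq := P.norm_q_lt_one hβ
    have h1 := norm_exp_mul_lt_one hβ hg hg0 hw
    have h2 : 1 - Complex.exp (-P.β * g) * w ≠ 0 := by
      rw [sub_ne_zero]
      rintro e
      rw [← e, norm_one] at h1
      exact lt_irrefl _ h1
    have h3 := qPoch_ne_zero_of_norm_lt hβ h1
    have h4 := sub_ne_zero.2 hw1.symm
    rw [qPoch_eq_mul hq] at h3
    have h5 := right_ne_zero_of_mul h3
    rw [qPoch_eq_mul hq w, qPoch_eq_mul hq (Complex.exp (-P.β * g) * w), ratio,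
      show Complex.exp (-P.β * g) * (P.q * w) = P.q * (Complex.exp (-P.β * g) * w) by ring]
    rw [div_mul_div_comm, div_eq_div_iff h5 (mul_ne_zero h4 h3)]
    ring

lemma phi_ne_zero (hβ : 0 < P.β) {g : ℝ} (hg : 0 ≤ g) {w : ℂ} (hw : ‖w‖ ≤ 1) (hw1 : w ≠ 1) :
    phi P g w ≠ 0 := by
  unfold phi
  split_ifs with hg0
  · exact one_ne_zero
  · exact div_ne_zero (qPoch_ne_zero_of_norm_le hβ hw hw1)
      (qPoch_ne_zero_of_norm_lt hβ (norm_exp_mul_lt_one hβ hg hg0 hw))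

lemma phi_conj (hβ : 0 < P.β) (g : ℝ) (w : ℂ) :
    phi P g ((starRingEnd ℂ) w) = (starRingEnd ℂ) (phi P g w) := by
  have hq := P.norm_q_lt_one hβ
  have hq' : (starRingEnd ℂ) P.q = P.q := by
    rw [Params.q, ← Complex.exp_conj]; simp
  have he : (starRingEnd ℂ) (Complex.exp (-P.β * g)) = Complex.exp (-P.β * g) := by
    rw [← Complex.exp_conj]; simp
  unfold phi
  split_ifs
  · simp
  · rw [map_div₀, ← qPoch_conj hq hq', ← qPoch_conj hq hq', map_mul, he]

lemma qPoch_div_eq_phi (hβ : 0 < P.β) (g : ℝ) {w : ℂ} (hw : ‖w‖ ≤ 1) (hw1 : w ≠ 1) :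
    qPoch w P.q / qPoch (Complex.exp (-P.β * g) * w) P.q = phi P g w := by
  unfold phi
  split_ifs with hg0
  · rw [hg0]
    simp [div_self (qPoch_ne_zero_of_norm_le hβ hw hw1)]
  · rfl

/-- The factor of the weight function that belongs to one variable. -/
def phiB (P : Params) (w : ℂ) : ℂ :=
  phi P P.g₀ w * phi P P.g₁ (-w) * phi P P.gp₀ (P.sq * w) * phi P P.gp₁ (-(P.sq * w))

lemma norm_sq_mul_le (hβ : 0 < P.β) {w : ℂ} (hw : ‖w‖ ≤ 1) : ‖P.sq * w‖ < 1 := by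
  rw [norm_mul]
  exact mul_lt_one_of_nonneg_of_lt_one_left (norm_nonneg _) (P.norm_sq_lt_one hβ) hw

lemma ne_of_norm_lt_one {w : ℂ} (h : ‖w‖ < 1) : w ≠ 1 ∧ -w ≠ 1 := by
  constructor <;> intro e
  · rw [e, norm_one] at h; exact lt_irrefl _ h
  · rw [← norm_neg, e, norm_one] at h; exact lt_irrefl _ h

lemma differentiableAt_phiB (hP : P.Admissible) {w : ℂ} (hw : ‖w‖ ≤ 1) :
    DifferentiableAt ℂ (phiB P) w := by
  obtain ⟨hβ, hg, h0, h1, h2, h3⟩ := hP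
  have hs := (norm_sq_mul_le hβ hw).le
  unfold phiB
  refine (((differentiableAt_phi hβ h0 hw).mul ?_).mul ?_).mul ?_
  · exact (differentiableAt_phi hβ h1 (by rwa [norm_neg])).comp w (by fun_prop)
  · exact (differentiableAt_phi hβ h2 hs).comp w (by fun_prop)
  · exact (differentiableAt_phi hβ h3 (by rwa [norm_neg])).comp w (by fun_prop)

lemma phiB_ne_zero (hP : P.Admissible) {w : ℂ} (hw : ‖w‖ ≤ 1) (hw1 : w ≠ 1) (hw2 : w ≠ -1) :
    phiB P w ≠ 0 := by
  obtain ⟨hβ, hg, h0, h1, h2, h3⟩ := hP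
  have hs := norm_sq_mul_le hβ hw
  have hs' := ne_of_norm_lt_one hs
  refine mul_ne_zero (mul_ne_zero (mul_ne_zero ?_ ?_) ?_) ?_
  · exact phi_ne_zero hβ h0 hw hw1
  · exact phi_ne_zero hβ h1 (by rwa [norm_neg]) fun e => hw2 (by rw [← e, neg_neg])
  · exact phi_ne_zero hβ h2 hs.le hs'.1
  · exact phi_ne_zero hβ h3 (by rw [norm_neg]; exact hs.le) hs'.2

lemma phiB_conj (hβ : 0 < P.β) (w : ℂ) :
    phiB P ((starRingEnd ℂ) w) = (starRingEnd ℂ) (phiB P w) := by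
  have h : (starRingEnd ℂ) P.sq = P.sq := by
    rw [P.sq_eq_ofReal, Complex.conj_ofReal]
  simp only [phiB, map_mul, ← phi_conj hβ, map_neg, h]

lemma daPlus_eq (hβ : 0 < P.β) {z : ℂ} (hw : ‖Complex.exp (Complex.I * z)‖ ≤ 1)
    (hw1 : Complex.exp (Complex.I * z) ≠ 1) :
    daPlus P z = phi P P.g (Complex.exp (Complex.I * z)) :=
  qPoch_div_eq_phi hβ P.g hw hw1

lemma dbPlus_eq (hβ : 0 < P.β) {z : ℂ} (hw : ‖Complex.exp (Complex.I * z)‖ ≤ 1)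
    (hw1 : Complex.exp (Complex.I * z) ≠ 1) (hw2 : Complex.exp (Complex.I * z) ≠ -1) :
    dbPlus P z = phiB P (Complex.exp (Complex.I * z)) := by
  have e1 : Complex.exp (2 * Complex.I * z) =
      Complex.exp (Complex.I * z) * Complex.exp (Complex.I * z) := by
    rw [← Complex.exp_add]; congr 1; ring
  have e2 : ∀ g : ℝ, Complex.exp (-P.β * (g + 1 / 2)) = Complex.exp (-P.β * g) * P.sq := by
    intro g
    rw [Params.sq, ← Complex.exp_add]; congr 1; ring
  rw [dbPlus, e1, e2, e2]
  set w := Complex.exp (Complex.I * z)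
  have hs := norm_sq_mul_le hβ hw
  have hs' := ne_of_norm_lt_one hs
  rw [phiB, ← qPoch_div_eq_phi hβ P.g₀ hw hw1,
    ← qPoch_div_eq_phi hβ P.g₁ (w := -w) (by rwa [norm_neg]) fun e => hw2 (by rw [← e, neg_neg]),
    ← qPoch_div_eq_phi hβ P.gp₀ hs.le hs'.1,
    ← qPoch_div_eq_phi hβ P.gp₁ (w := -(P.sq * w)) (by rw [norm_neg]; exact hs.le) hs'.2,
    div_mul_div_comm, div_mul_div_comm, div_mul_div_comm, P.q_eq,
    qPoch_sq_mul_sq (P.norm_sq_lt_one hβ)]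
  simp only [neg_mul, mul_neg, mul_assoc]

/-- The pole of `va` disappears: multiplication by `va` amounts to a q-shift of one half of the
weight. The same holds for `vb` and `phiB`. -/
lemma va_mul_phi (hβ : 0 < P.β) (hg : 0 ≤ P.g) {z : ℂ} (hw : ‖Complex.exp (Complex.I * z)‖ ≤ 1)
    (hw1 : Complex.exp (Complex.I * z) ≠ 1) :
    va P z * phi P P.g (Complex.exp (Complex.I * z)) =
      Complex.exp (P.β * P.g / 2) * phi P P.g (P.q * Complex.exp (Complex.I * z)) := by
  rw [va_eq, phi_q_mul hβ hg hw hw1]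
  ring

lemma vb_mul_phiB (hP : P.Admissible) {z : ℂ} (hw : ‖Complex.exp (Complex.I * z)‖ ≤ 1)
    (hw1 : Complex.exp (Complex.I * z) ≠ 1) (hw2 : Complex.exp (Complex.I * z) ≠ -1) :
    vb P z * phiB P (Complex.exp (Complex.I * z)) =
      Complex.exp (P.β * P.gbar) * phiB P (P.q * Complex.exp (Complex.I * z)) := by
  obtain ⟨hβ, hg, h0, h1, h2, h3⟩ := hP
  have e : Complex.exp (P.β * P.gbar) = Complex.exp (P.β * P.g₀ / 2) * Complex.exp (P.β * P.g₁ / 2) *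
      Complex.exp (P.β * P.gp₀ / 2) * Complex.exp (P.β * P.gp₁ / 2) := by
    simp only [← Complex.exp_add, Params.gbar]
    congr 1
    push_cast
    ring
  have hs := norm_sq_mul_le hβ hw
  have hs' := ne_of_norm_lt_one hs
  have a1 := phi_q_mul hβ h0 hw hw1
  have a2 := phi_q_mul hβ h1 (w := -Complex.exp (Complex.I * z)) (by rwa [norm_neg])
    fun e => hw2 (by rw [← e, neg_neg])
  have a3 := phi_q_mul hβ h2 hs.le hs'.1
  have a4 := phi_q_mul hβ h3 (w := -(P.sq * Complex.exp (Complex.I * z)))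
    (by rw [norm_neg]; exact hs.le) hs'.2
  rw [mul_neg] at a2 a4
  rw [vb_eq, e, phiB, phiB, mul_left_comm P.sq P.q, a1, a2, a3, a4]
  ring

end Phi

end Koornwinder
end

open scoped BigOperators

noncomputable section

namespace Koornwinder

open Filter Topology MeasureTheory

/-! ### Integration over the torus and contour shifts -/

section Torus

variable {n : ℕ}

/-- Lebesgue measure on the interval `(-π, π]`. -/
abbrev circleMeasure : Measure ℝ := volume.restrict (Set.Ioc (-Real.pi) Real.pi)

/-- Lebesgue measure on the cube `(-π, π]ⁿ`. -/
abbrev torusMeasure (n : ℕ) : Measure (Fin n → ℝ) := Measure.pi fun _ => circleMeasure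

lemma torusMeasure_eq_restrict :
    torusMeasure n = volume.restrict (Set.univ.pi fun _ => Set.Ioc (-Real.pi) Real.pi) := by
  rw [volume_pi, Measure.restrict_pi_pi]

lemma setIntegral_cube (f : (Fin n → ℝ) → ℂ) :
    ∫ x in Set.Icc (fun _ : Fin n => -Real.pi) (fun _ : Fin n => Real.pi), f x =
      ∫ x, f x ∂torusMeasure n := by
  rw [torusMeasure_eq_restrict, volume_pi]
  exact (setIntegral_congr_set Measure.univ_pi_Ioc_ae_eq_Icc).symm

lemma integrable_torus {f : (Fin n → ℝ) → ℂ} (hf : Continuous f) :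
    Integrable f (torusMeasure n) := by
  rw [torusMeasure_eq_restrict]
  refine (hf.continuousOn.integrableOn_compact (K := Set.Icc (fun _ : Fin n => -Real.pi)
    (fun _ : Fin n => Real.pi)) isCompact_Icc).mono_set ?_
  rw [← Set.pi_univ_Icc]
  exact Set.pi_mono fun j _ => Set.Ioc_subset_Icc_self

/-- Translation invariance of Haar measure on `ℝ / 2πℤ`, transported to the fundamental interval. -/
lemma measurePreserving_rotate (s : ℝ) :
    MeasurePreserving (fun x => toIocMod Real.two_pi_pos (-Real.pi) (x + s))
      circleMeasure circleMeasure := by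
  have : Fact (0 < 2 * Real.pi) := ⟨Real.two_pi_pos⟩
  have hpi : -Real.pi + 2 * Real.pi = Real.pi := by ring
  have h1 := AddCircle.measurePreserving_mk (2 * Real.pi) (-Real.pi)
  have h2 := measurePreserving_add_right (volume : Measure (AddCircle (2 * Real.pi)))
    ((s : ℝ) : AddCircle (2 * Real.pi))
  have h3 := AddCircle.measurePreserving_equivIoc (2 * Real.pi) (a := -Real.pi)
  have h4 := measurePreserving_subtype_coe (μa := (volume : Measure ℝ))
    (measurableSet_Ioc (a := -Real.pi) (b := -Real.pi + 2 * Real.pi))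
  have h5 := h4.comp (h3.comp (h2.comp h1))
  have h6 : circleMeasure =
      volume.restrict (Set.Ioc (-Real.pi) (-Real.pi + 2 * Real.pi)) := by rw [hpi]
  rw [h6]
  exact h5

lemma integral_translate {T : (Fin n → ℝ) → ℂ} (hT : Continuous T)
    (hper : ∀ x y : Fin n → ℝ, (∀ j, ∃ k : ℤ, y j = x j - k * (2 * Real.pi)) → T y = T x)
    (s : Fin n → ℝ) : ∫ x, T (x + s) ∂torusMeasure n = ∫ x, T x ∂torusMeasure n := by
  have h : MeasurePreserving (fun (x : Fin n → ℝ) j =>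
      toIocMod Real.two_pi_pos (-Real.pi) (x j + s j)) (torusMeasure n) (torusMeasure n) :=
    measurePreserving_pi (fun _ : Fin n => circleMeasure) (fun _ => circleMeasure)
      (fun j => measurePreserving_rotate (s j))
  conv_rhs => rw [← h.map_eq]
  rw [integral_map h.aemeasurable hT.aestronglyMeasurable]
  refine integral_congr_ae (.of_forall fun x => (hper _ _ fun j => ?_).symm)
  refine ⟨toIocDiv Real.two_pi_pos (-Real.pi) (x j + s j), ?_⟩
  rw [← self_sub_toIocDiv_zsmul, zsmul_eq_mul]
  rfl

lemma measurePreserving_neg_circle :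
    MeasurePreserving (fun x : ℝ => -x) circleMeasure circleMeasure := by
  have h : circleMeasure = volume.restrict (Set.Icc (-Real.pi) Real.pi) :=
    Measure.restrict_congr_set Ioc_ae_eq_Icc
  have h1 := (Measure.measurePreserving_neg (volume : Measure ℝ)).restrict_preimage
    (measurableSet_Icc (a := -Real.pi) (b := Real.pi))
  rw [show (Neg.neg ⁻¹' Set.Icc (-Real.pi) Real.pi : Set ℝ) = Set.Icc (-Real.pi) Real.pi by
    ext x; simp only [Set.mem_preimage, Set.mem_Icc]; constructor <;> rintro ⟨h, h'⟩ <;>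
      constructor <;> linarith] at h1
  rw [h]
  exact h1

/-- The action of a sign configuration on `ℝⁿ`. -/
def flipReal (ε : Fin n → ℤˣ) (x : Fin n → ℝ) : Fin n → ℝ := fun j => ((ε j : ℤ) : ℝ) * x j

lemma measurePreserving_flipReal (ε : Fin n → ℤˣ) :
    MeasurePreserving (flipReal ε) (torusMeasure n) (torusMeasure n) := by
  refine measurePreserving_pi (fun _ : Fin n => circleMeasure) (fun _ => circleMeasure)
    (f := fun j x => ((ε j : ℤ) : ℝ) * x) (fun j => ?_)
  rcases Int.units_eq_one_or (ε j) with e | e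
  · simp only [e, Units.val_one, Int.cast_one, one_mul]
    exact MeasurePreserving.id circleMeasure
  · simpa [e] using measurePreserving_neg_circle

lemma continuous_flipReal (ε : Fin n → ℤˣ) : Continuous (flipReal ε) := by
  unfold flipReal
  fun_prop

lemma integral_comp_flipReal {T : (Fin n → ℝ) → ℂ} (hT : Continuous T) (ε : Fin n → ℤˣ) :
    ∫ x, T (flipReal ε x) ∂torusMeasure n = ∫ x, T x ∂torusMeasure n := by
  have h := measurePreserving_flipReal ε
  conv_rhs => rw [← h.map_eq]
  rw [integral_map h.aemeasurable hT.aestronglyMeasurable]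

/-- The inclusion of `ℝⁿ` in `ℂⁿ`. -/
def toC (x : Fin n → ℝ) : Fin n → ℂ := fun j => (x j : ℂ)

lemma continuous_toC : Continuous (toC (n := n)) := by
  unfold toC
  fun_prop

lemma toC_flipReal (ε : Fin n → ℤˣ) (x : Fin n → ℝ) :
    toC (flipReal ε x) = flipSigns ε (toC x) := by
  funext j
  simp [toC, flipReal, flipSigns]

lemma volume_hyperplane {ℓ : (Fin n → ℝ) →ₗ[ℝ] ℝ} (hℓ : ℓ ≠ 0) (a : ℝ) :
    volume {x | ℓ x = a} = 0 := by
  rcases Set.eq_empty_or_nonempty {x | ℓ x = a} with h | ⟨x₁, hx₁⟩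
  · rw [h, measure_empty]
  have h1 : {x | ℓ x = a} = (AffineSubspace.mk' x₁ (LinearMap.ker ℓ) : Set (Fin n → ℝ)) := by
    ext x
    rw [SetLike.mem_coe, AffineSubspace.mem_mk', LinearMap.mem_ker, vsub_eq_sub, map_sub, hx₁,
      sub_eq_zero]
    rfl
  rw [h1]
  refine Measure.addHaar_affineSubspace _ _ fun e => hℓ ?_
  have h2 := congrArg AffineSubspace.direction e
  rw [AffineSubspace.direction_mk', AffineSubspace.direction_top] at h2
  exact LinearMap.ker_eq_top.1 h2

/-- By periodicity of the exponential the set lies in a countable union of affine hyperplanes. -/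
lemma volume_expo_eq {mu : Fin n → ℤ} (hmu : mu ≠ 0) (c : ℂ) :
    volume {x : Fin n → ℝ | expo mu (toC x) = c} = 0 := by
  rcases Set.eq_empty_or_nonempty {x : Fin n → ℝ | expo mu (toC x) = c} with h | ⟨x₁, hx₁⟩
  · rw [h, measure_empty]
  set ℓ : (Fin n → ℝ) →ₗ[ℝ] ℝ := ∑ j, (mu j : ℝ) • LinearMap.proj j with hℓ
  have hℓapp : ∀ x, ℓ x = ∑ j, (mu j : ℝ) * x j := by
    intro x; simp [hℓ, LinearMap.sum_apply]
  have hne : ℓ ≠ 0 := by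
    intro e
    apply hmu
    funext j
    have := LinearMap.congr_fun e (Pi.single j 1)
    rw [hℓapp] at this
    simpa [Pi.single_apply] using this
  have hexpo : ∀ x, expo mu (toC x) = Complex.exp (Complex.I * (ℓ x : ℝ)) := by
    intro x
    rw [expo, hℓapp]
    simp [toC]
  refine measure_mono_null (t := ⋃ k : ℤ, {x | ℓ x = ℓ x₁ + k * (2 * Real.pi)}) ?_
    (measure_iUnion_null fun k => volume_hyperplane hne _)
  intro x hx
  have h1 : Complex.exp (Complex.I * (ℓ x : ℝ)) = Complex.exp (Complex.I * (ℓ x₁ : ℝ)) := by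
    rw [← hexpo, ← hexpo]; exact hx.trans hx₁.symm
  obtain ⟨k, hk⟩ := Complex.exp_eq_exp_iff_exists_int.1 h1
  refine Set.mem_iUnion.2 ⟨k, ?_⟩
  have h2 : ((ℓ x : ℝ) : ℂ) = ((ℓ x₁ + k * (2 * Real.pi) : ℝ) : ℂ) := by
    push_cast
    refine mul_left_cancel₀ Complex.I_ne_zero ?_
    rw [hk]; ring
  exact_mod_cast h2

lemma ae_torus_of_volume {p : (Fin n → ℝ) → Prop} (h : ∀ᵐ x, p x) :
    ∀ᵐ x ∂torusMeasure n, p x := by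
  rw [torusMeasure_eq_restrict]
  exact ae_restrict_of_ae h

lemma ae_hypFun_ne_zero (P : Params) :
    ∀ᵐ x : Fin n → ℝ, ∀ h ∈ polarHyps P n, hypFun h (toC x) ≠ 0 := by
  rw [Filter.eventually_all_finset]
  intro h hh
  obtain ⟨j, hj⟩ := generalPosition_polarHyps.primitive h hh
  have h0 : h.1 ≠ 0 := fun e => by rw [e] at hj; simp at hj
  rw [ae_iff]
  refine measure_mono_null ?_ (volume_expo_eq h0 h.2)
  intro x hx
  have := not_not.1 hx
  exact sub_eq_zero.1 this

/-- Cauchy's theorem on a rectangle; the vertical sides cancel by periodicity. -/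
lemma integral_shift_strip {g : ℂ → ℂ} {b : ℝ} (hb : 0 ≤ b)
    (hper : ∀ z, g (z + 2 * Real.pi) = g z)
    (hd : ∀ z : ℂ, -b ≤ z.im → z.im ≤ 0 → DifferentiableAt ℂ g z) :
    ∫ s : ℝ in (-Real.pi)..Real.pi, g s =
      ∫ s : ℝ in (-Real.pi)..Real.pi, g (s - b * Complex.I) := by
  have h := Complex.integral_boundary_rect_eq_zero_of_differentiableOn g
    (-Real.pi - b * Complex.I) Real.pi (by
      intro z hz
      refine (hd z ?_ ?_).differentiableWithinAt
      all_goals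
        have h2 := hz.2
        simp [Set.uIcc_of_le (neg_nonpos.2 hb)] at h2
        linarith [h2.1, h2.2])
  have e : ∀ y : ℝ, g (Real.pi + y * Complex.I) = g (-Real.pi + y * Complex.I) := by
    intro y
    rw [← hper (-Real.pi + y * Complex.I)]
    congr 1; ring
  simp [e] at h
  have h' := sub_eq_zero.1 h
  rw [← h']
  simp only [sub_eq_add_neg]

/-- The point `x` with the coordinates in `A` translated by `z`. -/
def slide (A : Finset (Fin n)) (x : Fin n → ℝ) (z : ℂ) : Fin n → ℂ :=
  fun j => (x j : ℂ) + if j ∈ A then z else 0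

/-- Simultaneous shift of the contours of integration in the variables `x_j`, `j ∈ A`. -/
lemma integral_slide {T : (Fin n → ℂ) → ℂ} (A : Finset (Fin n)) {b : ℝ} (hb : 0 ≤ b)
    (hper : ∀ x x' : Fin n → ℂ,
      (∀ j, Complex.exp (Complex.I * x j) = Complex.exp (Complex.I * x' j)) → T x = T x')
    (hd : ∀ (x : Fin n → ℝ) (z : ℂ), -b ≤ z.im → z.im ≤ 0 →
      DifferentiableAt ℂ (fun z => T (slide A x z)) z)
    (hc : ∀ y : ℝ, -b ≤ y → y ≤ 0 → Continuous fun x => T (slide A x (y * Complex.I))) :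
    ∫ x, T (slide A x 0) ∂torusMeasure n = ∫ x, T (slide A x (-b * Complex.I)) ∂torusMeasure n := by
  set e : Fin n → ℝ := fun j => if j ∈ A then 1 else 0 with he
  have hslide : ∀ (x : Fin n → ℝ) (s y : ℝ), slide A x (s + y * Complex.I) =
      slide A (x + s • e) (y * Complex.I) := by
    intro x s y
    funext j
    simp only [slide, he, Pi.add_apply, Pi.smul_apply, smul_eq_mul]
    split_ifs <;> push_cast <;> ring
  -- Translation invariance permits averaging over a common real translation `s` of the variables in
  -- `A`. After exchanging the integrals, the inner one is a contour integral in a single complex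
  -- variable.
  have key : ∀ y : ℝ, -b ≤ y → y ≤ 0 →
      (2 * Real.pi) • ∫ x, T (slide A x (y * Complex.I)) ∂torusMeasure n =
      ∫ x, (∫ s : ℝ in (-Real.pi)..Real.pi, T (slide A x (s + y * Complex.I))) ∂torusMeasure n := by
    intro y hy1 hy2
    have hF := hc y hy1 hy2
    rw [← intervalIntegral_integral_swap]
    · have h1 : ∀ s : ℝ, ∫ x, T (slide A x (s + y * Complex.I)) ∂torusMeasure n =
          ∫ x, T (slide A x (y * Complex.I)) ∂torusMeasure n := by
        intro s
        simp only [hslide]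
        refine integral_translate (T := fun x => T (slide A x (y * Complex.I))) hF ?_ (s • e)
        intro x x' h
        refine hper _ _ fun j => ?_
        obtain ⟨k, hk⟩ := h j
        rw [Complex.exp_eq_exp_iff_exists_int]
        refine ⟨-k, ?_⟩
        simp only [slide, hk]
        push_cast
        ring
      simp only [h1]
      rw [intervalIntegral.integral_const]
      congr 1
      ring
    · have hG : Continuous (Function.uncurry fun (s : ℝ) (x : Fin n → ℝ) =>
          T (slide A x (s + y * Complex.I))) := by
        simp only [hslide]
        have : Continuous fun p : ℝ × (Fin n → ℝ) => p.2 + p.1 • e := by fun_prop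
        exact hF.comp this
      rw [torusMeasure_eq_restrict, Measure.prod_restrict]
      refine (hG.continuousOn.integrableOn_compact
        (K := Set.Icc (-Real.pi) Real.pi ×ˢ Set.Icc (fun _ : Fin n => -Real.pi)
          (fun _ : Fin n => Real.pi)) (isCompact_Icc.prod isCompact_Icc)).mono_set ?_
      refine Set.prod_mono ?_ ?_
      · rw [Set.uIoc_of_le (by linarith [Real.pi_pos])]
        exact Set.Ioc_subset_Icc_self
      · rw [← Set.pi_univ_Icc]
        exact Set.pi_mono fun j _ => Set.Ioc_subset_Icc_self
  have h0 := key 0 (by linarith) le_rfl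
  have h1 := key (-b) le_rfl (by linarith)
  have h2 : ∀ x : Fin n → ℝ, ∫ s : ℝ in (-Real.pi)..Real.pi,
      T (slide A x (s + ((0 : ℝ) : ℂ) * Complex.I)) =
      ∫ s : ℝ in (-Real.pi)..Real.pi, T (slide A x (s + ((-b : ℝ) : ℂ) * Complex.I)) := by
    intro x
    have h3 := integral_shift_strip (g := fun z => T (slide A x z)) hb (fun z => by
      refine hper _ _ fun j => ?_
      simp only [slide]
      split_ifs
      · rw [Complex.exp_eq_exp_iff_exists_int]
        exact ⟨1, by push_cast; ring⟩
      · rfl) (hd x)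
    simp only [Complex.ofReal_zero, zero_mul, add_zero, h3, Complex.ofReal_neg, neg_mul,
      ← sub_eq_add_neg]
  simp only [h2] at h0
  have h4 := h0.trans h1.symm
  have h5 := smul_right_injective ℂ Real.two_pi_pos.ne' h4
  simpa using h5

end Torus

end Koornwinder
end

open scoped BigOperators

noncomputable section

namespace Koornwinder

open Filter Topology MeasureTheory

/-! ### Products of weight and coefficients as holomorphic functions -/

section Regularized

variable {n : ℕ} (P : Params)

/-- `e^{iz}`. -/
def ex (z : ℂ) : ℂ := Complex.exp (Complex.I * z)

lemma ex_add (z w : ℂ) : ex (z + w) = ex z * ex w := by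
  rw [ex, ex, ex, ← Complex.exp_add, mul_add]

lemma norm_ex (z : ℂ) : ‖ex z‖ = Real.exp (-z.im) := by
  rw [ex, Complex.norm_exp]; simp

lemma ex_two_γ : ex (2 * P.γ) = P.q := by
  rw [ex, P.exp_two_γ, P.q_eq]

lemma norm_q : ‖P.q‖ = Real.exp (-P.β) := by
  rw [Params.q, Complex.norm_exp]; simp

/-- The even function `φ(e^{iz}) φ(e^{-iz})`. -/
def phiEven (z : ℂ) : ℂ := phi P P.g (ex z) * phi P P.g (ex (-z))

lemma phiEven_neg (z : ℂ) : phiEven P (-z) = phiEven P z := by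
  rw [phiEven, phiEven, neg_neg, mul_comm]

/-- The part of the weight function that belongs to a pair of variables. -/
def weightPair (x : Fin n → ℂ) (i l : Fin n) : ℂ := phiEven P (x i + x l) * phiEven P (x i - x l)

/-- The part of the weight function that belongs to one variable. -/
def weightSingle (z : ℂ) : ℂ := phiB P (ex z) * phiB P (ex (-z))

/-- The weight function of the variables `x_k`, `k ∈ K`, as a regular function. -/
def weightOn (x : Fin n → ℂ) (K : Finset (Fin n)) : ℂ :=
  pairProd (weightPair P x) K * ∏ j ∈ K, weightSingle P (x j)

/-- The regularized version of `v_b`. -/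
def vbReg (z : ℂ) : ℂ := Complex.exp (P.β * P.gbar) * (phiB P (P.q * ex z) * phiB P (ex (-z)))

/-- The regularized version of `vaa`. -/
def vaaReg (x : Fin n → ℂ) (i l : Fin n) : ℂ :=
  Complex.exp (P.β * P.g) * (phi P P.g (P.q * (P.q * ex (x i + x l))) * phi P P.g (ex (-(x i + x l))))
    * phiEven P (x i - x l)

/-- The regularized version of `vac`. -/
def vacReg (x : Fin n → ℂ) (i l : Fin n) : ℂ :=
  Complex.exp (P.β * P.g) * (phi P P.g (P.q * ex (x i + x l)) * phi P P.g (ex (-(x i + x l)))) *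
    (phi P P.g (P.q * ex (x i - x l)) * phi P P.g (ex (-(x i - x l))))

/-- The regularized version of `Vpos`. -/
def Vreg (x : Fin n → ℂ) (A B : Finset (Fin n)) : ℂ :=
  (∏ j ∈ A, vbReg P (x j)) * pairProd (vaaReg P x) A * ∏ j ∈ A, ∏ k ∈ B, vacReg P x j k

lemma weightPair_symm (x : Fin n → ℂ) (i l : Fin n) : weightPair P x i l = weightPair P x l i := by
  rw [weightPair, weightPair, add_comm, ← phiEven_neg P (x i - x l), neg_sub]

lemma weightOn_union (x : Fin n → ℂ) {A B : Finset (Fin n)} (h : Disjoint A B) :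
    weightOn P x (A ∪ B) = weightOn P x A * (∏ a ∈ A, ∏ b ∈ B, weightPair P x a b) *
      weightOn P x B := by
  rw [weightOn, weightOn, weightOn, pairProd_union _ (weightPair_symm P x) h, Finset.prod_union h]
  ring

/-- Real points at which the coefficients of the operators have no poles. -/
structure RealGeneric (x : Fin n → ℂ) : Prop where
  im : ∀ j, (x j).im = 0
  single : ∀ j, ex (x j) ≠ 1 ∧ ex (x j) ≠ -1
  pair : ∀ i l, i ≠ l → ex (x i + x l) ≠ 1 ∧ ex (x i - x l) ≠ 1

variable {P}

lemma realGeneric_of_hypFun_ne_zero {x : Fin n → ℝ}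
    (h : ∀ h ∈ polarHyps P n, hypFun h (toC x) ≠ 0) : RealGeneric (toC x) where
  im j := by simp [toC]
  single j := by
    constructor <;> intro e
    · refine h (Pi.single j 1, 1) (mem_polarHyps.2 (Or.inl ⟨j, 1, by simp [mem_singleRoots], rfl⟩)) ?_
      rw [hypFun, expo_single]
      exact sub_eq_zero.2 e
    · refine h (Pi.single j 1, -1)
        (mem_polarHyps.2 (Or.inl ⟨j, -1, by simp [mem_singleRoots], rfl⟩)) ?_
      rw [hypFun, expo_single]
      exact sub_eq_zero.2 e
  pair := by
    have key : ∀ i l, i < l → ∀ τ : ℤˣ, ex (toC x i + ((τ : ℤ) : ℂ) * toC x l) ≠ 1 := by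
      intro i l hil τ e
      refine h (pairWeight i l τ, 1)
        (mem_polarHyps.2 (Or.inr ⟨i, l, hil, τ, 1, one_mem_pairRoots, rfl⟩)) ?_
      rw [hypFun, expo_pairWeight]
      exact sub_eq_zero.2 e
    intro i l hil
    rcases lt_or_gt_of_ne hil with h1 | h1
    · have a1 := key i l h1 1
      have a2 := key i l h1 (-1)
      simp only [Units.val_one, Int.cast_one, one_mul, Units.val_neg, Int.cast_neg, neg_mul,
        ← sub_eq_add_neg] at a1 a2
      exact ⟨a1, a2⟩
    · have a1 := key l i h1 1
      have a2 := key l i h1 (-1)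
      simp only [Units.val_one, Int.cast_one, one_mul, Units.val_neg, Int.cast_neg, neg_mul,
        ← sub_eq_add_neg] at a1 a2
      refine ⟨by rwa [add_comm], fun e => a2 ?_⟩
      rw [ex] at e ⊢
      rw [← neg_sub, mul_neg, Complex.exp_neg, e, inv_one]

namespace RealGeneric

variable {x : Fin n → ℂ}

lemma norm_single (hx : RealGeneric x) (j : Fin n) : ‖ex (x j)‖ = 1 := by rw [norm_ex, hx.im]; simp

lemma norm_add (hx : RealGeneric x) (i l : Fin n) : ‖ex (x i + x l)‖ = 1 := by
  rw [norm_ex, Complex.add_im, hx.im, hx.im]; simp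

lemma norm_sub (hx : RealGeneric x) (i l : Fin n) : ‖ex (x i - x l)‖ = 1 := by
  rw [norm_ex, Complex.sub_im, hx.im, hx.im]; simp

lemma vb_mul (hx : RealGeneric x) (hP : P.Admissible) (j : Fin n) :
    weightSingle P (x j) * vb P (x j) = vbReg P (x j) := by
  have h := vb_mul_phiB hP (z := x j) (hx.norm_single j).le (hx.single j).1 (hx.single j).2
  rw [weightSingle, vbReg]
  simp only [ex] at *
  linear_combination phiB P (Complex.exp (Complex.I * -x j)) * h

lemma vac_mul (hx : RealGeneric x) (hP : P.Admissible) {i l : Fin n} (hil : i ≠ l) :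
    weightPair P x i l * vac P x i l = vacReg P x i l := by
  have h1 := va_mul_phi hP.1 hP.2.1 (hx.norm_add i l).le (hx.pair i l hil).1
  have h2 := va_mul_phi hP.1 hP.2.1 (hx.norm_sub i l).le (hx.pair i l hil).2
  have hc : Complex.exp (P.β * P.g) = Complex.exp (P.β * P.g / 2) * Complex.exp (P.β * P.g / 2) := by
    rw [← Complex.exp_add]; congr 1; ring
  rw [weightPair, vac, vacReg, phiEven, phiEven, hc]
  simp only [ex] at *
  rw [show ∀ a b c d e f : ℂ, a * b * (c * d) * (e * f) = (e * a) * b * ((f * c) * d) by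
    intros; ring, h1, h2]
  ring

/-- The two factors of `vaa` shift the same half of the weight twice. After the first shift the
argument lies inside the unit disc, so the second needs no genericity. -/
lemma vaa_mul (hx : RealGeneric x) (hP : P.Admissible) {i l : Fin n} (hil : i ≠ l) :
    weightPair P x i l * vaa P x i l = vaaReg P x i l := by
  have hn := (hx.norm_add i l).le
  have h1 := va_mul_phi hP.1 hP.2.1 hn (hx.pair i l hil).1
  have hq := P.norm_q_lt_one hP.1
  have e : ex (x i + x l + 2 * P.γ) = P.q * ex (x i + x l) := by
    rw [ex_add, ex_two_γ, mul_comm]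
  have hlt : ‖ex (x i + x l + 2 * P.γ)‖ < 1 := by
    rw [e, norm_mul, hx.norm_add, mul_one]; exact hq
  have h2 := va_mul_phi hP.1 hP.2.1 (z := x i + x l + 2 * P.γ) hlt.le (ne_of_norm_lt_one hlt).1
  have e' := e
  simp only [ex] at e'
  rw [e'] at h2
  have hc : Complex.exp (P.β * P.g) = Complex.exp (P.β * P.g / 2) * Complex.exp (P.β * P.g / 2) := by
    rw [← Complex.exp_add]; congr 1; ring
  rw [weightPair, vaa, vaaReg, phiEven, hc]
  simp only [ex] at *
  linear_combination phi P P.g (Complex.exp (Complex.I * -(x i + x l))) * phiEven P (x i - x l) *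
    (va P (x i + x l + 2 * P.γ) * h1 + Complex.exp (P.β * P.g / 2) * h2)

/-- The weight factors touching `A` are absorbed by the coefficients of the block. The weight of `B`
is left over and serves the next step of the recursion. -/
lemma weightOn_mul_Vpos (hx : RealGeneric x) (hP : P.Admissible) {A B : Finset (Fin n)} (hAB : Disjoint A B) :
    weightOn P x (A ∪ B) * Vpos P A B x = Vreg P x A B * weightOn P x B := by
  have h1 : (∏ j ∈ A, weightSingle P (x j)) * ∏ j ∈ A, vb P (x j) = ∏ j ∈ A, vbReg P (x j) := by
    rw [← Finset.prod_mul_distrib]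
    exact Finset.prod_congr rfl fun j _ => hx.vb_mul hP j
  have h2 : pairProd (weightPair P x) A * pairProd (vaa P x) A = pairProd (vaaReg P x) A := by
    rw [← pairProd_mul]
    exact pairProd_congr fun i _ l _ hil => hx.vaa_mul hP hil.ne
  have h3 : (∏ j ∈ A, ∏ k ∈ B, weightPair P x j k) * ∏ j ∈ A, ∏ k ∈ B, vac P x j k =
      ∏ j ∈ A, ∏ k ∈ B, vacReg P x j k := by
    rw [← Finset.prod_mul_distrib]
    refine Finset.prod_congr rfl fun j hj => ?_
    rw [← Finset.prod_mul_distrib]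
    exact Finset.prod_congr rfl fun k hk =>
      hx.vac_mul hP fun e => Finset.disjoint_left.1 hAB hj (e ▸ hk)
  rw [weightOn_union P x hAB, Vpos_eq, Vreg, ← h1, ← h2, ← h3, weightOn]
  ring

lemma weight_eq (hx : RealGeneric x) (hP : P.Admissible) : weight P x = weightOn P x Finset.univ := by
  have hneg : ∀ z : ℂ, Complex.exp (Complex.I * -z) = (Complex.exp (Complex.I * z))⁻¹ := by
    intro z; rw [mul_neg, Complex.exp_neg]
  have hda : ∀ z : ℂ, ‖ex z‖ = 1 → ex z ≠ 1 → da P z = phiEven P z := by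
    intro z h1 h2
    rw [da, phiEven, daPlus_eq hP.1 h1.le h2, daPlus_eq hP.1 (z := -z)]
    · rfl
    · rw [hneg, norm_inv]; exact (inv_eq_one.2 h1).le
    · rw [hneg]; exact fun e => h2 (inv_eq_one.1 e)
  have hdb : ∀ z : ℂ, ‖ex z‖ = 1 → ex z ≠ 1 → ex z ≠ -1 → db P z = weightSingle P z := by
    intro z h1 h2 h3
    rw [db, weightSingle, dbPlus_eq hP.1 h1.le h2 h3, dbPlus_eq hP.1 (z := -z)]
    · rfl
    · rw [hneg, norm_inv]; exact (inv_eq_one.2 h1).le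
    · rw [hneg]; exact fun e => h2 (inv_eq_one.1 e)
    · rw [hneg]; intro e
      rw [inv_eq_iff_eq_inv, inv_neg, inv_one] at e
      exact h3 e
  rw [weight, weightOn, pairProd, Finset.univ_product_univ]
  congr 1
  · refine Finset.prod_congr rfl fun q hq => ?_
    have hne := (Finset.mem_filter.1 hq).2.ne
    rw [hda _ (hx.norm_add _ _) (hx.pair _ _ hne).1, hda _ (hx.norm_sub _ _) (hx.pair _ _ hne).2]
    rfl
  · exact Finset.prod_congr rfl fun j _ =>
      hdb _ (hx.norm_single j) (hx.single j).1 (hx.single j).2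

end RealGeneric

/-- The weight travels through the recursion block by block and ends up as the terminal value; this
is the purpose of the argument `w` of `recSum`. -/
lemma mul_recSum {ι : Type*} [DecidableEq ι] {v v' : Finset ι → Finset ι → ℂ} {w : Finset ι → ℂ}
    (h : ∀ A B, Disjoint A B → w (A ∪ B) * v A B = v' A B * w B) (m : ℕ) (K : Finset ι) :
    w K * recSum v (fun _ => 1) m K = recSum v' w m K := by
  induction m using Nat.strong_induction_on generalizing K with
  | _ m ih =>
    by_cases hm : m = 0
    · subst hm; simp only [recSum_zero, mul_one]
    · rw [recSum_of_ne_zero _ _ hm, recSum_of_ne_zero _ _ hm, mul_neg, Finset.mul_sum]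
      congr 1
      refine Finset.sum_congr rfl fun A hA => ?_
      rw [mem_smallSubsets] at hA
      have := hA.2.1.card_pos
      have h1 := h A (K \ A) Finset.disjoint_sdiff
      rw [Finset.union_sdiff_of_subset hA.1] at h1
      rw [← ih _ (by omega), ← mul_assoc, h1, mul_assoc]

lemma recSum_congr_on {ι : Type*} [DecidableEq ι] {v v' : Finset ι → Finset ι → ℂ}
    {w w' : Finset ι → ℂ} {K : Finset ι} (m : ℕ)
    (h : ∀ A B, A ⊆ K → B ⊆ K → v A B = v' A B) (h' : ∀ B, B ⊆ K → w B = w' B) :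
    recSum v w m K = recSum v' w' m K := by
  induction m using Nat.strong_induction_on generalizing K with
  | _ m ih =>
    by_cases hm : m = 0
    · subst hm; simp only [recSum_zero]; exact h' K subset_rfl
    · rw [recSum_of_ne_zero _ _ hm, recSum_of_ne_zero _ _ hm]
      congr 1
      refine Finset.sum_congr rfl fun A hA => ?_
      rw [mem_smallSubsets] at hA
      have := hA.2.1.card_pos
      have hs : K \ A ⊆ K := Finset.sdiff_subset
      rw [h A (K \ A) hA.1 hs, ih _ (by omega) (fun A B hA hB => h A B (hA.trans hs) (hB.trans hs))
        fun B hB => h' B (hB.trans hs)]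

/-! ### Dependence on the variables -/

variable (P)

lemma phiEven_congr {z z' : ℂ} (h : ex z = ex z') : phiEven P z = phiEven P z' := by
  have h' : ex (-z) = ex (-z') := by
    simp only [ex, mul_neg, Complex.exp_neg] at h ⊢; rw [h]
  rw [phiEven, phiEven, h, h']

lemma weightOn_congr {x x' : Fin n → ℂ} {K : Finset (Fin n)} (h : ∀ j ∈ K, ex (x j) = ex (x' j)) :
    weightOn P x K = weightOn P x' K := by
  have hneg : ∀ j ∈ K, ex (-x j) = ex (-x' j) := fun j hj => by
    have := h j hj
    simp only [ex, mul_neg, Complex.exp_neg] at this ⊢; rw [this]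
  rw [weightOn, weightOn]
  congr 1
  · refine pairProd_congr fun i hi l hl _ => ?_
    have e1 : ex (x i + x l) = ex (x' i + x' l) := by rw [ex_add, ex_add, h i hi, h l hl]
    have e2 : ex (x i - x l) = ex (x' i - x' l) := by
      rw [sub_eq_add_neg, sub_eq_add_neg, ex_add, ex_add, h i hi, hneg l hl]
    rw [weightPair, weightPair, phiEven_congr P e1, phiEven_congr P e2]
  · refine Finset.prod_congr rfl fun j hj => ?_
    rw [weightSingle, weightSingle, h j hj, hneg j hj]

lemma Vreg_congr {x x' : Fin n → ℂ} {A B : Finset (Fin n)} (hA : ∀ j ∈ A, ex (x j) = ex (x' j))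
    (hB : ∀ j ∈ B, ex (x j) = ex (x' j)) : Vreg P x A B = Vreg P x' A B := by
  have hneg : ∀ {z z' : ℂ}, ex z = ex z' → ex (-z) = ex (-z') := fun h => by
    simp only [ex, mul_neg, Complex.exp_neg] at h ⊢; rw [h]
  have hadd : ∀ {z z' w w' : ℂ}, ex z = ex z' → ex w = ex w' → ex (z + w) = ex (z' + w') :=
    fun h h' => by rw [ex_add, ex_add, h, h']
  have hsub : ∀ {z z' w w' : ℂ}, ex z = ex z' → ex w = ex w' → ex (z - w) = ex (z' - w') :=
    fun h h' => by rw [sub_eq_add_neg, sub_eq_add_neg]; exact hadd h (hneg h')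
  rw [Vreg, Vreg]
  congr 1
  · congr 1
    · refine Finset.prod_congr rfl fun j hj => ?_
      rw [vbReg, vbReg, hA j hj, hneg (hA j hj)]
    · refine pairProd_congr fun i hi l hl _ => ?_
      rw [vaaReg, vaaReg, hadd (hA i hi) (hA l hl), hneg (hadd (hA i hi) (hA l hl)),
        phiEven_congr P (hsub (hA i hi) (hA l hl))]
  · refine Finset.prod_congr rfl fun i hi => Finset.prod_congr rfl fun l hl => ?_
    rw [vacReg, vacReg, hadd (hA i hi) (hB l hl), hneg (hadd (hA i hi) (hB l hl)),
      hsub (hA i hi) (hB l hl), hneg (hsub (hA i hi) (hB l hl))]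

/-- The reflection `x_j ↦ -x_j - 2γ` of the variables in `A`. -/
def reflectShift (A : Finset (Fin n)) (x : Fin n → ℂ) : Fin n → ℂ :=
  fun j => if j ∈ A then -x j - 2 * P.γ else x j

lemma ex_neg_two_γ : P.q * ex (-(2 * P.γ)) = 1 := by
  rw [← ex_two_γ, ← ex_add, add_neg_cancel, ex, mul_zero, Complex.exp_zero]

/-- The substitution exchanges the arguments `q e^{iz}` and `e^{-iz}` of a single variable, and `q²
e^{iz}` and `e^{-iz}` for sums of two variables in `A`. For a mixed pair the factors of `x_i + x_l`
and of `x_i - x_l` change places. -/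
lemma Vreg_reflectShift {A B : Finset (Fin n)} (hAB : Disjoint A B) (x : Fin n → ℂ) :
    Vreg P (reflectShift P A x) A B = Vreg P x A B := by
  have hq := ex_neg_two_γ P
  have hq' := ex_two_γ P
  have hb : ∏ j ∈ A, vbReg P (reflectShift P A x j) = ∏ j ∈ A, vbReg P (x j) := by
    refine Finset.prod_congr rfl fun j hj => ?_
    have e0 : reflectShift P A x j = -x j - 2 * P.γ := by simp only [reflectShift, hj, if_true]
    have e1 : P.q * ex (-x j - 2 * P.γ) = ex (-x j) := by
      rw [sub_eq_add_neg, ex_add]; linear_combination ex (-x j) * hq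
    have e2 : ex (-(-x j - 2 * P.γ)) = P.q * ex (x j) := by
      rw [show -(-x j - 2 * P.γ) = 2 * P.γ + x j by ring, ex_add, hq']
    rw [vbReg, vbReg, e0, e1, e2, mul_comm (phiB P (ex (-x j)))]
  have haa : pairProd (vaaReg P (reflectShift P A x)) A = pairProd (vaaReg P x) A := by
    refine pairProd_congr fun i hi l hl _ => ?_
    have e0 : reflectShift P A x i = -x i - 2 * P.γ := by simp only [reflectShift, hi, if_true]
    have e0' : reflectShift P A x l = -x l - 2 * P.γ := by simp only [reflectShift, hl, if_true]
    have e1 : P.q * (P.q * ex (-x i - 2 * P.γ + (-x l - 2 * P.γ))) = ex (-(x i + x l)) := by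
      rw [show -x i - 2 * P.γ + (-x l - 2 * P.γ) =
        -(x i + x l) + (-(2 * P.γ) + -(2 * P.γ)) by ring, ex_add, ex_add]
      linear_combination ex (-(x i + x l)) * (P.q * ex (-(2 * P.γ)) + 1) * hq
    have e2 : ex (-(-x i - 2 * P.γ + (-x l - 2 * P.γ))) = P.q * (P.q * ex (x i + x l)) := by
      rw [show -(-x i - 2 * P.γ + (-x l - 2 * P.γ)) = 2 * P.γ + (2 * P.γ + (x i + x l)) by ring,
        ex_add, ex_add, hq']
    have e3 : -x i - 2 * P.γ - (-x l - 2 * P.γ) = -(x i - x l) := by ring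
    rw [vaaReg, vaaReg, e0, e0', e1, e2, e3, phiEven_neg, mul_comm (phi P P.g (ex (-(x i + x l))))]
  have hac : ∏ i ∈ A, ∏ l ∈ B, vacReg P (reflectShift P A x) i l =
      ∏ i ∈ A, ∏ l ∈ B, vacReg P x i l := by
    refine Finset.prod_congr rfl fun i hi => Finset.prod_congr rfl fun l hl => ?_
    have hl' : l ∉ A := fun h => Finset.disjoint_left.1 hAB h hl
    have e0 : reflectShift P A x i = -x i - 2 * P.γ := by simp only [reflectShift, hi, if_true]
    have e0' : reflectShift P A x l = x l := by simp only [reflectShift, hl', if_false]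
    have e1 : P.q * ex (-x i - 2 * P.γ + x l) = ex (-(x i - x l)) := by
      rw [show -x i - 2 * P.γ + x l = -(x i - x l) + -(2 * P.γ) by ring, ex_add]
      linear_combination ex (-(x i - x l)) * hq
    have e2 : ex (-(-x i - 2 * P.γ + x l)) = P.q * ex (x i - x l) := by
      rw [show -(-x i - 2 * P.γ + x l) = 2 * P.γ + (x i - x l) by ring, ex_add, hq']
    have e3 : P.q * ex (-x i - 2 * P.γ - x l) = ex (-(x i + x l)) := by
      rw [show -x i - 2 * P.γ - x l = -(x i + x l) + -(2 * P.γ) by ring, ex_add]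
      linear_combination ex (-(x i + x l)) * hq
    have e4 : ex (-(-x i - 2 * P.γ - x l)) = P.q * ex (x i + x l) := by
      rw [show -(-x i - 2 * P.γ - x l) = 2 * P.γ + (x i + x l) by ring, ex_add, hq']
    rw [vacReg, vacReg, e0, e0', e1, e2, e3, e4]
    ring
  rw [Vreg, Vreg, hb, haa, hac]

lemma weightOn_flipSigns (ε : Fin n → ℤˣ) (x : Fin n → ℂ) (K : Finset (Fin n)) :
    weightOn P (flipSigns ε x) K = weightOn P x K := by
  rw [weightOn, weightOn]
  congr 1
  · refine pairProd_congr fun i _ l _ _ => ?_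
    have h := phiEven_neg P
    rcases Int.units_eq_one_or (ε i) with e | e <;> rcases Int.units_eq_one_or (ε l) with e' | e' <;>
      simp only [weightPair, flipSigns, e, e', Units.val_one, Units.val_neg, Int.cast_one,
        Int.cast_neg, one_mul, neg_mul]
    · rw [sub_neg_eq_add, ← sub_eq_add_neg, mul_comm]
    · rw [neg_add_eq_sub, ← h (x l - x i), neg_sub, ← h (-x i - x l), neg_sub, sub_neg_eq_add,
        mul_comm, add_comm]
    · rw [← neg_add, h, ← h (-x i - -x l)]
      congr 2; ring
  · refine Finset.prod_congr rfl fun j _ => ?_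
    rcases Int.units_eq_one_or (ε j) with e | e <;> simp [weightSingle, flipSigns, e, mul_comm]

/-! ### Differentiability -/

variable {P}

/-- The points at which the regularized coefficients are holomorphic. -/
def InStrip (P : Params) (A B : Finset (Fin n)) (y : Fin n → ℂ) : Prop :=
  ∃ t : ℝ, -P.β ≤ t ∧ t ≤ 0 ∧ (∀ j ∈ A, (y j).im = t) ∧ ∀ l ∈ B, (y l).im = 0

lemma differentiableAt_finsetProd {ι : Type*} {s : Finset ι} {F : ι → (Fin n → ℂ) → ℂ}
    {y : Fin n → ℂ} (h : ∀ i ∈ s, DifferentiableAt ℂ (F i) y) :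
    DifferentiableAt ℂ (fun x => ∏ i ∈ s, F i x) y := by
  classical
  induction s using Finset.induction_on with
  | empty => simp
  | insert a s ha ih =>
    simp only [Finset.prod_insert ha]
    exact (h a (by simp)).mul (ih fun i hi => h i (by simp [hi]))

lemma differentiableAt_phi_comp (hP : P.Admissible) {F : (Fin n → ℂ) → ℂ} {y : Fin n → ℂ}
    (hF : DifferentiableAt ℂ F y) (h : ‖F y‖ ≤ 1) :
    DifferentiableAt ℂ (fun x => phi P P.g (F x)) y :=
  (differentiableAt_phi hP.1 hP.2.1 h).comp y hF

lemma differentiableAt_phiB_comp (hP : P.Admissible) {F : (Fin n → ℂ) → ℂ} {y : Fin n → ℂ}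
    (hF : DifferentiableAt ℂ F y) (h : ‖F y‖ ≤ 1) : DifferentiableAt ℂ (fun x => phiB P (F x)) y :=
  (differentiableAt_phiB hP h).comp y hF

lemma differentiableAt_phiEven (hP : P.Admissible) {F : (Fin n → ℂ) → ℂ} {y : Fin n → ℂ}
    (hF : DifferentiableAt ℂ F y) (h : (F y).im = 0) :
    DifferentiableAt ℂ (fun x => phiEven P (F x)) y := by
  unfold phiEven
  refine (differentiableAt_phi_comp hP (by unfold ex; fun_prop) ?_).mul
    (differentiableAt_phi_comp hP (by unfold ex; fun_prop) ?_)
  · rw [norm_ex, h]; simp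
  · rw [norm_ex, Complex.neg_im, h]; simp

lemma differentiableAt_weightOn (hP : P.Admissible) {K : Finset (Fin n)} {y : Fin n → ℂ}
    (h : ∀ k ∈ K, (y k).im = 0) : DifferentiableAt ℂ (fun x => weightOn P x K) y := by
  unfold weightOn pairProd
  refine (differentiableAt_finsetProd fun q hq => ?_).mul
    (differentiableAt_finsetProd fun j hj => ?_)
  · simp only [Finset.mem_filter, Finset.mem_product] at hq
    refine (differentiableAt_phiEven hP (by fun_prop) ?_).mul
      (differentiableAt_phiEven hP (by fun_prop) ?_)
    · rw [Complex.add_im, h _ hq.1.1, h _ hq.1.2, add_zero]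
    · rw [Complex.sub_im, h _ hq.1.1, h _ hq.1.2, sub_zero]
  · unfold weightSingle
    refine (differentiableAt_phiB_comp hP (by unfold ex; fun_prop) ?_).mul
      (differentiableAt_phiB_comp hP (by unfold ex; fun_prop) ?_)
    · rw [norm_ex, h j hj]; simp
    · rw [norm_ex, Complex.neg_im, h j hj]; simp

/-- For `-β ≤ Im z ≤ 0` both `q e^{iz}` and `e^{-iz}` stay in the closed unit disc. Within `A`
imaginary parts of sums double, which the second factor `q` compensates, and differences stay real
because all variables in `A` move together. -/
lemma differentiableAt_Vreg (hP : P.Admissible) {A B : Finset (Fin n)} {y : Fin n → ℂ}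
    (h : InStrip P A B y) : DifferentiableAt ℂ (fun x => Vreg P x A B) y := by
  obtain ⟨t, ht1, ht2, hA, hB⟩ := h
  unfold Vreg pairProd
  refine ((differentiableAt_finsetProd fun j hj => ?_).mul
    (differentiableAt_finsetProd fun q hq => ?_)).mul
    (differentiableAt_finsetProd fun i hi => differentiableAt_finsetProd fun l hl => ?_)
  · unfold vbReg
    refine (differentiableAt_const _).mul ((differentiableAt_phiB_comp hP
      (by unfold ex; fun_prop) ?_).mul (differentiableAt_phiB_comp hP (by unfold ex; fun_prop) ?_))
    · rw [norm_mul, norm_q, norm_ex, hA j hj, ← Real.exp_add, Real.exp_le_one_iff]; linarith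
    · rw [norm_ex, Complex.neg_im, hA j hj, Real.exp_le_one_iff]; linarith
  · simp only [Finset.mem_filter, Finset.mem_product] at hq
    have h1 := hA _ hq.1.1
    have h2 := hA _ hq.1.2
    unfold vaaReg
    refine ((differentiableAt_const _).mul ((differentiableAt_phi_comp hP
      (by unfold ex; fun_prop) ?_).mul (differentiableAt_phi_comp hP
        (by unfold ex; fun_prop) ?_))).mul (differentiableAt_phiEven hP (by fun_prop) ?_)
    · rw [norm_mul, norm_mul, norm_q, norm_ex, Complex.add_im, h1, h2, ← Real.exp_add,
        ← Real.exp_add, Real.exp_le_one_iff]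
      linarith
    · rw [norm_ex, Complex.neg_im, Complex.add_im, h1, h2, Real.exp_le_one_iff]; linarith
    · rw [Complex.sub_im, h1, h2, sub_self]
  · have h1 := hA i hi
    have h2 := hB l hl
    unfold vacReg
    refine ((differentiableAt_const _).mul ((differentiableAt_phi_comp hP
      (by unfold ex; fun_prop) ?_).mul (differentiableAt_phi_comp hP
        (by unfold ex; fun_prop) ?_))).mul ((differentiableAt_phi_comp hP
      (by unfold ex; fun_prop) ?_).mul (differentiableAt_phi_comp hP (by unfold ex; fun_prop) ?_))
    · rw [norm_mul, norm_q, norm_ex, Complex.add_im, h1, h2, ← Real.exp_add, Real.exp_le_one_iff]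
      linarith
    · rw [norm_ex, Complex.neg_im, Complex.add_im, h1, h2, Real.exp_le_one_iff]; linarith
    · rw [norm_mul, norm_q, norm_ex, Complex.sub_im, h1, h2, ← Real.exp_add, Real.exp_le_one_iff]
      linarith
    · rw [norm_ex, Complex.neg_im, Complex.sub_im, h1, h2, Real.exp_le_one_iff]; linarith

lemma differentiableAt_recSum (hP : P.Admissible) (m : ℕ) {K : Finset (Fin n)} {y : Fin n → ℂ}
    (h : ∀ k ∈ K, (y k).im = 0) :
    DifferentiableAt ℂ (fun x => recSum (Vreg P x) (weightOn P x) m K) y := by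
  induction m using Nat.strong_induction_on generalizing K with
  | _ m ih =>
    by_cases hm : m = 0
    · subst hm; simp only [recSum_zero]; exact differentiableAt_weightOn hP h
    · simp only [recSum_of_ne_zero _ _ hm]
      refine DifferentiableAt.fun_neg (DifferentiableAt.fun_sum fun A hA => ?_)
      rw [mem_smallSubsets] at hA
      have := hA.2.1.card_pos
      have hs : ∀ k ∈ K \ A, (y k).im = 0 := fun k hk => h k (Finset.sdiff_subset hk)
      exact (differentiableAt_Vreg hP
        ⟨0, by linarith [hP.1], le_rfl, fun j hj => h j (hA.1 hj), hs⟩).mul (ih _ (by omega) hs)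

end Regularized

end Koornwinder
end

open scoped BigOperators

noncomputable section

namespace Koornwinder

open Filter Topology MeasureTheory

variable {n : ℕ} {P : Params}

/-! ### Symmetry of the operators -/

lemma differentiable_of_mem_trig {f : (Fin n → ℂ) → ℂ} (hf : f ∈ trig n) : Differentiable ℂ f := by
  refine trig_induction (p := Differentiable ℂ) (fun μ => ?_) (differentiable_const 0)
    (fun F G h1 h2 => h1.add h2) (fun c F h => h.const_smul c) hf
  unfold expo
  fun_prop

/-- The contribution of the shifts in the variables `x_j`, `j ∈ A`, to the sesquilinear form of
the difference operator. -/
def formTerm (P : Params) (r : ℕ) (f h : (Fin n → ℂ) → ℂ) (A : Finset (Fin n)) (x : Fin n → ℂ) : ℂ :=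
  Vreg P x A Aᶜ * recSum (Vreg P x) (weightOn P x) (r - A.card) Aᶜ * (f (up P A x) * h x)

lemma differentiableAt_formTerm (hP : P.Admissible) {r : ℕ} {f h : (Fin n → ℂ) → ℂ}
    (hf : f ∈ trig n) (hh : h ∈ trig n) {A : Finset (Fin n)} {y : Fin n → ℂ}
    (hy : InStrip P A Aᶜ y) : DifferentiableAt ℂ (formTerm P r f h A) y := by
  have hup : Differentiable ℂ (up P A : (Fin n → ℂ) → Fin n → ℂ) := by
    rw [differentiable_pi]
    intro j
    unfold up
    split_ifs <;> fun_prop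
  have hr : DifferentiableAt ℂ
      (fun x => recSum (Vreg P x) (weightOn P x) (r - A.card) Aᶜ) y :=
    differentiableAt_recSum hP _ hy.choose_spec.2.2.2
  exact ((differentiableAt_Vreg hP hy).mul hr).mul
    ((((differentiable_of_mem_trig hf).comp hup) y).mul (differentiable_of_mem_trig hh y))

lemma inStrip_slide (A : Finset (Fin n)) (x : Fin n → ℝ) {z : ℂ} (h1 : -P.β ≤ z.im) (h2 : z.im ≤ 0) :
    InStrip P A Aᶜ (slide A x z) := by
  refine ⟨z.im, h1, h2, fun j hj => ?_, fun j hj => ?_⟩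
  · simp [slide, hj]
  · simp [slide, Finset.mem_compl.1 hj]

lemma slide_zero (A : Finset (Fin n)) (x : Fin n → ℝ) : slide A x 0 = toC x := by
  funext j; simp [slide, toC]

lemma continuous_formTerm (hP : P.Admissible) {r : ℕ} {f h : (Fin n → ℂ) → ℂ}
    (hf : f ∈ trig n) (hh : h ∈ trig n) (A : Finset (Fin n)) {y : ℝ} (h1 : -P.β ≤ y) (h2 : y ≤ 0) :
    Continuous fun x : Fin n → ℝ => formTerm P r f h A (slide A x (y * Complex.I)) := by
  have hs : Continuous fun x : Fin n → ℝ => slide A x (y * Complex.I) := by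
    unfold slide; fun_prop
  rw [continuous_iff_continuousAt]
  intro x
  exact ContinuousAt.comp (f := fun x : Fin n → ℝ => slide A x (y * Complex.I))
    (differentiableAt_formTerm hP hf hh
      (inStrip_slide A x (by simpa using h1) (by simpa using h2))).continuousAt hs.continuousAt

lemma continuous_formTerm_toC (hP : P.Admissible) {r : ℕ} {f h : (Fin n → ℂ) → ℂ}
    (hf : f ∈ trig n) (hh : h ∈ trig n) (A : Finset (Fin n)) :
    Continuous fun x : Fin n → ℝ => formTerm P r f h A (toC x) := by
  have := continuous_formTerm hP (r := r) hf hh A (y := 0) (by linarith [hP.1]) le_rfl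
  simpa only [Complex.ofReal_zero, zero_mul, slide_zero] using this

lemma formTerm_congr {r : ℕ} {f h : (Fin n → ℂ) → ℂ} (hf : IsWeylInvariant f)
    (hh : IsWeylInvariant h) (A : Finset (Fin n)) {x x' : Fin n → ℂ}
    (e : ∀ j, Complex.exp (Complex.I * x j) = Complex.exp (Complex.I * x' j)) :
    formTerm P r f h A x = formTerm P r f h A x' := by
  rw [formTerm, formTerm, Vreg_congr P (fun j _ => e j) (fun j _ => e j), hh.congr x x' e,
    recSum_congr_on (K := Aᶜ) (r - A.card)
      (fun B C _ _ => Vreg_congr P (A := B) (B := C) (fun j _ => e j) (fun j _ => e j))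
      (fun B _ => weightOn_congr P fun j _ => e j), hf.congr (up P A x) (up P A x')]
  intro j
  unfold up
  split_ifs
  · rw [mul_add, mul_add, Complex.exp_add, Complex.exp_add, e j]
  · exact e j

/-- The sign vector that is `-1` on `A` and `1` elsewhere. -/
def negOn (A : Finset (Fin n)) : Fin n → ℤˣ := fun j => if j ∈ A then -1 else 1

/-- The shift `up` after the reflection is the flip of `x` on `A`, and the reflection itself is the
flip of `up x`. Invariance therefore exchanges `f` and `h`, while the recursive sum involves only
variables outside `A`. -/
lemma formTerm_reflectShift {r : ℕ} {f h : (Fin n → ℂ) → ℂ} (hf : IsWeylInvariant f)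
    (hh : IsWeylInvariant h) (A : Finset (Fin n)) (x : Fin n → ℂ) :
    formTerm P r f h A (reflectShift P A x) = formTerm P r h f A x := by
  have hc : ∀ j ∈ Aᶜ, reflectShift P A x j = x j := fun j hj => by
    simp [reflectShift, Finset.mem_compl.1 hj]
  have h1 : f (up P A (reflectShift P A x)) = f x := by
    rw [← hf.flip (negOn A) x]
    congr 1
    funext j
    by_cases hj : j ∈ A <;> simp [up, reflectShift, flipSigns, negOn, hj]
  have h2 : h (reflectShift P A x) = h (up P A x) := by
    rw [← hh.flip (negOn A) (up P A x)]
    congr 1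
    funext j
    by_cases hj : j ∈ A <;> simp [up, reflectShift, flipSigns, negOn, hj]
    ring
  rw [formTerm, formTerm, Vreg_reflectShift P disjoint_compl_right, h1, h2,
    recSum_congr_on (K := Aᶜ) (r - A.card)
      (fun B C hB hC => Vreg_congr P (A := B) (B := C) (fun j hj => by rw [hc j (hB hj)])
        (fun j hj => by rw [hc j (hC hj)]))
      (fun B hB => weightOn_congr P fun j hj => by rw [hc j (hB hj)])]
  ring

/-- The contours of the variables in `A` are moved by `-iβ`. A sign flip on the torus then places
the argument at `reflectShift A x`, where the roles of `f` and `h` are exchanged. -/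
lemma integral_formTerm_symm (hP : P.Admissible) {r : ℕ} {f h : (Fin n → ℂ) → ℂ}
    (hf : f ∈ trig n) (hh : h ∈ trig n) (hfW : IsWeylInvariant f) (hhW : IsWeylInvariant h)
    (A : Finset (Fin n)) :
    ∫ x, formTerm P r f h A (toC x) ∂torusMeasure n =
      ∫ x, formTerm P r h f A (toC x) ∂torusMeasure n := by
  have hs : ∀ x : Fin n → ℝ, Differentiable ℂ (slide A x) := by
    intro x
    rw [differentiable_pi]
    intro j
    unfold slide
    split_ifs <;> fun_prop
  have e := integral_slide (T := formTerm P r f h A) A hP.1.le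
    (fun x x' h => formTerm_congr hfW hhW A h)
    (fun x z h1 h2 => (differentiableAt_formTerm hP hf hh (inStrip_slide A x h1 h2)).comp z (hs x z))
    (fun y h1 h2 => continuous_formTerm hP hf hh A h1 h2)
  simp only [slide_zero] at e
  have hcont := continuous_formTerm hP (r := r) hf hh A le_rfl (by linarith [hP.1])
  rw [Complex.ofReal_neg] at hcont
  rw [e, ← integral_comp_flipReal hcont (negOn A)]
  refine integral_congr_ae (Filter.Eventually.of_forall fun x => ?_)
  simp only
  rw [← formTerm_reflectShift hfW hhW A (toC x)]
  congr 1
  funext j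
  by_cases hj : j ∈ A <;> simp [slide, flipReal, negOn, reflectShift, toC, hj, Params.γ]
  ring

/-- The bilinear form with weight function `Δ`. -/
def bform (P : Params) (f h : (Fin n → ℂ) → ℂ) : ℂ :=
  ∫ x, f (toC x) * h (toC x) * weightOn P (toC x) Finset.univ ∂torusMeasure n

lemma RealGeneric.flipSigns {x : Fin n → ℂ} (hx : RealGeneric x) (ε : Fin n → ℤˣ) :
    RealGeneric (flipSigns ε x) := by
  have hinv : ∀ z : ℂ, ex (-z) = (ex z)⁻¹ := fun z => by rw [ex, ex, mul_neg, Complex.exp_neg]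
  have hinv1 : ∀ z : ℂ, ex (-z) = 1 ↔ ex z = 1 := fun z => by rw [hinv, inv_eq_one]
  have hinv2 : ∀ z : ℂ, ex (-z) = -1 ↔ ex z = -1 := fun z => by
    rw [hinv, inv_eq_iff_eq_inv, inv_neg, inv_one]
  refine ⟨fun j => ?_, fun j => ?_, fun i l hil => ?_⟩
  · rcases Int.units_eq_one_or (ε j) with e | e <;> simp [Koornwinder.flipSigns, e, hx.im j]
  · have := hx.single j
    rcases Int.units_eq_one_or (ε j) with e | e <;>
      simpa [Koornwinder.flipSigns, e, hinv1, hinv2] using this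
  · have h := hx.pair i l hil
    have h1 : ex (-x i + -x l) ≠ 1 := by rw [← neg_add]; rw [Ne, hinv1]; exact h.1
    have h2 : ex (-x i + x l) ≠ 1 := by
      rw [show -x i + x l = -(x i - x l) by ring]; rw [Ne, hinv1]; exact h.2
    have h3 : ex (x l - x i) ≠ 1 := by
      rw [show x l - x i = -(x i - x l) by ring]; rw [Ne, hinv1]; exact h.2
    rcases Int.units_eq_one_or (ε i) with e | e <;> rcases Int.units_eq_one_or (ε l) with e' | e' <;>
      simp only [Koornwinder.flipSigns, e, e', Units.val_one, Units.val_neg, Int.cast_one,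
        Int.cast_neg, neg_mul, one_mul, sub_neg_eq_add] <;>
      constructor <;> first
        | exact h.1 | exact h.2 | exact h1 | exact h2

lemma RealGeneric.weightOn_mul_Dpos {x : Fin n → ℂ} (hx : RealGeneric x) (hP : P.Admissible)
    (r : ℕ) (f h : (Fin n → ℂ) → ℂ) :
    Dpos P r f x * h x * weightOn P x Finset.univ =
      ∑ A ∈ Finset.univ.filter (fun A : Finset (Fin n) => A.card ≤ r), formTerm P r f h A x := by
  rw [Dpos, Finset.sum_mul, Finset.sum_mul]
  refine Finset.sum_congr rfl fun A _ => ?_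
  have h1 := hx.weightOn_mul_Vpos hP (disjoint_compl_right (a := A))
  rw [Finset.union_compl] at h1
  rw [formTerm, ← mul_recSum (v := fun A B => Vpos P A B x) (w := weightOn P x)
    (fun A B hAB => hx.weightOn_mul_Vpos hP hAB)]
  linear_combination (recSum (fun A B => Vpos P A B x) (fun _ => 1) (r - A.card) Aᶜ *
    f (up P A x) * h x) * h1

lemma ae_realGeneric (P : Params) : ∀ᵐ x ∂torusMeasure n, RealGeneric (toC x) :=
  (ae_torus_of_volume (ae_hypFun_ne_zero P)).mono fun _ h => realGeneric_of_hypFun_ne_zero h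

/-- The weight and `h` are even in each variable, so the `2 ^ n` sign configurations contribute
equal integrals. -/
lemma bform_eq_sum (hP : P.Admissible) {r : ℕ} {f h N : (Fin n → ℂ) → ℂ}
    (hf : f ∈ trig n) (hh : h ∈ trig n) (hhW : IsWeylInvariant h)
    (hN : ∀ x, (∀ h ∈ polarHyps P n, hypFun h x ≠ 0) → Dsum P r f x = N x) :
    bform P N h = 2 ^ n * ∑ A ∈ Finset.univ.filter (fun A : Finset (Fin n) => A.card ≤ r),
      ∫ x, formTerm P r f h A (toC x) ∂torusMeasure n := by
  set S : (Fin n → ℝ) → ℂ := fun x =>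
    ∑ A ∈ Finset.univ.filter (fun A : Finset (Fin n) => A.card ≤ r), formTerm P r f h A (toC x)
    with hS
  have hSc : Continuous S := continuous_finsetSum _ fun A _ => continuous_formTerm_toC hP hf hh A
  have h1 : bform P N h = ∫ x, ∑ ε : Fin n → ℤˣ, S (flipReal ε x) ∂torusMeasure n := by
    refine integral_congr_ae ?_
    filter_upwards [ae_torus_of_volume (ae_hypFun_ne_zero P)] with x hx
    have hg := realGeneric_of_hypFun_ne_zero hx
    rw [← hN _ hx, Dsum, Finset.sum_mul, Finset.sum_mul]
    refine Finset.sum_congr rfl fun ε _ => ?_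
    rw [hS]
    simp only [toC_flipReal]
    rw [← (hg.flipSigns ε).weightOn_mul_Dpos hP r f h, hhW.flip, weightOn_flipSigns]
  rw [h1, integral_finsetSum (f := fun ε x => S (flipReal ε x)) _
    fun ε _ => integrable_torus (hSc.comp (continuous_flipReal ε))]
  simp only [integral_comp_flipReal hSc]
  rw [Finset.sum_const, Finset.card_univ, hS,
    integral_finsetSum _ fun A _ => integrable_torus (continuous_formTerm_toC hP hf hh A)]
  simp

/-- The difference operators are symmetric with respect to the bilinear form. -/
theorem bform_Dsum_symm (hP : P.Admissible) {r : ℕ} {f h N M : (Fin n → ℂ) → ℂ}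
    (hf : f ∈ trig n) (hh : h ∈ trig n) (hfW : IsWeylInvariant f) (hhW : IsWeylInvariant h)
    (hN : ∀ x, (∀ h ∈ polarHyps P n, hypFun h x ≠ 0) → Dsum P r f x = N x)
    (hM : ∀ x, (∀ h ∈ polarHyps P n, hypFun h x ≠ 0) → Dsum P r h x = M x) :
    bform P N h = bform P f M := by
  have hsymm : bform P f M = bform P M f := by
    unfold bform
    congr 1
    funext x
    ring
  rw [hsymm, bform_eq_sum hP hf hh hhW hN, bform_eq_sum hP hh hf hfW hM]
  simp only [integral_formTerm_symm hP hf hh hfW hhW]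

end Koornwinder

end

open scoped BigOperators

noncomputable section

namespace Koornwinder

open Filter Topology MeasureTheory

variable {n : ℕ} {P : Params}

/-! ### Positivity of the weight function -/

lemma ex_neg_ofReal (t : ℝ) : ex (-(t : ℂ)) = (starRingEnd ℂ) (ex t) := by
  rw [ex, ex, ← Complex.exp_conj]
  simp

/-- The holomorphic half of the weight function. -/
def halfWeight (P : Params) (x : Fin n → ℂ) : ℂ :=
  pairProd (fun i l => phi P P.g (ex (x i + x l)) * phi P P.g (ex (x i - x l))) Finset.univ *
    ∏ j, phiB P (ex (x j))

/-- The parameters are real, so at real points the factors in `e^{-iz}` are the complex conjugates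
of those in `e^{iz}`. -/
lemma weightOn_toC (hP : P.Admissible) (x : Fin n → ℝ) :
    weightOn P (toC x) Finset.univ = (Complex.normSq (halfWeight P (toC x)) : ℂ) := by
  have hE : ∀ t : ℝ, phiEven P (t : ℂ) =
      phi P P.g (ex t) * (starRingEnd ℂ) (phi P P.g (ex t)) := fun t => by
    rw [phiEven, ex_neg_ofReal, phi_conj hP.1]
  have hB : ∀ t : ℝ, weightSingle P (t : ℂ) =
      phiB P (ex t) * (starRingEnd ℂ) (phiB P (ex t)) := fun t => by
    rw [weightSingle, ex_neg_ofReal, phiB_conj hP.1]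
  rw [← Complex.mul_conj, halfWeight, weightOn, map_mul, map_prod, pairProd, pairProd, map_prod,
    mul_mul_mul_comm, ← Finset.prod_mul_distrib, ← Finset.prod_mul_distrib]
  congr 1
  · refine Finset.prod_congr rfl fun q _ => ?_
    have e1 := hE (x q.1 + x q.2)
    have e2 := hE (x q.1 - x q.2)
    push_cast at e1 e2
    rw [weightPair, map_mul]
    simp only [toC]
    rw [e1, e2]
    ring
  · exact Finset.prod_congr rfl fun j _ => hB (x j)

lemma RealGeneric.halfWeight_ne_zero {x : Fin n → ℂ} (hx : RealGeneric x) (hP : P.Admissible) :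
    halfWeight P x ≠ 0 := by
  refine mul_ne_zero (Finset.prod_ne_zero_iff.2 fun q hq => ?_)
    (Finset.prod_ne_zero_iff.2 fun j _ => ?_)
  · have hne := (Finset.mem_filter.1 hq).2.ne
    exact mul_ne_zero
      (phi_ne_zero hP.1 hP.2.1 (hx.norm_add _ _).le (hx.pair _ _ hne).1)
      (phi_ne_zero hP.1 hP.2.1 (hx.norm_sub _ _).le (hx.pair _ _ hne).2)
  · exact phiB_ne_zero hP (hx.norm_single j).le (hx.single j).1 (hx.single j).2

/-! ### The bilinear form -/

lemma continuous_weightOn_toC (hP : P.Admissible) :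
    Continuous fun x : Fin n → ℝ => weightOn P (toC x) Finset.univ := by
  rw [continuous_iff_continuousAt]
  intro x
  exact ContinuousAt.comp (f := toC (n := n)) (g := fun x => weightOn P x Finset.univ)
    (differentiableAt_weightOn hP fun k _ => by simp [toC]).continuousAt
    continuous_toC.continuousAt

lemma continuous_bform_integrand (hP : P.Admissible) {f h : (Fin n → ℂ) → ℂ} (hf : f ∈ trig n)
    (hh : h ∈ trig n) : Continuous fun x : Fin n → ℝ =>
      f (toC x) * h (toC x) * weightOn P (toC x) Finset.univ :=
  (((continuous_of_mem_trig hf).comp continuous_toC).mul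
    ((continuous_of_mem_trig hh).comp continuous_toC)).mul (continuous_weightOn_toC hP)

lemma bform_comm (f h : (Fin n → ℂ) → ℂ) : bform P f h = bform P h f := by
  unfold bform
  congr 1
  funext x
  ring

lemma bform_add_left (hP : P.Admissible) {f g h : (Fin n → ℂ) → ℂ} (hf : f ∈ trig n)
    (hg : g ∈ trig n) (hh : h ∈ trig n) : bform P (f + g) h = bform P f h + bform P g h := by
  unfold bform
  rw [← integral_add (integrable_torus (continuous_bform_integrand hP hf hh))
    (integrable_torus (continuous_bform_integrand hP hg hh))]
  congr 1
  funext x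
  simp only [Pi.add_apply]
  ring

lemma bform_smul_left (c : ℂ) (f h : (Fin n → ℂ) → ℂ) : bform P (c • f) h = c * bform P f h := by
  unfold bform
  rw [← integral_const_mul]
  congr 1
  funext x
  simp only [Pi.smul_apply, smul_eq_mul]
  ring

/-- At real points conjugation is the flip of all signs. Against monomials the Hermitian product
therefore coincides with the bilinear form, and the latter can be used throughout. -/
lemma conj_monomial_toC (nu : Fin n → ℤ) (x : Fin n → ℝ) :
    (starRingEnd ℂ) (monomial nu (toC x)) = monomial nu (toC x) := by
  conv_rhs => rw [← (isWeylInvariant_monomial nu).flip (fun _ => -1) (toC x)]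
  rw [monomial, monomial, map_sum]
  refine Finset.sum_congr rfl fun mu _ => ?_
  rw [expo, expo, ← Complex.exp_conj]
  simp [flipSigns, toC]

lemma innerProd_monomial (hP : P.Admissible) (p : (Fin n → ℂ) → ℂ) (nu : Fin n → ℤ) :
    innerProd P p (monomial nu) = bform P p (monomial nu) := by
  rw [innerProd, setIntegral_cube]
  refine integral_congr_ae ?_
  filter_upwards [ae_realGeneric P] with x hx
  have h1 := conj_monomial_toC nu x
  have h2 := hx.weight_eq hP
  change p (toC x) * (starRingEnd ℂ) (monomial nu (toC x)) * weight P (toC x) = _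
  rw [h1, h2]

/-- Continuity gives vanishing on the cube and periodicity vanishing on `ℝⁿ`; then all coefficients
are zero. -/
lemma eq_zero_of_ae_eq_zero {s : (Fin n → ℂ) → ℂ} (hs : s ∈ trig n)
    (h : ∀ᵐ x ∂torusMeasure n, s (toC x) = 0) : s = 0 := by
  have hcont : Continuous fun x : Fin n → ℝ => s (toC x) :=
    (continuous_of_mem_trig hs).comp continuous_toC
  rw [torusMeasure_eq_restrict] at h
  have hcube : Set.EqOn (fun x : Fin n → ℝ => s (toC x)) (fun _ => 0)
      (Set.univ.pi fun _ => Set.Ioc (-Real.pi) Real.pi) := by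
    refine Measure.eqOn_of_ae_eq h hcont.continuousOn continuousOn_const ?_
    rw [interior_pi_set Set.finite_univ, closure_pi_set]
    refine Set.pi_mono fun j _ => ?_
    rw [interior_Ioc, closure_Ioo (by linarith [Real.pi_pos])]
    exact Set.Ioc_subset_Icc_self
  have hcongr : ∀ x x' : Fin n → ℂ,
      (∀ j, Complex.exp (Complex.I * x j) = Complex.exp (Complex.I * x' j)) → s x = s x' := by
    intro x x' hx
    refine trig_induction (p := fun F => F x = F x') (fun μ => expo_congr μ hx) rfl ?_ ?_ hs
    · intro F G h1 h2; simp [h1, h2]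
    · intro c F h1; simp [h1]
  obtain ⟨a, rfl⟩ := mem_trig_iff.1 hs
  rw [coeff_eq_zero_of_real a, map_zero]
  intro x
  have hy := hcube (x := fun j => toIocMod Real.two_pi_pos (-Real.pi) (x j)) (by
    intro j _
    have := toIocMod_mem_Ioc Real.two_pi_pos (-Real.pi) (x j)
    rwa [show -Real.pi + 2 * Real.pi = Real.pi by ring] at this)
  refine (hcongr _ _ fun j => ?_).trans hy
  have e : (x j : ℂ) = toC (fun j => toIocMod Real.two_pi_pos (-Real.pi) (x j)) j +
      (toIocDiv Real.two_pi_pos (-Real.pi) (x j) : ℂ) * (2 * Real.pi) := by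
    have := toIocMod_add_toIocDiv_zsmul Real.two_pi_pos (-Real.pi) (x j)
    rw [zsmul_eq_mul] at this
    simp only [toC]
    exact_mod_cast this.symm
  rw [e, mul_add, Complex.exp_add]
  have := Complex.exp_int_mul_two_pi_mul_I (toIocDiv Real.two_pi_pos (-Real.pi) (x j))
  rw [show Complex.I * ((toIocDiv Real.two_pi_pos (-Real.pi) (x j) : ℂ) * (2 * Real.pi)) =
    (toIocDiv Real.two_pi_pos (-Real.pi) (x j) : ℂ) * (2 * Real.pi * Complex.I) by ring, this, mul_one]

/-- Positive definiteness of the weighted inner product on trigonometric polynomials. -/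
lemma eq_zero_of_bform_conj_eq_zero (hP : P.Admissible) {s t : (Fin n → ℂ) → ℂ} (hs : s ∈ trig n)
    (ht : ∀ x : Fin n → ℝ, t (toC x) = (starRingEnd ℂ) (s (toC x))) (h : bform P s t = 0) :
    s = 0 := by
  set F : (Fin n → ℝ) → ℝ := fun x =>
    Complex.normSq (s (toC x)) * Complex.normSq (halfWeight P (toC x)) with hF
  have hFC : ∀ x, s (toC x) * t (toC x) * weightOn P (toC x) Finset.univ = (F x : ℂ) := by
    intro x
    rw [ht, weightOn_toC hP, Complex.mul_conj, hF, Complex.ofReal_mul]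
  have hcont : Continuous fun x : Fin n → ℝ => (F x : ℂ) := by
    have hsc := (continuous_of_mem_trig hs).comp continuous_toC
    simp only [← hFC, ht]
    exact (hsc.mul (Complex.continuous_conj.comp hsc)).mul (continuous_weightOn_toC hP)
  have hF_int : Integrable F (torusMeasure n) := by
    simpa using (integrable_torus hcont).re
  have h0 : ∫ x, F x ∂torusMeasure n = 0 := by
    rw [bform] at h
    simp only [hFC] at h
    rw [integral_complex_ofReal] at h
    exact_mod_cast h
  rw [integral_eq_zero_iff_of_nonneg
    (fun x => mul_nonneg (Complex.normSq_nonneg _) (Complex.normSq_nonneg _)) hF_int] at h0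
  refine eq_zero_of_ae_eq_zero hs ?_
  filter_upwards [h0, ae_realGeneric P] with x hx hg
  rcases mul_eq_zero.1 hx with h1 | h1
  · exact Complex.normSq_eq_zero.1 h1
  · exact absurd (Complex.normSq_eq_zero.1 h1) (hg.halfWeight_ne_zero hP)

/-! ### The span of the lower monomials -/

lemma DomLE.antisymm {mu nu : Fin n → ℤ} (h : DomLE mu nu) (h' : DomLE nu mu) : mu = nu := by
  funext k
  induction k using WellFoundedLT.induction with
  | _ k ih =>
    have e := le_antisymm (h k) (h' k)
    rw [← Finset.Iio_insert, Finset.sum_insert (by simp), Finset.sum_insert (by simp),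
      Finset.sum_congr rfl fun j hj => ih j (Finset.mem_Iio.1 hj)] at e
    exact add_right_cancel e

lemma DomLT.trans {mu nu lam : Fin n → ℤ} (h : DomLT mu nu) (h' : DomLT nu lam) :
    DomLT mu lam := by
  refine ⟨fun k => (h.1 k).trans (h'.1 k), ?_⟩
  rintro rfl
  exact h'.2 (h'.1.antisymm h.1)

lemma monomial_mem_lowerSpan {nu lam : Fin n → ℤ} (hnu : IsDominant nu) (h : DomLT nu lam) :
    monomial nu ∈ lowerSpan lam :=
  Submodule.subset_span ⟨nu, hnu, h, rfl⟩

lemma lowerSpan_mono {nu lam : Fin n → ℤ} (h : DomLT nu lam) : lowerSpan nu ≤ lowerSpan lam :=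
  Submodule.span_mono fun _ ⟨mu, h1, h2, h3⟩ => ⟨mu, h1, h2.trans h, h3⟩

lemma lowerSpan_induction {lam : Fin n → ℤ} {p : ((Fin n → ℂ) → ℂ) → Prop}
    (hm : ∀ nu, IsDominant nu → DomLT nu lam → p (monomial nu)) (h0 : p 0)
    (hadd : ∀ F G, F ∈ lowerSpan lam → G ∈ lowerSpan lam → p F → p G → p (F + G))
    (hsmul : ∀ (c : ℂ) F, F ∈ lowerSpan lam → p F → p (c • F))
    {F : (Fin n → ℂ) → ℂ} (hF : F ∈ lowerSpan lam) : p F := by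
  unfold lowerSpan at *
  induction hF using Submodule.span_induction with
  | mem F h => obtain ⟨nu, h1, h2, rfl⟩ := h; exact hm nu h1 h2
  | zero => exact h0
  | add F G hF hG h1 h2 => exact hadd F G hF hG h1 h2
  | smul c F hF h => exact hsmul c F hF h

lemma mem_trig_of_mem_lowerSpan {lam : Fin n → ℤ} {s : (Fin n → ℂ) → ℂ} (hs : s ∈ lowerSpan lam) :
    s ∈ trig n :=
  lowerSpan_induction (p := fun s => s ∈ trig n) (fun nu _ _ => monomial_mem_trig nu) (zero_mem _)
    (fun _ _ _ _ => add_mem) (fun c _ _ h => Subalgebra.smul_mem _ h c) hs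

lemma IsWeylInvariant.add {f g : (Fin n → ℂ) → ℂ} (hf : IsWeylInvariant f)
    (hg : IsWeylInvariant g) : IsWeylInvariant (f + g) where
  congr x x' h := by simp only [Pi.add_apply, hf.congr x x' h, hg.congr x x' h]
  perm σ x := by simp only [Pi.add_apply, hf.perm, hg.perm]
  flip ε x := by simp only [Pi.add_apply, hf.flip, hg.flip]

lemma IsWeylInvariant.const_smul {f : (Fin n → ℂ) → ℂ} (hf : IsWeylInvariant f) (c : ℂ) :
    IsWeylInvariant (c • f) where
  congr x x' h := by simp only [Pi.smul_apply, hf.congr x x' h]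
  perm σ x := by simp only [Pi.smul_apply, hf.perm]
  flip ε x := by simp only [Pi.smul_apply, hf.flip]

lemma isWeylInvariant_of_mem_lowerSpan {lam : Fin n → ℤ} {s : (Fin n → ℂ) → ℂ}
    (hs : s ∈ lowerSpan lam) : IsWeylInvariant s :=
  lowerSpan_induction (fun nu _ _ => isWeylInvariant_monomial nu)
    ⟨fun _ _ _ => rfl, fun _ _ => rfl, fun _ _ => rfl⟩
    (fun _ _ _ _ h1 h2 => h1.add h2) (fun c _ _ h => h.const_smul c) hs

lemma exists_conj_mem_lowerSpan {lam : Fin n → ℤ} {s : (Fin n → ℂ) → ℂ} (hs : s ∈ lowerSpan lam) :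
    ∃ t ∈ lowerSpan lam, ∀ x : Fin n → ℝ, t (toC x) = (starRingEnd ℂ) (s (toC x)) := by
  refine lowerSpan_induction (p := fun s => ∃ t ∈ lowerSpan lam, ∀ x : Fin n → ℝ,
    t (toC x) = (starRingEnd ℂ) (s (toC x))) ?_ ?_ ?_ ?_ hs
  · exact fun nu h1 h2 => ⟨_, monomial_mem_lowerSpan h1 h2, fun x => (conj_monomial_toC nu x).symm⟩
  · exact ⟨0, zero_mem _, by simp⟩
  · rintro F G _ _ ⟨t, ht, h1⟩ ⟨u, hu, h2⟩
    exact ⟨t + u, add_mem ht hu, fun x => by simp [h1, h2]⟩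
  · rintro c F _ ⟨t, ht, h1⟩
    exact ⟨(starRingEnd ℂ) c • t, Submodule.smul_mem _ _ ht, fun x => by simp [h1]⟩

lemma eq_zero_of_bform_lowerSpan_eq_zero (hP : P.Admissible) {lam : Fin n → ℤ}
    {s : (Fin n → ℂ) → ℂ} (hs : s ∈ lowerSpan lam) (h : ∀ u ∈ lowerSpan lam, bform P s u = 0) :
    s = 0 := by
  obtain ⟨t, ht, hc⟩ := exists_conj_mem_lowerSpan hs
  exact eq_zero_of_bform_conj_eq_zero hP (mem_trig_of_mem_lowerSpan hs) hc (h t ht)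

/-- The entries of a dominant weight below `lam` are non-negative and bounded by the partial sums of
`lam`. -/
instance (lam : Fin n → ℤ) : FiniteDimensional ℂ (lowerSpan lam) := by
  have hfin : {nu : Fin n → ℤ | IsDominant nu ∧ DomLT nu lam}.Finite := by
    refine (Set.finite_Icc (0 : Fin n → ℤ) fun k => ∑ j ∈ Finset.Iic k, lam j).subset ?_
    rintro nu ⟨h1, h2⟩
    exact ⟨h1.2, fun k => (Finset.single_le_sum (fun j _ => h1.2 j)
      (Finset.mem_Iic.2 le_rfl)).trans (h2.1 k)⟩
  refine FiniteDimensional.span_of_finite ℂ ((hfin.image monomial).subset ?_)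
  rintro _ ⟨nu, h1, h2, rfl⟩
  exact ⟨nu, ⟨h1, h2⟩, rfl⟩

/-- Distinct dominant weights have distinct orbits, since each would pair strictly less with the
staircase than the other. Hence the coefficient of `e^lam` vanishes on the lower span. -/
lemma monomial_notMem_lowerSpan {lam : Fin n → ℤ} (hlam : IsDominant lam) :
    monomial lam ∉ lowerSpan lam := by
  intro h
  obtain ⟨a, ha, h0⟩ : ∃ a : (Fin n → ℤ) →₀ ℂ,
      Finsupp.linearCombination ℂ expo a = monomial lam ∧ a lam = 0 := by
    refine lowerSpan_induction (p := fun s => ∃ a : (Fin n → ℤ) →₀ ℂ,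
      Finsupp.linearCombination ℂ expo a = s ∧ a lam = 0) ?_ ?_ ?_ ?_ h
    · intro nu h1 h2
      refine ⟨orbitSum nu, linearCombination_orbitSum nu, ?_⟩
      rw [orbitSum_apply, if_neg]
      intro hmem
      have hst := isStrictlyDominant_staircase (n := n)
      rcases eq_or_dot_lt_of_mem_weylOrbit h1 hst hmem with e | e
      · exact h2.2 e.symm
      · rcases eq_or_dot_lt_of_mem_weylOrbit hlam hst (mem_weylOrbit_symm hmem) with e' | e'
        · exact h2.2 e'
        · exact lt_asymm e e'
    · exact ⟨0, by simp, rfl⟩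
    · rintro F G _ _ ⟨a, rfl, h1⟩ ⟨b, rfl, h2⟩
      exact ⟨a + b, map_add _ _ _, by simp [h1, h2]⟩
    · rintro c F _ ⟨a, rfl, h1⟩
      exact ⟨c • a, map_smul _ _ _, by simp [h1]⟩
  rw [← linearCombination_orbitSum] at ha
  rw [finsupp_eq_of_linearCombination_eq ha, orbitSum_apply, if_pos (self_mem_weylOrbit lam)] at h0
  exact one_ne_zero h0

/-! ### Koornwinder polynomials -/

/-- The restriction of the bilinear form to the span of the lower monomials. -/
def lowerForm (hP : P.Admissible) (lam : Fin n → ℤ) :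
    trig n →ₗ[ℂ] Module.Dual ℂ (lowerSpan lam) :=
  LinearMap.mk₂ ℂ (fun (f : trig n) (u : lowerSpan lam) => bform P f.1 u.1)
    (fun f g u => bform_add_left hP f.2 g.2 (mem_trig_of_mem_lowerSpan u.2))
    (fun c f u => bform_smul_left c _ _)
    (fun f u v => by
      rw [bform_comm, bform_comm f.1 u.1, bform_comm f.1 v.1]
      exact bform_add_left hP (mem_trig_of_mem_lowerSpan u.2) (mem_trig_of_mem_lowerSpan v.2) f.2)
    (fun c f u => by
      rw [bform_comm, bform_comm f.1 u.1]
      exact bform_smul_left c _ _)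

/-- Positivity makes the form non-degenerate on the finite-dimensional lower span, so every
functional on it is represented by an element. -/
lemma exists_projection (hP : P.Admissible) (lam : Fin n → ℤ) {f : (Fin n → ℂ) → ℂ}
    (hf : f ∈ trig n) : ∃ s ∈ lowerSpan lam, ∀ u ∈ lowerSpan lam, bform P s u = bform P f u := by
  set ι : lowerSpan lam →ₗ[ℂ] trig n :=
    LinearMap.codRestrict (Subalgebra.toSubmodule (trig n)) (lowerSpan lam).subtype
      (fun s => mem_trig_of_mem_lowerSpan s.2)
  have hinj : Function.Injective (lowerForm hP lam ∘ₗ ι) := by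
    rw [← LinearMap.ker_eq_bot, LinearMap.ker_eq_bot']
    intro s hs
    exact Subtype.ext (eq_zero_of_bform_lowerSpan_eq_zero hP s.2
      fun u hu => LinearMap.congr_fun hs ⟨u, hu⟩)
  have hsurj := (LinearMap.injective_iff_surjective_of_finrank_eq_finrank
    (Subspace.dual_finrank_eq (K := ℂ) (V := lowerSpan lam)).symm).1 hinj
  obtain ⟨s, hs⟩ := hsurj (lowerForm hP lam ⟨f, hf⟩)
  exact ⟨s, s.2, fun u hu => LinearMap.congr_fun hs ⟨u, hu⟩⟩

lemma isKoornwinder_iff (hP : P.Admissible) {lam : Fin n → ℤ} {p : (Fin n → ℂ) → ℂ} :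
    IsKoornwinder P lam p ↔
      p - monomial lam ∈ lowerSpan lam ∧ ∀ u ∈ lowerSpan lam, bform P p u = 0 := by
  constructor
  · rintro ⟨h1, h2⟩
    have h1' : p - monomial lam ∈ lowerSpan lam := h1
    have hp : p ∈ trig n := by
      rw [← sub_add_cancel p (monomial lam)]
      exact add_mem (mem_trig_of_mem_lowerSpan h1') (monomial_mem_trig lam)
    refine ⟨h1', fun u hu => lowerSpan_induction (p := fun u => bform P p u = 0) ?_ ?_ ?_ ?_ hu⟩
    · intro nu hnu hlt
      rw [← innerProd_monomial hP]
      exact h2 nu hnu hlt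
    · simp [bform]
    · intro F G hF hG e1 e2
      rw [bform_comm, bform_add_left hP (mem_trig_of_mem_lowerSpan hF)
        (mem_trig_of_mem_lowerSpan hG) hp, bform_comm, e1, bform_comm, e2, add_zero]
    · intro c F _ e
      rw [bform_comm, bform_smul_left, bform_comm, e, mul_zero]
  · rintro ⟨h1, h2⟩
    refine ⟨h1, fun nu hnu hlt => ?_⟩
    rw [innerProd_monomial hP]
    exact h2 _ (monomial_mem_lowerSpan hnu hlt)

/-- The solution is `m_λ` minus its projection; the difference of two solutions lies in the lower
span and is orthogonal to it. -/
theorem existsUnique_isKoornwinder (hP : P.Admissible) (lam : Fin n → ℤ) :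
    ∃! p : (Fin n → ℂ) → ℂ, IsKoornwinder P lam p := by
  obtain ⟨s, hs, hproj⟩ := exists_projection hP lam (monomial_mem_trig lam)
  have hst := mem_trig_of_mem_lowerSpan hs
  have hmt := monomial_mem_trig lam
  refine ⟨monomial lam + (-1 : ℂ) • s, (isKoornwinder_iff hP).2 ⟨?_, fun u hu => ?_⟩, fun p hp => ?_⟩
  · rw [add_sub_cancel_left]
    exact Submodule.smul_mem _ _ hs
  · rw [bform_add_left hP hmt (Subalgebra.smul_mem _ hst _) (mem_trig_of_mem_lowerSpan hu),
      bform_smul_left, hproj u hu]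
    ring
  · obtain ⟨h1, h2⟩ := (isKoornwinder_iff hP).1 hp
    have h3 := add_mem h1 hs
    have e : p + (-1 : ℂ) • (monomial lam + (-1 : ℂ) • s) = p - monomial lam + s := by
      module
    have hpt : p ∈ trig n := by
      rw [← sub_add_cancel p (monomial lam)]
      exact add_mem (mem_trig_of_mem_lowerSpan h1) hmt
    have h4 := eq_zero_of_bform_lowerSpan_eq_zero hP h3 fun u hu => by
      have hu' := mem_trig_of_mem_lowerSpan hu
      have hss := Subalgebra.smul_mem _ hst (-1 : ℂ)
      rw [← e, bform_add_left hP hpt (Subalgebra.smul_mem _ (add_mem hmt hss) _) hu', h2 u hu,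
        bform_smul_left, bform_add_left hP hmt hss hu', bform_smul_left, hproj u hu]
      ring
    rw [← e] at h4
    rw [neg_one_smul, ← sub_eq_add_neg, sub_eq_zero] at h4
    exact h4

lemma IsKoornwinder.ne_zero {lam : Fin n → ℤ} (hlam : IsDominant lam) {p : (Fin n → ℂ) → ℂ}
    (hp : IsKoornwinder P lam p) : p ≠ 0 := by
  rintro rfl
  have h : (0 : (Fin n → ℂ) → ℂ) - monomial lam ∈ lowerSpan lam := hp.1
  rw [zero_sub, neg_mem_iff] at h
  exact monomial_notMem_lowerSpan hlam h

lemma Dsum_add (r : ℕ) (f g : (Fin n → ℂ) → ℂ) (x : Fin n → ℂ) :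
    Dsum P r (f + g) x = Dsum P r f x + Dsum P r g x := by
  simp only [Dsum, Dpos, Pi.add_apply, mul_add, Finset.sum_add_distrib]

lemma Dsum_smul (r : ℕ) (c : ℂ) (f : (Fin n → ℂ) → ℂ) (x : Fin n → ℂ) :
    Dsum P r (c • f) x = c * Dsum P r f x := by
  simp only [Dsum, Dpos, Pi.smul_apply, smul_eq_mul, Finset.mul_sum]
  refine Finset.sum_congr rfl fun ε _ => Finset.sum_congr rfl fun A _ => ?_
  ring

lemma exists_lowerSpan_Dsum (hβ : 0 < P.β) {lam : Fin n → ℤ} {r : ℕ} (hr : 1 ≤ r) (hrn : r ≤ n)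
    {s : (Fin n → ℂ) → ℂ} (hs : s ∈ lowerSpan lam) :
    ∃ N ∈ lowerSpan lam, ∀ x, (∀ h ∈ polarHyps P n, hypFun h x ≠ 0) → Dsum P r s x = N x := by
  refine lowerSpan_induction (p := fun s => ∃ N ∈ lowerSpan lam, ∀ x,
    (∀ h ∈ polarHyps P n, hypFun h x ≠ 0) → Dsum P r s x = N x) ?_ ?_ ?_ ?_ hs
  · intro nu h1 h2
    obtain ⟨L, hL, h⟩ := exists_Dsum_monomial_eq (P := P) hβ h1 hr hrn
    exact ⟨_ • monomial nu + L, add_mem (Submodule.smul_mem _ _ (monomial_mem_lowerSpan h1 h2))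
      (lowerSpan_mono h2 hL), fun x hx => h x hx⟩
  · exact ⟨0, zero_mem _, fun x _ => by simp [Dsum, Dpos]⟩
  · rintro F G _ _ ⟨N, hN, h1⟩ ⟨M, hM, h2⟩
    exact ⟨N + M, add_mem hN hM, fun x hx => by rw [Dsum_add, h1 x hx, h2 x hx]; rfl⟩
  · rintro c F _ ⟨N, hN, h1⟩
    exact ⟨c • N, Submodule.smul_mem _ _ hN, fun x hx => by rw [Dsum_smul, h1 x hx]; rfl⟩

lemma IsKoornwinder.Dsum_eq (hP : P.Admissible) {lam : Fin n → ℤ} (hlam : IsDominant lam)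
    {p : (Fin n → ℂ) → ℂ} (hp : IsKoornwinder P lam p) {r : ℕ} (hr : 1 ≤ r) (hrn : r ≤ n)
    {x : Fin n → ℂ} (hx : ∀ h ∈ polarHyps P n, hypFun h x ≠ 0) :
    Dsum P r p x = 2 ^ n * ((E r (fun j => Real.cosh (P.β * ((lam j : ℝ) + rho P j)))
          (fun j => Real.cosh (P.β * rho P j)) : ℝ) : ℂ) * p x := by
  obtain ⟨hps, horth⟩ := (isKoornwinder_iff hP).1 hp
  obtain ⟨L, hL, hDm⟩ := exists_Dsum_monomial_eq (P := P) hP.1 hlam hr hrn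
  set c : ℂ := 2 ^ n * ((E r (fun j => Real.cosh (P.β * ((lam j : ℝ) + rho P j)))
          (fun j => Real.cosh (P.β * rho P j)) : ℝ) : ℂ) with hc
  set s := p - monomial lam with hs
  have hpe : p = monomial lam + s := by rw [hs]; abel
  obtain ⟨N, hN, hDs⟩ := exists_lowerSpan_Dsum (P := P) hP.1 hr hrn hps
  have hpt : p ∈ trig n := by
    rw [hpe]
    exact add_mem (monomial_mem_trig lam) (mem_trig_of_mem_lowerSpan hps)
  have hpW : IsWeylInvariant p := by
    rw [hpe]
    exact (isWeylInvariant_monomial lam).add (isWeylInvariant_of_mem_lowerSpan hps)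
  have hL' : L + N + (-c) • s ∈ lowerSpan lam :=
    add_mem (add_mem hL hN) (Submodule.smul_mem _ _ hps)
  have hDp : ∀ x, (∀ h ∈ polarHyps P n, hypFun h x ≠ 0) →
      Dsum P r p x = (c • p + (L + N + (-c) • s)) x := by
    intro x hx
    rw [hpe, Dsum_add, hDm x hx, hDs x hx]
    simp only [Pi.add_apply, Pi.smul_apply, smul_eq_mul]
    ring
  -- This element is `Dsum p - c p`. Its pairing with `u` in the lower span equals that of `p` with
  -- the image of `u`, which is again in the lower span and hence orthogonal to `p`.
  have h0 : L + N + (-c) • s = 0 := by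
    refine eq_zero_of_bform_lowerSpan_eq_zero hP hL' fun u hu => ?_
    obtain ⟨M, hM, hDu⟩ := exists_lowerSpan_Dsum (P := P) hP.1 hr hrn hu
    have hu' := mem_trig_of_mem_lowerSpan hu
    have h1 := bform_Dsum_symm hP hpt hu' hpW (isWeylInvariant_of_mem_lowerSpan hu) hDp hDu
    rw [horth M hM, bform_add_left hP (Subalgebra.smul_mem _ hpt c)
      (mem_trig_of_mem_lowerSpan hL') hu', bform_smul_left, horth u hu, mul_zero, zero_add] at h1
    exact h1
  rw [hDp x hx, h0, add_zero]
  rfl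

theorem IsKoornwinder.D_eq (hP : P.Admissible) {lam : Fin n → ℤ} (hlam : IsDominant lam)
    {p : (Fin n → ℂ) → ℂ} (hp : IsKoornwinder P lam p) {r : ℕ} (hr : 1 ≤ r) (hrn : r ≤ n)
    {x : Fin n → ℂ} (hx : IsRegular P x) :
    D P r p x = ((2 ^ r * E r (fun j => Real.cosh (P.β * ((lam j : ℝ) + rho P j)))
          (fun j => Real.cosh (P.β * rho P j)) : ℝ) : ℂ) * p x := by
  have hps := ((isKoornwinder_iff hP).1 hp).1
  have hpW : IsWeylInvariant p := by
    rw [← sub_add_cancel p (monomial lam)]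
    exact (isWeylInvariant_of_mem_lowerSpan hps).add (isWeylInvariant_monomial lam)
  have h1 := two_pow_mul_D P hr p hpW.flip x
  have h2 := hp.Dsum_eq hP hlam hr hrn hx.hypFun_ne_zero
  rw [Dsum] at h2
  rw [h2] at h1
  have h3 : (2 : ℂ) ^ n ≠ 0 := pow_ne_zero _ two_ne_zero
  apply mul_left_cancel₀ h3
  rw [h1]
  push_cast
  ring

end Koornwinder

end

theorem mainTheorem1 (P : Koornwinder.Params) (hP : P.Admissible) (n : ℕ)
    (lam : Fin n → ℤ) (hlam : Koornwinder.IsDominant lam) :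
    (∃! p : (Fin n → ℂ) → ℂ, Koornwinder.IsKoornwinder P lam p) ∧
    ∀ p : (Fin n → ℂ) → ℂ, Koornwinder.IsKoornwinder P lam p →
      p ≠ 0 ∧
      ∀ r : ℕ, 1 ≤ r → r ≤ n → ∀ x : Fin n → ℂ, Koornwinder.IsRegular P x →
        Koornwinder.D P r p x =
          ((2 ^ r * Koornwinder.E r
            (fun j => Real.cosh (P.β * ((lam j : ℝ) + Koornwinder.rho P j)))
            (fun j => Real.cosh (P.β * Koornwinder.rho P j)) : ℝ) : ℂ) * p x :=
  ⟨Koornwinder.existsUnique_isKoornwinder hP lam, fun _ hp =>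
    ⟨hp.ne_zero hlam, fun _ hr hrn _ hx => hp.D_eq hP hlam hr hrn hx⟩⟩
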